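/- **Theorem (Deterministic SVP reduction).** Lattices are given by a basis of $n \ge 1$ linearly independent vectors in $\mathbb{Q}^N$ (rationals written as reduced numerator and denominator in binary); $n$ is the dimension (rank) of the lattice, $m$ is the maximal bit length of a basis vector, and $\lambda_1(\mathcal{L})$ is the Euclidean length of a shortest non-zero vector of $\mathcal{L}$. A $\gamma$-GapSVP oracle is given a basis of a lattice $\mathcal{L}$ of dimension $n$ and a rational $d>0$; it answers YES if $\lambda_1(\mathcal{L}) < d$ and NO if $\lambda_1(\mathcal{L}) \ge \gamma(n)\, d$ (and arbitrarily otherwise). The $\gamma'$-SVP problem asks, given a basis of a lattice $\mathcal{L}$, for a vector $x \in \mathcal{L}$ with $0 < \|x\| \le \gamma' \lambda_1(\mathcal{L})$. For all functions $\gamma = \gamma(n) \ge 1$ and $p = p(n) \ge 2$ there is a deterministic dimension-preserving (Cook) reduction from $\gamma'$-SVP to $\gamma$-GapSVP, where $$\gamma' := \gamma^{O(n^2/\log p)},$$ that runs in time $\mathrm{poly}(n)\cdot \mathrm{poly}(m) \cdot p$. Precisely, there are a deterministic oracle program $M$ (for a random access machine with logarithmic cost) and constants $C$, $c$, all independent of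 $\gamma$ and $p$, such that for all functions $\gamma : \mathbb{N} \to [1,\infty)$ and $p : \mathbb{N} \to [2,\infty)$, every $\gamma$-GapSVP oracle, and every basis of a lattice $\mathcal{L}$ of dimension $n \ge 1$ in $\mathbb{Q}^N$: given the basis and the parameter value $\lfloor p(n) \rfloor$, the program $M$ halts after time at most $c\, n^c\, m^c\, p(n)$; all its oracle queries are GapSVP instances of the same dimension $n$ (in the same space $\mathbb{Q}^N$); and it outputs an $x \in \mathcal{L}$ with $$0 < \|x\| \le \gamma(n)^{C n^2/\log_2 p(n)} \cdot \lambda_1(\mathcal{L}).$$ -/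

import Mathlib

namespace SVPRed

/-! ### Lattices -/

/-- A rational vector seen as a vector of Euclidean space. -/
noncomputable def toReal {N : ℕ} (v : Fin N → ℚ) : EuclideanSpace ℝ (Fin N) :=
  WithLp.toLp 2 fun j => (v j : ℝ)

/-- A rational lattice basis: `n` linearly independent vectors with rational coordinates
in `N`-dimensional Euclidean space. -/
structure RatBasis (n N : ℕ) where
  vec : Fin n → Fin N → ℚ
  indep : LinearIndependent ℝ fun i => toReal (vec i)

/-- The lattice generated by a basis: all integer combinations of the basis vectors. -/
noncomputable def RatBasis.lattice {n N : ℕ} (B : RatBasis n N) :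
    Submodule ℤ (EuclideanSpace ℝ (Fin N)) :=
  Submodule.span ℤ (Set.range fun i => toReal (B.vec i))

/-- The length of a shortest non-zero vector. (The lattices below have positive rank and are
discrete, so the infimum is attained.) -/
noncomputable def lambda1 {N : ℕ} (L : Submodule ℤ (EuclideanSpace ℝ (Fin N))) : ℝ :=
  sInf {r : ℝ | ∃ x ∈ L, x ≠ 0 ∧ ‖x‖ = r}

/-! ### Bit lengths and the representation of inputs -/

/-- Bit length of an integer, with a sign bit. -/
def bits (z : ℤ) : ℕ := Nat.size z.natAbs + 1

/-- Bit length of a rational vector: total length of all numerators and denominators. -/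
def vecBits {N : ℕ} (v : Fin N → ℚ) : ℕ := ∑ j, (bits (v j).num + bits ((v j).den : ℤ))

/-- The maximal bit length of a basis vector. -/
def RatBasis.maxBits {n N : ℕ} (B : RatBasis n N) : ℕ :=
  Finset.univ.sup fun i => vecBits (B.vec i)

/-- A rational is written as its reduced numerator followed by its positive denominator. -/
def encodeRat (q : ℚ) : List ℤ := [q.num, (q.den : ℤ)]

def encodeVec {N : ℕ} (v : Fin N → ℚ) : List ℤ := (List.ofFn fun j => encodeRat (v j)).flatten

/-- Rank, ambient dimension, and then the basis vectors one after the other. -/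
def encodeBasis {n N : ℕ} (B : RatBasis n N) : List ℤ :=
  (n : ℤ) :: (N : ℤ) :: (List.ofFn fun i => encodeVec (B.vec i)).flatten

/-- A GapSVP instance: a basis and a threshold. -/
def encodeGap {n N : ℕ} (B : RatBasis n N) (d : ℚ) : List ℤ := encodeBasis B ++ encodeRat d

/-! ### Oracle random access machines with logarithmic cost

Programs are finite. The memory consists of arrays of integers, numbered by naturals; a program
mentions only finitely many of them. Every elementary operation is charged according to the
bit lengths of the numbers and the addresses it touches. -/

abbrev Mem := ℕ → ℤ → ℤ

inductive Op
  | add | sub | mul | div | lt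

/-- Integer arithmetic (`div` rounds, and is `0` for a zero divisor) and comparison. -/
def Op.apply : Op → ℤ → ℤ → ℤ
  | .add, x, y => x + y
  | .sub, x, y => x - y
  | .mul, x, y => x * y
  | .div, x, y => x / y
  | .lt, x, y => if x < y then 1 else 0

inductive Expr
  /-- an integer constant -/
  | const (z : ℤ)
  /-- `get a i` is the content of the `i`-th cell of array number `a` -/
  | get (a : ℕ) (i : Expr)
  | op (o : Op) (e₁ e₂ : Expr)

def Expr.val (σ : Mem) : Expr → ℤ
  | .const z => z
  | .get a i => σ a (i.val σ)
  | .op o e₁ e₂ => o.apply (e₁.val σ) (e₂.val σ)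

/-- Cost of evaluating an expression. -/
def Expr.cost (σ : Mem) : Expr → ℕ
  | .const z => bits z
  | .get a i => i.cost σ + bits (i.val σ) + bits (σ a (i.val σ))
  | .op _ e₁ e₂ => e₁.cost σ + e₂.cost σ + bits (e₁.val σ) * bits (e₂.val σ)

inductive Program
  | skip
  /-- `set a i e` stores the value of `e` in the `i`-th cell of array `a` -/
  | set (a : ℕ) (i e : Expr)
  | seq (P Q : Program)
  /-- run `P` if the value of `e` is non-zero, and `Q` otherwise -/
  | ite (e : Expr) (P Q : Program)
  /-- run `P` as long as the value of `e` is non-zero -/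
  | loop (e : Expr) (P : Program)
  /-- `ask a len b` submits the first `len` cells of array `a` to the oracle and stores the
  answer (`1` for yes, `0` for no) in the cell `0` of array `b` -/
  | ask (a : ℕ) (len : Expr) (b : ℕ)

def Mem.write (σ : Mem) (a : ℕ) (i z : ℤ) : Mem :=
  fun a' i' => if a' = a ∧ i' = i then z else σ a' i'

/-- The first `k` cells of array `a`. -/
def Mem.read (σ : Mem) (a k : ℕ) : List ℤ := (List.range k).map fun i => σ a (i : ℤ)

/-- The memory at the start: the input in array `0`, and zeros elsewhere. -/
def startMem (input : List ℤ) : Mem :=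
  fun a i => if a = 0 ∧ 0 ≤ i then input.getD i.toNat 0 else 0

/-- `Exec O P σ σ' t qs`: with oracle `O`, the program `P` started in memory `σ` halts in
memory `σ'` after total cost `t`, and `qs` is the list of its oracle queries, in order. -/
inductive Exec (O : List ℤ → Bool) : Program → Mem → Mem → ℕ → List (List ℤ) → Prop
  | skip (σ : Mem) : Exec O .skip σ σ 1 []
  | set (σ : Mem) (a : ℕ) (i e : Expr) :
      Exec O (.set a i e) σ (σ.write a (i.val σ) (e.val σ))
        (1 + i.cost σ + e.cost σ + bits (i.val σ) + bits (e.val σ)) []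
  | seq {P Q : Program} {σ σ₁ σ₂ : Mem} {t₁ t₂ : ℕ} {q₁ q₂ : List (List ℤ)} :
      Exec O P σ σ₁ t₁ q₁ → Exec O Q σ₁ σ₂ t₂ q₂ →
        Exec O (.seq P Q) σ σ₂ (1 + t₁ + t₂) (q₁ ++ q₂)
  | ite_true {e : Expr} {P Q : Program} {σ σ₁ : Mem} {t : ℕ} {q : List (List ℤ)} :
      e.val σ ≠ 0 → Exec O P σ σ₁ t q → Exec O (.ite e P Q) σ σ₁ (1 + e.cost σ + t) q
  | ite_false {e : Expr} {P Q : Program} {σ σ₁ : Mem} {t : ℕ} {q : List (List ℤ)} :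
      e.val σ = 0 → Exec O Q σ σ₁ t q → Exec O (.ite e P Q) σ σ₁ (1 + e.cost σ + t) q
  | loop_done {e : Expr} {P : Program} {σ : Mem} :
      e.val σ = 0 → Exec O (.loop e P) σ σ (1 + e.cost σ) []
  | loop_step {e : Expr} {P : Program} {σ σ₁ σ₂ : Mem} {t₁ t₂ : ℕ} {q₁ q₂ : List (List ℤ)} :
      e.val σ ≠ 0 → Exec O P σ σ₁ t₁ q₁ → Exec O (.loop e P) σ₁ σ₂ t₂ q₂ →
        Exec O (.loop e P) σ σ₂ (1 + e.cost σ + t₁ + t₂) (q₁ ++ q₂)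
  | ask (σ : Mem) (a : ℕ) (len : Expr) (b : ℕ) :
      Exec O (.ask a len b) σ
        (σ.write b 0 (if O (σ.read a (len.val σ).toNat) then 1 else 0))
        (1 + len.cost σ + ((σ.read a (len.val σ).toNat).map bits).sum)
        [σ.read a (len.val σ).toNat]

/-! ### The lattice problems -/

/-- `O` solves `γ`-GapSVP, where `γ` may depend on the rank `n`: it answers yes if the shortest
non-zero vector is shorter than `d`, and no if its length is at least `γ d`. Its answers on
all other inputs are arbitrary. -/
def IsGapSVPOracle (γ : ℕ → ℝ) (O : List ℤ → Bool) : Prop :=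
  ∀ (n N : ℕ) (B : RatBasis n N) (d : ℚ), 0 < n → 0 < d →
    (lambda1 B.lattice < d → O (encodeGap B d) = true) ∧
    (γ n * d ≤ lambda1 B.lattice → O (encodeGap B d) = false)

/-- `x` is a solution of the `α`-SVP instance `B`. -/
def IsSVPSolution {n N : ℕ} (α : ℝ) (B : RatBasis n N) (x : Fin N → ℚ) : Prop :=
  toReal x ∈ B.lattice ∧ 0 < ‖toReal x‖ ∧ ‖toReal x‖ ≤ α * lambda1 B.lattice

/-- Every query is a GapSVP instance of rank `n` in ambient dimension `N`. -/
def QueriesInDimension (n N : ℕ) (qs : List (List ℤ)) : Prop :=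
  ∀ q ∈ qs, ∃ (B : RatBasis n N) (d : ℚ), 0 < d ∧ q = encodeGap B d

end SVPRed

open SVPRed

namespace SVPRed

/-! ### Cost bounds for programs -/

/-! The lattice is thinned out through a chain of sublattices of index two until a short vector can
be read off, and the oracle is used to choose the chain so that the minimum grows little.

After clearing denominators and basis reduction there is an integral basis `V`; put `Y = V 0 ⬝ᵥ V
0`. A lattice vector not longer than `V 0` has coordinates of size at most `R = 4 ^ n`
(`Reduced.abs_coeff_le`). Every vector of `ℤ²` lies in one of the three sublattices of index two
(`M2.Mem.refine`). This is applied to the pair of coordinates `0` and `j`: a digit `0`, `1` or `2`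
selects one of the three, and `k = 4 * n + 3` digits select a plane lattice of determinant `2 ^ k >
4 * R ^ 2`. In a reduced basis of such a plane lattice all vectors with entries at most `R` are
multiples of the first one (`M2.Red.eq_mul`), so with respect to the new basis the coordinate `j` of
every short lattice vector vanishes. The `n - 1` phases `j = 1, …, n - 1`, with `K = (n - 1) * k`
digits altogether, leave only multiples of a single basis vector (`mem_span_of_mem_build`).

The digits are determined in batches of `s`, where `q = 3 ^ s` is about `p`. The `q` candidate
sublattices cover the current one (`exists_digits`), so one of them contains a shortest vector of
it. A binary search for the threshold, in which all candidates are submitted for each threshold,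
ends with a `lo` that is at most the scaled minimum of every candidate and with one candidate whose
scaled minimum is below `γ * (lo + 1)`. The rounding costs at most another factor `γ`: if `γ` is too
close to `1` to absorb it, then nothing is lost, because squared lengths are integers
(`sqrt_le_of_search`). So a batch loses at most `γ ^ 2` (`SearchInv.loss`). The last digits, at most
`s` of them, are tried exhaustively without oracle (`le_min_of_final`). Hence `e` batches with `e =
0` or `e * s < K` cause a loss, and `2 * e` is at most `32 * n ^ 2 / log p`
(`pow_le_rpow_exponent`). All minima are capped by `Y`: if a sublattice has no vector shorter than
`V 0`, then `V 0` itself is good enough.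

The program is written out and verified by rules for `Run` and `Ok`, which carry along a bound `2 ^
x` for all memory cells. For a fixed program the cost is then polynomial in `x`
(`Program.polyB_cst`); only the unnested loops over the `q` codes bring in the factor `q ≤ 2 * p`.
Numbers stay short because Gram determinants, and orthogonal components multiplied by them, are
integral and bounded; the number of exchanges in the basis reduction is bounded by the usual
potential. -/

instance : Add Expr := ⟨.op .add⟩
instance : Sub Expr := ⟨.op .sub⟩
instance : Mul Expr := ⟨.op .mul⟩
instance : Div Expr := ⟨.op .div⟩
instance (k : ℕ) : OfNat Expr k := ⟨.const k⟩

/-- The comparison `e < f`, with value `1` or `0`. -/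
def Expr.less (e f : Expr) : Expr := .op .lt e f

/-- The scalar variable kept in the cell `0` of array `a`. -/
def var (a : ℕ) : Expr := .get a 0

section val
variable (σ : Mem) (e f : Expr)
@[simp] theorem val_add : (e + f).val σ = e.val σ + f.val σ := rfl
@[simp] theorem val_sub : (e - f).val σ = e.val σ - f.val σ := rfl
@[simp] theorem val_mul : (e * f).val σ = e.val σ * f.val σ := rfl
@[simp] theorem val_div : (e / f).val σ = e.val σ / f.val σ := rfl
@[simp] theorem val_less : (e.less f).val σ = if e.val σ < f.val σ then 1 else 0 := rfl
@[simp] theorem val_var (a : ℕ) : (var a).val σ = σ a 0 := rfl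
@[simp] theorem val_get (a : ℕ) : (Expr.get a e).val σ = σ a (e.val σ) := rfl
@[simp] theorem val_const (z : ℤ) : (Expr.const z).val σ = z := rfl
@[simp] theorem val_ofNat (k : ℕ) [k.AtLeastTwo] :
    Expr.val σ (no_index (OfNat.ofNat k : Expr)) = (OfNat.ofNat k : ℤ) := rfl
@[simp] theorem val_zero : Expr.val σ (0 : Expr) = 0 := rfl
@[simp] theorem val_one : Expr.val σ (1 : Expr) = 1 := rfl
end val

@[simp] theorem write_same (σ : Mem) (a : ℕ) (i z : ℤ) : σ.write a i z a i = z := by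
  simp [Mem.write]

@[simp] theorem write_other (σ : Mem) {a b : ℕ} (i z : ℤ) (h : b ≠ a) :
    σ.write a i z b = σ b := by
  funext j; simp [Mem.write, h]

theorem write_other_idx (σ : Mem) (a : ℕ) {i j : ℤ} (z : ℤ) (h : j ≠ i) :
    σ.write a i z a j = σ a j := by
  simp [Mem.write, h]

theorem write_self_apply (σ : Mem) (a : ℕ) (i z j : ℤ) :
    σ.write a i z a j = if j = i then z else σ a j := by
  simp [Mem.write]

/-- All cells hold integers of absolute value below `2 ^ x`. -/
def MemB (x : ℕ) (σ : Mem) : Prop := ∀ a i, |σ a i| < 2 ^ x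

theorem MemB.mono {x y : ℕ} (h : x ≤ y) {σ : Mem} (hσ : MemB x σ) : MemB y σ := fun a i =>
  (hσ a i).trans_le (pow_le_pow_right₀ (by norm_num) h)

theorem MemB.write {x : ℕ} {σ : Mem} (hσ : MemB x σ) (a : ℕ) (i : ℤ) {z : ℤ} (hz : |z| < 2 ^ x) :
    MemB x (σ.write a i z) := by
  intro a' i'
  unfold Mem.write
  split
  · exact hz
  · exact hσ a' i'

theorem bits_le_of_abs_lt {z : ℤ} {x : ℕ} (h : |z| < 2 ^ x) : bits z ≤ x + 1 := by
  unfold bits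
  have : Nat.size z.natAbs ≤ x := by
    rw [Nat.size_le]
    zify
    exact h
  omega

theorem bits_pos (z : ℤ) : 1 ≤ bits z := by unfold bits; omega

theorem size_add_le (a b : ℕ) : Nat.size (a + b) ≤ Nat.size a + Nat.size b + 1 := by
  rw [Nat.size_le]
  have h1 := Nat.lt_size_self a
  have h2 := Nat.lt_size_self b
  have h3 : 2 ^ a.size ≤ 2 ^ (a.size + b.size) := Nat.pow_le_pow_right (by norm_num) (by omega)
  have h4 : 2 ^ b.size ≤ 2 ^ (a.size + b.size) := Nat.pow_le_pow_right (by norm_num) (by omega)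
  rw [pow_succ]
  omega

theorem size_mul_le (a b : ℕ) : Nat.size (a * b) ≤ Nat.size a + Nat.size b := by
  rw [Nat.size_le, pow_add]
  exact Nat.mul_lt_mul'' (Nat.lt_size_self a) (Nat.lt_size_self b)

/-- The sign bit counted in each operand leaves room for the carry of an addition, so one additive
bound serves for all operations. This is why weights simply add up along an expression. -/
theorem bits_apply_le (o : Op) (y z : ℤ) : bits (o.apply y z) ≤ bits y + bits z := by
  unfold bits
  cases o with
  | add =>
    have h := (Nat.size_le_size (Int.natAbs_add_le y z)).trans (size_add_le _ _)
    simp only [Op.apply]; omega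
  | sub =>
    have h := (Nat.size_le_size (Int.natAbs_sub_le y z)).trans (size_add_le _ _)
    simp only [Op.apply]; omega
  | mul =>
    have h := size_mul_le y.natAbs z.natAbs
    simp only [Op.apply, Int.natAbs_mul]; omega
  | div =>
    have h := Nat.size_le_size (Int.natAbs_ediv_le_natAbs y z)
    simp only [Op.apply]; omega
  | lt =>
    simp only [Op.apply]
    split
    · rename_i h
      have : y ≠ 0 ∨ z ≠ 0 := by omega
      have : 0 < Nat.size y.natAbs ∨ 0 < Nat.size z.natAbs := by
        rcases this with h | h
        · left; rw [Nat.size_pos]; omega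
        · right; rw [Nat.size_pos]; omega
      have : Nat.size (Int.natAbs 1) = 1 := by decide
      omega
    · simp only [Int.natAbs_zero, Nat.size_zero]
      omega

/-- A bound for the bit length of the value, in units of the largest bit length in memory. -/
def Expr.wt : Expr → ℕ
  | .const z => bits z
  | .get _ i => i.wt + 1
  | .op _ e f => e.wt + f.wt

/-- A bound for the cost of an expression when all cells have bit length at most `s`. -/
def Expr.cst (s : ℕ) : Expr → ℕ
  | .const z => bits z
  | .get _ i => i.cst s + i.wt * s + s
  | .op _ e f => e.cst s + f.cst s + (e.wt * s) * (f.wt * s)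

/-- A bound for the cost of a program when all cells have absolute value below `2 ^ x` and no
loop is repeated more than `x` times. -/
def Program.cst (x : ℕ) : Program → ℕ
  | .skip => 1
  | .set _ i e => 1 + i.cst (x + 1) + e.cst (x + 1) + i.wt * (x + 1) + e.wt * (x + 1)
  | .seq P Q => 1 + P.cst x + Q.cst x
  | .ite e P Q => 1 + e.cst (x + 1) + (P.cst x + Q.cst x)
  | .loop e P => (x + 1) * (1 + e.cst (x + 1) + P.cst x)
  | .ask _ len _ => 1 + len.cst (x + 1) + x * (x + 1)

theorem bits_val_le {x : ℕ} {σ : Mem} (hσ : MemB x σ) (e : Expr) :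
    bits (e.val σ) ≤ e.wt * (x + 1) := by
  induction e with
  | const z => exact Nat.le_mul_of_pos_right _ (by omega)
  | get a i ih =>
    simp only [Expr.val, Expr.wt, add_mul, one_mul]
    exact (bits_le_of_abs_lt (hσ _ _)).trans (by omega)
  | op o e f ihe ihf =>
    simp only [Expr.val, Expr.wt, add_mul]
    exact (bits_apply_le o _ _).trans (by omega)

theorem cost_le {x : ℕ} {σ : Mem} (hσ : MemB x σ) (e : Expr) : e.cost σ ≤ e.cst (x + 1) := by
  induction e with
  | const z => exact le_rfl
  | get a i ih =>
    simp only [Expr.cost, Expr.cst]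
    have := bits_val_le hσ i
    have := bits_le_of_abs_lt (hσ a (i.val σ))
    omega
  | op o e f ihe ihf =>
    simp only [Expr.cost, Expr.cst]
    have := Nat.mul_le_mul (bits_val_le hσ e) (bits_val_le hσ f)
    omega

/-- `f` is bounded by a polynomial. -/
def PolyB (f : ℕ → ℕ) : Prop := ∃ c, ∀ x, f x ≤ c * (x + 2) ^ c

/-- Coefficient and exponent may both be raised to their sum, as the base is positive. -/
theorem PolyB.mk' {f : ℕ → ℕ} (a c : ℕ) (h : ∀ x, f x ≤ a * (x + 2) ^ c) : PolyB f := by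
  refine ⟨a + c, fun x => (h x).trans ?_⟩
  exact Nat.mul_le_mul (by omega) (Nat.pow_le_pow_right (by omega) (by omega))

theorem PolyB.const (k : ℕ) : PolyB fun _ => k := .mk' k 0 (by simp)

theorem PolyB.id : PolyB fun x => x := .mk' 1 1 (by simp)

theorem PolyB.add {f g : ℕ → ℕ} (hf : PolyB f) (hg : PolyB g) : PolyB fun x => f x + g x := by
  obtain ⟨a, ha⟩ := hf
  obtain ⟨b, hb⟩ := hg
  refine ⟨a + b, fun x => ?_⟩
  have h1 : (x + 2) ^ a ≤ (x + 2) ^ (a + b) := Nat.pow_le_pow_right (by omega) (by omega)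
  have h2 : (x + 2) ^ b ≤ (x + 2) ^ (a + b) := Nat.pow_le_pow_right (by omega) (by omega)
  rw [add_mul]
  exact Nat.add_le_add ((ha x).trans (Nat.mul_le_mul_left _ h1))
    ((hb x).trans (Nat.mul_le_mul_left _ h2))

theorem PolyB.mul {f g : ℕ → ℕ} (hf : PolyB f) (hg : PolyB g) : PolyB fun x => f x * g x := by
  obtain ⟨a, ha⟩ := hf
  obtain ⟨b, hb⟩ := hg
  refine .mk' (a * b) (a + b) fun x => ?_
  refine (Nat.mul_le_mul (ha x) (hb x)).trans (le_of_eq ?_)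
  ring

theorem PolyB.pow {f : ℕ → ℕ} (hf : PolyB f) (k : ℕ) : PolyB fun x => f x ^ k := by
  induction k with
  | zero => simpa using PolyB.const 1
  | succ k ih => simpa only [pow_succ] using ih.mul hf

theorem PolyB.comp {f g : ℕ → ℕ} (hf : PolyB f) (hg : PolyB g) : PolyB fun x => f (g x) := by
  obtain ⟨a, ha⟩ := hf
  obtain ⟨c, hc⟩ := (PolyB.const a).mul ((hg.add (.const 2)).pow a)
  exact ⟨c, fun x => (ha _).trans (hc x)⟩

theorem Expr.polyB_cst (e : Expr) : PolyB fun x => e.cst (x + 1) := by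
  induction e with
  | const z => exact .const _
  | get a i ih => 
    exact (ih.add ((PolyB.const i.wt).mul (PolyB.id.add (.const 1)))).add
      (PolyB.id.add (.const 1))
  | op o e f ihe ihf =>
    have h := fun w : ℕ => (PolyB.const w).mul (PolyB.id.add (.const 1))
    exact (ihe.add ihf).add ((h _).mul (h _))

/-- A fixed program has a fixed nesting depth, and each loop only multiplies the bound by `x + 1`.
All polynomial time bounds come from here, except for loops whose number of rounds exceeds `x`. -/
theorem Program.polyB_cst (P : Program) : PolyB fun x => P.cst x := by
  have h := fun w : ℕ => (PolyB.const w).mul (PolyB.id.add (.const 1))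
  induction P with
  | skip => exact .const _
  | set a i e => exact ((((PolyB.const 1).add i.polyB_cst).add e.polyB_cst).add (h _)).add (h _)
  | seq P Q hP hQ => exact ((PolyB.const 1).add hP).add hQ
  | ite e P Q hP hQ => exact ((PolyB.const 1).add e.polyB_cst).add (hP.add hQ)
  | loop e P hP => exact (PolyB.id.add (.const 1)).mul (((PolyB.const 1).add e.polyB_cst).add hP)
  | ask a len b => exact ((PolyB.const 1).add len.polyB_cst).add (PolyB.id.mul (PolyB.id.add (.const 1)))

/-! ### Rules for running programs -/

/-- `P`, started in `σ`, halts after cost at most `T` with all queries in `G`, in a memory that is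
bounded by `2 ^ x` and satisfies `Q`. -/
def Run (O : List ℤ → Bool) (G : List ℤ → Prop) (x : ℕ) (P : Program) (σ : Mem) (T : ℕ)
    (Q : Mem → Prop) : Prop :=
  ∃ σ' t qs, Exec O P σ σ' t qs ∧ t ≤ T ∧ (∀ q ∈ qs, G q) ∧ MemB x σ' ∧ Q σ'

/-- The special case of `Run` where the bound is the one that is read off the program. -/
def Ok (O : List ℤ → Bool) (G : List ℤ → Prop) (x : ℕ) (P : Program) (σ : Mem)
    (Q : Mem → Prop) : Prop := Run O G x P σ (P.cst x) Q

variable {O : List ℤ → Bool} {G : List ℤ → Prop} {x : ℕ} {P P' : Program} {σ : Mem} {T T' : ℕ}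
  {Q R : Mem → Prop}

theorem Run.mono (h : Run O G x P σ T Q) {y : ℕ} (hxy : x ≤ y) (hT : T ≤ T')
    (hQ : ∀ σ', MemB x σ' → Q σ' → R σ') : Run O G y P σ T' R := by
  obtain ⟨σ', t, qs, h1, h2, h3, h4, h5⟩ := h
  exact ⟨σ', t, qs, h1, h2.trans hT, h3, h4.mono hxy, hQ _ h4 h5⟩

theorem Ok.imp (h : Ok O G x P σ Q) (hQ : ∀ σ', MemB x σ' → Q σ' → R σ') : Ok O G x P σ R :=
  Run.mono h le_rfl le_rfl hQ

theorem run_seq (h : Run O G x P σ T Q) (h' : ∀ σ', MemB x σ' → Q σ' → Run O G x P' σ' T' R) :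
    Run O G x (.seq P P') σ (1 + T + T') R := by
  obtain ⟨σ₁, t₁, q₁, h1, h2, h3, h4, h5⟩ := h
  obtain ⟨σ₂, t₂, q₂, k1, k2, k3, k4, k5⟩ := h' _ h4 h5
  refine ⟨σ₂, _, _, .seq h1 k1, by omega, ?_, k4, k5⟩
  intro q hq
  rcases List.mem_append.1 hq with hq | hq
  exacts [h3 q hq, k3 q hq]

theorem ok_seq (h : Ok O G x P σ Q) (h' : ∀ σ', MemB x σ' → Q σ' → Ok O G x P' σ' R) :
    Ok O G x (.seq P P') σ R := run_seq h h'

theorem ok_skip (hσ : MemB x σ) (hQ : Q σ) : Ok O G x .skip σ Q :=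
  ⟨σ, 1, [], .skip σ, le_rfl, by simp, hσ, hQ⟩

theorem ok_set (hσ : MemB x σ) {a : ℕ} {i e : Expr} (he : |e.val σ| < 2 ^ x)
    (hQ : Q (σ.write a (i.val σ) (e.val σ))) : Ok O G x (.set a i e) σ Q := by
  refine ⟨_, _, _, .set σ a i e, ?_, by simp, hσ.write _ _ he, hQ⟩
  have := cost_le hσ i
  have := cost_le hσ e
  have := bits_val_le hσ i
  have := bits_val_le hσ e
  simp only [Program.cst]
  omega

theorem run_ite (hσ : MemB x σ) {e : Expr} (h : e.val σ ≠ 0 → Run O G x P σ T Q)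
    (h' : e.val σ = 0 → Run O G x P' σ T' Q) :
    Run O G x (.ite e P P') σ (1 + e.cst (x + 1) + (T + T')) Q := by
  have := cost_le hσ e
  by_cases he : e.val σ = 0
  · obtain ⟨σ₁, t₁, q₁, h1, h2, h3⟩ := h' he
    exact ⟨_, _, _, .ite_false he h1, by omega, h3⟩
  · obtain ⟨σ₁, t₁, q₁, h1, h2, h3⟩ := h he
    exact ⟨_, _, _, .ite_true he h1, by omega, h3⟩

theorem ok_ite (hσ : MemB x σ) {e : Expr} (h : e.val σ ≠ 0 → Ok O G x P σ Q)
    (h' : e.val σ = 0 → Ok O G x P' σ Q) : Ok O G x (.ite e P P') σ Q := run_ite hσ h h'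

/-- In `Mem.read` the whole list of indices is coerced to a list of integers by a `flatMap`; here
the coercion is moved to the single index. -/
theorem read_eq (σ : Mem) (a k : ℕ) : σ.read a k = (List.range k).map fun i : ℕ => σ a (i : ℤ) := by
  have h (l : List ℕ) : List.map (fun i : ℤ => σ a i) (List.flatMap (fun i : ℕ => [(i : ℤ)]) l) =
      l.map fun i : ℕ => σ a (i : ℤ) := by
    induction l with
    | nil => rfl
    | cons y l ih => simp [List.flatMap_cons, ih]
  exact h _

theorem ok_ask (hσ : MemB x σ) {a b : ℕ} {len : Expr} (hx : 0 < x) (hlen : len.val σ ≤ x)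
    (hG : G (σ.read a (len.val σ).toNat))
    (hQ : Q (σ.write b 0 (if O (σ.read a (len.val σ).toNat) then 1 else 0))) :
    Ok O G x (.ask a len b) σ Q := by
  refine ⟨_, _, _, .ask σ a len b, ?_, by simpa using hG, hσ.write _ _ ?_, hQ⟩
  · have h1 := cost_le hσ len
    have h2 : ((σ.read a (len.val σ).toNat).map bits).sum ≤
        ((σ.read a (len.val σ).toNat).map bits).length • (x + 1) := by
      refine List.sum_le_card_nsmul _ _ fun y hy => ?_
      obtain ⟨z, hz, rfl⟩ := List.mem_map.1 hy
      rw [read_eq] at hz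
      obtain ⟨i, -, rfl⟩ := List.mem_map.1 hz
      exact bits_le_of_abs_lt (hσ _ _)
    have h3 : ((σ.read a (len.val σ).toNat).map bits).length ≤ x := by
      simp only [read_eq, List.length_map, List.length_range]
      omega
    have h4 := Nat.mul_le_mul_right (x + 1) h3
    simp only [smul_eq_mul] at h2
    simp only [Program.cst]
    omega
  · have : (1 : ℤ) < 2 ^ x := one_lt_pow₀ (by norm_num) (by omega)
    split <;> simp [this]

/-- A loop whose invariant `I j` says that at most `j` rounds remain. -/
theorem run_loop {e : Expr} (I : ℕ → Mem → Prop) (m : ℕ)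
    (hstep : ∀ j ≤ m, ∀ σ, MemB x σ → I j σ → e.val σ ≠ 0 →
      ∃ j', j = j' + 1 ∧ Run O G x P σ T (I j'))
    (hdone : ∀ j ≤ m, ∀ σ, MemB x σ → I j σ → e.val σ = 0 → Q σ)
    (hσ : MemB x σ) (hI : I m σ) :
    Run O G x (.loop e P) σ ((m + 1) * (1 + e.cst (x + 1) + T)) Q := by
  induction m generalizing σ with
  | zero =>
    by_cases he : e.val σ = 0
    · refine ⟨_, _, _, .loop_done he, ?_, by simp, hσ, hdone 0 le_rfl σ hσ hI he⟩
      have := cost_le hσ e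
      omega
    · obtain ⟨j', h, -⟩ := hstep 0 le_rfl σ hσ hI he
      omega
  | succ m ih =>
    have hc := cost_le hσ e
    by_cases he : e.val σ = 0
    · refine ⟨_, _, _, .loop_done he, ?_, by simp, hσ, hdone _ le_rfl σ hσ hI he⟩
      nlinarith
    · obtain ⟨j', h, hr⟩ := hstep _ le_rfl σ hσ hI he
      obtain rfl : m = j' := by omega
      obtain ⟨σ₁, t₁, q₁, h1, h2, h3, h4, h5⟩ := hr
      obtain ⟨σ₂, t₂, q₂, k1, k2, k3, k4, k5⟩ := ih (fun j hj => hstep j (by omega))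
        (fun j hj => hdone j (by omega)) h4 h5
      refine ⟨σ₂, _, _, .loop_step he h1 k1, ?_, ?_, k4, k5⟩
      · rw [add_mul (m + 1) 1, one_mul]
        omega
      · intro q hq
        rcases List.mem_append.1 hq with hq | hq
        exacts [h3 q hq, k3 q hq]

theorem ok_loop {e : Expr} (I : ℕ → Mem → Prop) (m : ℕ) (hm : m ≤ x)
    (hstep : ∀ j ≤ m, ∀ σ, MemB x σ → I j σ → e.val σ ≠ 0 →
      ∃ j', j = j' + 1 ∧ Ok O G x P σ (I j'))
    (hdone : ∀ j ≤ m, ∀ σ, MemB x σ → I j σ → e.val σ = 0 → Q σ)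
    (hσ : MemB x σ) (hI : I m σ) : Ok O G x (.loop e P) σ Q :=
  (run_loop I m hstep hdone hσ hI).mono le_rfl (Nat.mul_le_mul_right _ (by omega)) fun _ _ h => h

/-- `for v = 0, …, e - 1 do P` -/
def forTo (v : ℕ) (e : Expr) (P : Program) : Program :=
  .seq (.set v 0 0) (.loop ((var v).less e) (.seq P (.set v 0 (var v + 1))))

/-- The cost of `forTo` with `m` rounds of cost `T`. -/
def forCst (x : ℕ) (v : ℕ) (e : Expr) (m T : ℕ) : ℕ :=
  1 + (Program.set v 0 0).cst x +
    (m + 1) * (1 + ((var v).less e).cst (x + 1) + (1 + T + (Program.set v 0 (var v + 1)).cst x))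

/-- The number of rounds only has to fit into a cell, and the cost `T` of the body is a free
parameter, so this rule also covers loops over all codes. The invariant is required after the
counter has been advanced, and the limit `e` has to keep its value because it is evaluated in every
round. -/
theorem run_for {v : ℕ} {e : Expr} (I : ℕ → Mem → Prop) (m : ℕ) (hmx : m < 2 ^ x)
    (hσ : MemB x σ) (h0 : I 0 (σ.write v 0 0))
    (he : ∀ k ≤ m, ∀ σ, MemB x σ → σ v 0 = k → I k σ → e.val σ = m)
    (hstep : ∀ k < m, ∀ σ, MemB x σ → σ v 0 = k → I k σ →
      Run O G x P σ T fun σ' => σ' v 0 = k ∧ I (k + 1) (σ'.write v 0 (k + 1 : ℕ)))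
    (hpost : ∀ σ, MemB x σ → I m σ → σ v 0 = m → Q σ) :
    Run O G x (forTo v e P) σ (forCst x v e m T) Q := by
  refine run_seq (Q := fun σ' => σ' v 0 = 0 ∧ I 0 σ') (ok_set hσ (by simp) (by simpa using h0)) ?_
  rintro σ hσ ⟨hv, hI⟩
  refine run_loop (fun j σ => ∃ k : ℕ, k + j = m ∧ σ v 0 = k ∧ I k σ) m ?_ ?_ hσ
    ⟨0, by omega, hv, hI⟩
  · rintro j hj σ hσ ⟨k, hk, hv, hI⟩ hne
    have h := he k (by omega) σ hσ hv hI
    simp only [val_less, val_var, hv, h, ne_eq, ite_eq_right_iff, Classical.not_imp] at hne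
    refine ⟨j - 1, by omega, run_seq (hstep k (by omega) σ hσ hv hI) ?_⟩
    rintro σ' hσ' ⟨hv', hI'⟩
    refine ok_set hσ' ?_ ⟨k + 1, by omega, ?_, ?_⟩
    · simp only [val_add, val_var, val_one, hv']
      rw [abs_of_nonneg (by omega)]
      have : ((m : ℕ) : ℤ) < 2 ^ x := by exact_mod_cast hmx
      omega
    · simp [hv']
    · simpa [hv'] using hI'
  · rintro j hj σ hσ ⟨k, hk, hv, hI⟩ h0
    have h := he k (by omega) σ hσ hv hI
    simp only [val_less, val_var, hv, h, ite_eq_right_iff, one_ne_zero, imp_false, not_lt] at h0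
    obtain rfl : k = m := by omega
    exact hpost σ hσ hI hv

theorem ok_for {v : ℕ} {e : Expr} (I : ℕ → Mem → Prop) (m : ℕ) (hmx : m ≤ x)
    (hσ : MemB x σ) (h0 : I 0 (σ.write v 0 0))
    (he : ∀ k ≤ m, ∀ σ, MemB x σ → σ v 0 = k → I k σ → e.val σ = m)
    (hstep : ∀ k < m, ∀ σ, MemB x σ → σ v 0 = k → I k σ →
      Ok O G x P σ fun σ' => σ' v 0 = k ∧ I (k + 1) (σ'.write v 0 (k + 1 : ℕ)))
    (hpost : ∀ σ, MemB x σ → I m σ → σ v 0 = m → Q σ) :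
    Ok O G x (forTo v e P) σ Q := by
  refine (run_for I m (hmx.trans_lt Nat.lt_two_pow_self) hσ h0 he hstep hpost).mono le_rfl ?_
    fun _ _ h => h
  refine Nat.add_le_add_left (Nat.mul_le_mul_right _ (by omega)) _

/-- `d[i] := e` for `v = 0, …, m - 1`, where `i` and `e` may depend on `v` -/
def mapTo (v : ℕ) (m : Expr) (d : ℕ) (i e : Expr) : Program := forTo v m (.set d i e)

/-- `mapTo` with consecutive target cells. The expressions may read the target array, as long as
they do not notice what has been written so far. -/
theorem ok_map {v d : ℕ} {me i e : Expr} (m : ℕ) (base : ℤ) (f : ℕ → ℤ) (hvd : v ≠ d) (hmx : m ≤ x)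
    (hσ : MemB x σ)
    (he : ∀ k : ℕ, k ≤ m → ∀ σ' : Mem, (∀ a, a ≠ v → a ≠ d → σ' a = σ a) → σ' v 0 = k →
      (∀ z, (z < base ∨ base + k ≤ z) → σ' d z = σ d z) →
      me.val σ' = m ∧ (k < m → i.val σ' = base + k ∧ e.val σ' = f k))
    (hf : ∀ k < m, |f k| < 2 ^ x)
    (hpost : ∀ σ' : Mem, MemB x σ' → (∀ a, a ≠ v → a ≠ d → σ' a = σ a) →
      (∀ k : ℕ, k < m → σ' d (base + k) = f k) →
      (∀ z, (z < base ∨ base + m ≤ z) → σ' d z = σ d z) → Q σ') :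
    Ok O G x (mapTo v me d i e) σ Q := by
  refine ok_for (fun k σ' => (∀ a, a ≠ v → a ≠ d → σ' a = σ a) ∧
      (∀ j : ℕ, j < k → σ' d (base + j) = f j) ∧
      (∀ z, (z < base ∨ base + k ≤ z) → σ' d z = σ d z)) m hmx hσ ?_ ?_ ?_ ?_
  · refine ⟨fun a h1 h2 => by simp [h1], by simp, fun z _ => by simp [hvd.symm]⟩
  · rintro k hk σ' hσ' hv ⟨h1, h2, h3⟩
    exact (he k hk σ' h1 hv h3).1
  · rintro k hk σ' hσ' hv ⟨h1, h2, h3⟩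
    obtain ⟨hi, hval⟩ := (he k hk.le σ' h1 hv h3).2 hk
    refine ok_set hσ' (by rw [hval]; exact hf k hk) ⟨by simp [hvd, hv], ?_, ?_, ?_⟩
    · intro a ha hd
      simp [ha, hd, h1 a ha hd]
    · intro j hj
      rw [write_other _ _ _ hvd.symm, hi, hval, write_self_apply]
      split
      · congr 1; omega
      · exact h2 j (by omega)
    · intro z hz
      push_cast at hz
      rw [write_other _ _ _ hvd.symm, hi, write_other_idx _ _ _ (by omega)]
      exact h3 z (by omega)
  · rintro σ' hσ' ⟨h1, h2, h3⟩ hv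
    exact hpost σ' hσ' h1 h2 h3

/-- `d := ∑ e` over `v = 0, …, m - 1` -/
def sumTo (v : ℕ) (m : Expr) (d : ℕ) (e : Expr) : Program :=
  .seq (.set d 0 0) (forTo v m (.set d 0 (var d + e)))

theorem ok_sum {v d : ℕ} {me e : Expr} (m : ℕ) (f : ℕ → ℤ) (hvd : v ≠ d) (hmx : m ≤ x)
    (hσ : MemB x σ)
    (he : ∀ k : ℕ, k ≤ m → ∀ σ' : Mem, (∀ a, a ≠ v → a ≠ d → σ' a = σ a) → σ' v 0 = k →
      me.val σ' = m ∧ (k < m → e.val σ' = f k))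
    (hf : ∀ k ≤ m, |∑ j ∈ Finset.range k, f j| < 2 ^ x)
    (hpost : ∀ σ' : Mem, MemB x σ' → (∀ a, a ≠ v → a ≠ d → σ' a = σ a) →
      σ' d 0 = ∑ j ∈ Finset.range m, f j → Q σ') :
    Ok O G x (sumTo v me d e) σ Q := by
  refine ok_seq (Q := fun σ' => (∀ a, a ≠ v → a ≠ d → σ' a = σ a) ∧ σ' d 0 = 0)
    (ok_set hσ (by simp) ⟨fun a _ hd => by simp [hd], by simp⟩) ?_
  rintro σ₁ hσ₁ ⟨k1, k2⟩
  refine ok_for (fun k σ' => (∀ a, a ≠ v → a ≠ d → σ' a = σ a) ∧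
      σ' d 0 = ∑ j ∈ Finset.range k, f j) m hmx hσ₁ ?_ ?_ ?_ ?_
  · exact ⟨fun a h1 h2 => by simp [h1, k1 a h1 h2], by simp [hvd.symm, k2]⟩
  · rintro k hk σ' hσ' hv ⟨h1, h2⟩
    exact (he k hk σ' h1 hv).1
  · rintro k hk σ' hσ' hv ⟨h1, h2⟩
    have hval := (he k hk.le σ' h1 hv).2 hk
    refine ok_set hσ' ?_ ⟨by simp [hvd, hv], ?_, ?_⟩
    · simp only [val_add, val_var, h2, hval, ← Finset.sum_range_succ]
      exact hf _ hk
    · intro a ha hd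
      simp [ha, hd, h1 a ha hd]
    · simp [hvd.symm, h2, hval, Finset.sum_range_succ]
  · rintro σ' hσ' ⟨h1, h2⟩ hv
    exact hpost σ' hσ' h1 h2

end SVPRed

namespace SVPRed

set_option linter.unusedSectionVars false

/-! ### Gram-Schmidt orthogonalization -/

section Span
open Submodule

variable {R M : Type*} [Ring R] [AddCommGroup M] [Module R M]

/-- The span of the first `l` members of a family. -/
def below (R : Type*) [Ring R] {M : Type*} [AddCommGroup M] [Module R M] (f : ℕ → M) (l : ℕ) :
    Submodule R M := span R (f '' Set.Iio l)

variable {f g : ℕ → M} {l i n : ℕ}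

theorem mem_below (h : i < l) : f i ∈ below R f l := subset_span ⟨i, h, rfl⟩

theorem below_mono {l l' : ℕ} (h : l ≤ l') : below R f l ≤ below R f l' :=
  span_mono (Set.image_mono (Set.Iio_subset_Iio h))

theorem below_le {K : Submodule R M} (h : ∀ i < l, f i ∈ K) : below R f l ≤ K :=
  span_le.2 (by rintro _ ⟨i, hi, rfl⟩; exact h i hi)

@[simp] theorem below_zero : below R f 0 = ⊥ := by simp [below]

/-- Changes of the family by shears do not affect the Gram-Schmidt vectors. -/
theorem below_eq_of_shear (h : ∀ i < n, g i - f i ∈ below R f i) (hl : l ≤ n) :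
    below R g l = below R f l := by
  induction l with
  | zero => simp
  | succ l ih =>
    have ih := ih (by omega)
    apply le_antisymm
    · refine below_le fun i hi => ?_
      have := add_mem (below_mono (by omega) (h i (by omega))) (mem_below (R := R) (f := f) hi)
      simpa using this
    · refine below_le fun i hi => ?_
      have h1 : below R f i ≤ below R g (l + 1) :=
        (below_mono (by omega)).trans (ih.symm.le.trans (below_mono (by omega)))
      have := sub_mem (mem_below (R := R) (f := g) hi) (h1 (h i (by omega)))
      simpa using this

variable (f) (i) in
/-- The family with the members `i` and `i + 1` exchanged. -/
def swapAt : ℕ → M := f ∘ Equiv.swap i (i + 1)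

theorem swapAt_left : swapAt f i i = f (i + 1) := by simp [swapAt]
theorem swapAt_right : swapAt f i (i + 1) = f i := by simp [swapAt]
theorem swapAt_other {k : ℕ} (h : k ≠ i) (h' : k ≠ i + 1) : swapAt f i k = f k := by
  simp [swapAt, Equiv.swap_apply_of_ne_of_ne h h']

/-- An initial segment of any other length contains both of the exchanged members or neither. -/
theorem below_swapAt (h : l ≠ i + 1) : below R (swapAt f i) l = below R f l := by
  rcases Nat.lt_or_ge l (i + 1) with hl | hl
  · have : swapAt f i '' Set.Iio l = f '' Set.Iio l := by
      refine Set.image_congr fun k hk => ?_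
      have : k < l := hk
      exact swapAt_other (by omega) (by omega)
    rw [below, below, this]
  · have hl : i + 1 < l := by omega
    apply le_antisymm
    · refine below_le fun k hk => ?_
      rcases eq_or_ne k i with rfl | h1
      · rw [swapAt_left]; exact mem_below hl
      rcases eq_or_ne k (i + 1) with rfl | h2
      · rw [swapAt_right]; exact mem_below (by omega)
      rw [swapAt_other h1 h2]; exact mem_below hk
    · refine below_le fun k hk => ?_
      rcases eq_or_ne k i with rfl | h1
      · rw [← swapAt_right (f := f)]; exact mem_below hl
      rcases eq_or_ne k (i + 1) with rfl | h2
      · rw [← swapAt_left (f := f)]; exact mem_below (by omega)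
      rw [← swapAt_other (f := f) h1 h2]; exact mem_below hk

end Span

section GramSchmidt
open Submodule

variable {E : Type*} [NormedAddCommGroup E] [InnerProductSpace ℝ E] [FiniteDimensional ℝ E]

/-- The component of a vector orthogonal to the first `l` members of the family. -/
noncomputable def perp (f : ℕ → E) (l : ℕ) : E →L[ℝ] E := (below ℝ f l)ᗮ.starProjection

/-- The Gram-Schmidt vectors. -/
noncomputable def gs (f : ℕ → E) (i : ℕ) : E := perp f i (f i)

/-- The product of the squared lengths of the first `l` Gram-Schmidt vectors. -/
noncomputable def gdet (f : ℕ → E) (l : ℕ) : ℝ := ∏ i ∈ Finset.range l, ‖gs f i‖ ^ 2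

/-- The first `n` members of the family are linearly independent. -/
def Indep (n : ℕ) (f : ℕ → E) : Prop := LinearIndependent ℝ fun i : Fin n => f i

variable {f g : ℕ → E} {l i n : ℕ} {u v w : E}

theorem perp_mem (f : ℕ → E) (l : ℕ) (v : E) : perp f l v ∈ (below ℝ f l)ᗮ :=
  starProjection_apply_mem _ _

theorem sub_perp_mem (f : ℕ → E) (l : ℕ) (v : E) : v - perp f l v ∈ below ℝ f l := by
  have := sub_starProjection_mem_orthogonal (K := (below ℝ f l)ᗮ) v
  rwa [orthogonal_orthogonal] at this

/-- The two conditions characterize the projection; formulas for `perp` are proved by checking them.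
-/
theorem perp_eq (h : ∀ i < l, inner ℝ u (f i) = 0) (h' : v - u ∈ below ℝ f l) :
    perp f l v = u := by
  apply eq_starProjection_of_mem_orthogonal
  · have : below ℝ f l ≤ (span ℝ {u})ᗮ := below_le fun i hi =>
      mem_orthogonal_singleton_iff_inner_right.2 (h i hi)
    exact fun w hw => inner_left_of_mem_orthogonal (mem_span_singleton_self u) (this hw)
  · rwa [orthogonal_orthogonal]

theorem inner_perp_of_mem (hw : w ∈ below ℝ f l) (v : E) : inner ℝ (perp f l v) w = 0 :=
  inner_left_of_mem_orthogonal hw (perp_mem f l v)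

theorem perp_of_mem (hw : w ∈ below ℝ f l) : perp f l w = 0 :=
  perp_eq (by simp) (by simpa using hw)

theorem inner_perp_perp (v w : E) : inner ℝ (perp f l v) (perp f l w) = inner ℝ (perp f l v) w := by
  have := inner_perp_of_mem (sub_perp_mem f l w) v
  rw [inner_sub_right] at this
  linarith

theorem inner_perp_comm (v w : E) : inner ℝ (perp f l v) w = inner ℝ v (perp f l w) := by
  rw [← inner_perp_perp, real_inner_comm, inner_perp_perp, real_inner_comm]

theorem norm_perp_le (f : ℕ → E) (l : ℕ) (v : E) : ‖perp f l v‖ ≤ ‖v‖ :=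
  (ContinuousLinearMap.le_of_opNorm_le _ (starProjection_norm_le _) v).trans (by simp)

@[simp] theorem perp_zero (f : ℕ → E) (v : E) : perp f 0 v = v := perp_eq (by simp) (by simp)

theorem gs_zero (f : ℕ → E) : gs f 0 = f 0 := perp_zero f _

theorem inner_gs_left (f : ℕ → E) (l : ℕ) (v : E) :
    inner ℝ (gs f l) (perp f l v) = inner ℝ (gs f l) v := inner_perp_perp _ _

theorem inner_gs_self (f : ℕ → E) (l : ℕ) : inner ℝ (gs f l) (f l) = ‖gs f l‖ ^ 2 := by
  rw [← inner_gs_left, ← real_inner_self_eq_norm_sq]; rfl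

theorem inner_gs_of_lt (h : i < l) : inner ℝ (gs f l) (f i) = 0 :=
  inner_perp_of_mem (mem_below h) _

theorem gs_mem_below (h : i < l) : gs f i ∈ below ℝ f l := by
  have h1 := sub_perp_mem f i (f i)
  have := sub_mem (mem_below (f := f) h) (below_mono h.le h1)
  simpa [gs] using this

/-- The span of the first `l + 1` members is that of the first `l` together with the vector `gs f l`
orthogonal to them, so only one more component has to be removed. -/
theorem perp_succ (h : gs f l ≠ 0) (v : E) :
    perp f (l + 1) v = perp f l v - (inner ℝ (gs f l) v / ‖gs f l‖ ^ 2) • gs f l := by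
  have hne : ‖gs f l‖ ^ 2 ≠ 0 := by simpa using h
  apply perp_eq
  · intro i hi
    rw [inner_sub_left, inner_smul_left]
    rcases Nat.lt_succ_iff_lt_or_eq.1 hi with hi | rfl
    · rw [inner_gs_of_lt hi, inner_perp_of_mem (mem_below hi)]
      simp
    · rw [inner_gs_self, inner_perp_comm, real_inner_comm]
      simp only [conj_trivial]
      rw [div_mul_cancel₀ _ hne]
      exact sub_self _
  · have h1 := below_mono (l.le_succ) (sub_perp_mem f l v)
    have h2 := smul_mem _ (inner ℝ (gs f l) v / ‖gs f l‖ ^ 2) (gs_mem_below (f := f) l.lt_succ_self)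
    convert add_mem h1 h2 using 1
    abel

theorem norm_perp_succ (h : gs f l ≠ 0) (v : E) :
    ‖perp f (l + 1) v‖ ^ 2 = ‖perp f l v‖ ^ 2 - inner ℝ (gs f l) v ^ 2 / ‖gs f l‖ ^ 2 := by
  have hne : ‖gs f l‖ ^ 2 ≠ 0 := by simpa using h
  rw [perp_succ h, norm_sub_sq_real, inner_smul_right, real_inner_comm (gs f l), inner_gs_left,
    norm_smul, mul_pow, Real.norm_eq_abs, sq_abs]
  field_simp
  ring

/-- Otherwise `f i` would lie in the span of its predecessors. -/
theorem gs_ne_zero (h : Indep n f) (hi : i < n) : gs f i ≠ 0 := by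
  intro h0
  have h1 := sub_perp_mem f i (f i)
  change f i - gs f i ∈ _ at h1
  rw [h0, sub_zero] at h1
  refine h.notMem_span_image (s := {j : Fin n | (j : ℕ) < i}) (x := ⟨i, hi⟩) (by simp) ?_
  have : (fun i : Fin n => f i) '' {j : Fin n | (j : ℕ) < i} = f '' Set.Iio i := ?_
  · rw [this]; exact h1
  ext y
  constructor
  · rintro ⟨j, hj, rfl⟩
    exact ⟨j, hj, rfl⟩
  · rintro ⟨j, hj, rfl⟩
    exact ⟨⟨j, lt_trans hj hi⟩, hj, rfl⟩

theorem norm_gs_pos (h : Indep n f) (hi : i < n) : 0 < ‖gs f i‖ ^ 2 := by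
  have := gs_ne_zero h hi
  positivity

theorem norm_perp_anti {l l' : ℕ} (h : l ≤ l') (v : E) : ‖perp f l' v‖ ≤ ‖perp f l v‖ := by
  have : perp f l' v = perp f l' (perp f l v) := by
    have := perp_of_mem (below_mono h (sub_perp_mem f l v))
    rw [map_sub, sub_eq_zero] at this
    exact this
  rw [this]
  exact norm_perp_le _ _ _

theorem perp_congr (h : below ℝ f l = below ℝ g l) : perp f l = perp g l := by
  simp only [perp, h]

/-- Pythagoras: a vector in terms of its Gram-Schmidt coefficients. -/
theorem norm_sq_eq (h : Indep n f) (hl : l ≤ n) (v : E) :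
    ‖v‖ ^ 2 = ‖perp f l v‖ ^ 2 +
      ∑ k ∈ Finset.range l, (inner ℝ (gs f k) v / ‖gs f k‖ ^ 2) ^ 2 * ‖gs f k‖ ^ 2 := by
  induction l with
  | zero => simp
  | succ l ih =>
    have hp := (norm_gs_pos h hl).ne'
    rw [ih (by omega), Finset.sum_range_succ, norm_perp_succ (gs_ne_zero h hl)]
    field_simp
    ring

theorem eq_perp_add_sum (h : Indep n f) (hl : l ≤ n) (v : E) :
    v = perp f l v + ∑ k ∈ Finset.range l, (inner ℝ (gs f k) v / ‖gs f k‖ ^ 2) • gs f k := by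
  induction l with
  | zero => simp
  | succ l ih =>
    rw [Finset.sum_range_succ, perp_succ (gs_ne_zero h hl)]
    conv_lhs => rw [ih (by omega)]
    abel

theorem gdet_succ (f : ℕ → E) (l : ℕ) : gdet f (l + 1) = gdet f l * ‖gs f l‖ ^ 2 :=
  Finset.prod_range_succ _ _

@[simp] theorem gdet_zero (f : ℕ → E) : gdet f 0 = 1 := rfl

theorem gdet_pos (h : Indep n f) (hl : l ≤ n) : 0 < gdet f l :=
  Finset.prod_pos fun _ hi => norm_gs_pos h ((Finset.mem_range.1 hi).trans_le hl)

theorem gdet_le {X : ℝ} (hX : 1 ≤ X) (h : ∀ i < n, ‖gs f i‖ ^ 2 ≤ X) (hl : l ≤ n) :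
    gdet f l ≤ X ^ n := by
  calc gdet f l ≤ ∏ _i ∈ Finset.range l, X := by
        refine Finset.prod_le_prod (fun i _ => by positivity) fun i hi => h _ ?_
        exact (Finset.mem_range.1 hi).trans_le hl
    _ = X ^ l := by simp
    _ ≤ X ^ n := pow_le_pow_right₀ hX hl

/-- The Gram matrix of the first `l` members of a family. -/
def gram (f : ℕ → E) (l : ℕ) : Matrix (Fin l) (Fin l) ℝ := .of fun i j => inner ℝ (f i) (f j)

/-- The coefficients with respect to the Gram-Schmidt vectors form a unitriangular matrix `T`, and
the Gram matrix is `T * D * Tᵀ` with `D` diagonal. For integer vectors this makes `gdet` an integer.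
-/
theorem det_gram (h : Indep n f) (hl : l ≤ n) : (gram f l).det = gdet f l := by
  let T : Matrix (Fin l) (Fin l) ℝ := .of fun i k =>
    inner ℝ (gs f k) (f i) / ‖gs f k‖ ^ 2
  have hT : T.det = 1 := by
    rw [Matrix.det_of_isLowerTriangular T]
    · refine Finset.prod_eq_one fun i _ => ?_
      simp only [T, Matrix.of_apply, inner_gs_self]
      exact div_self (norm_gs_pos h (i.2.trans_le hl)).ne'
    · intro i j hij
      have hij : (i : ℕ) < j := hij
      simp [T, inner_gs_of_lt hij]
  have hG : gram f l = T * Matrix.diagonal (fun k : Fin l => ‖gs f k‖ ^ 2) * T.transpose := by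
    ext i j
    rw [Matrix.mul_apply]
    simp only [Matrix.mul_diagonal, Matrix.transpose_apply, gram, Matrix.of_apply, T]
    have hi := eq_perp_add_sum h hl (f i)
    rw [perp_of_mem (mem_below i.2), zero_add] at hi
    conv_lhs => rw [hi]
    rw [sum_inner, Finset.sum_range]
    refine Finset.sum_congr rfl fun k _ => ?_
    have := (norm_gs_pos h (k.2.trans_le hl)).ne'
    rw [inner_smul_left, conj_trivial]
    field_simp
  rw [hG, Matrix.det_mul, Matrix.det_mul, Matrix.det_transpose, hT, Matrix.det_diagonal, gdet,
    Finset.prod_range]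
  ring

/-! #### Elementary operations on the family -/

theorem gs_eq_of_shear (h : ∀ i < n, g i - f i ∈ below ℝ f i) (hi : i < n) : gs g i = gs f i := by
  have h1 := below_eq_of_shear h hi.le
  have h2 := perp_of_mem (h i hi)
  rw [gs, gs, perp_congr h1]
  rw [map_sub, sub_eq_zero] at h2
  exact h2

theorem gs_swapAt_other {k : ℕ} (h : k ≠ i) (h' : k ≠ i + 1) : gs (swapAt f i) k = gs f k := by
  rw [gs, gs, perp_congr (below_swapAt h'), swapAt_other h h']

theorem gs_swapAt_left : gs (swapAt f i) i = perp f i (f (i + 1)) := by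
  rw [gs, perp_congr (below_swapAt (by omega)), swapAt_left]

theorem norm_gs_swapAt_left (h : gs f i ≠ 0) : ‖gs (swapAt f i) i‖ ^ 2 =
    ‖gs f (i + 1)‖ ^ 2 + (inner ℝ (gs f i) (f (i + 1)) / ‖gs f i‖ ^ 2) ^ 2 * ‖gs f i‖ ^ 2 := by
  have h1 := norm_perp_succ h (f (i + 1))
  have hp : 0 < ‖gs f i‖ := by positivity
  rw [gs_swapAt_left, gs, h1]
  field_simp
  ring

theorem norm_gs_swapAt_right_le : ‖gs (swapAt f i) (i + 1)‖ ≤ ‖gs f i‖ := by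
  rw [gs, swapAt_right]
  refine (norm_perp_anti (by omega : i ≤ i + 1) _).trans ?_
  rw [perp_congr (below_swapAt (by omega))]
  rfl

theorem Indep.swapAt (h : Indep n f) (hi : i + 1 < n) : Indep n (swapAt f i) := by
  have := h.comp (Equiv.swap ⟨i, by omega⟩ ⟨i + 1, hi⟩) (Equiv.injective _)
  unfold Indep
  convert this using 1
  funext k
  simp only [Function.comp, SVPRed.swapAt, Equiv.swap_apply_def, Fin.ext_iff]
  split_ifs <;> rfl

/-- Both sides are the squared area of the parallelogram spanned by the components of `f i` and `f
(i + 1)` orthogonal to the first `i` members. -/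
theorem norm_gs_swapAt_mul (h : Indep n f) (hi : i + 1 < n) :
    ‖gs (swapAt f i) i‖ ^ 2 * ‖gs (swapAt f i) (i + 1)‖ ^ 2 =
      ‖gs f i‖ ^ 2 * ‖gs f (i + 1)‖ ^ 2 := by
  have h0 := gs_ne_zero h (by omega : i < n)
  have h1 := gs_ne_zero (h.swapAt hi) (by omega : i < n)
  have h2 := norm_perp_succ h1 (f i)
  rw [← swapAt_right (f := f) (i := i)] at h2
  change ‖gs _ _‖ ^ 2 = _ at h2
  have h3 : inner ℝ (gs (swapAt f i) i) (f i) = inner ℝ (gs f i) (f (i + 1)) := by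
    rw [gs_swapAt_left, inner_perp_comm, real_inner_comm]; rfl
  have h4 := norm_gs_swapAt_left h0
  have h5 : ‖perp (swapAt f i) i (f i)‖ = ‖gs f i‖ := by
    rw [perp_congr (below_swapAt (by omega))]; rfl
  rw [swapAt_right, h3, h5] at h2
  have p0 : ‖gs f i‖ ^ 2 ≠ 0 := by positivity
  have p1 : ‖gs (swapAt f i) i‖ ^ 2 ≠ 0 := by positivity
  rw [h2, mul_sub, mul_div_cancel₀ _ p1, h4]
  field_simp
  ring

theorem gdet_swapAt_of_ne (h : Indep n f) (hi : i + 1 < n) (hl : l ≠ i + 1) :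
    gdet (swapAt f i) l = gdet f l := by
  rcases Nat.lt_or_ge l (i + 1) with h1 | h1
  · refine Finset.prod_congr rfl fun k hk => ?_
    have := Finset.mem_range.1 hk
    rw [gs_swapAt_other (by omega) (by omega)]
  · obtain ⟨m, rfl⟩ := Nat.exists_eq_add_of_le (by omega : i + 2 ≤ l)
    clear hl h1
    induction m with
    | zero =>
      have : gdet (swapAt f i) i = gdet f i := by
        refine Finset.prod_congr rfl fun k hk => ?_
        have := Finset.mem_range.1 hk
        rw [gs_swapAt_other (by omega) (by omega)]
      rw [add_zero, gdet_succ, gdet_succ, gdet_succ, gdet_succ, mul_assoc, mul_assoc,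
        norm_gs_swapAt_mul h hi, this]
    | succ m ih => rw [← add_assoc, gdet_succ, gdet_succ, ih, gs_swapAt_other (by omega) (by omega)]

/-- The potential function that bounds the number of exchanges. -/
noncomputable def potential (n : ℕ) (f : ℕ → E) : ℝ := ∏ l ∈ Finset.range (n + 1), gdet f l

/-- Only the factor `gdet (i + 1)` changes. Its last factor `‖gs f i‖ ^ 2` becomes `‖gs f (i + 1)‖ ^
2 + μ ^ 2 * ‖gs f i‖ ^ 2`, which is at most `1 / 2 + 1 / 4` of the old value. -/
theorem potential_swapAt (h : Indep n f) (hi : i + 1 < n)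
    (hμ : |inner ℝ (gs f i) (f (i + 1)) / ‖gs f i‖ ^ 2| ≤ 1 / 2)
    (hlt : 2 * ‖gs f (i + 1)‖ ^ 2 < ‖gs f i‖ ^ 2) :
    4 * potential n (swapAt f i) ≤ 3 * potential n f := by
  have hmem : i + 1 ∈ Finset.range (n + 1) := by simp; omega
  rw [potential, potential, ← Finset.mul_prod_erase _ _ hmem, ← Finset.mul_prod_erase _ _ hmem]
  have h1 : ∏ l ∈ (Finset.range (n + 1)).erase (i + 1), gdet (swapAt f i) l =
      ∏ l ∈ (Finset.range (n + 1)).erase (i + 1), gdet f l :=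
    Finset.prod_congr rfl fun l hl => gdet_swapAt_of_ne h hi (Finset.ne_of_mem_erase hl)
  have h2 : 0 < ∏ l ∈ (Finset.range (n + 1)).erase (i + 1), gdet f l :=
    Finset.prod_pos fun l hl => gdet_pos h (by
      have := Finset.mem_range.1 (Finset.mem_of_mem_erase hl); omega)
  rw [h1, ← mul_assoc, ← mul_assoc]
  refine mul_le_mul_of_nonneg_right ?_ h2.le
  rw [gdet_succ, gdet_succ, gdet_swapAt_of_ne h hi (by omega),
    norm_gs_swapAt_left (gs_ne_zero h (by omega))]
  have h3 := gdet_pos h (by omega : i ≤ n)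
  have h4 := norm_gs_pos h (by omega : i < n)
  have h5 : (inner ℝ (gs f i) (f (i + 1)) / ‖gs f i‖ ^ 2) ^ 2 ≤ 1 / 4 := by
    rw [← sq_abs]
    nlinarith [abs_nonneg (inner ℝ (gs f i) (f (i + 1)) / ‖gs f i‖ ^ 2)]
  have h6 := mul_le_mul_of_nonneg_right h5 h4.le
  nlinarith

/-! #### Reduced families -/

/-- Size-reduced, and with Gram-Schmidt vectors that do not decrease too fast. -/
structure Reduced (n : ℕ) (f : ℕ → E) : Prop where
  size : ∀ i < n, ∀ l < i, |inner ℝ (gs f l) (f i) / ‖gs f l‖ ^ 2| ≤ 1 / 2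
  decay : ∀ i, i + 1 < n → ‖gs f i‖ ^ 2 ≤ 2 * ‖gs f (i + 1)‖ ^ 2

theorem Reduced.norm_gs_zero_le (h : Reduced n f) (hi : i < n) :
    ‖gs f 0‖ ^ 2 ≤ 2 ^ i * ‖gs f i‖ ^ 2 := by
  induction i with
  | zero => simp
  | succ i ih =>
    have := ih (by omega)
    have h2 := mul_le_mul_of_nonneg_left (h.decay i hi) (by positivity : (0 : ℝ) ≤ 2 ^ i)
    have h3 : (2 : ℝ) ^ (i + 1) = 2 ^ i * 2 := pow_succ _ _
    rw [h3]
    linarith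

/-- Vectors that are not longer than the first vector of a reduced basis have small
coefficients. -/
theorem Reduced.abs_coeff_le (h : Reduced n f) (hf : Indep n f) {c : ℕ → ℝ}
    (hv : ‖∑ k ∈ Finset.range n, c k • f k‖ ≤ ‖f 0‖) (hi : i < n) : |c i| ≤ 4 ^ n := by
  set v := ∑ k ∈ Finset.range n, c k • f k with hv'
  -- Downward induction, where `m` is the number of later coefficients. Up to an error of at most
  -- half the sum of the later bounds, `c i` is the Gram-Schmidt coefficient of `v`, which is at
  -- most `2 ^ i`; therefore the bound at most doubles from one index to the next lower one.
  suffices H : ∀ m i, i + m + 1 = n → |c i| ≤ 2 ^ n * 2 ^ m by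
    refine (H (n - 1 - i) i (by omega)).trans ?_
    rw [show (4 : ℝ) ^ n = 2 ^ n * 2 ^ n by rw [← mul_pow]; norm_num]
    exact mul_le_mul_of_nonneg_left (pow_le_pow_right₀ (by norm_num) (by omega)) (by positivity)
  intro m
  induction m using Nat.strong_induction_on with
  | _ m ih =>
  intro i him
  have hi : i < n := by omega
  have hp := norm_gs_pos hf hi
  have e1 : inner ℝ (gs f i) v / ‖gs f i‖ ^ 2 = c i + ∑ t ∈ Finset.range m,
      c (i + 1 + t) * (inner ℝ (gs f i) (f (i + 1 + t)) / ‖gs f i‖ ^ 2) := by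
    rw [hv', inner_sum, show n = i + 1 + m by omega, Finset.sum_range_add, Finset.sum_range_succ,
      Finset.sum_eq_zero, zero_add, inner_smul_right, inner_gs_self, add_div,
      mul_div_cancel_right₀ _ hp.ne', Finset.sum_div]
    · simp only [inner_smul_right, mul_div_assoc]
    · intro k hk
      rw [inner_smul_right, inner_gs_of_lt (Finset.mem_range.1 hk), mul_zero]
  have e2 : |inner ℝ (gs f i) v / ‖gs f i‖ ^ 2| ≤ 2 ^ i := by
    refine abs_le_of_sq_le_sq ?_ (by positivity)
    have h1 : inner ℝ (gs f i) v ^ 2 ≤ ‖gs f i‖ ^ 2 * ‖v‖ ^ 2 := by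
      rw [← mul_pow, ← sq_abs]
      exact pow_le_pow_left₀ (abs_nonneg _) (abs_real_inner_le_norm _ _) 2
    have h2 : ‖v‖ ^ 2 ≤ ‖gs f 0‖ ^ 2 := by
      rw [gs_zero]; exact pow_le_pow_left₀ (norm_nonneg _) hv 2
    have h3 := h.norm_gs_zero_le hi
    -- The argument gives the square root of `2 ^ i`; the weaker bound `2 ^ i` avoids the root.
    have h4 : (2 : ℝ) ^ i ≤ (2 ^ i) ^ 2 := by
      rw [sq]; exact le_mul_of_one_le_left (by positivity) (one_le_pow₀ (by norm_num))
    rw [div_pow, div_le_iff₀ (by positivity)]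
    calc _ ≤ ‖gs f i‖ ^ 2 * (2 ^ i * ‖gs f i‖ ^ 2) :=
          h1.trans (mul_le_mul_of_nonneg_left (h2.trans h3) hp.le)
      _ = 2 ^ i * (‖gs f i‖ ^ 2) ^ 2 := by ring
      _ ≤ _ := mul_le_mul_of_nonneg_right h4 (by positivity)
  have e3 : |∑ t ∈ Finset.range m,
      c (i + 1 + t) * (inner ℝ (gs f i) (f (i + 1 + t)) / ‖gs f i‖ ^ 2)| ≤
      2 ^ n * (2 ^ m - 1) / 2 := by
    refine (Finset.abs_sum_le_sum_abs _ _).trans ?_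
    have : ∀ t ∈ Finset.range m,
        |c (i + 1 + t) * (inner ℝ (gs f i) (f (i + 1 + t)) / ‖gs f i‖ ^ 2)| ≤
        2 ^ n / 2 * 2 ^ (m - 1 - t) := by
      intro t ht
      have ht := Finset.mem_range.1 ht
      rw [abs_mul]
      have h1 := ih (m - 1 - t) (by omega) (i + 1 + t) (by omega)
      have h2 := h.size (i + 1 + t) (by omega) i (by omega)
      calc _ ≤ (2 ^ n * 2 ^ (m - 1 - t)) * (1 / 2 : ℝ) :=
            mul_le_mul h1 h2 (abs_nonneg _) (by positivity)
        _ = _ := by ring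
    refine (Finset.sum_le_sum this).trans (le_of_eq ?_)
    rw [← Finset.mul_sum, Finset.sum_range_reflect (fun t => (2 : ℝ) ^ t), geom_sum_eq (by norm_num)]
    ring
  have e4 : c i = inner ℝ (gs f i) v / ‖gs f i‖ ^ 2 - ∑ t ∈ Finset.range m,
      c (i + 1 + t) * (inner ℝ (gs f i) (f (i + 1 + t)) / ‖gs f i‖ ^ 2) := by
    rw [e1]; ring
  have e5 : (2 : ℝ) ^ i ≤ 2 ^ n / 2 := by
    rw [le_div_iff₀ (by norm_num), ← pow_succ]
    exact pow_le_pow_right₀ (by norm_num) (by omega)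
  have e6 : (0 : ℝ) ≤ 2 ^ n * 2 ^ m := by positivity
  rw [e4]
  refine (abs_sub _ _).trans ?_
  linarith

end GramSchmidt

end SVPRed

namespace SVPRed

set_option linter.unusedSectionVars false

/-! ### Integer vectors -/

/-- Integer vectors with `N` coordinates. -/
abbrev Vec (N : ℕ) := Fin N → ℤ

variable {N : ℕ}

/-- The embedding of the integer vectors into Euclidean space. -/
noncomputable def emb : Vec N →+ EuclideanSpace ℝ (Fin N) where
  toFun v := WithLp.toLp 2 fun j => (v j : ℝ)
  map_zero' := by ext; simp
  map_add' u v := by ext; simp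

@[simp] theorem emb_apply (v : Vec N) (j : Fin N) : emb v j = v j := rfl

theorem emb_smul (z : ℤ) (v : Vec N) : emb (z • v) = (z : ℝ) • emb v := by
  ext; simp

theorem inner_emb (u v : Vec N) : inner ℝ (emb u) (emb v) = ((u ⬝ᵥ v : ℤ) : ℝ) := by
  simp [PiLp.inner_apply, dotProduct, mul_comm]

theorem norm_emb_sq (v : Vec N) : ‖emb v‖ ^ 2 = ((v ⬝ᵥ v : ℤ) : ℝ) := by
  rw [← real_inner_self_eq_norm_sq, inner_emb]

theorem emb_injective : Function.Injective (emb : Vec N → _) := by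
  intro u v h
  ext j
  have := congrArg (fun w => w j) h
  simpa using this

theorem emb_eq_zero {v : Vec N} : emb v = 0 ↔ v = 0 := by
  rw [← map_zero (emb (N := N)), emb_injective.eq_iff]

/-- The family of embedded vectors. -/
noncomputable def embf (b : ℕ → Vec N) : ℕ → EuclideanSpace ℝ (Fin N) := fun i => emb (b i)

/-- The lattice generated by the first `n` vectors. -/
abbrev Lat (n : ℕ) (b : ℕ → Vec N) : Submodule ℤ (Vec N) := below ℤ b n

theorem mem_Lat {n : ℕ} {b : ℕ → Vec N} {v : Vec N} :
    v ∈ Lat n b ↔ ∃ c : ℕ → ℤ, v = ∑ k ∈ Finset.range n, c k • b k := by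
  constructor
  · intro h
    induction h using Submodule.span_induction with
    | mem v h =>
      obtain ⟨i, hi, rfl⟩ := h
      refine ⟨fun k => if k = i then 1 else 0, ?_⟩
      have hi : i < n := hi
      simp [hi]
    | zero => exact ⟨0, by simp⟩
    | add u v _ _ hu hv =>
      obtain ⟨c, rfl⟩ := hu
      obtain ⟨d, rfl⟩ := hv
      exact ⟨c + d, by simp [add_smul, Finset.sum_add_distrib]⟩
    | smul z v _ hv =>
      obtain ⟨c, rfl⟩ := hv
      exact ⟨z • c, by simp [Finset.smul_sum, mul_smul]⟩
  · rintro ⟨c, rfl⟩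
    exact Submodule.sum_mem _ fun k hk =>
      Submodule.smul_mem _ _ (mem_below (Finset.mem_range.1 hk))

theorem emb_mem_below {n : ℕ} {b : ℕ → Vec N} {v : Vec N} (h : v ∈ Lat n b) :
    emb v ∈ below ℝ (embf b) n := by
  obtain ⟨c, rfl⟩ := mem_Lat.1 h
  rw [map_sum]
  refine Submodule.sum_mem _ fun k hk => ?_
  rw [emb_smul]
  exact Submodule.smul_mem _ _ (mem_below (f := embf b) (Finset.mem_range.1 hk))

/-- A family whose span contains as many independent vectors is independent. -/
theorem Indep.of_below {E : Type*} [NormedAddCommGroup E] [InnerProductSpace ℝ E]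
    [FiniteDimensional ℝ E] {n : ℕ} {f g : ℕ → E} (h : Indep n f)
    (hfg : ∀ i < n, f i ∈ below ℝ g n) : Indep n g := by
  have hr : ∀ f : ℕ → E, below ℝ f n = Submodule.span ℝ (Set.range fun i : Fin n => f i) := by
    intro f
    have : f '' Set.Iio n = Set.range fun i : Fin n => f i := ?_
    · rw [below, this]
    ext v
    constructor
    · rintro ⟨i, hi, rfl⟩; exact ⟨⟨i, hi⟩, rfl⟩
    · rintro ⟨i, rfl⟩; exact ⟨i, i.2, rfl⟩
  unfold Indep at *
  rw [linearIndependent_iff_card_le_finrank_span]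
  have h1 := linearIndependent_iff_card_eq_finrank_span.1 h
  rw [h1]
  unfold Set.finrank
  rw [← hr, ← hr]
  exact Submodule.finrank_mono (below_le hfg)

section Integrality
variable {n l : ℕ} {b : ℕ → Vec N}

/-- The integral Gram matrix. -/
def igram (b : ℕ → Vec N) (l : ℕ) : Matrix (Fin l) (Fin l) ℤ := .of fun i j => b i ⬝ᵥ b j

/-- The Gram determinant of the first `l` vectors. -/
def igdet (b : ℕ → Vec N) (l : ℕ) : ℤ := (igram b l).det

theorem igdet_cast (h : Indep n (embf b)) (hl : l ≤ n) :
    (igdet b l : ℝ) = gdet (embf b) l := by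
  rw [← det_gram h hl, igdet]
  have : gram (embf b) l = (igram b l).map (Int.castRingHom ℝ) := by
    ext i j
    simp [gram, igram, embf, inner_emb]
  rw [this, ← RingHom.mapMatrix_apply, ← RingHom.map_det]
  rfl

theorem one_le_igdet (h : Indep n (embf b)) (hl : l ≤ n) : 1 ≤ igdet b l := by
  have := gdet_pos h hl
  rw [← igdet_cast h hl] at this
  exact_mod_cast this

/-- The multiple of the orthogonal component that is integral by Cramer's rule. -/
def iperp (b : ℕ → Vec N) (l : ℕ) (v : Vec N) : Vec N :=
  igdet b l • v - ∑ k : Fin l, ((igram b l).adjugate.mulVec fun k => b k ⬝ᵥ v) k • b k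

/-- Orthogonality to the first `l` vectors is a linear system with the Gram matrix, and the adjugate
solves it up to the factor `igdet b l`. -/
theorem emb_iperp (h : Indep n (embf b)) (hl : l ≤ n) (v : Vec N) :
    emb (iperp b l v) = gdet (embf b) l • perp (embf b) l (emb v) := by
  rw [← map_smul]
  symm
  apply perp_eq
  · intro i hi
    rw [embf, inner_emb, iperp, sub_dotProduct, smul_dotProduct, sum_dotProduct]
    have h1 := congrFun (Matrix.mulVec_mulVec (fun k : Fin l => b k ⬝ᵥ v) (igram b l)
      (igram b l).adjugate) ⟨i, hi⟩
    rw [Matrix.mul_adjugate, Matrix.smul_mulVec, Matrix.one_mulVec] at h1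
    have h2 : ∑ k : Fin l, (b i ⬝ᵥ b k) *
        ((igram b l).adjugate.mulVec fun k => b k ⬝ᵥ v) k = igdet b l * (b i ⬝ᵥ v) := h1
    rw [Int.cast_eq_zero, sub_eq_zero, dotProduct_comm v, smul_eq_mul, ← h2]
    refine Finset.sum_congr rfl fun k _ => ?_
    rw [smul_dotProduct, smul_eq_mul, mul_comm, dotProduct_comm (b k)]
  · rw [← igdet_cast h hl, ← emb_smul, ← map_sub]
    refine emb_mem_below ?_
    rw [iperp, sub_sub_cancel]
    exact Submodule.sum_mem (Lat l b) fun k _ =>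
      Submodule.smul_mem (Lat l b) _ (mem_below (R := ℤ) (f := b) k.2)

theorem emb_iperp_self (h : Indep n (embf b)) (hl : l ≤ n) :
    emb (iperp b l (b l)) = gdet (embf b) l • gs (embf b) l := emb_iperp h hl _

theorem iperp_zero (h : Indep n (embf b)) (v : Vec N) : iperp b 0 v = v := by
  apply emb_injective
  rw [emb_iperp h (Nat.zero_le n)]
  simp

theorem igdet_zero (b : ℕ → Vec N) : igdet b 0 = 1 := by simp [igdet]

/-- This lets the program obtain the next Gram determinant from a single scalar product. -/
theorem dot_iperp_self (h : Indep n (embf b)) (hl : l < n) :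
    iperp b l (b l) ⬝ᵥ b l = igdet b (l + 1) := by
  have : ((iperp b l (b l) ⬝ᵥ b l : ℤ) : ℝ) = igdet b (l + 1) := by
    rw [← inner_emb, emb_iperp_self h hl.le, inner_smul_left, igdet_cast h hl, gdet_succ]
    change _ * inner ℝ (gs (embf b) l) (embf b l) = _
    rw [inner_gs_self]
    simp
  exact_mod_cast this

/-- The recursion that computes the orthogonal components without fractions. -/
theorem iperp_succ (h : Indep n (embf b)) (hl : l < n) (v : Vec N) (j : Fin N) :
    (igdet b (l + 1) * iperp b l v j - (v ⬝ᵥ iperp b l (b l)) * iperp b l (b l) j) / igdet b l =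
      iperp b (l + 1) v j := by
  have hd := one_le_igdet h hl.le
  refine Int.ediv_eq_of_eq_mul_left (by omega) ?_
  suffices H : igdet b (l + 1) • iperp b l v - (v ⬝ᵥ iperp b l (b l)) • iperp b l (b l) =
      igdet b l • iperp b (l + 1) v by
    have := congrFun H j
    simpa [mul_comm] using this
  apply emb_injective
  have hp := norm_gs_pos h hl
  have hg := gdet_pos h hl.le
  rw [map_sub, emb_smul, emb_smul, emb_smul, ← inner_emb, emb_iperp h hl.le, emb_iperp_self h hl.le,
    emb_iperp h hl, perp_succ (gs_ne_zero h hl), igdet_cast h hl, igdet_cast h hl.le, gdet_succ,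
    real_inner_comm, inner_smul_left, conj_trivial, smul_sub, smul_sub, smul_smul, smul_smul,
    smul_smul, smul_smul, smul_smul]
  congr 2
  · ring
  · have : ‖gs (embf b) l‖ ≠ 0 := norm_ne_zero_iff.2 (gs_ne_zero h hl)
    field_simp

/-- The Gram-Schmidt coefficients in terms of the integral data. -/
theorem coeff_eq (h : Indep n (embf b)) (hl : l < n) (v : Vec N) :
    inner ℝ (gs (embf b) l) (emb v) / ‖gs (embf b) l‖ ^ 2 =
      ((v ⬝ᵥ iperp b l (b l) : ℤ) : ℝ) / igdet b (l + 1) := by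
  have hp := norm_gs_pos h hl
  have hg := gdet_pos h hl.le
  rw [← inner_emb, emb_iperp_self h hl.le, igdet_cast h hl, gdet_succ, inner_smul_right,
    real_inner_comm]
  field_simp

/-- Projections do not lengthen `v`, and the multiplier is at most `X ^ n`. This keeps the
intermediate integers of the orthogonalization short. -/
theorem iperp_dot_self_le (h : Indep n (embf b)) (hl : l ≤ n) {X Y : ℕ} (hX : 1 ≤ X)
    (hgs : ∀ i < n, ‖gs (embf b) i‖ ^ 2 ≤ X) {v : Vec N} (hv : v ⬝ᵥ v ≤ Y) :
    iperp b l v ⬝ᵥ iperp b l v ≤ X ^ (2 * n) * Y := by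
  have h1 : ((iperp b l v ⬝ᵥ iperp b l v : ℤ) : ℝ) ≤ (X : ℝ) ^ (2 * n) * Y := by
    rw [← norm_emb_sq, emb_iperp h hl, norm_smul, mul_pow, Real.norm_eq_abs, sq_abs, mul_comm 2 n,
      pow_mul]
    refine mul_le_mul (pow_le_pow_left₀ (gdet_pos h hl).le ?_ 2) ?_ (by positivity) (by positivity)
    · exact gdet_le (by exact_mod_cast hX) hgs hl
    · refine (pow_le_pow_left₀ (norm_nonneg _) (norm_perp_le _ _ _) 2).trans ?_
      rw [norm_emb_sq]
      exact_mod_cast hv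
  exact_mod_cast h1

theorem igdet_le (h : Indep n (embf b)) (hl : l ≤ n) {X : ℕ} (hX : 1 ≤ X)
    (hgs : ∀ i < n, ‖gs (embf b) i‖ ^ 2 ≤ X) : igdet b l ≤ X ^ n := by
  have : (igdet b l : ℝ) ≤ (X : ℝ) ^ n := by
    rw [igdet_cast h hl]; exact gdet_le (by exact_mod_cast hX) hgs hl
  exact_mod_cast this

/-- The data computed from a family do not change under shears. -/
theorem igdet_eq_of_shear {b' : ℕ → Vec N} (h : Indep n (embf b)) (h' : Indep n (embf b'))
    (hgs : ∀ i < n, gs (embf b') i = gs (embf b) i) (hl : l ≤ n) : igdet b' l = igdet b l := by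
  have : (igdet b' l : ℝ) = igdet b l := by
    rw [igdet_cast h hl, igdet_cast h' hl]
    refine Finset.prod_congr rfl fun i hi => ?_
    rw [hgs i ((Finset.mem_range.1 hi).trans_le hl)]
  exact_mod_cast this

end Integrality

theorem dot_self_nonneg (v : Vec N) : 0 ≤ v ⬝ᵥ v :=
  Finset.sum_nonneg fun j _ => mul_self_nonneg (v j)

/-- For an integer the absolute value is at most the square, so no root is needed. -/
theorem abs_le_of_dot_self_le {v : Vec N} {A : ℤ} (h : v ⬝ᵥ v ≤ A) (j : Fin N) : |v j| ≤ A := by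
  have h1 : v j * v j ≤ v ⬝ᵥ v :=
    Finset.single_le_sum (f := fun j => v j * v j) (fun j _ => mul_self_nonneg (v j))
      (Finset.mem_univ j)
  have h2 : |v j| ≤ v j * v j := by
    rw [← abs_mul_abs_self]
    rcases eq_or_lt_of_le (abs_nonneg (v j)) with h | h
    · rw [← h]; simp
    · exact le_mul_of_one_le_left h.le h
  exact h2.trans (h1.trans h)

theorem abs_dot_le {u v : Vec N} {A B : ℤ} (hu : ∀ j, |u j| ≤ A) (hv : ∀ j, |v j| ≤ B) :
    |u ⬝ᵥ v| ≤ N * (A * B) := by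
  refine (Finset.abs_sum_le_sum_abs _ _).trans ?_
  refine (Finset.sum_le_card_nsmul _ _ (A * B) fun j _ => ?_).trans (by simp)
  rw [abs_mul]
  exact mul_le_mul (hu j) (hv j) (abs_nonneg _) ((abs_nonneg _).trans (hu j))

end SVPRed

namespace SVPRed

set_option linter.unusedSectionVars false

/-! ### Memory layout and programs on rows of matrices -/

notation "aIn" => (0 : ℕ)
notation "aOut" => (1 : ℕ)
notation "vn" => (2 : ℕ)
notation "vN" => (3 : ℕ)
notation "aV" => (4 : ℕ)
notation "aW" => (5 : ℕ)
notation "aD" => (6 : ℕ)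
notation "vi" => (7 : ℕ)
notation "vl" => (8 : ℕ)
notation "vj" => (9 : ℕ)
notation "vacc" => (10 : ℕ)
notation "vq" => (11 : ℕ)
notation "vflag" => (12 : ℕ)
notation "vk" => (13 : ℕ)
notation "atmp" => (14 : ℕ)

variable {N : ℕ} {O : List ℤ → Bool} {G : List ℤ → Prop} {x : ℕ} {σ : Mem} {Q : Mem → Prop}

/-- Only arrays in the list `S` differ. -/
def Frame (S : List ℕ) (σ σ' : Mem) : Prop := ∀ a, a ∉ S → σ' a = σ a

theorem Frame.refl (S : List ℕ) (σ : Mem) : Frame S σ σ := fun _ _ => rfl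

theorem Frame.trans {S : List ℕ} {σ σ₁ σ₂ : Mem} (h : Frame S σ σ₁) (h' : Frame S σ₁ σ₂) :
    Frame S σ σ₂ := fun a ha => (h' a ha).trans (h a ha)

theorem Frame.mono {S S' : List ℕ} {σ σ' : Mem} (h : Frame S σ σ') (hS : S ⊆ S') : Frame S' σ σ' :=
  fun a ha => h a fun h => ha (hS h)

theorem Frame.write {S : List ℕ} {σ σ' : Mem} (h : Frame S σ σ') {a : ℕ} (ha : a ∈ S) (i z : ℤ) :
    Frame S σ (σ'.write a i z) := fun b hb => by
  have hba : b ≠ a := by rintro rfl; exact hb ha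
  rw [write_other _ _ _ hba, h b hb]

/-- Row `r` of the matrix with `N` columns that is stored in array `a`. -/
def rowAt (N : ℕ) (σ : Mem) (a r : ℕ) : Vec N := fun j => σ a ((r : ℤ) * N + (j : ℕ))

theorem rowAt_congr {σ σ' : Mem} {a : ℕ} (h : σ' a = σ a) (r : ℕ) : rowAt N σ' a r = rowAt N σ a r := by
  funext j; simp [rowAt, h]

@[simp] theorem rowAt_write (N : ℕ) (σ : Mem) {a b : ℕ} (r : ℕ) (i z : ℤ) (h : a ≠ b) :
    rowAt N (σ.write b i z) a r = rowAt N σ a r := rowAt_congr (write_other _ _ _ h) r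

/-- The entry of the current column in the row with number `r`. -/
def elt (a : ℕ) (r : Expr) : Expr := .get a (r * var vN + var vj)

theorem val_elt {a r : ℕ} {re : Expr} {k : Fin N} (hr : re.val σ = r) (hN : σ vN 0 = N)
    (hj : σ vj 0 = (k : ℕ)) : (elt a re).val σ = rowAt N σ a r k := by
  simp [elt, rowAt, hr, hN, hj]

/-- Fills the row with number `r` of the matrix `a`. -/
def rowTo (a : ℕ) (r e : Expr) : Program := mapTo vj (var vN) a (r * var vN + var vj) e

/-- The expression may use the other rows of the matrix that is being written, and the entry that is
about to be overwritten. This is all that row operations in place require. -/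
theorem ok_row {a : ℕ} {re e : Expr} (r : ℕ) (g : Vec N) (ha : a ≠ vj) (ha' : a ≠ vN) (hNx : N ≤ x)
    (hσ : MemB x σ) (hN : σ vN 0 = N)
    (he : ∀ (k : Fin N) (σ' : Mem), Frame [vj, a] σ σ' → σ' vj 0 = (k : ℕ) →
      (∀ r' ≠ r, rowAt N σ' a r' = rowAt N σ a r') → rowAt N σ' a r k = rowAt N σ a r k →
      re.val σ' = r ∧ e.val σ' = g k)
    (hg : ∀ k, |g k| < 2 ^ x)
    (hpost : ∀ σ' : Mem, MemB x σ' → Frame [vj, a] σ σ' → rowAt N σ' a r = g →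
      (∀ r' ≠ r, rowAt N σ' a r' = rowAt N σ a r') → Q σ') :
    Ok O G x (rowTo a re e) σ Q := by
  have hframe : ∀ σ' : Mem, (∀ b, b ≠ vj → b ≠ a → σ' b = σ b) → Frame [vj, a] σ σ' := by
    intro σ' h b hb
    simp only [List.mem_cons, List.not_mem_nil, or_false, not_or] at hb
    exact h b hb.1 hb.2
  have hrows : ∀ (k : ℕ) (σ' : Mem), k ≤ N →
      (∀ z, (z < (r : ℤ) * N ∨ (r : ℤ) * N + k ≤ z) → σ' a z = σ a z) →
      ∀ r' ≠ r, rowAt N σ' a r' = rowAt N σ a r' := by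
    intro k σ' hk h r' hr'
    funext j
    refine h _ ?_
    have := j.2
    rcases Nat.lt_or_gt_of_ne hr' with h' | h'
    · left; nlinarith
    · right; nlinarith
  refine ok_map N ((r : ℤ) * N) (fun k => if h : k < N then g ⟨k, h⟩ else 0) ha.symm hNx hσ
    ?_ ?_ ?_
  · intro k hk σ' h1 h2 h3
    have hN' : σ' vN 0 = N := by rw [h1 vN (by decide) ha'.symm, hN]
    refine ⟨by simpa using hN', fun hk => ?_⟩
    obtain ⟨e1, e2⟩ := he ⟨k, hk⟩ σ' (hframe σ' h1) h2 (hrows k σ' hk.le h3)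
      (h3 _ (Or.inr le_rfl))
    simp [e1, e2, hN', h2, hk]
  · intro k hk
    simpa [hk] using hg ⟨k, hk⟩
  · intro σ' h0 h1 h2 h3
    refine hpost σ' h0 (hframe σ' h1) ?_ (hrows N σ' le_rfl h3)
    funext j
    simpa [rowAt] using h2 j j.2

/-- The inner product of two rows. -/
def dotTo (d : ℕ) (e e' : Expr) : Program := sumTo vj (var vN) d (e * e')

theorem ok_dot {d : ℕ} {e e' : Expr} (u v : Vec N) (hd : d ≠ vj) (hd' : d ≠ vN) (hNx : N ≤ x)
    (hσ : MemB x σ) (hN : σ vN 0 = N)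
    (he : ∀ (k : Fin N) (σ' : Mem), Frame [vj, d] σ σ' → σ' vj 0 = (k : ℕ) →
      e.val σ' = u k ∧ e'.val σ' = v k)
    {A B : ℤ} (hu : ∀ k, |u k| ≤ A) (hv : ∀ k, |v k| ≤ B) (hAB : N * (A * B) < 2 ^ x)
    (hpost : ∀ σ' : Mem, MemB x σ' → Frame [vj, d] σ σ' → σ' d 0 = u ⬝ᵥ v → Q σ') :
    Ok O G x (dotTo d e e') σ Q := by
  have hframe : ∀ σ' : Mem, (∀ b, b ≠ vj → b ≠ d → σ' b = σ b) → Frame [vj, d] σ σ' := by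
    intro σ' h b hb
    simp only [List.mem_cons, List.not_mem_nil, or_false, not_or] at hb
    exact h b hb.1 hb.2
  let f : ℕ → ℤ := fun k => if h : k < N then u ⟨k, h⟩ * v ⟨k, h⟩ else 0
  refine ok_sum N f hd.symm hNx hσ ?_ ?_ ?_
  · intro k hk σ' h1 h2
    have hN' : σ' vN 0 = N := by rw [h1 vN (by decide) hd'.symm, hN]
    refine ⟨by simpa using hN', fun hk => ?_⟩
    obtain ⟨e1, e2⟩ := he ⟨k, hk⟩ σ' (hframe σ' h1) h2
    simp [f, e1, e2, hk]
  · intro k hk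
    refine lt_of_le_of_lt ((Finset.abs_sum_le_sum_abs _ _).trans ?_) hAB
    rcases Nat.eq_zero_or_pos N with rfl | hN0
    · simp [Nat.le_zero.1 hk]
    have hAB' : ∀ i ∈ Finset.range k, |f i| ≤ A * B := by
      intro i hi
      have hi : i < N := (Finset.mem_range.1 hi).trans_le hk
      simp only [f, hi, dite_true, abs_mul]
      exact mul_le_mul (hu _) (hv _) (abs_nonneg _) ((abs_nonneg _).trans (hu ⟨i, hi⟩))
    refine (Finset.sum_le_card_nsmul _ _ _ hAB').trans ?_
    have h0 : 0 ≤ A * B := mul_nonneg ((abs_nonneg _).trans (hu ⟨0, hN0⟩))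
      ((abs_nonneg _).trans (hv ⟨0, hN0⟩))
    simp only [Finset.card_range, nsmul_eq_mul]
    exact mul_le_mul_of_nonneg_right (by exact_mod_cast hk) h0
  · intro σ' h0 h1 h2
    refine hpost σ' h0 (hframe σ' h1) ?_
    rw [h2, Finset.sum_range, dotProduct]
    simp [f]

end SVPRed

namespace SVPRed

set_option linter.unusedSectionVars false

/-! ### Basis reduction -/

variable {N : ℕ} {O : List ℤ → Bool} {G : List ℤ → Prop} {x : ℕ} {σ : Mem} {Q : Mem → Prop}

/-- The current numbers are all small in comparison with the bound `2 ^ x` for the memory. -/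
structure GsoBound (n N X A x : ℕ) (b : ℕ → Vec N) : Prop where
  indep : Indep n (embf b)
  one_le : 1 ≤ X
  gs_le : ∀ i < n, ‖gs (embf b) i‖ ^ 2 ≤ X
  row_le : ∀ i < n, b i ⬝ᵥ b i ≤ (n * X : ℕ)
  le_A : X ^ (2 * n) * (n * X) ≤ A
  lt_x : (N + 1) * (A * ((N + 2) * A * A) ^ n * A) < 2 ^ x
  n_le : n ≤ x
  N_le : N ≤ x

namespace GsoBound
variable {n X A : ℕ} {b : ℕ → Vec N} (H : GsoBound n N X A x b)
include H

theorem nX_le : n * X ≤ A := (Nat.le_mul_of_pos_left _ (by have := H.one_le; positivity)).trans H.le_A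

theorem one_le_A (hn : 0 < n) : 1 ≤ A :=
  le_trans (Nat.succ_le_of_lt (Nat.mul_pos hn H.one_le)) H.nX_le

theorem pow_le (hn : 0 < n) : X ^ n ≤ A := by
  refine le_trans ?_ H.le_A
  refine (Nat.pow_le_pow_right H.one_le (by omega : n ≤ 2 * n)).trans ?_
  exact Nat.le_mul_of_pos_right _ (Nat.mul_pos hn H.one_le)

theorem iperp_le {l i : ℕ} (hl : l ≤ n) (hi : i < n) (j : Fin N) :
    |iperp b l (b i) j| ≤ A := by
  refine abs_le_of_dot_self_le ?_ j
  refine (iperp_dot_self_le H.indep hl H.one_le H.gs_le (H.row_le i hi)).trans ?_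
  exact_mod_cast H.le_A

theorem entry_le {v : Vec N} (hv : v ⬝ᵥ v ≤ (n * X : ℕ)) (j : Fin N) : |v j| ≤ A :=
  (abs_le_of_dot_self_le hv j).trans (by exact_mod_cast H.nX_le)

theorem igdet_pos {l : ℕ} (hl : l ≤ n) : 1 ≤ igdet b l := one_le_igdet H.indep hl

theorem igdet_le_A (hn : 0 < n) {l : ℕ} (hl : l ≤ n) : igdet b l ≤ A :=
  (igdet_le H.indep hl H.one_le H.gs_le).trans (by exact_mod_cast H.pow_le hn)

/-- During size reduction a row may grow temporarily, by a factor of at most `(N + 2) * A * A` for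
each earlier row that is subtracted; `t` is the number of subtractions so far. -/
theorem big_lt (hn : 0 < n) {t : ℕ} (ht : t ≤ n) :
    ((N : ℤ) + 1) * ((A * ((N + 2) * A * A) ^ t : ℕ) * A) < 2 ^ x := by
  have h1 : 1 ≤ (N + 2) * A * A := by
    have := H.one_le_A hn
    exact Nat.one_le_iff_ne_zero.2 (by positivity)
  have h2 : ((N + 1) * (A * ((N + 2) * A * A) ^ t * A)) < 2 ^ x := by
    refine lt_of_le_of_lt ?_ H.lt_x
    gcongr
  exact_mod_cast h2

theorem A_lt (hn : 0 < n) : (A : ℤ) < 2 ^ x := by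
  have h := H.big_lt hn (Nat.zero_le n)
  have h1 : (1 : ℤ) ≤ A := by exact_mod_cast H.one_le_A hn
  simp only [pow_zero, mul_one] at h
  nlinarith

theorem NAA_lt (hn : 0 < n) : (N : ℤ) * (A * A) < 2 ^ x := by
  have h := H.big_lt hn (Nat.zero_le n)
  simp only [pow_zero, mul_one] at h
  nlinarith

end GsoBound

/-- Computes the integral Gram-Schmidt vector number `i` and the next Gram determinant. -/
def gsoStep : Program :=
  .seq (rowTo aW (var vi) (elt aV (var vi))) <|
  .seq (forTo vl (var vi) <|
    .seq (dotTo vacc (elt aV (var vi)) (elt aW (var vl))) <|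
      rowTo aW (var vi) ((.get aD (var vl + 1) * elt aW (var vi) - var vacc * elt aW (var vl)) /
        .get aD (var vl))) <|
  .seq (dotTo vacc (elt aW (var vi)) (elt aV (var vi))) <|
  .set aD (var vi + 1) (var vacc)

/-- The first `m` integral Gram-Schmidt vectors and the Gram determinants are in memory. -/
def HasGso (N : ℕ) (b : ℕ → Vec N) (m : ℕ) (σ : Mem) : Prop :=
  (∀ l < m, rowAt N σ aW l = iperp b l (b l)) ∧ ∀ l ≤ m, σ aD l = igdet b l

/-- In the inner loop row `i` of `aW` runs through `iperp b l (b i)` for `l = 0, …, i`. The division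
in `iperp_succ` is exact, so integer division computes it without fractions. -/
theorem ok_gsoStep {n X A i : ℕ} {b : ℕ → Vec N} (H : GsoBound n N X A x b) (hi : i < n)
    (hσ : MemB x σ) (hN : σ vN 0 = N) (hvi : σ vi 0 = i) (hG : HasGso N b i σ)
    (hV : rowAt N σ aV i = b i)
    (hpost : ∀ σ' : Mem, MemB x σ' → Frame [aW, aD, vl, vj, vacc] σ σ' →
      HasGso N b (i + 1) σ' → Q σ') : Ok O G x gsoStep σ Q := by
  have hn : 0 < n := by omega
  refine ok_seq (Q := fun σ' => Frame [aW, aD, vl, vj, vacc] σ σ' ∧ HasGso N b i σ' ∧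
    rowAt N σ' aW i = iperp b 0 (b i)) ?_ ?_
  · refine ok_row i (b i) (by decide) (by decide) H.N_le hσ hN ?_ ?_ ?_
    · intro k σ' hF hj _ _
      have e1 := hF vi (by decide)
      have e2 := hF vN (by decide)
      have e3 := hF aV (by decide)
      refine ⟨by simp [e1, hvi], ?_⟩
      rw [val_elt (r := i) (by simp [e1, hvi]) (by rw [e2, hN]) hj, rowAt_congr e3, hV]
    · exact fun k => (H.entry_le (H.row_le i hi) k).trans_lt (H.A_lt hn)
    · intro σ' hσ' hF hr hr'
      refine ⟨hF.mono (by decide), ⟨fun l hl => ?_, fun l hl => ?_⟩, ?_⟩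
      · rw [hr' l (by omega), hG.1 l hl]
      · rw [hF aD (by decide), hG.2 l hl]
      · rw [hr, iperp_zero H.indep]
  rintro σ₁ hσ₁ ⟨hF₁, hG₁, hr₁⟩
  refine ok_seq (Q := fun σ' => Frame [aW, aD, vl, vj, vacc] σ σ' ∧ HasGso N b i σ' ∧
    rowAt N σ' aW i = iperp b i (b i)) ?_ ?_
  · refine ok_for (fun l σ' => Frame [aW, aD, vl, vj, vacc] σ σ' ∧ HasGso N b i σ' ∧
      rowAt N σ' aW i = iperp b l (b i)) i (hi.le.trans H.n_le) hσ₁ ?_ ?_ ?_ ?_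
    · refine ⟨hF₁.write (by decide) _ _, ?_, ?_⟩
      · simpa [HasGso, rowAt] using hG₁
      · simpa [rowAt] using hr₁
    · rintro k hk σ' hσ' - ⟨hF, -⟩
      simp [hF vi (by decide), hvi]
    · rintro l hl σ₂ hσ₂ hvl ⟨hF₂, hG₂, hr₂⟩
      have hN₂ : σ₂ vN 0 = N := by rw [hF₂ vN (by decide), hN]
      have hvi₂ : σ₂ vi 0 = i := by rw [hF₂ vi (by decide), hvi]
      have hV₂ : rowAt N σ₂ aV i = b i := by rw [rowAt_congr (hF₂ aV (by decide)), hV]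
      refine ok_seq (Q := fun σ' => Frame [vj, vacc] σ₂ σ' ∧
        σ' vacc 0 = b i ⬝ᵥ iperp b l (b l)) ?_ ?_
      · refine ok_dot (b i) (iperp b l (b l)) (by decide) (by decide) H.N_le hσ₂ hN₂ ?_
          (H.entry_le (H.row_le i hi)) (H.iperp_le (by omega) (by omega)) (H.NAA_lt hn)
          fun σ' _ hF h => ⟨hF, h⟩
        intro k σ' hF hj
        have e2 : σ' vN 0 = N := by rw [hF vN (by decide), hN₂]
        refine ⟨?_, ?_⟩
        · rw [val_elt (r := i) (by simp [hF vi (by decide), hvi₂]) e2 hj,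
            rowAt_congr (hF aV (by decide)), hV₂]
        · rw [val_elt (r := l) (by simp [hF vl (by decide), hvl]) e2 hj,
            rowAt_congr (hF aW (by decide)), hG₂.1 l hl]
      rintro σ₃ hσ₃ ⟨hF₃, hacc⟩
      have hN₃ : σ₃ vN 0 = N := by rw [hF₃ vN (by decide), hN₂]
      have hvi₃ : σ₃ vi 0 = i := by rw [hF₃ vi (by decide), hvi₂]
      have hvl₃ : σ₃ vl 0 = l := by rw [hF₃ vl (by decide), hvl]
      refine ok_row i (iperp b (l + 1) (b i)) (by decide) (by decide) H.N_le hσ₃ hN₃ ?_ ?_ ?_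
      · intro k σ' hF hj hoth hown
        have e1 : σ' vN 0 = N := by rw [hF vN (by decide), hN₃]
        have e2 : σ' vi 0 = i := by rw [hF vi (by decide), hvi₃]
        have e3 : σ' vl 0 = l := by rw [hF vl (by decide), hvl₃]
        have e4 : (elt aW (var vi)).val σ' = iperp b l (b i) k := by
          rw [val_elt (r := i) (by simp [e2]) e1 hj, hown, rowAt_congr (hF₃ aW (by decide)), hr₂]
        have e5 : (elt aW (var vl)).val σ' = iperp b l (b l) k := by
          rw [val_elt (r := l) (by simp [e3]) e1 hj, hoth l (by omega),
            rowAt_congr (hF₃ aW (by decide)), hG₂.1 l hl]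
        have e6 : σ' aD (l : ℕ) = igdet b l := by
          rw [hF aD (by decide), hF₃ aD (by decide), hG₂.2 l hl.le]
        have e7 : σ' aD ((l : ℤ) + 1) = igdet b (l + 1) := by
          have := hG₂.2 (l + 1) hl
          push_cast at this
          rw [hF aD (by decide), hF₃ aD (by decide), this]
        have e8 : σ' vacc 0 = b i ⬝ᵥ iperp b l (b l) := by rw [hF vacc (by decide), hacc]
        refine ⟨by simp [e2], ?_⟩
        simp only [val_div, val_sub, val_mul, val_get, val_add, val_var, val_one, e3, e4, e5, e6,
          e7, e8]
        exact iperp_succ H.indep (by omega) _ _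
      · exact fun k => (H.iperp_le (by omega) hi k).trans_lt (H.A_lt hn)
      · intro σ' hσ' hF hr hr'
        refine ⟨by rw [hF vl (by decide), hvl₃], ?_, ⟨fun m hm => ?_, fun m hm => ?_⟩, ?_⟩
        · exact (hF₂.trans ((hF₃.mono (by decide)).trans (hF.mono (by decide)))).write
            (by decide) _ _
        · rw [rowAt_congr (σ := σ') (by simp), hr' m (by omega), rowAt_congr (hF₃ aW (by decide)),
            hG₂.1 m hm]
        · rw [write_other _ _ _ (by decide), hF aD (by decide), hF₃ aD (by decide), hG₂.2 m hm]
        · rw [rowAt_congr (σ := σ') (by simp), hr]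
    · exact fun σ' _ h _ => h
  rintro σ₂ hσ₂ ⟨hF₂, hG₂, hr₂⟩
  have hN₂ : σ₂ vN 0 = N := by rw [hF₂ vN (by decide), hN]
  have hvi₂ : σ₂ vi 0 = i := by rw [hF₂ vi (by decide), hvi]
  have hV₂ : rowAt N σ₂ aV i = b i := by rw [rowAt_congr (hF₂ aV (by decide)), hV]
  refine ok_seq (Q := fun σ' => Frame [vj, vacc] σ₂ σ' ∧ σ' vacc 0 = igdet b (i + 1)) ?_ ?_
  · refine ok_dot (iperp b i (b i)) (b i) (by decide) (by decide) H.N_le hσ₂ hN₂ ?_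
      (H.iperp_le hi.le hi) (H.entry_le (H.row_le i hi)) (H.NAA_lt hn)
      fun σ' _ hF h => ⟨hF, by rw [h, dot_iperp_self H.indep hi]⟩
    intro k σ' hF hj
    have e2 : σ' vN 0 = N := by rw [hF vN (by decide), hN₂]
    have e3 : σ' vi 0 = i := by rw [hF vi (by decide), hvi₂]
    refine ⟨?_, ?_⟩
    · rw [val_elt (r := i) (by simp [e3]) e2 hj, rowAt_congr (hF aW (by decide)), hr₂]
    · rw [val_elt (r := i) (by simp [e3]) e2 hj, rowAt_congr (hF aV (by decide)), hV₂]
  rintro σ₃ hσ₃ ⟨hF₃, hacc⟩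
  have e3 : σ₃ vi 0 = i := by rw [hF₃ vi (by decide), hvi₂]
  refine ok_set hσ₃ ?_ ?_
  · rw [val_var, hacc, abs_of_nonneg (by have := H.igdet_pos (l := i + 1) hi; omega)]
    exact (H.igdet_le_A hn hi).trans_lt (H.A_lt hn)
  · refine hpost _ (hσ₃.write _ _ (hσ₃ _ _))
      ((hF₂.trans (hF₃.mono (by decide))).write (by decide) _ _) ⟨fun l hl => ?_, fun l hl => ?_⟩
    · rw [rowAt_congr (σ := σ₃) (by simp), rowAt_congr (hF₃ aW (by decide))]
      rcases Nat.lt_succ_iff_lt_or_eq.1 hl with h | rfl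
      · exact hG₂.1 l h
      · exact hr₂
    · simp only [val_add, val_var, val_one, e3, hacc]
      rw [write_self_apply]
      split_ifs with h
      · rw [show l = i + 1 by omega]
      · rw [hF₃ aD (by decide), hG₂.2 l (by omega)]

end SVPRed

/-! ### Size reduction of a single row. -/

namespace SVPRed

set_option linter.unusedSectionVars false

variable {N : ℕ} {O : List ℤ → Bool} {G : List ℤ → Prop} {x : ℕ} {σ : Mem} {Q : Mem → Prop}

/-- The Gram-Schmidt coefficient of `v` at the `l`-th vector. -/
noncomputable def coeff (b : ℕ → Vec N) (l : ℕ) (v : Vec N) : ℝ :=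
  inner ℝ (gs (embf b) l) (emb v) / ‖gs (embf b) l‖ ^ 2

theorem coeff_sub_smul (b : ℕ → Vec N) (l : ℕ) (v w : Vec N) (q : ℤ) :
    coeff b l (v - q • w) = coeff b l v - q * coeff b l w := by
  simp only [coeff, map_sub, emb_smul, inner_sub_right, inner_smul_right]
  ring

section Shear
variable {n i l : ℕ} {b : ℕ → Vec N} {v : Vec N}

/-- The vector lies in the span of the first `l` basis vectors, to which the `l`-th Gram-Schmidt
vector is orthogonal. -/
theorem coeff_eq_zero (h : v - b i ∈ Lat i b) (hil : i < l) : coeff b l v = 0 := by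
  have h1 : v ∈ Lat l b := by
    have := add_mem (below_mono hil.le h) (mem_below (R := ℤ) (f := b) hil)
    simpa using this
  rw [coeff, gs, inner_perp_of_mem (emb_mem_below h1), zero_div]

theorem coeff_eq_one (hb : Indep n (embf b)) (h : v - b i ∈ Lat i b) (hi : i < n) :
    coeff b i v = 1 := by
  have h1 := inner_perp_of_mem (emb_mem_below h) (embf b i)
  rw [map_sub, inner_sub_right, sub_eq_zero] at h1
  change inner ℝ (gs (embf b) i) _ = inner ℝ (gs (embf b) i) (embf b i) at h1
  rw [coeff, h1, inner_gs_self]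
  exact div_self (norm_gs_pos hb hi).ne'

theorem shear_emb (h : v - b i ∈ Lat i b) : emb v - embf b i ∈ below ℝ (embf b) i := by
  rw [embf, ← map_sub]
  exact emb_mem_below h

/-- Size-reduced vectors are short. -/
theorem dot_self_le_of_coeff_le {X : ℕ} (hb : Indep n (embf b))
    (hgs : ∀ i < n, ‖gs (embf b) i‖ ^ 2 ≤ X) (hi : i < n) (h : v - b i ∈ Lat i b)
    (hc : ∀ l < i, |coeff b l v| ≤ 1 / 2) : v ⬝ᵥ v ≤ (n * X : ℕ) := by
  have h1 := norm_sq_eq hb hi.le (emb v)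
  have h2 : perp (embf b) i (emb v) = gs (embf b) i := by
    have := perp_of_mem (shear_emb h)
    rwa [map_sub, sub_eq_zero] at this
  have h3 : ∑ k ∈ Finset.range i, (inner ℝ (gs (embf b) k) (emb v) / ‖gs (embf b) k‖ ^ 2) ^ 2 *
      ‖gs (embf b) k‖ ^ 2 ≤ ∑ _k ∈ Finset.range i, (X : ℝ) := by
    refine Finset.sum_le_sum fun k hk => ?_
    have hk := Finset.mem_range.1 hk
    have h4 : coeff b k v ^ 2 ≤ 1 := by
      rw [← sq_abs]
      have := hc k hk
      nlinarith [abs_nonneg (coeff b k v)]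
    calc _ = coeff b k v ^ 2 * ‖gs (embf b) k‖ ^ 2 := rfl
      _ ≤ 1 * ‖gs (embf b) k‖ ^ 2 := mul_le_mul_of_nonneg_right h4 (by positivity)
      _ ≤ X := by rw [one_mul]; exact hgs k (hk.trans hi)
  have h5 := hgs i hi
  rw [Finset.sum_const, Finset.card_range, nsmul_eq_mul] at h3
  have h6 : ((v ⬝ᵥ v : ℤ) : ℝ) ≤ (i + 1 : ℕ) * X := by
    rw [← norm_emb_sq, h1, h2]
    push_cast
    linarith
  have h7 : v ⬝ᵥ v ≤ ((i + 1) * X : ℕ) := by exact_mod_cast h6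
  refine h7.trans ?_
  exact_mod_cast Nat.mul_le_mul_right X hi

end Shear

/-- Rounding to a nearest integer. -/
theorem abs_div_sub_round_le (a : ℤ) {d : ℤ} (hd : 0 < d) :
    |(a : ℝ) / d - ((2 * a + d) / (2 * d) : ℤ)| ≤ 1 / 2 := by
  have h1 := Int.emod_nonneg (2 * a + d) (by omega : 2 * d ≠ 0)
  have h2 := Int.emod_lt_of_pos (2 * a + d) (by omega : 0 < 2 * d)
  have h3 := Int.mul_ediv_add_emod (2 * a + d) (2 * d)
  generalize (2 * a + d) / (2 * d) = q at *
  generalize (2 * a + d) % (2 * d) = r at *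
  have hd' : (0 : ℝ) < d := by exact_mod_cast hd
  have h3' : (2 : ℝ) * d * q + r = 2 * a + d := by exact_mod_cast h3
  have h1' : (0 : ℝ) ≤ r := by exact_mod_cast h1
  have h2' : (r : ℝ) < 2 * d := by exact_mod_cast h2
  rw [abs_le]
  constructor
  · rw [le_sub_iff_add_le, le_div_iff₀ hd']; linarith
  · rw [sub_le_iff_le_add, div_le_iff₀ hd']; linarith

theorem abs_round_le (a : ℤ) {d : ℤ} (hd : 0 < d) : |(2 * a + d) / (2 * d)| ≤ |a| + 1 := by
  have h1 := abs_div_sub_round_le a hd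
  generalize (2 * a + d) / (2 * d) = q at *
  have h2 : |(a : ℝ) / d| ≤ |(a : ℝ)| := by
    rw [abs_div]
    refine div_le_self (abs_nonneg _) ?_
    rw [le_abs]; left; exact_mod_cast hd
  have h3 : |(q : ℝ)| < |(a : ℝ)| + 2 := by
    have := abs_sub_abs_le_abs_sub (q : ℝ) (a / d)
    rw [abs_sub_comm] at this
    linarith
  have : |q| < |a| + 2 := by exact_mod_cast h3
  omega

/-- Growth in one subtraction: `B` bounds the row being reduced, `M * (B * A) + 1` the rounded
quotient, and the last `A` the row that is subtracted. -/
theorem reduce_entry_le {A B M : ℤ} (hA : 1 ≤ A) (hB : 1 ≤ B) :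
    B + (M * (B * A) + 1) * A ≤ B * ((M + 2) * A * A) := by
  have h5 : 1 ≤ A * A := by nlinarith
  have h6 : B ≤ B * (A * A) := le_mul_of_one_le_right (by omega) h5
  have h7 : A * 1 ≤ (A * A) * B := mul_le_mul (by nlinarith) hB (by omega) (by omega)
  have h8 : B * ((M + 2) * A * A) = M * (B * A) * A + B * (A * A) + (A * A) * B := by ring
  rw [h8, add_mul]
  linarith

theorem le_succ_mul_mul {A B M : ℤ} (hA : 1 ≤ A) (hB : 1 ≤ B) :
    M * (B * A) + 1 ≤ (M + 1) * (B * A) := by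
  have h5 : 1 ≤ B * A := by nlinarith
  rw [add_mul]
  linarith

/-- Reduces row `i` by the previous rows. -/
def sizeStep : Program :=
  forTo vk (var vi) <|
    .seq (.set vl 0 (var vi - 1 - var vk)) <|
    .seq (dotTo vacc (elt aV (var vi)) (elt aW (var vl))) <|
    .seq (.set vq 0 ((2 * var vacc + .get aD (var vl + 1)) / (2 * .get aD (var vl + 1)))) <|
      rowTo aV (var vi) (elt aV (var vi) - var vq * elt aV (var vl))

/-- The earlier rows are used in order of decreasing `l`. Subtracting a multiple of `c l` changes
the coefficient at `l` by the rounded quotient, since `c l` has coefficient `1` there, and leaves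
the coefficients at larger indices alone. As `c l` differs from `b l` only by a shear, the data
computed from `b` remain valid. -/
theorem ok_sizeStep {n X A i : ℕ} {b c : ℕ → Vec N} (H : GsoBound n N X A x b) (hi : i < n)
    (hσ : MemB x σ) (hN : σ vN 0 = N) (hvi : σ vi 0 = i) (hG : HasGso N b (i + 1) σ)
    (hV : rowAt N σ aV i = b i) (hc : ∀ l < i, rowAt N σ aV l = c l)
    (hcb : ∀ l < i, c l - b l ∈ Lat l b) (hcX : ∀ l < i, c l ⬝ᵥ c l ≤ (n * X : ℕ))
    (hpost : ∀ (σ' : Mem) (v : Vec N), MemB x σ' → Frame [aV, vk, vl, vj, vacc, vq] σ σ' →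
      rowAt N σ' aV i = v → (∀ r ≠ i, rowAt N σ' aV r = rowAt N σ aV r) → v - b i ∈ Lat i b →
      (∀ l < i, |coeff b l v| ≤ 1 / 2) → Q σ') : Ok O G x sizeStep σ Q := by
  have hn : 0 < n := by omega
  have hA := H.one_le_A hn
  set K := (N + 2) * A * A with hK
  refine ok_for (fun k σ' => Frame [aV, vk, vl, vj, vacc, vq] σ σ' ∧
    (∀ r ≠ i, rowAt N σ' aV r = rowAt N σ aV r) ∧ ∃ v, rowAt N σ' aV i = v ∧ v - b i ∈ Lat i b ∧
      (∀ l < i, i ≤ l + k → |coeff b l v| ≤ 1 / 2) ∧ ∀ j, |v j| ≤ (A * K ^ k : ℕ)) i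
    (hi.le.trans H.n_le) hσ ?_ ?_ ?_ ?_
  · refine ⟨(Frame.refl _ _).write (by decide) _ _, fun r _ => by simp, b i, by simp [hV],
      by simp, fun l hl hl' => by omega, fun j => ?_⟩
    simpa using H.entry_le (H.row_le i hi) j
  · rintro k hk σ' hσ' - ⟨hF, -⟩
    simp [hF vi (by decide), hvi]
  · rintro k hk σ₁ hσ₁ hvk ⟨hF₁, hr₁, v, hv, hvb, hvc, hvA⟩
    obtain ⟨l, hl⟩ : ∃ l, l + k + 1 = i := ⟨i - 1 - k, by omega⟩
    have hxl : (i : ℤ) < 2 ^ x := by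
      exact_mod_cast (hi.trans_le H.n_le).trans Nat.lt_two_pow_self
    have hbig := H.big_lt hn (by omega : k ≤ n)
    have hbig' := H.big_lt hn (by omega : k + 1 ≤ n)
    rw [← hK] at hbig hbig'
    set B : ℤ := ((A * K ^ k : ℕ) : ℤ) with hB
    have hA' : (1 : ℤ) ≤ A := by exact_mod_cast hA
    have hB1 : 1 ≤ B := by
      have : 1 ≤ A * K ^ k := Nat.one_le_iff_ne_zero.2 (by positivity)
      rw [hB]; exact_mod_cast this
    have hBK : ((A * K ^ (k + 1) : ℕ) : ℤ) = B * ((N + 2) * A * A) := by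
      rw [hB, hK]; push_cast; ring
    have hN0 : (0 : ℤ) ≤ N := by positivity
    have hNBA : (N : ℤ) * (B * A) + 1 < 2 ^ x := (le_succ_mul_mul hA' hB1).trans_lt hbig
    refine ok_seq (Q := fun σ' => Frame [vl] σ₁ σ' ∧ σ' vl 0 = l) (ok_set hσ₁ ?_ ⟨?_, ?_⟩) ?_
    · simp only [val_sub, val_var, val_one, hF₁ vi (by decide), hvi, hvk]
      rw [abs_of_nonneg (by omega)]
      omega
    · exact (Frame.refl _ _).write (by decide) _ _
    · simp only [val_zero, write_same, val_sub, val_var, val_one, hF₁ vi (by decide), hvi, hvk]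
      omega
    rintro σ₂ hσ₂ ⟨hF₂, hvl₂⟩
    have hN₂ : σ₂ vN 0 = N := by rw [hF₂ vN (by decide), hF₁ vN (by decide), hN]
    have hvi₂ : σ₂ vi 0 = i := by rw [hF₂ vi (by decide), hF₁ vi (by decide), hvi]
    have hV₂ : rowAt N σ₂ aV i = v := by rw [rowAt_congr (hF₂ aV (by decide)), hv]
    have hW₂ : rowAt N σ₂ aW l = iperp b l (b l) := by
      rw [rowAt_congr (hF₂ aW (by decide)), rowAt_congr (hF₁ aW (by decide)), hG.1 l (by omega)]
    have hc₂ : rowAt N σ₂ aV l = c l := by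
      rw [rowAt_congr (hF₂ aV (by decide)), hr₁ l (by omega), hc l (by omega)]
    have hD₂ : σ₂ aD ((l : ℤ) + 1) = igdet b (l + 1) := by
      have := hG.2 (l + 1) (by omega)
      push_cast at this
      rw [hF₂ aD (by decide), hF₁ aD (by decide), this]
    have hD1 := H.igdet_pos (l := l + 1) (by omega)
    refine ok_seq (Q := fun σ' => Frame [vj, vacc] σ₂ σ' ∧ σ' vacc 0 = v ⬝ᵥ iperp b l (b l)) ?_ ?_
    · refine ok_dot v (iperp b l (b l)) (by decide) (by decide) H.N_le hσ₂ hN₂ ?_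
        hvA (H.iperp_le (by omega) (by omega)) (by linarith) fun σ' _ hF h => ⟨hF, h⟩
      intro k σ' hF hj
      have e2 : σ' vN 0 = N := by rw [hF vN (by decide), hN₂]
      refine ⟨?_, ?_⟩
      · rw [val_elt (r := i) (by simp [hF vi (by decide), hvi₂]) e2 hj,
          rowAt_congr (hF aV (by decide)), hV₂]
      · rw [val_elt (r := l) (by simp [hF vl (by decide), hvl₂]) e2 hj,
          rowAt_congr (hF aW (by decide)), hW₂]
    rintro σ₃ hσ₃ ⟨hF₃, hacc⟩
    have hdot : |v ⬝ᵥ iperp b l (b l)| ≤ N * (B * A) :=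
      abs_dot_le hvA (H.iperp_le (by omega) (by omega))
    have hq := abs_round_le (v ⬝ᵥ iperp b l (b l)) (d := igdet b (l + 1)) (by omega)
    have hqr := abs_div_sub_round_le (v ⬝ᵥ iperp b l (b l)) (d := igdet b (l + 1)) (by omega)
    set q := (2 * (v ⬝ᵥ iperp b l (b l)) + igdet b (l + 1)) / (2 * igdet b (l + 1)) with hqdef
    have hqv : ((2 * var vacc + .get aD (var vl + 1)) / (2 * .get aD (var vl + 1)) : Expr).val σ₃ =
        q := by
      simp only [val_div, val_add, val_mul, val_ofNat, val_var, val_get, val_one, hacc,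
        hF₃ vl (by decide), hvl₂, hF₃ aD (by decide), hD₂]
      rfl
    refine ok_seq (Q := fun σ' => Frame [vq] σ₃ σ' ∧ σ' vq 0 = q) (ok_set hσ₃ ?_ ⟨?_, ?_⟩) ?_
    · rw [hqv]; linarith
    · exact (Frame.refl _ _).write (by decide) _ _
    · simp only [val_zero, write_same, hqv]
    rintro σ₄ hσ₄ ⟨hF₄, hq₄⟩
    have hN₄ : σ₄ vN 0 = N := by rw [hF₄ vN (by decide), hF₃ vN (by decide), hN₂]
    have hvi₄ : σ₄ vi 0 = i := by rw [hF₄ vi (by decide), hF₃ vi (by decide), hvi₂]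
    have hvl₄ : σ₄ vl 0 = l := by rw [hF₄ vl (by decide), hF₃ vl (by decide), hvl₂]
    have hV₄ : ∀ r, rowAt N σ₄ aV r = rowAt N σ₂ aV r := fun r => by
      rw [rowAt_congr (hF₄ aV (by decide)), rowAt_congr (hF₃ aV (by decide))]
    have hentry : ∀ j, |(v - q • c l) j| ≤ B * ((N + 2) * A * A) := by
      intro j
      have h1 := hvA j
      have h2 := H.entry_le (hcX l (by omega)) j
      simp only [Pi.sub_apply, Pi.smul_apply, smul_eq_mul]
      have h3 : |q * c l j| ≤ (N * (B * A) + 1) * A := by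
        rw [abs_mul]
        exact mul_le_mul (by linarith) h2 (abs_nonneg _) (by positivity)
      exact (abs_sub _ _).trans ((add_le_add h1 h3).trans (reduce_entry_le hA' hB1))
    refine ok_row i (v - q • c l) (by decide) (by decide) H.N_le hσ₄ hN₄ ?_ ?_ ?_
    · intro k σ' hF hj hoth hown
      have e1 : σ' vN 0 = N := by rw [hF vN (by decide), hN₄]
      have e2 : σ' vi 0 = i := by rw [hF vi (by decide), hvi₄]
      have e3 : σ' vl 0 = l := by rw [hF vl (by decide), hvl₄]
      refine ⟨by simp [e2], ?_⟩
      rw [val_sub, val_mul, val_elt (r := i) (by simp [e2]) e1 hj,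
        val_elt (r := l) (by simp [e3]) e1 hj, hown, hoth l (by omega), hV₄, hV₄, hV₂, hc₂,
        val_var, hF vq (by decide), hq₄]
      rfl
    · intro j
      refine (hentry j).trans_lt (lt_of_le_of_lt ?_ hbig')
      rw [hBK]
      have hB2 : 1 ≤ B * ((N + 2) * A * A) := by
        refine hB1.trans (le_trans ?_ (reduce_entry_le (M := N) hA' hB1))
        have : 0 ≤ (N * (B * A) + 1) * (A : ℤ) := by positivity
        linarith
      have : 0 ≤ N * ((B * ((N + 2) * A * A)) * (A : ℤ)) := by positivity
      have : B * ((N + 2) * A * A) ≤ (B * ((N + 2) * A * A)) * A :=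
        le_mul_of_one_le_right (by omega) hA'
      rw [add_mul (N : ℤ) 1, one_mul]
      linarith
    · intro σ' hσ' hF hr hr'
      have hcl := hcb l (by omega)
      refine ⟨?_, ?_, fun r hr => ?_, v - q • c l, by simp [hr], ?_, ?_, ?_⟩
      · rw [hF vk (by decide), hF₄ vk (by decide), hF₃ vk (by decide), hF₂ vk (by decide), hvk]
      · exact (hF₁.trans ((hF₂.mono (by decide)).trans ((hF₃.mono (by decide)).trans
          ((hF₄.mono (by decide)).trans (hF.mono (by decide)))))).write (by decide) _ _
      · rw [rowAt_write _ _ _ _ _ (by decide), hr' r hr, hV₄, rowAt_congr (hF₂ aV (by decide)),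
          hr₁ r hr]
      · have h1 : c l ∈ Lat i b := by
          have := add_mem (below_mono (by omega) hcl) (mem_below (R := ℤ) (f := b)
            (show l < i by omega))
          simpa using this
        have := sub_mem hvb (Submodule.smul_mem _ q h1)
        convert this using 1
        abel
      · intro l' hl' hlk
        rw [coeff_sub_smul]
        rcases Nat.lt_or_ge l l' with h | h
        · rw [coeff_eq_zero hcl h, mul_zero, sub_zero]
          exact hvc l' hl' (by omega)
        · obtain rfl : l' = l := by omega
          rw [coeff_eq_one H.indep hcl (by omega), mul_one, coeff, coeff_eq H.indep (by omega)]
          exact hqr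
      · intro j
        rw [hBK]
        exact hentry j
  · rintro σ' hσ' ⟨hF, hr, v, hv, hvb, hvc, -⟩ -
    exact hpost σ' v hσ' hF hv hr hvb fun l hl => hvc l hl (by omega)

end SVPRed

/-! ### One pass of basis reduction: size reduction of all rows and the search for an exchange. -/

namespace SVPRed

set_option linter.unusedSectionVars false

variable {N : ℕ} {O : List ℤ → Bool} {G : List ℤ → Prop} {x : ℕ} {σ : Mem} {Q : Mem → Prop}

/-- Gram-Schmidt orthogonalization and size reduction of the whole basis. -/
def reducePass : Program :=
  .seq (.set aD 0 1) <| forTo vi (var vn) <| .seq gsoStep sizeStep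

/-- The arrays that are changed during basis reduction. -/
abbrev lllArrays : List ℕ := [aV, aW, aD, vi, vl, vj, vacc, vq, vflag, vk, atmp]

/-- Row `i` is orthogonalized while it still equals `b i` and is reduced afterwards. Interleaving
the two is harmless because shears do not change the Gram-Schmidt vectors. -/
theorem ok_reducePass {n X A : ℕ} {b : ℕ → Vec N} (H : GsoBound n N X A x b) (hn : 0 < n)
    (hσ : MemB x σ) (hvn : σ vn 0 = n) (hN : σ vN 0 = N) (hV : ∀ i < n, rowAt N σ aV i = b i)
    (hpost : ∀ (σ' : Mem) (c : ℕ → Vec N), MemB x σ' →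
      Frame [aV, aW, aD, vi, vl, vj, vacc, vq, vk] σ σ' →
      (∀ i < n, rowAt N σ' aV i = c i) → (∀ i < n, c i - b i ∈ Lat i b) →
      (∀ i < n, ∀ l < i, |coeff b l (c i)| ≤ 1 / 2) → (∀ l ≤ n, σ' aD l = igdet b l) → Q σ') :
    Ok O G x reducePass σ Q := by
  have hx1 : (1 : ℤ) < 2 ^ x := one_lt_pow₀ (by norm_num) (by have := H.n_le; omega)
  refine ok_seq (Q := fun σ' => Frame [aD] σ σ' ∧ σ' aD 0 = 1) (ok_set hσ (by simpa using hx1)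
    ⟨(Frame.refl _ _).write (by decide) _ _, by simp⟩) ?_
  rintro σ₁ hσ₁ ⟨hF₁, hD₁⟩
  refine ok_for (fun i σ' => Frame [aV, aW, aD, vi, vl, vj, vacc, vq, vk] σ σ' ∧
    HasGso N b i σ' ∧ ∃ c : ℕ → Vec N, (∀ r < n, rowAt N σ' aV r = c r) ∧
      (∀ r < n, c r - b r ∈ Lat r b) ∧ (∀ r < i, ∀ l < r, |coeff b l (c r)| ≤ 1 / 2) ∧
      ∀ r, i ≤ r → r < n → c r = b r) n H.n_le hσ₁ ?_ ?_ ?_ ?_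
  · refine ⟨(hF₁.mono (by decide)).write (by decide) _ _, ⟨by simp, fun l hl => ?_⟩, b,
      fun r hr => ?_, by simp, by simp, fun _ _ _ => rfl⟩
    · obtain rfl : l = 0 := by omega
      simp [hD₁, igdet_zero]
    · rw [rowAt_write _ _ _ _ _ (by decide), rowAt_congr (hF₁ aV (by decide)), hV r hr]
  · rintro k hk σ' hσ' - ⟨hF, -⟩
    simp [hF vn (by decide), hvn]
  · rintro i hi σ₂ hσ₂ hvi ⟨hF₂, hG₂, c, hc, hcb, hc2, hc3⟩
    have hVi : rowAt N σ₂ aV i = b i := by rw [hc i hi, hc3 i le_rfl hi]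
    refine ok_seq (Q := fun σ' => Frame [aW, aD, vl, vj, vacc] σ₂ σ' ∧ HasGso N b (i + 1) σ') ?_ ?_
    · exact ok_gsoStep H hi hσ₂ (by rw [hF₂ vN (by decide), hN]) hvi hG₂ hVi
        fun σ' _ hF hG => ⟨hF, hG⟩
    rintro σ₃ hσ₃ ⟨hF₃, hG₃⟩
    have hV₃ : ∀ r, rowAt N σ₃ aV r = rowAt N σ₂ aV r := rowAt_congr (hF₃ aV (by decide))
    refine ok_sizeStep (c := c) H hi hσ₃ (by rw [hF₃ vN (by decide), hF₂ vN (by decide), hN])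
      (by rw [hF₃ vi (by decide), hvi]) hG₃ (by rw [hV₃, hVi])
      (fun l hl => by rw [hV₃, hc l (by omega)]) (fun l hl => hcb l (by omega))
      (fun l hl => dot_self_le_of_coeff_le H.indep H.gs_le (by omega) (hcb l (by omega)) (hc2 l hl))
      ?_
    intro σ₄ v hσ₄ hF₄ hv hr hvb hvc
    refine ⟨by rw [hF₄ vi (by decide), hF₃ vi (by decide), hvi], ?_, ⟨?_, ?_⟩,
      fun r => if r = i then v else c r, ?_, ?_, ?_, ?_⟩
    · exact (hF₂.trans ((hF₃.mono (by decide)).trans (hF₄.mono (by decide)))).write (by decide) _ _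
    · intro l hl
      rw [rowAt_write _ _ _ _ _ (by decide), rowAt_congr (hF₄ aW (by decide)), hG₃.1 l hl]
    · intro l hl
      rw [write_other _ _ _ (by decide), hF₄ aD (by decide), hG₃.2 l hl]
    · intro r hr'
      rw [rowAt_write _ _ _ _ _ (by decide)]
      dsimp only
      split_ifs with h
      · rw [h, hv]
      · rw [hr r h, hV₃, hc r hr']
    · intro r hr'
      dsimp only
      split_ifs with h
      · rw [h]; exact hvb
      · exact hcb r hr'
    · intro r hr'
      dsimp only
      split_ifs with h
      · rw [h]; exact hvc
      · exact hc2 r (by omega)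
    · intro r h1 h2
      dsimp only
      rw [if_neg (by omega)]
      exact hc3 r (by omega) h2
  · rintro σ' hσ' ⟨hF, hG, c, h1, h2, h3, -⟩ -
    exact hpost σ' c hσ' hF h1 h2 h3 hG.2

/-- Exchanges the rows `i` and `i + 1`. -/
def swapRows : Program :=
  .seq (.set vflag 0 1) <|
  .seq (rowTo atmp 0 (elt aV (var vi))) <|
  .seq (rowTo aV (var vi) (elt aV (var vi + 1))) <|
    rowTo aV (var vi + 1) (elt atmp 0)

theorem ok_swapRows {n i : ℕ} {c : ℕ → Vec N} (hN' : N ≤ x) (hi : i + 1 < n)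
    (hx : 0 < x) (hσ : MemB x σ) (hN : σ vN 0 = N) (hvi : σ vi 0 = i)
    (hV : ∀ r < n, rowAt N σ aV r = c r)
    (hpost : ∀ σ' : Mem, MemB x σ' → Frame [aV, vj, vflag, atmp] σ σ' → σ' vflag 0 = 1 →
      (∀ r < n, rowAt N σ' aV r = swapAt c i r) → Q σ') : Ok O G x swapRows σ Q := by
  have hx1 : (1 : ℤ) < 2 ^ x := one_lt_pow₀ (by norm_num) (by omega)
  have hb : ∀ (σ : Mem) (a r : ℕ) (k : Fin N), MemB x σ → |rowAt N σ a r k| < 2 ^ x :=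
    fun σ a r k h => h _ _
  refine ok_seq (Q := fun σ' => Frame [vflag] σ σ' ∧ σ' vflag 0 = 1) (ok_set hσ (by simpa using hx1)
    ⟨(Frame.refl _ _).write (by decide) _ _, by simp⟩) ?_
  rintro σ₁ hσ₁ ⟨hF₁, hf₁⟩
  have hN₁ : σ₁ vN 0 = N := by rw [hF₁ vN (by decide), hN]
  have hvi₁ : σ₁ vi 0 = i := by rw [hF₁ vi (by decide), hvi]
  refine ok_seq (Q := fun σ' => Frame [vj, atmp] σ₁ σ' ∧ rowAt N σ' atmp 0 = rowAt N σ₁ aV i) ?_ ?_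
  · refine ok_row 0 _ (by decide) (by decide) hN' hσ₁ hN₁ ?_ (fun k => hb _ _ _ k hσ₁)
      fun σ' _ hF h _ => ⟨hF, h⟩
    intro k σ' hF hj _ _
    refine ⟨by simp, ?_⟩
    rw [val_elt (r := i) (by simp [hF vi (by decide), hvi₁]) (by rw [hF vN (by decide), hN₁]) hj,
      rowAt_congr (hF aV (by decide))]
  rintro σ₂ hσ₂ ⟨hF₂, ht₂⟩
  have hN₂ : σ₂ vN 0 = N := by rw [hF₂ vN (by decide), hN₁]
  have hvi₂ : σ₂ vi 0 = i := by rw [hF₂ vi (by decide), hvi₁]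
  refine ok_seq (Q := fun σ' => Frame [vj, aV] σ₂ σ' ∧ rowAt N σ' aV i = rowAt N σ₂ aV (i + 1) ∧
    ∀ r ≠ i, rowAt N σ' aV r = rowAt N σ₂ aV r) ?_ ?_
  · refine ok_row i _ (by decide) (by decide) hN' hσ₂ hN₂ ?_ (fun k => hb _ _ _ k hσ₂)
      fun σ' _ hF h h' => ⟨hF, h, h'⟩
    intro k σ' hF hj hoth _
    refine ⟨by simp [hF vi (by decide), hvi₂], ?_⟩
    rw [val_elt (r := i + 1) (by simp [hF vi (by decide), hvi₂]) (by rw [hF vN (by decide), hN₂]) hj,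
      hoth _ (by omega)]
  rintro σ₃ hσ₃ ⟨hF₃, hi₃, hr₃⟩
  have hN₃ : σ₃ vN 0 = N := by rw [hF₃ vN (by decide), hN₂]
  have hvi₃ : σ₃ vi 0 = i := by rw [hF₃ vi (by decide), hvi₂]
  refine ok_row (i + 1) (rowAt N σ₃ atmp 0) (by decide) (by decide) hN' hσ₃ hN₃ ?_
    (fun k => hb _ _ _ k hσ₃) ?_
  · intro k σ' hF hj hoth _
    refine ⟨by simp [hF vi (by decide), hvi₃], ?_⟩
    rw [val_elt (r := 0) (by simp) (by rw [hF vN (by decide), hN₃]) hj,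
      rowAt_congr (hF atmp (by decide))]
  · intro σ' hσ' hF h h'
    refine hpost σ' hσ' ?_ ?_ ?_
    · exact (hF₁.mono (by decide)).trans ((hF₂.mono (by decide)).trans
        ((hF₃.mono (by decide)).trans (hF.mono (by decide))))
    · rw [hF vflag (by decide), hF₃ vflag (by decide), hF₂ vflag (by decide), hf₁]
    · have hV₂ : ∀ r < n, rowAt N σ₂ aV r = c r := fun r hr => by
        rw [rowAt_congr (hF₂ aV (by decide)), rowAt_congr (hF₁ aV (by decide)), hV r hr]
      intro r hr
      rcases eq_or_ne r (i + 1) with rfl | h1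
      · rw [h, swapAt_right, rowAt_congr (hF₃ atmp (by decide)), ht₂,
          rowAt_congr (hF₁ aV (by decide)), hV i (by omega)]
      rcases eq_or_ne r i with rfl | h2
      · rw [h' r (by omega), hi₃, hV₂ _ hi, swapAt_left]
      rw [h' r h1, hr₃ r h2, hV₂ r hr, swapAt_other h2 h1]

/-- Looks for a position where the Gram-Schmidt vectors decrease too fast. -/
def swapScan : Program :=
  .seq (.set vflag 0 0) <| forTo vi (var vn - 1) <|
    .ite ((2 * Expr.get aD (var vi + 2) * Expr.get aD (var vi)).less
        (Expr.get aD (var vi + 1) * Expr.get aD (var vi + 1)) * (1 - var vflag)) swapRows .skip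

/-- With `d` the Gram determinants, `‖gs i‖ ^ 2` is `d (i + 1) / d i`, so that the tested inequality
says `2 * ‖gs (i + 1)‖ ^ 2 < ‖gs i‖ ^ 2`. After an exchange the stored determinants are out of date;
the factor `1 - vflag` therefore allows only one exchange per pass. -/
theorem ok_swapScan {n : ℕ} {c : ℕ → Vec N} {d : ℕ → ℤ} (hN' : N ≤ x) (hn : 0 < n) (hnx : n ≤ x)
    (hσ : MemB x σ) (hN : σ vN 0 = N) (hvn : σ vn 0 = n)
    (hV : ∀ r < n, rowAt N σ aV r = c r) (hd : ∀ l ≤ n, σ aD l = d l)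
    (hpost : ∀ σ' : Mem, MemB x σ' → Frame [aV, vi, vj, vflag, atmp] σ σ' →
      ((σ' vflag 0 = 0 ∧ (∀ r < n, rowAt N σ' aV r = c r) ∧
        ∀ i, i + 1 < n → d (i + 1) * d (i + 1) ≤ 2 * d (i + 2) * d i) ∨
      (σ' vflag 0 = 1 ∧ ∃ i, i + 1 < n ∧ 2 * d (i + 2) * d i < d (i + 1) * d (i + 1) ∧
        ∀ r < n, rowAt N σ' aV r = swapAt c i r)) → Q σ') : Ok O G x swapScan σ Q := by
  refine ok_seq (Q := fun σ' => Frame [vflag] σ σ' ∧ σ' vflag 0 = 0) (ok_set hσ (by simp)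
    ⟨(Frame.refl _ _).write (by decide) _ _, by simp⟩) ?_
  rintro σ₁ hσ₁ ⟨hF₁, hf₁⟩
  refine ok_for (fun k σ' => Frame [aV, vi, vj, vflag, atmp] σ σ' ∧
    ((σ' vflag 0 = 0 ∧ (∀ r < n, rowAt N σ' aV r = c r) ∧
        ∀ i < k, d (i + 1) * d (i + 1) ≤ 2 * d (i + 2) * d i) ∨
      (σ' vflag 0 = 1 ∧ ∃ i, i + 1 < n ∧ 2 * d (i + 2) * d i < d (i + 1) * d (i + 1) ∧
        ∀ r < n, rowAt N σ' aV r = swapAt c i r))) (n - 1) (by omega) hσ₁ ?_ ?_ ?_ ?_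
  · refine ⟨(hF₁.mono (by decide)).write (by decide) _ _, Or.inl ⟨by simpa using hf₁, ?_, by simp⟩⟩
    intro r hr
    rw [rowAt_write _ _ _ _ _ (by decide), rowAt_congr (hF₁ aV (by decide)), hV r hr]
  · rintro k hk σ' hσ' - ⟨hF, -⟩
    simp only [val_sub, val_var, hF vn (by decide), hvn, val_one]
    omega
  · rintro k hk σ₂ hσ₂ hvi ⟨hF₂, h₂⟩
    have hD : σ₂ aD = σ aD := hF₂ aD (by decide)
    have d0 := hd k (by omega)
    have d1 := hd (k + 1) (by omega)
    have d2 := hd (k + 2) (by omega)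
    push_cast at d1 d2
    have hval : ((2 * Expr.get aD (var vi + 2) * Expr.get aD (var vi)).less
        (Expr.get aD (var vi + 1) * Expr.get aD (var vi + 1)) * (1 - var vflag)).val σ₂ =
        (if 2 * d (k + 2) * d k < d (k + 1) * d (k + 1) then 1 else 0) * (1 - σ₂ vflag 0) := by
      simp only [val_mul, val_sub, val_less, val_get, val_add, val_var, val_ofNat, val_one, hvi, hD,
        d0, d1, d2]
    refine ok_ite hσ₂ (fun hne => ?_) (fun h0 => ?_)
    · rw [hval] at hne
      rcases h₂ with ⟨hf, hr, -⟩ | ⟨hf, -⟩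
      · have hlt : 2 * d (k + 2) * d k < d (k + 1) * d (k + 1) := by
          by_contra h
          simp [h] at hne
        refine ok_swapRows (i := k) hN' (by omega) (by omega) hσ₂ (by rw [hF₂ vN (by decide), hN])
          hvi hr ?_
        intro σ' hσ' hF hf' hr'
        refine ⟨by rw [hF vi (by decide), hvi], ?_, Or.inr ⟨by simpa using hf', k, by omega, hlt, ?_⟩⟩
        · exact (hF₂.trans (hF.mono (by decide))).write (by decide) _ _
        · intro r hr
          rw [rowAt_write _ _ _ _ _ (by decide), hr' r hr]
      · simp [hf] at hne
    · rw [hval] at h0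
      refine ok_skip hσ₂ ⟨hvi, hF₂.write (by decide) _ _, ?_⟩
      rcases h₂ with ⟨hf, hr, h⟩ | ⟨hf, i, hi, h, hr⟩
      · refine Or.inl ⟨by simpa using hf, fun r hr' => ?_, fun i hi => ?_⟩
        · rw [rowAt_write _ _ _ _ _ (by decide), hr r hr']
        · rcases Nat.lt_succ_iff_lt_or_eq.1 hi with h' | rfl
          · exact h i h'
          · simp only [hf, sub_zero, mul_one, ite_eq_right_iff, one_ne_zero, imp_false,
              not_lt] at h0
            exact h0
      · refine Or.inr ⟨by simpa using hf, i, hi, h, fun r hr' => ?_⟩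
        rw [rowAt_write _ _ _ _ _ (by decide), hr r hr']
  · rintro σ' hσ' ⟨hF, h⟩ -
    refine hpost σ' hσ' hF (h.imp (fun ⟨h1, h2, h3⟩ => ⟨h1, h2, fun i hi => h3 i (by omega)⟩) id)

end SVPRed

/-! ### Invariants and termination of the basis reduction. -/

namespace SVPRed

set_option linter.unusedSectionVars false

variable {N : ℕ} {O : List ℤ → Bool} {G : List ℤ → Prop} {x : ℕ} {σ : Mem} {Q : Mem → Prop}

theorem embf_swapAt (b : ℕ → Vec N) (i : ℕ) : embf (swapAt b i) = swapAt (embf b) i := rfl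

/-- The facts about a basis that are preserved during basis reduction. -/
structure LllInv (n X : ℕ) (b₀ b : ℕ → Vec N) : Prop where
  indep : Indep n (embf b)
  gs_le : ∀ i < n, ‖gs (embf b) i‖ ^ 2 ≤ X
  row_le : ∀ i < n, b i ⬝ᵥ b i ≤ (n * X : ℕ)
  lat : Lat n b = Lat n b₀

section Steps
variable {n X : ℕ} {b₀ b c : ℕ → Vec N}

/-- The Gram-Schmidt vectors are unchanged, and a size-reduced row is short in terms of them; so the
bound for the rows does not deteriorate over the passes. -/
theorem LllInv.shear (H : LllInv n X b₀ b) (hcb : ∀ i < n, c i - b i ∈ Lat i b)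
    (hc : ∀ i < n, ∀ l < i, |coeff b l (c i)| ≤ 1 / 2) :
    LllInv n X b₀ c ∧ ∀ i < n, gs (embf c) i = gs (embf b) i := by
  have hs : ∀ i < n, embf c i - embf b i ∈ below ℝ (embf b) i := fun i hi => shear_emb (hcb i hi)
  have hg : ∀ i < n, gs (embf c) i = gs (embf b) i := fun i hi => gs_eq_of_shear hs hi
  refine ⟨⟨?_, fun i hi => ?_, fun i hi => ?_, ?_⟩, hg⟩
  · refine H.indep.of_below fun i hi => ?_
    rw [below_eq_of_shear hs le_rfl]
    exact mem_below hi
  · rw [hg i hi]; exact H.gs_le i hi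
  · exact dot_self_le_of_coeff_le H.indep H.gs_le hi (hcb i hi) (hc i hi)
  · rw [← H.lat]; exact below_eq_of_shear hcb le_rfl

/-- Both new Gram-Schmidt vectors are no longer than the old `gs (embf b) i`: the first by the
condition for the exchange, the second as a projection of it. -/
theorem LllInv.swap (H : LllInv n X b₀ b) {i : ℕ} (hi : i + 1 < n)
    (hμ : |coeff b i (b (i + 1))| ≤ 1 / 2)
    (hlt : 2 * igdet b (i + 2) * igdet b i < igdet b (i + 1) * igdet b (i + 1)) :
    LllInv n X b₀ (swapAt b i) ∧
      4 * potential n (embf (swapAt b i)) ≤ 3 * potential n (embf b) := by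
  have hp := norm_gs_pos H.indep (by omega : i < n)
  have hd := gdet_pos H.indep (by omega : i ≤ n)
  have hlt' : 2 * ‖gs (embf b) (i + 1)‖ ^ 2 < ‖gs (embf b) i‖ ^ 2 := by
    have h : (2 : ℝ) * igdet b (i + 2) * igdet b i < igdet b (i + 1) * igdet b (i + 1) := by
      exact_mod_cast hlt
    rw [igdet_cast H.indep (by omega), igdet_cast H.indep (by omega),
      igdet_cast H.indep (by omega), gdet_succ, gdet_succ] at h
    have hpos : 0 < gdet (embf b) i * gdet (embf b) i * ‖gs (embf b) i‖ ^ 2 := by positivity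
    refine lt_of_mul_lt_mul_left ?_ hpos.le
    linarith
  have hμ' : |inner ℝ (gs (embf b) i) (embf b (i + 1)) / ‖gs (embf b) i‖ ^ 2| ≤ 1 / 2 := hμ
  have h2 : (inner ℝ (gs (embf b) i) (embf b (i + 1)) / ‖gs (embf b) i‖ ^ 2) ^ 2 ≤ 1 / 4 := by
    rw [← sq_abs]
    exact (pow_le_pow_left₀ (abs_nonneg _) hμ' 2).trans (by norm_num)
  refine ⟨⟨H.indep.swapAt hi, fun k hk => ?_, fun k hk => ?_, ?_⟩,
    by rw [embf_swapAt]; exact potential_swapAt H.indep hi hμ' hlt'⟩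
  · rw [embf_swapAt]
    rcases eq_or_ne k i with rfl | h1
    · rw [norm_gs_swapAt_left (gs_ne_zero H.indep hk)]
      have h3 := mul_le_mul_of_nonneg_right h2 hp.le
      have h4 := H.gs_le k hk
      linarith
    rcases eq_or_ne k (i + 1) with rfl | h2
    · exact (pow_le_pow_left₀ (norm_nonneg _) norm_gs_swapAt_right_le 2).trans
        (H.gs_le i (by omega))
    · rw [gs_swapAt_other h1 h2]; exact H.gs_le k hk
  · rcases eq_or_ne k i with rfl | h1
    · rw [swapAt_left]; exact H.row_le _ hi
    rcases eq_or_ne k (i + 1) with rfl | h2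
    · rw [swapAt_right]; exact H.row_le _ (by omega)
    · rw [swapAt_other h1 h2]; exact H.row_le _ hk
  · rw [← H.lat]; exact below_swapAt (by omega)

theorem LllInv.reduced (H : LllInv n X b₀ b)
    (hμ : ∀ i < n, ∀ l < i, |coeff b l (b i)| ≤ 1 / 2)
    (hd : ∀ i, i + 1 < n → igdet b (i + 1) * igdet b (i + 1) ≤ 2 * igdet b (i + 2) * igdet b i) :
    Reduced n (embf b) := by
  refine ⟨hμ, fun i hi => ?_⟩
  have hp := norm_gs_pos H.indep (by omega : i < n)
  have hd' := gdet_pos H.indep (by omega : i ≤ n)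
  have h : (igdet b (i + 1) * igdet b (i + 1) : ℝ) ≤ 2 * igdet b (i + 2) * igdet b i := by
    exact_mod_cast hd i hi
  rw [igdet_cast H.indep (by omega), igdet_cast H.indep (by omega),
    igdet_cast H.indep (by omega), gdet_succ, gdet_succ, gdet_succ] at h
  have hpos : 0 < gdet (embf b) i * gdet (embf b) i * ‖gs (embf b) i‖ ^ 2 := by positivity
  refine le_of_mul_le_mul_left ?_ hpos
  linarith

theorem LllInv.potential_le (H : LllInv n X b₀ b) (hX : 1 ≤ X) :
    potential n (embf b) ≤ (X : ℝ) ^ (n * (n + 1)) := by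
  rw [pow_mul]
  refine (Finset.prod_le_prod (fun l hl => ?_) (g := fun _ => (X : ℝ) ^ n) fun l hl => ?_).trans
    (by simp)
  · exact (gdet_pos H.indep (Nat.lt_succ_iff.1 (Finset.mem_range.1 hl))).le
  · exact gdet_le (by exact_mod_cast hX) H.gs_le (Nat.lt_succ_iff.1 (Finset.mem_range.1 hl))

/-- A product of positive integers. This lower bound is what forces the reduction to stop. -/
theorem LllInv.one_le_potential (H : LllInv n X b₀ b) : 1 ≤ potential n (embf b) := by
  refine Finset.prod_induction _ (fun r : ℝ => 1 ≤ r) (fun _ _ => one_le_mul_of_one_le_of_one_le)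
    le_rfl fun l hl => ?_
  have := one_le_igdet H.indep (Nat.lt_succ_iff.1 (Finset.mem_range.1 hl))
  rw [← igdet_cast H.indep (Nat.lt_succ_iff.1 (Finset.mem_range.1 hl))]
  exact_mod_cast this

theorem LllInv.init (h : Indep n (embf b)) (hX : ∀ i < n, b i ⬝ᵥ b i ≤ X) : LllInv n X b b := by
  refine ⟨h, fun i hi => ?_, fun i hi => ?_, rfl⟩
  · refine (pow_le_pow_left₀ (norm_nonneg _) (norm_perp_le _ _ _) 2).trans ?_
    rw [embf, norm_emb_sq]
    exact_mod_cast hX i hi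
  · refine (hX i hi).trans ?_
    exact_mod_cast Nat.le_mul_of_pos_left X (by omega)

end Steps

/-- Basis reduction after Lenstra, Lenstra and Lovász. -/
def lll : Program :=
  .seq (.set vflag 0 1) <| .loop (var vflag) <| .seq reducePass swapScan

/-- Each exchange multiplies the potential by at most `3 / 4`. While exchanges go on, the invariant
is `potential * 3 ^ j < 4 ^ j` with `j` the number of rounds left; `j = 0` would contradict
`potential ≥ 1`. A pass without exchange leaves a reduced basis and clears the flag. -/
theorem ok_lll {n X A J : ℕ} {b : ℕ → Vec N} (hn : 0 < n) (hX1 : 1 ≤ X)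
    (h : Indep n (embf b)) (hX : ∀ i < n, b i ⬝ᵥ b i ≤ X) (hA : X ^ (2 * n) * (n * X) ≤ A)
    (hx : (N + 1) * (A * ((N + 2) * A * A) ^ n * A) < 2 ^ x) (hnx : n ≤ x) (hNx : N ≤ x)
    (hJ : X ^ (n * (n + 1)) * 3 ^ J < 4 ^ J) (hJx : J ≤ x)
    (hσ : MemB x σ) (hvn : σ vn 0 = n) (hN : σ vN 0 = N) (hV : ∀ i < n, rowAt N σ aV i = b i)
    (hpost : ∀ (σ' : Mem) (c : ℕ → Vec N), MemB x σ' → Frame lllArrays σ σ' →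
      (∀ i < n, rowAt N σ' aV i = c i) → LllInv n X b c → Reduced n (embf c) → Q σ') :
    Ok O G x lll σ Q := by
  have hx1 : (1 : ℤ) < 2 ^ x := one_lt_pow₀ (by norm_num) (by omega)
  have hB : ∀ c, LllInv n X b c → GsoBound n N X A x c := fun c H =>
    ⟨H.indep, hX1, H.gs_le, H.row_le, hA, hx, hnx, hNx⟩
  have H₀ := LllInv.init h hX
  refine ok_seq (Q := fun σ' => Frame [vflag] σ σ' ∧ σ' vflag 0 = 1) (ok_set hσ (by simpa using hx1)
    ⟨(Frame.refl _ _).write (by decide) _ _, by simp⟩) ?_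
  rintro σ₁ hσ₁ ⟨hF₁, hf₁⟩
  refine ok_loop (fun j σ' => Frame lllArrays σ σ' ∧ ∃ c : ℕ → Vec N,
    (∀ i < n, rowAt N σ' aV i = c i) ∧ LllInv n X b c ∧
    ((σ' vflag 0 = 1 ∧ potential n (embf c) * 3 ^ j < 4 ^ j) ∨
      (σ' vflag 0 = 0 ∧ Reduced n (embf c)))) J hJx ?_ ?_ hσ₁ ?_
  · rintro j - σ₂ hσ₂ ⟨hF₂, c, hc, Hc, h₂⟩ hne
    rcases h₂ with ⟨hf, hpot⟩ | ⟨hf, -⟩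
    swap
    · exact absurd hf hne
    have hpot1 := Hc.one_le_potential
    have hj : j ≠ 0 := by
      rintro rfl
      simp only [pow_zero, mul_one] at hpot
      linarith
    refine ⟨j - 1, by omega, ok_seq (Q := fun σ' => Frame lllArrays σ σ' ∧ ∃ e : ℕ → Vec N,
      (∀ i < n, rowAt N σ' aV i = e i) ∧ (∀ i < n, e i - c i ∈ Lat i c) ∧
      (∀ i < n, ∀ l < i, |coeff c l (e i)| ≤ 1 / 2) ∧ (∀ l ≤ n, σ' aD l = igdet c l)) ?_ ?_⟩
    · refine ok_reducePass (hB c Hc) hn hσ₂ (by rw [hF₂ vn (by decide), hvn])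
        (by rw [hF₂ vN (by decide), hN]) hc ?_
      intro σ' e _ hF h1 h2 h3 h4
      exact ⟨hF₂.trans (hF.mono (by decide)), e, h1, h2, h3, h4⟩
    rintro σ₃ hσ₃ ⟨hF₃, e, he, hec, hμ, hD⟩
    obtain ⟨He, hgs⟩ := Hc.shear hec hμ
    have hgdet : ∀ l ≤ n, gdet (embf e) l = gdet (embf c) l := fun l hl =>
      Finset.prod_congr rfl fun i hi => by rw [hgs i ((Finset.mem_range.1 hi).trans_le hl)]
    have hig : ∀ l ≤ n, igdet c l = igdet e l := fun l hl =>
      (igdet_eq_of_shear Hc.indep He.indep hgs hl).symm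
    have hμe : ∀ i < n, ∀ l < i, |coeff e l (e i)| ≤ 1 / 2 := by
      intro i hi l hl
      have : coeff e l (e i) = coeff c l (e i) := by rw [coeff, hgs l (by omega)]; rfl
      rw [this]; exact hμ i hi l hl
    have hpe : potential n (embf e) = potential n (embf c) :=
      Finset.prod_congr rfl fun l hl => hgdet l (Nat.lt_succ_iff.1 (Finset.mem_range.1 hl))
    refine ok_swapScan (d := igdet e) hNx hn hnx hσ₃ (by rw [hF₃ vN (by decide), hN])
      (by rw [hF₃ vn (by decide), hvn]) he (fun l hl => by rw [hD l hl, hig l hl]) ?_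
    rintro σ' - hF (⟨hf', hr, hd⟩ | ⟨hf', i, hi, hlt, hr⟩)
    · exact ⟨hF₃.trans (hF.mono (by decide)), e, hr, He, Or.inr ⟨hf', He.reduced hμe hd⟩⟩
    · obtain ⟨Hs, hps⟩ := He.swap hi (hμe _ hi _ (by omega)) hlt
      refine ⟨hF₃.trans (hF.mono (by decide)), swapAt e i, hr, Hs, Or.inl ⟨hf', ?_⟩⟩
      obtain ⟨m, rfl⟩ := Nat.exists_eq_succ_of_ne_zero hj
      rw [hpe] at hps
      simp only [Nat.succ_eq_add_one, pow_succ, Nat.add_sub_cancel] at hpot ⊢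
      have h3 : (0 : ℝ) < 3 ^ m := by positivity
      have := mul_le_mul_of_nonneg_right hps h3.le
      linarith
  · rintro j - σ' hσ' ⟨hF, c, hc, Hc, h₂⟩ h0
    rcases h₂ with ⟨hf, -⟩ | ⟨-, hred⟩
    · rw [val_var, hf] at h0
      exact absurd h0 one_ne_zero
    · exact hpost σ' c hσ' hF hc Hc hred
  · refine ⟨hF₁.mono (by decide), b, fun i hi => ?_, H₀, Or.inl ⟨hf₁, ?_⟩⟩
    · rw [rowAt_congr (hF₁ aV (by decide)), hV i hi]
    · refine lt_of_le_of_lt (mul_le_mul_of_nonneg_right (H₀.potential_le hX1) (by positivity)) ?_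
      exact_mod_cast hJ

end SVPRed

namespace SVPRed

/-! ### Reduction in rank two -/

/-- Two integer vectors `(a, b)` and `(c, d)` in the plane. -/
structure M2 where
  (a b c d : ℤ)

namespace M2

def one : M2 := ⟨1, 0, 0, 1⟩
def det (P : M2) : ℤ := P.a * P.d - P.b * P.c
def n1 (P : M2) : ℤ := P.a * P.a + P.b * P.b
def n2 (P : M2) : ℤ := P.c * P.c + P.d * P.d
def ip (P : M2) : ℤ := P.a * P.c + P.b * P.d

/-- The rounded quotient in the reduction step. -/
def quo (P : M2) : ℤ := (2 * P.ip + P.n1) / (2 * P.n1)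

/-- The second vector reduced by the first one. -/
def shear (P : M2) : M2 := ⟨P.a, P.b, P.c - P.quo * P.a, P.d - P.quo * P.b⟩

/-- One step of the reduction algorithm of Lagrange and Gauss. -/
def gaussStep (P : M2) : M2 :=
  if 2 * P.shear.n2 < P.n1 then ⟨P.shear.c, P.shear.d, P.a, P.b⟩ else P.shear

/-- Membership in the lattice generated by the two vectors. -/
def Mem (P : M2) (x y : ℤ) : Prop := ∃ α β : ℤ, x = α * P.a + β * P.c ∧ y = α * P.b + β * P.d

/-- The passage to a sublattice of index two, or (for other arguments) to the lattice itself. -/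
def refine (z : ℤ) (P : M2) : M2 :=
  if z = 0 then ⟨2 * P.a, 2 * P.b, P.c, P.d⟩
  else if z = 1 then ⟨P.a, P.b, 2 * P.c, 2 * P.d⟩
  else if z = 2 then ⟨P.a + P.c, P.b + P.d, 2 * P.c, 2 * P.d⟩
  else P

/-- Reduced pairs of vectors. -/
structure Red (P : M2) : Prop where
  size : |2 * P.ip| ≤ P.n1
  decay : P.n1 ≤ 2 * P.n2

variable {P : M2}

theorem n1_nonneg (P : M2) : 0 ≤ P.n1 := add_nonneg (mul_self_nonneg _) (mul_self_nonneg _)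

theorem n1_pos (h : P.det ≠ 0) : 0 < P.n1 := by
  rcases eq_or_lt_of_le P.n1_nonneg with h0 | h0
  · exfalso
    apply h
    unfold n1 at h0
    have ha : P.a = 0 := by nlinarith [mul_self_nonneg P.a, mul_self_nonneg P.b]
    have hb : P.b = 0 := by nlinarith [mul_self_nonneg P.a, mul_self_nonneg P.b]
    simp [det, ha, hb]
  · exact h0

theorem det_shear (P : M2) : P.shear.det = P.det := by simp only [det, shear]; ring

theorem det_gaussStep (P : M2) : |P.gaussStep.det| = |P.det| := by
  unfold gaussStep
  split
  · rw [← det_shear, ← abs_neg]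
    congr 1
    simp only [det, shear]
    ring
  · rw [det_shear]

theorem mem_shear {x y : ℤ} : P.shear.Mem x y ↔ P.Mem x y := by
  constructor
  · rintro ⟨α, β, h1, h2⟩
    exact ⟨α - β * P.quo, β, by rw [h1, shear]; ring, by rw [h2, shear]; ring⟩
  · rintro ⟨α, β, h1, h2⟩
    exact ⟨α + β * P.quo, β, by rw [h1, shear]; ring, by rw [h2, shear]; ring⟩

theorem mem_gaussStep {x y : ℤ} : P.gaussStep.Mem x y ↔ P.Mem x y := by
  unfold gaussStep
  split
  · rw [← mem_shear (P := P)]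
    constructor
    · rintro ⟨α, β, h1, h2⟩
      exact ⟨β, α, by rw [h1]; simp only [shear]; ring, by rw [h2]; simp only [shear]; ring⟩
    · rintro ⟨α, β, h1, h2⟩
      exact ⟨β, α, by rw [h1]; simp only [shear]; ring, by rw [h2]; simp only [shear]; ring⟩
  · exact mem_shear

theorem ip_shear (P : M2) : P.shear.ip = P.ip - P.quo * P.n1 := by
  simp only [ip, n1, shear]; ring

theorem n2_shear (P : M2) : P.shear.n2 = P.n2 - P.quo * (2 * P.ip - P.quo * P.n1) := by
  simp only [ip, n1, n2, shear]; ring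

theorem abs_ip_shear_le (h : 0 < P.n1) : |2 * P.shear.ip| ≤ P.n1 := by
  have h1 := Int.emod_nonneg (2 * P.ip + P.n1) (by omega : 2 * P.n1 ≠ 0)
  have h2 := Int.emod_lt_of_pos (2 * P.ip + P.n1) (by omega : 0 < 2 * P.n1)
  have h3 := Int.mul_ediv_add_emod (2 * P.ip + P.n1) (2 * P.n1)
  rw [ip_shear]
  change 2 * P.n1 * P.quo + _ = _ at h3
  have h4 : 2 * P.n1 * P.quo = 2 * (P.quo * P.n1) := by ring
  rw [abs_le]
  constructor <;> linarith

/-- This is the amount by which the shear decreases `n2`. For a quotient rounded to a nearest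
integer the second factor is zero or has the sign of the first. -/
theorem quo_mul_nonneg (h : 0 < P.n1) : 0 ≤ P.quo * (2 * P.ip - P.quo * P.n1) := by
  have h1 := abs_le.1 (abs_ip_shear_le h)
  rw [ip_shear] at h1
  rcases lt_trichotomy P.quo 0 with hq | hq | hq
  · refine mul_nonneg_of_nonpos_of_nonpos hq.le ?_
    nlinarith
  · simp [hq]
  · refine mul_nonneg hq.le ?_
    nlinarith

theorem n2_shear_le (h : 0 < P.n1) : P.shear.n2 ≤ P.n2 := by
  have := quo_mul_nonneg h
  rw [n2_shear]
  linarith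

/-- For a reduced pair `quo` need not vanish, as a tie may be rounded to `1`; but then the length
stays the same. Hence further steps keep a reduced pair reduced, and a fixed number of steps can be
run without a test for termination. -/
theorem Red.n2_shear_eq (h : P.Red) (h0 : 0 < P.n1) : P.shear.n2 = P.n2 := by
  have h1 := quo_mul_nonneg h0
  have h2 := abs_le.1 h.size
  have h3 : P.quo * (2 * P.ip - P.quo * P.n1) ≤ 0 := by
    rcases lt_trichotomy P.quo 0 with hq | hq | hq
    · refine mul_nonpos_of_nonpos_of_nonneg hq.le ?_
      nlinarith
    · simp [hq]
    · refine mul_nonpos_of_nonneg_of_nonpos hq.le ?_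
      nlinarith
  rw [n2_shear]
  linarith

theorem red_shear (h0 : 0 < P.n1) (h : ¬2 * P.shear.n2 < P.n1) : P.shear.Red :=
  ⟨abs_ip_shear_le h0, not_lt.1 h⟩

theorem Red.gaussStep (h : P.Red) (h0 : P.det ≠ 0) : P.gaussStep.Red := by
  have h1 := n1_pos h0
  have h2 : ¬2 * P.shear.n2 < P.n1 := by
    rw [h.n2_shear_eq h1]
    exact not_lt.2 h.decay
  rw [M2.gaussStep, if_neg h2]
  exact red_shear h1 h2

theorem det_gauss_ne (h : P.det ≠ 0) : P.gaussStep.det ≠ 0 := by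
  rw [← abs_pos, det_gaussStep, abs_pos]
  exact h

theorem Red.iterate (h : P.Red) (h0 : P.det ≠ 0) (m : ℕ) : (M2.gaussStep^[m] P).Red := by
  induction m generalizing P with
  | zero => exact h
  | succ m ih => exact ih (h.gaussStep h0) (det_gauss_ne h0)

/-- Each exchange more than halves `n1`, and a step without exchange produces a reduced pair. -/
theorem red_iterate {m : ℕ} (h0 : P.det ≠ 0) (h : P.n1 < 2 ^ m) : (gaussStep^[m] P).Red := by
  induction m generalizing P with
  | zero =>
    have := n1_pos h0
    simp at h
    omega
  | succ m ih =>
    rw [Function.iterate_succ_apply]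
    by_cases hs : 2 * P.shear.n2 < P.n1
    · refine ih (det_gauss_ne h0) ?_
      rw [gaussStep, if_pos hs]
      rw [pow_succ] at h
      change P.shear.n2 < _
      omega
    · have h1 : P.gaussStep.Red := by
        rw [gaussStep, if_neg hs]
        exact red_shear (n1_pos h0) hs
      exact h1.iterate (det_gauss_ne h0) m

theorem det_iterate (P : M2) (m : ℕ) : |(gaussStep^[m] P).det| = |P.det| := by
  induction m generalizing P with
  | zero => rfl
  | succ m ih => rw [Function.iterate_succ_apply, ih, det_gaussStep]

theorem mem_iterate {x y : ℤ} (m : ℕ) : (gaussStep^[m] P).Mem x y ↔ P.Mem x y := by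
  induction m generalizing P with
  | zero => rfl
  | succ m ih => rw [Function.iterate_succ_apply, ih, mem_gaussStep]

/-- Both vectors have squared length at most `S`. -/
def Le (P : M2) (S : ℤ) : Prop := P.n1 ≤ S ∧ P.n2 ≤ S

theorem Le.gaussStep {S : ℤ} (h : P.Le S) (h0 : P.det ≠ 0) : P.gaussStep.Le S := by
  have h1 := n2_shear_le (n1_pos h0)
  unfold M2.gaussStep
  split
  · exact ⟨h1.trans h.2, h.1⟩
  · exact ⟨h.1, h1.trans h.2⟩

theorem Le.iterate {S : ℤ} (h : P.Le S) (h0 : P.det ≠ 0) (m : ℕ) : (M2.gaussStep^[m] P).Le S := by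
  induction m generalizing P with
  | zero => exact h
  | succ m ih => exact ih (h.gaussStep h0) (det_gauss_ne h0)

theorem Le.refine {S : ℤ} (h : P.Le S) (hS : 0 ≤ S) (z : ℤ) : (P.refine z).Le (4 * S) := by
  obtain ⟨h1, h2⟩ := h
  simp only [n1, n2] at h1 h2
  unfold M2.refine
  split_ifs
  · constructor <;> simp only [n1, n2] <;> linarith
  · constructor <;> simp only [n1, n2] <;> linarith
  · constructor <;> simp only [n1, n2]
    · nlinarith [mul_self_nonneg (P.a - P.c), mul_self_nonneg (P.b - P.d)]
    · linarith
  · constructor <;> simp only [n1, n2] <;> linarith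

theorem det_refine {z : ℤ} (hz : 0 ≤ z) (hz' : z < 3) : (P.refine z).det = 2 * P.det := by
  obtain rfl | rfl | rfl : z = 0 ∨ z = 1 ∨ z = 2 := by omega
  all_goals simp only [refine, det]; norm_num; ring

theorem det_refine_ne (h : P.det ≠ 0) (z : ℤ) : (P.refine z).det ≠ 0 := by
  by_cases hz : 0 ≤ z ∧ z < 3
  · rw [det_refine hz.1 hz.2]; omega
  · rw [refine, if_neg (by omega), if_neg (by omega), if_neg (by omega)]
    exact h

/-- The three sublattices of index two cover the lattice. -/
theorem Mem.refine {x y : ℤ} (h : P.Mem x y) : ∃ z : ℤ, 0 ≤ z ∧ z < 3 ∧ (P.refine z).Mem x y := by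
  obtain ⟨α, β, rfl, rfl⟩ := h
  rcases Int.emod_two_eq_zero_or_one α with h1 | h1
  · refine ⟨0, by norm_num, by norm_num, α / 2, β, ?_, ?_⟩ <;>
    · obtain ⟨t, rfl⟩ : ∃ t, α = 2 * t := ⟨α / 2, by omega⟩
      simp only [M2.refine, if_true, Int.mul_ediv_cancel_left _ (two_ne_zero)]
      ring
  rcases Int.emod_two_eq_zero_or_one β with h2 | h2
  · refine ⟨1, by norm_num, by norm_num, α, β / 2, ?_, ?_⟩ <;>
    · obtain ⟨t, rfl⟩ : ∃ t, β = 2 * t := ⟨β / 2, by omega⟩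
      simp only [M2.refine, Int.mul_ediv_cancel_left _ (two_ne_zero), one_ne_zero, if_true,
        if_false]
      ring
  · obtain ⟨t, rfl⟩ : ∃ t, β = α + 2 * t := ⟨(β - α) / 2, by omega⟩
    refine ⟨2, by norm_num, by norm_num, α, t, ?_, ?_⟩ <;>
    · simp only [M2.refine]
      norm_num
      ring

theorem mem_one (x y : ℤ) : one.Mem x y := ⟨x, y, by simp [one], by simp [one]⟩

/-- In a reduced pair with large determinant all short vectors are multiples of the first one. -/
theorem Red.eq_mul {x y R : ℤ} (h : P.Red) (hd : 4 * R ^ 2 < |P.det|) (hx : |x| ≤ R) (hy : |y| ≤ R)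
    (hm : P.Mem x y) : ∃ α, x = α * P.a ∧ y = α * P.b := by
  obtain ⟨α, β, h1, h2⟩ := hm
  have hβ : β = 0 := by
    by_contra hβ
    have hdet : P.det ≠ 0 := by
      intro h0
      rw [h0] at hd
      simp at hd
      nlinarith [sq_nonneg R]
    have h3 := n1_pos hdet
    have hlag : P.det ^ 2 = P.n1 * P.n2 - P.ip ^ 2 := by simp only [det, n1, n2, ip]; ring
    have hip : (2 * P.ip) ^ 2 ≤ P.n1 ^ 2 := sq_le_sq' (abs_le.1 h.size).1 (abs_le.1 h.size).2
    -- By reducedness `n1 * n2` is at least `n1 ^ 2 / 2` and `ip ^ 2` is at most `n1 ^ 2 / 4`.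
    have h4 : P.n1 ^ 2 ≤ 4 * P.det ^ 2 := by
      have := mul_le_mul_of_nonneg_left h.decay h3.le
      nlinarith
    have h5 : P.n1 ≤ 2 * |P.det| := by
      refine abs_le_of_sq_le_sq' ?_ (by positivity) |>.2
      rw [mul_pow, sq_abs]
      linarith
    -- Up to sign `β * det` is the cross product of `(x, y)` with the first vector of the pair, and
    -- a cross product is at most the product of the lengths.
    have h6 : β ^ 2 * P.det ^ 2 ≤ (x ^ 2 + y ^ 2) * P.n1 := by
      have : (x ^ 2 + y ^ 2) * P.n1 = (β * P.det) ^ 2 + (x * P.a + y * P.b) ^ 2 := by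
        rw [h1, h2]; simp only [det, n1]; ring
      rw [this, mul_pow]
      nlinarith [sq_nonneg (x * P.a + y * P.b)]
    have h7 : 1 ≤ β ^ 2 := by
      have := Int.one_le_abs hβ
      rw [← sq_abs]; nlinarith
    have hx2 : x ^ 2 ≤ R ^ 2 := sq_le_sq' (abs_le.1 hx).1 (abs_le.1 hx).2
    have hy2 : y ^ 2 ≤ R ^ 2 := sq_le_sq' (abs_le.1 hy).1 (abs_le.1 hy).2
    have h8 : (x ^ 2 + y ^ 2) * P.n1 ≤ (2 * R ^ 2) * (2 * |P.det|) :=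
      mul_le_mul (by linarith) h5 h3.le (by positivity)
    have h9 : P.det ^ 2 ≤ β ^ 2 * P.det ^ 2 := le_mul_of_one_le_left (sq_nonneg _) h7
    rw [← sq_abs P.det] at h9 h6
    have h10 : 0 < |P.det| := abs_pos.2 hdet
    nlinarith
  subst hβ
  exact ⟨α, by linarith, by linarith⟩

end M2

end SVPRed

namespace SVPRed

/-! ### Sparsification -/

variable {N n : ℕ}

theorem write_eq_update (σ : Mem) (a : ℕ) (i z : ℤ) :
    σ.write a i z a = Function.update (σ a) i z := by
  funext j
  rw [write_self_apply, Function.update_apply]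

/-- The sublattice of `ℤ²` that is described by `e` digits. -/
def pre (dig : ℤ → ℤ) (off : ℕ) : ℕ → M2
  | 0 => .one
  | e + 1 => (pre dig off e).refine (dig ((off + e : ℕ) : ℤ))

theorem pre_congr {dig dig' : ℤ → ℤ} {off e : ℕ}
    (h : ∀ i : ℕ, off ≤ i → i < off + e → dig i = dig' i) : pre dig off e = pre dig' off e := by
  induction e with
  | zero => rfl
  | succ e ih =>
    rw [pre, pre, ih fun i h1 h2 => h i h1 (by omega), h (off + e) (by omega) (by omega)]

/-- The digit `3` falls under the last case of `M2.refine` and so stands for a digit that has not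
been chosen yet. -/
theorem pre_add_of_three {dig : ℤ → ℤ} {off e m : ℕ}
    (h : ∀ i : ℕ, off + e ≤ i → i < off + (e + m) → dig i = 3) :
    pre dig off (e + m) = pre dig off e := by
  induction m with
  | zero => rfl
  | succ m ih =>
    rw [← add_assoc, pre, h (off + (e + m)) (by omega) (by omega), ih fun i h1 h2 => h i h1 (by omega)]
    simp [M2.refine]

theorem det_pre_ne (dig : ℤ → ℤ) (off e : ℕ) : (pre dig off e).det ≠ 0 := by
  induction e with
  | zero => simp [pre, M2.det, M2.one]
  | succ e ih => exact M2.det_refine_ne ih _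

theorem det_pre {dig : ℤ → ℤ} {off e : ℕ}
    (h : ∀ i : ℕ, off ≤ i → i < off + e → 0 ≤ dig i ∧ dig i < 3) : (pre dig off e).det = 2 ^ e := by
  induction e with
  | zero => simp [pre, M2.det, M2.one]
  | succ e ih =>
    obtain ⟨h1, h2⟩ := h (off + e) (by omega) (by omega)
    rw [pre, M2.det_refine h1 h2, ih fun i h1 h2 => h i h1 (by omega), pow_succ']

theorem pre_le (dig : ℤ → ℤ) (off e : ℕ) : (pre dig off e).Le (4 ^ e) := by
  induction e with
  | zero => simp [pre, M2.Le, M2.one, M2.n1, M2.n2]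
  | succ e ih => rw [pow_succ']; exact ih.refine (by positivity) _

/-- A reduced basis of the sublattice given by `k` digits. -/
def redPre (k : ℕ) (dig : ℤ → ℤ) (off : ℕ) : M2 := M2.gaussStep^[2 * k + 1] (pre dig off k)

variable {k : ℕ} {dig dig' : ℤ → ℤ} {off : ℕ}

theorem abs_det_redPre : |(redPre k dig off).det| = |(pre dig off k).det| := M2.det_iterate _ _

theorem det_redPre_ne : (redPre k dig off).det ≠ 0 := by
  rw [← abs_pos, abs_det_redPre, abs_pos]
  exact det_pre_ne _ _ _

/-- The number of steps in `redPre` comes from `n1 ≤ 4 ^ k < 2 ^ (2 * k + 1)`. -/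
theorem red_redPre : (redPre k dig off).Red := by
  apply M2.red_iterate (det_pre_ne _ _ _)
  refine (pre_le dig off k).1.trans_lt ?_
  rw [pow_succ, pow_mul]
  norm_num

theorem redPre_le : (redPre k dig off).Le (4 ^ k) := (pre_le dig off k).iterate (det_pre_ne _ _ _) _

theorem mem_redPre {x y : ℤ} : (redPre k dig off).Mem x y ↔ (pre dig off k).Mem x y :=
  M2.mem_iterate _

theorem redPre_congr (h : ∀ i : ℕ, off ≤ i → i < off + k → dig i = dig' i) :
    redPre k dig off = redPre k dig' off := by
  rw [redPre, redPre, pre_congr h]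

theorem M2.Le.entries {P : M2} {A : ℤ} (hA : 0 ≤ A) (h : P.Le (A ^ 2)) :
    |P.a| ≤ A ∧ |P.b| ≤ A ∧ |P.c| ≤ A ∧ |P.d| ≤ A := by
  obtain ⟨h1, h2⟩ := h
  simp only [n1, n2] at h1 h2
  refine ⟨?_, ?_, ?_, ?_⟩ <;> refine abs_le_of_sq_le_sq ?_ hA
  · nlinarith [mul_self_nonneg P.b]
  · nlinarith [mul_self_nonneg P.a]
  · nlinarith [mul_self_nonneg P.d]
  · nlinarith [mul_self_nonneg P.c]

theorem abs_redPre_le : |(redPre k dig off).a| ≤ 2 ^ k ∧ |(redPre k dig off).b| ≤ 2 ^ k ∧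
    |(redPre k dig off).c| ≤ 2 ^ k ∧ |(redPre k dig off).d| ≤ 2 ^ k := by
  apply M2.Le.entries (by positivity)
  have := redPre_le (k := k) (dig := dig) (off := off)
  rwa [show (4 : ℤ) = 2 ^ 2 by norm_num, pow_right_comm] at this

/-- The vectors with numbers `0` and `j` are replaced by combinations of them. -/
def phase (P : M2) (W : ℕ → Vec N) (j : ℕ) : ℕ → Vec N := fun i =>
  if i = 0 then P.a • W 0 + P.b • W j else if i = j then P.c • W 0 + P.d • W j else W i

theorem phase_zero (P : M2) (W : ℕ → Vec N) (j : ℕ) : phase P W j 0 = P.a • W 0 + P.b • W j := rfl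

theorem phase_self (P : M2) (W : ℕ → Vec N) {j : ℕ} (hj : 0 < j) :
    phase P W j j = P.c • W 0 + P.d • W j := by
  rw [phase, if_neg hj.ne', if_pos rfl]

theorem phase_other (P : M2) (W : ℕ → Vec N) {i j : ℕ} (h : i ≠ 0) (h' : i ≠ j) :
    phase P W j i = W i := by
  rw [phase, if_neg h, if_neg h']

theorem sum_range_split {M : Type*} [AddCommMonoid M] {j : ℕ} (hj : 0 < j) (hjn : j < n) (f : ℕ → M) :
    ∑ i ∈ Finset.range n, f i = f 0 + f j + ∑ i ∈ ((Finset.range n).erase 0).erase j, f i := by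
  rw [add_assoc, Finset.add_sum_erase _ f, Finset.add_sum_erase _ f]
  · simp; omega
  · simp; omega

/-- In coordinates with respect to the old basis, a phase restricts the pair of coordinates `0` and
`j` to a plane lattice and leaves the others free. Statements about sublattices are thus reduced to
the plane. -/
theorem mem_Lat_phase {P : M2} {W : ℕ → Vec N} {j : ℕ} (hj : 0 < j) (hjn : j < n) {v : Vec N} :
    v ∈ Lat n (phase P W j) ↔
      ∃ x : ℕ → ℤ, v = ∑ i ∈ Finset.range n, x i • W i ∧ P.Mem (x 0) (x j) := by
  rw [mem_Lat]
  have hrest (f g : ℕ → Vec N) (h : ∀ i, i ≠ 0 → i ≠ j → f i = g i) :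
      ∑ i ∈ ((Finset.range n).erase 0).erase j, f i =
        ∑ i ∈ ((Finset.range n).erase 0).erase j, g i :=
    Finset.sum_congr rfl fun i hi => by
      simp only [Finset.mem_erase] at hi
      exact h i hi.2.1 hi.1
  constructor
  · rintro ⟨c, rfl⟩
    refine ⟨fun i => if i = 0 then c 0 * P.a + c j * P.c else
      if i = j then c 0 * P.b + c j * P.d else c i, ?_, c 0, c j, ?_, ?_⟩
    · rw [sum_range_split hj hjn, sum_range_split hj hjn]
      congr 1
      · simp only [phase_zero, phase_self _ _ hj, if_true, hj.ne', if_false]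
        module
      · apply hrest
        intro i h0 hj
        simp only [phase_other _ _ h0 hj, if_neg h0, if_neg hj]
    · simp
    · simp [hj.ne']
  · rintro ⟨x, rfl, α, β, h1, h2⟩
    refine ⟨fun i => if i = 0 then α else if i = j then β else x i, ?_⟩
    rw [sum_range_split hj hjn, sum_range_split hj hjn]
    congr 1
    · simp only [phase_zero, phase_self _ _ hj, if_true, hj.ne', if_false, h1, h2]
      module
    · apply hrest
      intro i h0 hj
      simp only [phase_other _ _ h0 hj, if_neg h0, if_neg hj]

/-- By Cramer's rule the multiples of `W 0` and `W j` by the determinant are combinations of the new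
vectors. -/
theorem Indep.phase {P : M2} {W : ℕ → Vec N} {j : ℕ} (h : Indep n (embf W)) (hP : P.det ≠ 0)
    (hj : 0 < j) (hjn : j < n) : Indep n (embf (SVPRed.phase P W j)) := by
  have hP' : (P.det : ℝ) ≠ 0 := by exact_mod_cast hP
  have h0 : embf (SVPRed.phase P W j) 0 ∈ below ℝ (embf (SVPRed.phase P W j)) n :=
    mem_below (by omega)
  have h1 : embf (SVPRed.phase P W j) j ∈ below ℝ (embf (SVPRed.phase P W j)) n := mem_below hjn
  refine h.of_below fun i hi => ?_
  by_cases hi0 : i = 0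
  · subst hi0
    refine (Submodule.smul_mem_iff _ hP').1 ?_
    convert sub_mem (Submodule.smul_mem _ (P.d : ℝ) h0) (Submodule.smul_mem _ (P.b : ℝ) h1) using 1
    simp only [embf, phase_zero, phase_self _ _ hj, map_add, emb_smul, M2.det]
    push_cast
    module
  by_cases hij : i = j
  · subst hij
    refine (Submodule.smul_mem_iff _ hP').1 ?_
    convert sub_mem (Submodule.smul_mem _ (P.a : ℝ) h1) (Submodule.smul_mem _ (P.c : ℝ) h0) using 1
    simp only [embf, phase_zero, phase_self _ _ hj, map_add, emb_smul, M2.det]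
    push_cast
    module
  · have := mem_below (R := ℝ) (f := embf (SVPRed.phase P W j)) hi
    rwa [embf, phase_other _ _ hi0 hij] at this

/-- The basis of the sublattice that is described by `j * k` digits. -/
def build (k : ℕ) (V : ℕ → Vec N) (dig : ℤ → ℤ) : ℕ → ℕ → Vec N
  | 0 => V
  | j + 1 => phase (redPre k dig (j * k)) (build k V dig j) (j + 1)

variable {V : ℕ → Vec N} {J : ℕ}

theorem build_congr (h : ∀ i : ℕ, i < J * k → dig i = dig' i) :
    build k V dig J = build k V dig' J := by
  induction J with
  | zero => rfl
  | succ J ih =>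
    rw [add_mul, one_mul] at h
    rw [build, build, ih fun i hi => h i (by omega), redPre_congr fun i _ hi => h i (by omega)]

theorem Indep.build (h : Indep n (embf V)) (hJ : J < n) : Indep n (embf (SVPRed.build k V dig J)) := by
  induction J with
  | zero => exact h
  | succ J ih => exact (ih (by omega)).phase det_redPre_ne (by omega) hJ

theorem Lat_phase_le {P : M2} {W : ℕ → Vec N} {j : ℕ} (hj : 0 < j) (hjn : j < n) :
    Lat n (phase P W j) ≤ Lat n W := by
  intro v hv
  obtain ⟨x, hx, -⟩ := (mem_Lat_phase hj hjn).1 hv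
  exact mem_Lat.2 ⟨x, hx⟩

theorem Lat_build_le (hJ : J < n) : Lat n (build k V dig J) ≤ Lat n V := by
  induction J with
  | zero => exact le_rfl
  | succ J ih => exact (Lat_phase_le (by omega) hJ).trans (ih (by omega))

/-- Without chosen digits the plane lattice is all of `ℤ²`, and the phase is a mere change of basis.
-/
theorem mem_Lat_build_succ_of_three (hJ : J + 1 < n)
    (h : ∀ i : ℕ, J * k ≤ i → i < J * k + k → dig i = 3) {v : Vec N} :
    v ∈ Lat n (build k V dig (J + 1)) ↔ v ∈ Lat n (build k V dig J) := by
  refine ⟨fun hv => Lat_phase_le (by omega) hJ hv, fun hv => ?_⟩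
  obtain ⟨x, hx⟩ := mem_Lat.1 hv
  refine (mem_Lat_phase (by omega) hJ).2 ⟨x, hx, mem_redPre.2 ?_⟩
  have := pre_add_of_three (dig := dig) (off := J * k) (e := 0) (m := k)
    fun i h1 h2 => h i (by omega) (by omega)
  rw [zero_add] at this
  rw [this]
  exact M2.mem_one _ _

theorem update_of_ne {t i : ℕ} (h : i ≠ t) (z : ℤ) :
    Function.update dig (t : ℤ) z i = dig i := Function.update_of_ne (by exact_mod_cast h) _ _

theorem mem_Lat_build_of_three (hJ : J < n) (h : ∀ i : ℕ, i < J * k → dig i = 3) {v : Vec N} :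
    v ∈ Lat n (build k V dig J) ↔ v ∈ Lat n V := by
  induction J with
  | zero => rfl
  | succ J ih =>
    rw [add_mul, one_mul] at h
    rw [mem_Lat_build_succ_of_three hJ fun i _ h2 => h i h2,
      ih (by omega) fun i hi => h i (by omega)]

/-- The sublattices given by the three values of a digit cover the lattice. -/
theorem exists_digit (hJ : J < n) {t : ℕ} (ht : t < J * k)
    (h : ∀ i : ℕ, t ≤ i → i < J * k → dig i = 3) {v : Vec N} (hv : v ∈ Lat n (build k V dig J)) :
    ∃ z : ℤ, 0 ≤ z ∧ z < 3 ∧ v ∈ Lat n (build k V (Function.update dig t z) J) := by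
  induction J with
  | zero => simp at ht
  | succ J ih =>
    have hJk : (J + 1) * k = J * k + k := by ring
    rw [hJk] at ht h
    -- If `t` belongs to an earlier phase, the last phase is undecided before and after the update
    -- and can be dropped. Otherwise `t` lies in the last phase, only the first `e` of its digits
    -- matter, and the covering of the plane lattice by three sublattices of index two applies to
    -- the coordinates `0` and `J + 1`.
    by_cases htJ : t < J * k
    · rw [mem_Lat_build_succ_of_three hJ fun i h1 h2 => h i (by omega) h2] at hv
      obtain ⟨z, h1, h2, h3⟩ := ih (by omega) htJ (fun i h1 h2 => h i h1 (by omega)) hv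
      refine ⟨z, h1, h2, ?_⟩
      rwa [mem_Lat_build_succ_of_three hJ]
      intro i h1 h2
      rw [update_of_ne (by omega)]
      exact h i (by omega) h2
    · obtain ⟨x, hx, hm⟩ := (mem_Lat_phase (by omega) hJ).1 hv
      obtain ⟨e, rfl⟩ := Nat.exists_eq_add_of_le (not_lt.1 htJ)
      obtain ⟨m, rfl⟩ := Nat.exists_eq_add_of_le (by omega : e + 1 ≤ k)
      have h5 : pre dig (J * (e + 1 + m)) (e + 1 + m) = pre dig (J * (e + 1 + m)) e := by
        rw [add_assoc]
        rw [add_assoc] at h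
        exact pre_add_of_three fun i h1 h2 => h i (by omega) (by omega)
      rw [mem_redPre, h5] at hm
      obtain ⟨z, h1, h2, h3⟩ := hm.refine
      refine ⟨z, h1, h2, (mem_Lat_phase (by omega) hJ).2 ⟨x, ?_, mem_redPre.2 ?_⟩⟩
      · rw [hx]
        have : build (e + 1 + m) V dig J = build (e + 1 + m) V
            (Function.update dig ((J * (e + 1 + m) + e : ℕ) : ℤ) z) J :=
          build_congr fun i hi => (update_of_ne (by omega) _).symm
        rw [← this]
      · rw [pre_add_of_three (e := e + 1), pre]
        · rw [pre_congr (dig' := dig)]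
          · simpa using h3
          · intro i h1 h2
            rw [update_of_ne (by omega)]
        · intro i h1 h2
          rw [update_of_ne (by omega)]
          exact h i (by omega) (by omega)

/-- Stores the `s` digits of `c` in base three, beginning with the position `t`. -/
def setDigits (dig : ℤ → ℤ) (t : ℕ) (c : ℤ) : ℕ → ℤ → ℤ
  | 0 => dig
  | s + 1 => Function.update (setDigits dig t c s) ((t + s : ℕ) : ℤ) (c / 3 ^ s % 3)

theorem setDigits_other {t s i : ℕ} (c : ℤ) (h : i < t ∨ t + s ≤ i) :
    setDigits dig t c s i = dig i := by
  induction s with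
  | zero => rfl
  | succ s ih => rw [setDigits, update_of_ne (by omega), ih (by omega)]

theorem setDigits_mem {t s i : ℕ} (c : ℤ) (h : t ≤ i) (h' : i < t + s) :
    0 ≤ setDigits dig t c s i ∧ setDigits dig t c s i < 3 := by
  induction s with
  | zero => omega
  | succ s ih =>
    by_cases hi : i = t + s
    · subst hi
      rw [setDigits, Function.update_self]
      omega
    · rw [setDigits, update_of_ne hi]
      exact ih (by omega)

theorem setDigits_congr {t s : ℕ} {c c' : ℤ} (h : c % 3 ^ s = c' % 3 ^ s) :
    setDigits dig t c s = setDigits dig t c' s := by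
  induction s with
  | zero => rfl
  | succ s ih =>
    obtain ⟨m, hm⟩ := Int.ModEq.dvd h.symm
    obtain rfl : c = c' + 3 * m * 3 ^ s := by rw [pow_succ] at hm; linarith
    rw [setDigits, setDigits, Int.add_mul_ediv_right _ _ (by positivity), Int.add_mul_emod_self_left,
      ih (Int.add_mul_emod_self_right ..)]

/-- The covering by three sublattices is applied `s` times; each new digit becomes the leading digit
of the code. -/
theorem exists_digits (hJ : J < n) {t s : ℕ} (ht : t + s ≤ J * k)
    (h : ∀ i : ℕ, t ≤ i → i < J * k → dig i = 3) {v : Vec N} (hv : v ∈ Lat n (build k V dig J)) :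
    ∃ c : ℕ, c < 3 ^ s ∧ v ∈ Lat n (build k V (setDigits dig t c s) J) := by
  induction s with
  | zero => exact ⟨0, by simp, hv⟩
  | succ s ih =>
    obtain ⟨c, hc, h1⟩ := ih (by omega)
    obtain ⟨z, hz, hz', h2⟩ := exists_digit (t := t + s) hJ (by omega) (fun i h2 h3 => by
      rw [setDigits_other _ (by omega)]
      exact h i (by omega) h3) h1
    lift z to ℕ using hz
    refine ⟨z * 3 ^ s + c, ?_, ?_⟩
    · rw [pow_succ]
      nlinarith
    · rw [setDigits, setDigits_congr (c' := c)]
      · have : ((z * 3 ^ s + c : ℕ) : ℤ) / 3 ^ s % 3 = z := by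
          push_cast
          rw [add_comm, Int.add_mul_ediv_right _ _ (by positivity),
            Int.ediv_eq_zero_of_lt (by positivity) (by exact_mod_cast hc)]
          omega
        rw [this]
        exact h2
      · push_cast
        rw [add_comm]
        exact Int.add_mul_emod_self_right ..

theorem Indep.coeff_unique {W : ℕ → Vec N} (h : Indep n (embf W)) {x y : ℕ → ℤ}
    (hxy : ∑ i ∈ Finset.range n, x i • W i = ∑ i ∈ Finset.range n, y i • W i) {i : ℕ} (hi : i < n) :
    x i = y i := by
  have h1 := congrArg emb hxy
  simp only [map_sum, emb_smul] at h1
  rw [← sub_eq_zero, ← Finset.sum_sub_distrib, Finset.sum_range] at h1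
  have := Fintype.linearIndependent_iff.1 h (fun i => (x i : ℝ) - y i)
    (by rw [← h1]; exact Finset.sum_congr rfl fun i _ => sub_smul _ _ _) ⟨i, hi⟩
  have : (x i : ℝ) = y i := sub_eq_zero.1 this
  exact_mod_cast this

/-- If all digits are given, the vectors with small coordinates in the sublattice are multiples of
the first basis vector. -/
theorem eq_smul_of_mem_build {R : ℤ} (h : Indep n (embf V)) (hJ : J < n) (hR : 4 * R ^ 2 < 2 ^ k)
    (hdig : ∀ i : ℕ, i < J * k → 0 ≤ dig i ∧ dig i < 3) {c : ℕ → ℤ} (hc : ∀ i < n, |c i| ≤ R)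
    (hv : ∑ i ∈ Finset.range n, c i • V i ∈ Lat n (build k V dig J)) :
    ∃ x : ℕ → ℤ, ∑ i ∈ Finset.range n, c i • V i =
      ∑ i ∈ Finset.range n, x i • build k V dig J i ∧ (∀ i < n, |x i| ≤ R) ∧
      ∀ i, 0 < i → i ≤ J → x i = 0 := by
  induction J with
  | zero => exact ⟨c, rfl, hc, fun i h1 h2 => by omega⟩
  | succ J ih =>
    have hJk : (J + 1) * k = J * k + k := by ring
    rw [hJk] at hdig
    obtain ⟨x, h1, h2, h3⟩ := ih (by omega) (fun i hi => hdig i (by omega))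
      (Lat_phase_le (by omega) hJ hv)
    obtain ⟨y, h4, h5⟩ := (mem_Lat_phase (by omega) hJ).1 hv
    rw [h1] at h4
    have h6 := fun i hi => (h.build (k := k) (dig := dig) (by omega : J < n)).coeff_unique h4
      (i := i) hi
    rw [← h6 0 (by omega), ← h6 (J + 1) hJ] at h5
    have hdet : |(redPre k dig (J * k)).det| = 2 ^ k := by
      rw [abs_det_redPre, det_pre fun i h1 h2 => hdig i h2, abs_of_pos (by positivity)]
    obtain ⟨α, h7, h8⟩ := red_redPre.eq_mul (by rw [hdet]; exact hR) (h2 0 (by omega)) (h2 _ hJ) h5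
    have hR0 : 0 ≤ R := (abs_nonneg _).trans (h2 0 (by omega))
    -- The first vector of the pair is a non-zero integer vector, so one of its multiples by `α` has
    -- an entry of size at least `|α|`. Thus the bound `R` does not grow from phase to phase.
    have hα : |α| ≤ R := by
      by_contra hlt
      have hdet0 := det_redPre_ne (k := k) (dig := dig) (off := J * k)
      have hab : ∀ y, |α * y| ≤ R → y = 0 := by
        intro y hy
        by_contra hy0
        rw [abs_mul] at hy
        nlinarith [Int.one_le_abs hy0]
      apply hdet0
      have ha := h2 0 (by omega)
      have hb := h2 _ hJ
      rw [h7] at ha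
      rw [h8] at hb
      rw [M2.det, hab _ ha, hab _ hb]
      ring
    refine ⟨fun i => if i = 0 then α else if i ≤ J + 1 then 0 else x i, ?_, ?_, ?_⟩
    · rw [h1, sum_range_split (by omega : 0 < J + 1) hJ, sum_range_split (by omega : 0 < J + 1) hJ]
      congr 1
      · simp only [build, phase_zero, if_true, h7, h8, Nat.succ_ne_zero, if_false, le_refl, zero_smul]
        module
      · refine Finset.sum_congr rfl fun i hi => ?_
        simp only [Finset.mem_erase] at hi
        simp only [build, phase_other _ _ hi.2.1 hi.1, if_neg hi.2.1]
        split
        · rw [h3 i (by omega) (by omega)]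
        · rfl
    · intro i hi
      simp only
      split_ifs
      · exact hα
      · simpa using hR0
      · exact h2 i hi
    · intro i hi hi'
      simp only [hi.ne', hi', if_false, if_true]

/-- Each phase removes one coordinate of a short vector, and after the last phase only the
coordinate `0` remains. -/
theorem mem_span_of_mem_build {R : ℤ} (hn : 0 < n) (h : Indep n (embf V)) (hR : 4 * R ^ 2 < 2 ^ k)
    (hdig : ∀ i : ℕ, i < (n - 1) * k → 0 ≤ dig i ∧ dig i < 3) {c : ℕ → ℤ} (hc : ∀ i < n, |c i| ≤ R)
    (hv : ∑ i ∈ Finset.range n, c i • V i ∈ Lat n (build k V dig (n - 1))) :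
    ∃ α : ℤ, ∑ i ∈ Finset.range n, c i • V i = α • build k V dig (n - 1) 0 := by
  obtain ⟨x, h1, -, h3⟩ := eq_smul_of_mem_build h (by omega) hR hdig hc hv
  refine ⟨x 0, ?_⟩
  rw [h1]
  refine Finset.sum_eq_single_of_mem 0 (by simpa using hn) fun i hi h0 => ?_
  rw [Finset.mem_range] at hi
  rw [h3 i (by omega) (by omega), zero_smul]

/-- A phase combines two vectors with coefficients of size at most `2 ^ k`. Since the pairs are
reduced from scratch in each phase, the bit length grows only by `k + 1` per phase. -/
theorem abs_build_le {E : ℤ} (hE : ∀ i < n, ∀ j, |V i j| ≤ E) (hJ : J < n) :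
    ∀ i < n, ∀ j, |build k V dig J i j| ≤ (2 ^ (k + 1)) ^ J * E := by
  induction J with
  | zero => simpa [build] using hE
  | succ J ih =>
    intro i hi j
    have ih := ih (by omega)
    obtain ⟨ha, hb, hc, hd⟩ := abs_redPre_le (k := k) (dig := dig) (off := J * k)
    have h0 := ih 0 (by omega) j
    have hE0 : 0 ≤ (2 ^ (k + 1)) ^ J * E := (abs_nonneg _).trans h0
    have key (y z : ℤ) (hy : |y| ≤ 2 ^ k) (hz : |z| ≤ 2 ^ k) :
        |y * build k V dig J 0 j + z * build k V dig J (J + 1) j| ≤ (2 ^ (k + 1)) ^ (J + 1) * E := by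
      refine (abs_add_le _ _).trans ?_
      rw [abs_mul, abs_mul]
      calc _ ≤ 2 ^ k * ((2 ^ (k + 1)) ^ J * E) + 2 ^ k * ((2 ^ (k + 1)) ^ J * E) := by
            gcongr
            exact ih _ hJ j
        _ = _ := by ring
    by_cases hi0 : i = 0
    · subst hi0
      simpa [build, phase_zero] using key _ _ ha hb
    by_cases hij : i = J + 1
    · subst hij
      simpa [build, phase_self _ _ (by omega : 0 < J + 1)] using key _ _ hc hd
    · rw [build, phase_other _ _ hi0 hij]
      refine (ih i hi j).trans ?_
      rw [pow_succ (2 ^ (k + 1)), mul_right_comm]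
      exact le_mul_of_one_le_right hE0 (one_le_pow₀ (by norm_num))

end SVPRed

namespace SVPRed

/-! ### The program for sparsification -/

notation "aQ" => (15 : ℕ)
notation "vkk" => (16 : ℕ)
notation "aDig" => (17 : ℕ)
notation "vph" => (18 : ℕ)
notation "vse" => (19 : ℕ)
notation "vpa" => (20 : ℕ)
notation "vpb" => (21 : ℕ)
notation "vpc" => (22 : ℕ)
notation "vpd" => (23 : ℕ)
notation "aRowA" => (24 : ℕ)
notation "aRowB" => (25 : ℕ)
notation "vsw" => (26 : ℕ)

variable {N n : ℕ} {O : List ℤ → Bool} {G : List ℤ → Prop} {x : ℕ} {σ : Mem} {P : Program}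
  {Q : Mem → Prop}

theorem ok_set_seq (hσ : MemB x σ) {a : ℕ} {i e : Expr} (he : |e.val σ| < 2 ^ x)
    (h : MemB x (σ.write a (i.val σ) (e.val σ)) → Ok O G x P (σ.write a (i.val σ) (e.val σ)) Q) :
    Ok O G x (.seq (.set a i e) P) σ Q := by
  refine ok_seq (Q := fun σ' => σ' = σ.write a (i.val σ) (e.val σ)) (ok_set hσ he rfl) ?_
  rintro _ h' rfl
  exact h h'

/-- A pair of vectors in the plane is stored in four variables. -/
def Holds (σ : Mem) (M : M2) : Prop :=
  σ vpa 0 = M.a ∧ σ vpb 0 = M.b ∧ σ vpc 0 = M.c ∧ σ vpd 0 = M.d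

theorem Holds.congr {σ σ' : Mem} {M : M2} {S : List ℕ} (h : Holds σ M) (hF : Frame S σ σ')
    (h1 : vpa ∉ S) (h2 : vpb ∉ S) (h3 : vpc ∉ S) (h4 : vpd ∉ S) : Holds σ' M := by
  unfold Holds
  rw [hF _ h1, hF _ h2, hF _ h3, hF _ h4]
  exact h

abbrev planeVars : List ℕ := [vpa, vpb, vpc, vpd, vsw, vq]

def refineStep : Program :=
  let z : Expr := .get aDig (var vph * var vkk + var vse)
  .ite z
    (.ite (z - 1)
      (.ite (z - 2) .skip
        (.seq (.set vpa 0 (var vpa + var vpc)) <| .seq (.set vpb 0 (var vpb + var vpd)) <|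
          .seq (.set vpc 0 (2 * var vpc)) <| .set vpd 0 (2 * var vpd)))
      (.seq (.set vpc 0 (2 * var vpc)) <| .set vpd 0 (2 * var vpd)))
    (.seq (.set vpa 0 (2 * var vpa)) <| .set vpb 0 (2 * var vpb))

theorem ok_refineStep {M : M2} {A : ℤ} (hσ : MemB x σ) (h : Holds σ M) (hM : M.Le (A ^ 2)) (hA : 0 ≤ A)
    (hA' : 2 * A < 2 ^ x) {z : ℤ} (hz : σ aDig (σ vph 0 * σ vkk 0 + σ vse 0) = z) :
    Ok O G x refineStep σ fun σ' => Frame planeVars σ σ' ∧ Holds σ' (M.refine z) := by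
  obtain ⟨h1, h2, h3, h4⟩ := h
  obtain ⟨ha, hb, hc, hd⟩ := hM.entries hA
  rw [abs_le] at ha hb hc hd
  have hz' : Expr.val σ (.get aDig (var vph * var vkk + var vse)) = z := by simpa using hz
  have key (y : ℤ) (hy : -A ≤ y ∧ y ≤ A) : |2 * y| < 2 ^ x := by rw [abs_lt]; constructor <;> linarith
  have key' (y y' : ℤ) (hy : -A ≤ y ∧ y ≤ A) (hy' : -A ≤ y' ∧ y' ≤ A) : |y + y'| < 2 ^ x := by
    rw [abs_lt]; constructor <;> linarith
  refine ok_ite hσ (fun c1 => ok_ite hσ (fun c2 => ok_ite hσ (fun c3 => ?_) fun c3 => ?_)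
    fun c2 => ?_) fun c1 => ?_
  all_goals simp only [val_sub, hz', val_one, val_ofNat] at *
  · refine ok_skip hσ ⟨Frame.refl _ _, ?_⟩
    rw [M2.refine, if_neg c1, if_neg (by omega), if_neg (by omega)]
    exact ⟨h1, h2, h3, h4⟩
  · obtain rfl : z = 2 := by omega
    refine ok_set_seq hσ (by simp [h1, h3, key' _ _ ha hc]) fun hσ => ok_set_seq hσ
      (by simp [h2, h4, Mem.write, key' _ _ hb hd]) fun hσ => ok_set_seq hσ
      (by simpa [h3, Mem.write] using key _ hc) fun hσ => ok_set hσ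
      (by simpa [h4, Mem.write] using key _ hd) ⟨?_, ?_⟩
    · exact ((((Frame.refl _ _).write (by decide) _ _).write (by decide) _ _).write
        (by decide) _ _).write (by decide) _ _
    · simp [Holds, M2.refine, Mem.write, h1, h2, h3, h4]
  · obtain rfl : z = 1 := by omega
    refine ok_set_seq hσ
      (by simpa [h3, Mem.write] using key _ hc) fun hσ => ok_set hσ
      (by simpa [h4, Mem.write] using key _ hd) ⟨?_, ?_⟩
    · exact ((Frame.refl _ _).write (by decide) _ _).write (by decide) _ _
    · simp [Holds, M2.refine, Mem.write, h1, h2, h3, h4]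
  · subst c1
    refine ok_set_seq hσ
      (by simpa [h1, Mem.write] using key _ ha) fun hσ => ok_set hσ
      (by simpa [h2, Mem.write] using key _ hb) ⟨?_, ?_⟩
    · exact ((Frame.refl _ _).write (by decide) _ _).write (by decide) _ _
    · simp [Holds, M2.refine, Mem.write, h1, h2, h3, h4]

def gaussProg : Program :=
  .seq (.set vq 0 ((2 * (var vpa * var vpc + var vpb * var vpd) +
      (var vpa * var vpa + var vpb * var vpb)) /
      (2 * (var vpa * var vpa + var vpb * var vpb)))) <|
    .seq (.set vpc 0 (var vpc - var vq * var vpa)) <|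
    .seq (.set vpd 0 (var vpd - var vq * var vpb)) <|
    .ite ((2 * (var vpc * var vpc + var vpd * var vpd)).less
      (var vpa * var vpa + var vpb * var vpb))
      (.seq (.set vsw 0 (var vpa)) <| .seq (.set vpa 0 (var vpc)) <| .seq (.set vpc 0 (var vsw)) <|
        .seq (.set vsw 0 (var vpb)) <| .seq (.set vpb 0 (var vpd)) <| .set vpd 0 (var vsw)) .skip

theorem abs_quo_le {M : M2} {A : ℤ} (hM : M.Le (A ^ 2)) (hA : 0 ≤ A) : |M.quo| ≤ 5 * A ^ 2 := by
  obtain ⟨ha, hb, hc, hd⟩ := hM.entries hA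
  rw [M2.quo]
  refine (Int.abs_ediv_le_abs _ _).trans ((abs_add_le _ _).trans ?_)
  have h1 : |M.ip| ≤ A * A + A * A := by
    refine (abs_add_le _ _).trans ?_
    rw [abs_mul, abs_mul]
    gcongr
  rw [abs_mul, abs_of_nonneg M.n1_nonneg, abs_two]
  linarith [hM.1]

theorem ok_gaussProg {M : M2} {A : ℤ} (hσ : MemB x σ) (h : Holds σ M) (hM : M.Le (A ^ 2)) (hA : 0 < A)
    (hA' : 5 * A ^ 2 < 2 ^ x) (hdet : M.det ≠ 0) :
    Ok O G x gaussProg σ fun σ' => Frame planeVars σ σ' ∧ Holds σ' M.gaussStep := by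
  obtain ⟨h1, h2, h3, h4⟩ := h
  have hs : M.shear.Le (A ^ 2) := ⟨hM.1, (M2.n2_shear_le (M2.n1_pos hdet)).trans hM.2⟩
  obtain ⟨ha, hb, hc, hd⟩ := hs.entries hA.le
  have hAx : A < 2 ^ x := by nlinarith
  simp only [M2.shear] at ha hb hc hd
  have hqv : Expr.val σ ((2 * (var vpa * var vpc + var vpb * var vpd) +
      (var vpa * var vpa + var vpb * var vpb)) /
      (2 * (var vpa * var vpa + var vpb * var vpb))) = M.quo := by
    simp only [val_div, val_add, val_mul, val_ofNat, val_var, h1, h2, h3, h4]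
    rfl
  refine ok_set_seq hσ ?_ fun hσ => ?_
  · rw [hqv]
    exact (abs_quo_le hM hA.le).trans_lt hA'
  rw [hqv, val_zero] at hσ ⊢
  have hF₁ : Frame planeVars σ (σ.write vq 0 M.quo) := (Frame.refl _ _).write (by decide) _ _
  refine ok_set_seq hσ ?_ fun hσ => ok_set_seq hσ ?_ fun hσ => ?_
  · simpa [Mem.write, h1, h3] using hc.trans_lt hAx
  · simpa [Mem.write, h2, h4] using hd.trans_lt hAx
  set σ₃ := ((σ.write vq 0 M.quo).write vpc _ _).write vpd _ _ with hσ₃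
  have hF₃ : Frame planeVars σ σ₃ := (hF₁.write (by decide) _ _).write (by decide) _ _
  have k1 : σ₃ vpa 0 = M.shear.a := by simp [hσ₃, Mem.write, h1, M2.shear]
  have k2 : σ₃ vpb 0 = M.shear.b := by simp [hσ₃, Mem.write, h2, M2.shear]
  have k3 : σ₃ vpc 0 = M.shear.c := by simp [hσ₃, Mem.write, h1, h3, M2.shear]
  have k4 : σ₃ vpd 0 = M.shear.d := by simp [hσ₃, Mem.write, h2, h4, M2.shear]
  clear_value σ₃
  have hval : Expr.val σ₃ ((2 * (var vpc * var vpc + var vpd * var vpd)).less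
      (var vpa * var vpa + var vpb * var vpb)) = if 2 * M.shear.n2 < M.n1 then 1 else 0 := by
    simp only [val_less, val_add, val_mul, val_ofNat, val_var, k1, k2, k3, k4]
    rfl
  refine ok_ite hσ (fun c => ?_) fun c => ?_
  · rw [hval] at c
    have c' : 2 * M.shear.n2 < M.n1 := by
      by_contra hc; rw [if_neg hc] at c; exact c rfl
    refine ok_set_seq hσ ?_ fun hσ => ok_set_seq hσ ?_ fun hσ => ok_set_seq hσ ?_ fun hσ =>
      ok_set_seq hσ ?_ fun hσ => ok_set_seq hσ ?_ fun hσ => ok_set hσ ?_ ⟨?_, ?_⟩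
    iterate 6 exact hσ _ _
    · exact (((((hF₃.write (by decide) _ _).write (by decide) _ _).write (by decide) _ _).write
        (by decide) _ _).write (by decide) _ _).write (by decide) _ _
    · rw [M2.gaussStep, if_pos c']
      simp [Holds, Mem.write, k1, k2, k3, k4, M2.shear]
  · rw [hval] at c
    have c' : ¬2 * M.shear.n2 < M.n1 := by
      intro hc; rw [if_pos hc] at c; exact one_ne_zero c
    refine ok_skip hσ ⟨hF₃, ?_⟩
    rw [M2.gaussStep, if_neg c']
    exact ⟨k1, k2, k3, k4⟩

def planeProg : Program :=
  .seq (.set vpa 0 1) <| .seq (.set vpb 0 0) <| .seq (.set vpc 0 0) <| .seq (.set vpd 0 1) <|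
    .seq (forTo vse (var vkk) refineStep) (forTo vse (2 * var vkk + 1) gaussProg)

theorem ok_planeProg {k j : ℕ} {dig : ℤ → ℤ} (hσ : MemB x σ) (hkk : σ vkk 0 = k)
    (hph : σ vph 0 = j) (hdig : σ aDig = dig) (hkx : 2 * k + 3 ≤ x) :
    Ok O G x planeProg σ fun σ' => Frame (vse :: planeVars) σ σ' ∧ Holds σ' (redPre k dig (j * k)) := by
  have h1x : (1 : ℤ) < 2 ^ x := one_lt_pow₀ (by norm_num) (by omega)
  have h5x : 5 * ((2 : ℤ) ^ k) ^ 2 < 2 ^ x := by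
    calc 5 * ((2 : ℤ) ^ k) ^ 2 < 2 ^ (2 * k + 3) := by
          have : (0 : ℤ) < 2 ^ k := by positivity
          rw [pow_add, pow_mul']; nlinarith
      _ ≤ _ := pow_le_pow_right₀ (by norm_num) hkx
  have h2x : ∀ e ≤ k, 2 * (2 : ℤ) ^ e < 2 ^ x := by
    intro e he
    rw [← pow_succ']
    exact pow_lt_pow_right₀ (by norm_num) (by omega)
  refine ok_set_seq hσ (by simpa using h1x) fun hσ => ok_set_seq hσ (by simp) fun hσ =>
    ok_set_seq hσ (by simp) fun hσ => ok_set_seq hσ (by simpa using h1x) fun hσ => ?_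
  simp only [val_zero, val_one] at hσ ⊢
  set σ₁ := (((σ.write vpa 0 1).write vpb 0 0).write vpc 0 0).write vpd 0 1 with hσ₁
  have hF₁ : Frame (vse :: planeVars) σ σ₁ :=
    ((((Frame.refl _ _).write (by decide) _ _).write (by decide) _ _).write (by decide) _ _).write
      (by decide) _ _
  have hH₁ : Holds σ₁ (pre dig (j * k) 0) := by simp [hσ₁, Holds, pre, M2.one, Mem.write]
  clear_value σ₁
  refine ok_seq (Q := fun σ' => Frame (vse :: planeVars) σ σ' ∧ Holds σ' (pre dig (j * k) k)) ?_ ?_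
  · refine ok_for (fun e σ' => Frame (vse :: planeVars) σ σ' ∧ Holds σ' (pre dig (j * k) e)) k
      (by omega) hσ ?_ ?_ ?_ fun σ' _ h _ => h
    · exact ⟨hF₁.write (by decide) _ _, hH₁.congr ((Frame.refl [vse] _).write (by decide) _ _)
        (by decide) (by decide) (by decide) (by decide)⟩
    · rintro e - σ' - - ⟨hF, -⟩
      simp [hF vkk (by decide), hkk]
    · rintro e he σ₂ hσ₂ hv ⟨hF₂, hH₂⟩
      have hle := pre_le dig (j * k) e
      rw [show (4 : ℤ) = 2 ^ 2 by norm_num, pow_right_comm] at hle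
      refine (ok_refineStep (z := dig ((j * k + e : ℕ) : ℤ)) hσ₂ hH₂ hle (by positivity)
        (h2x e he.le) ?_).imp ?_
      · rw [hF₂ aDig (by decide), hF₂ vph (by decide), hF₂ vkk (by decide), hdig, hph, hkk, hv]
        push_cast
        rfl
      · rintro σ' - ⟨hF, hH⟩
        refine ⟨by rw [hF vse (by decide), hv], (hF₂.trans (hF.mono (by decide))).write
          (by decide) _ _, hH.congr ((Frame.refl [vse] _).write (by decide) _ _)
          (by decide) (by decide) (by decide) (by decide)⟩
  · rintro σ₂ hσ₂ ⟨hF₂, hH₂⟩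
    refine ok_for (fun e σ' => Frame (vse :: planeVars) σ σ' ∧
      Holds σ' (M2.gaussStep^[e] (pre dig (j * k) k))) (2 * k + 1)
      (by omega) hσ₂ ?_ ?_ ?_ fun σ' _ h _ => h
    · exact ⟨hF₂.write (by decide) _ _, hH₂.congr ((Frame.refl [vse] _).write (by decide) _ _)
        (by decide) (by decide) (by decide) (by decide)⟩
    · rintro e - σ' - - ⟨hF, -⟩
      simp [hF vkk (by decide), hkk]
    · rintro e he σ₃ hσ₃ hv ⟨hF₃, hH₃⟩
      have hdet := det_pre_ne dig (j * k) k
      have hle := pre_le dig (j * k) k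
      rw [show (4 : ℤ) = 2 ^ 2 by norm_num, pow_right_comm] at hle
      have hdet' : (M2.gaussStep^[e] (pre dig (j * k) k)).det ≠ 0 := by
        rw [← abs_pos, M2.det_iterate, abs_pos]; exact hdet
      refine (ok_gaussProg hσ₃ hH₃ (hle.iterate hdet e) (by positivity) h5x hdet').imp ?_
      rintro σ' - ⟨hF, hH⟩
      rw [← Function.iterate_succ_apply' M2.gaussStep] at hH
      refine ⟨by rw [hF vse (by decide), hv], (hF₃.trans (hF.mono (by decide))).write
          (by decide) _ _, hH.congr ((Frame.refl [vse] _).write (by decide) _ _)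
          (by decide) (by decide) (by decide) (by decide)⟩

end SVPRed

/-! ### Computing the basis of a sublattice from its digits. -/

namespace SVPRed

variable {N n : ℕ} {O : List ℤ → Bool} {G : List ℤ → Prop} {x : ℕ} {σ : Mem} {P : Program}
  {Q : Mem → Prop}

def copyProg : Program := mapTo vl (var vn * var vN) aW (var vl) (.get aV (var vl))

theorem ok_copyProg (hσ : MemB x σ) (hn : σ vn 0 = n) (hN : σ vN 0 = N) (hx : n * N ≤ x) :
    Ok O G x copyProg σ fun σ' => Frame [vl, aW] σ σ' ∧
      ∀ i < n, rowAt N σ' aW i = rowAt N σ aV i := by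
  have hF : ∀ σ' : Mem, (∀ a, a ≠ vl → a ≠ aW → σ' a = σ a) → Frame [vl, aW] σ σ' :=
    fun σ' h a ha => by
      simp only [List.mem_cons, List.not_mem_nil, or_false, not_or] at ha
      exact h a ha.1 ha.2
  refine ok_map (n * N) 0 (fun i => σ aV i) (by decide) hx hσ ?_ (fun i _ => hσ _ _) ?_
  · intro i hi σ' h hv _
    refine ⟨by simp [h vn (by decide) (by decide), h vN (by decide) (by decide), hn, hN],
      fun hi => ⟨by simp [hv], by simp [hv, h aV (by decide) (by decide)]⟩⟩
  · intro σ' _ h h2 _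
    refine ⟨hF σ' h, fun i hi => ?_⟩
    funext j
    have : i * N + j < n * N := by
      have := j.2
      nlinarith
    simpa [rowAt] using h2 _ this

/-- Both old rows are copied beforehand, since each of the two new rows depends on both of them. -/
def phaseProg : Program :=
  .seq planeProg <|
    .seq (rowTo aRowA 0 (elt aW 0)) <| .seq (rowTo aRowB 0 (elt aW (var vph + 1))) <|
    .seq (rowTo aW 0 (var vpa * elt aRowA 0 + var vpb * elt aRowB 0)) <|
      rowTo aW (var vph + 1) (var vpc * elt aRowA 0 + var vpd * elt aRowB 0)

abbrev phaseArrays : List ℕ := vse :: vj :: aRowA :: aRowB :: aW :: planeVars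

theorem ok_phaseProg {k j : ℕ} {dig : ℤ → ℤ} {W : ℕ → Vec N} {E : ℤ} (hσ : MemB x σ)
    (hN : σ vN 0 = N) (hkk : σ vkk 0 = k) (hph : σ vph 0 = j) (hdig : σ aDig = dig)
    (hkx : 2 * k + 3 ≤ x) (hNx : N ≤ x) (hW : ∀ i < n, rowAt N σ aW i = W i) (hj : j + 1 < n)
    (hE : ∀ i < n, ∀ l, |W i l| ≤ E)
    (hEx : 2 ^ (k + 1) * E < 2 ^ x) :
    Ok O G x phaseProg σ fun σ' => Frame phaseArrays σ σ' ∧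
      ∀ i < n, rowAt N σ' aW i = phase (redPre k dig (j * k)) W (j + 1) i := by
  refine ok_seq (ok_planeProg hσ hkk hph hdig hkx) ?_
  rintro σ₁ hσ₁ ⟨hF₁, hH₁⟩
  have hN₁ : σ₁ vN 0 = N := by rw [hF₁ _ (by decide), hN]
  have hr₁ : ∀ i, rowAt N σ₁ aW i = rowAt N σ aW i := fun i => rowAt_congr (hF₁ _ (by decide)) i
  refine ok_seq (Q := fun σ' => Frame [vj, aRowA] σ₁ σ' ∧ rowAt N σ' aRowA 0 = W 0) ?_ ?_
  · refine ok_row 0 (W 0) (by decide) (by decide) hNx hσ₁ hN₁ ?_ ?_ fun σ' _ hF h _ => ⟨hF, h⟩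
    · intro l σ' hF hl _ _
      refine ⟨by simp, ?_⟩
      rw [val_elt (r := 0) (by simp) (by rw [hF _ (by decide), hN₁]) hl,
        rowAt_congr (hF _ (by decide)), hr₁, hW _ (by omega)]
    · intro l
      rw [← hW 0 (by omega)]
      exact hσ _ _
  rintro σ₂ hσ₂ ⟨hF₂, hA₂⟩
  have hN₂ : σ₂ vN 0 = N := by rw [hF₂ _ (by decide), hN₁]
  refine ok_seq (Q := fun σ' => Frame [vj, aRowB] σ₂ σ' ∧ rowAt N σ' aRowB 0 = W (j + 1)) ?_ ?_
  · refine ok_row 0 (W (j + 1)) (by decide) (by decide) hNx hσ₂ hN₂ ?_ ?_ fun σ' _ hF h _ => ⟨hF, h⟩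
    · intro l σ' hF hl _ _
      refine ⟨by simp, ?_⟩
      rw [val_elt (r := j + 1) _ (by rw [hF _ (by decide), hN₂]) hl,
        rowAt_congr (hF _ (by decide)), rowAt_congr (hF₂ _ (by decide)), hr₁, hW _ hj]
      simp [hF vph (by decide), hF₂ vph (by decide), hF₁ vph (by decide), hph]
    · intro l
      rw [← hW _ hj]
      exact hσ _ _
  rintro σ₃ hσ₃ ⟨hF₃, hB₃⟩
  have hN₃ : σ₃ vN 0 = N := by rw [hF₃ _ (by decide), hN₂]
  have hA₃ : rowAt N σ₃ aRowA 0 = W 0 := by rw [rowAt_congr (hF₃ _ (by decide)), hA₂]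
  have hH₃ : Holds σ₃ (redPre k dig (j * k)) :=
    (hH₁.congr hF₂ (by decide) (by decide) (by decide) (by decide)).congr hF₃
      (by decide) (by decide) (by decide) (by decide)
  have hr₃ : ∀ i < n, rowAt N σ₃ aW i = W i := fun i hi => by
    rw [rowAt_congr (hF₃ _ (by decide)), rowAt_congr (hF₂ _ (by decide)), hr₁, hW i hi]
  obtain ⟨ha, hb, hc, hd⟩ := abs_redPre_le (k := k) (dig := dig) (off := j * k)
  set M := redPre k dig (j * k)
  have key (y z : ℤ) (hy : |y| ≤ 2 ^ k) (hz : |z| ≤ 2 ^ k) (l : Fin N) :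
      |y * W 0 l + z * W (j + 1) l| < 2 ^ x := by
    refine lt_of_le_of_lt ?_ hEx
    refine (abs_add_le _ _).trans ?_
    rw [abs_mul, abs_mul]
    calc _ ≤ 2 ^ k * E + 2 ^ k * E := by
          gcongr
          · exact hE _ (by omega) _
          · exact hE _ hj _
      _ = _ := by ring
  refine ok_seq (Q := fun σ' => Frame [vj, aW] σ₃ σ' ∧ rowAt N σ' aW 0 = M.a • W 0 + M.b • W (j + 1) ∧
    ∀ i < n, i ≠ 0 → rowAt N σ' aW i = W i) ?_ ?_
  · refine ok_row 0 (M.a • W 0 + M.b • W (j + 1)) (by decide) (by decide) hNx hσ₃ hN₃ ?_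
      (fun l => by simpa using key _ _ ha hb l)
      fun σ' _ hF h h' => ⟨hF, h, fun i hi h0 => by rw [h' i h0, hr₃ i hi]⟩
    intro l σ' hF hl _ _
    refine ⟨by simp, ?_⟩
    have hN' : σ' vN 0 = N := by rw [hF _ (by decide), hN₃]
    obtain ⟨e1, e2, -, -⟩ := hH₃.congr hF (by decide) (by decide) (by decide) (by decide)
    rw [val_add, val_mul, val_mul, val_elt (r := 0) (by simp) hN' hl,
      val_elt (r := 0) (by simp) hN' hl, rowAt_congr (hF _ (by decide)), hA₃,
      rowAt_congr (hF _ (by decide)), hB₃, val_var, val_var, e1, e2]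
    rfl
  rintro σ₄ hσ₄ ⟨hF₄, h0₄, hr₄⟩
  have hN₄ : σ₄ vN 0 = N := by rw [hF₄ _ (by decide), hN₃]
  refine ok_row (j + 1) (M.c • W 0 + M.d • W (j + 1)) (by decide) (by decide) hNx hσ₄ hN₄ ?_
      (fun l => by simpa using key _ _ hc hd l) ?_
  · intro l σ' hF hl _ _
    have hN' : σ' vN 0 = N := by rw [hF _ (by decide), hN₄]
    obtain ⟨-, -, e1, e2⟩ := (hH₃.congr hF₄ (by decide) (by decide) (by decide) (by decide)).congr hF
      (by decide) (by decide) (by decide) (by decide)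
    refine ⟨by simp [hF vph (by decide), hF₄ vph (by decide), hF₃ vph (by decide),
      hF₂ vph (by decide), hF₁ vph (by decide), hph], ?_⟩
    rw [val_add, val_mul, val_mul, val_elt (r := 0) (by simp) hN' hl,
      val_elt (r := 0) (by simp) hN' hl, rowAt_congr (hF _ (by decide)),
      rowAt_congr (hF₄ _ (by decide)), hA₃,
      rowAt_congr (hF _ (by decide)), rowAt_congr (hF₄ _ (by decide)), hB₃, val_var, val_var, e1, e2]
    rfl
  · intro σ' _ hF h h'
    refine ⟨(hF₁.mono (by decide)).trans ((hF₂.mono (by decide)).trans ((hF₃.mono (by decide)).trans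
      ((hF₄.mono (by decide)).trans (hF.mono (by decide))))), fun i hi => ?_⟩
    by_cases hi0 : i = 0
    · subst hi0
      rw [h' 0 (by omega), h0₄, phase_zero]
    by_cases hij : i = j + 1
    · subst hij
      rw [h, phase_self _ _ (by omega)]
    · rw [h' i hij, hr₄ i hi hi0, phase_other _ _ hi0 hij]

/-- Every sublattice is built afresh from the reduced basis in `aV`, which this program does not
change; only the digits are kept between calls. -/
def buildProg : Program := .seq copyProg <| forTo vph (var vn - 1) phaseProg

abbrev buildArrays : List ℕ := vl :: vph :: phaseArrays

theorem ok_buildProg {k : ℕ} {dig : ℤ → ℤ} {V : ℕ → Vec N} {E : ℤ} (hσ : MemB x σ) (hn0 : 0 < n)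
    (hn : σ vn 0 = n) (hN : σ vN 0 = N) (hkk : σ vkk 0 = k) (hdig : σ aDig = dig)
    (hkx : 2 * k + 3 ≤ x) (hNx : N ≤ x) (hnx : n ≤ x) (hnN : n * N ≤ x)
    (hV : ∀ i < n, rowAt N σ aV i = V i)
    (hE : ∀ i < n, ∀ l, |V i l| ≤ E) (hEx : (2 ^ (k + 1)) ^ n * E < 2 ^ x) (hE0 : 0 ≤ E) :
    Ok O G x buildProg σ fun σ' => Frame buildArrays σ σ' ∧
      ∀ i < n, rowAt N σ' aW i = build k V dig (n - 1) i := by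
  refine ok_seq (ok_copyProg hσ hn hN hnN) ?_
  rintro σ₁ hσ₁ ⟨hF₁, hr₁⟩
  refine ok_for (fun j σ' => Frame buildArrays σ σ' ∧
    ∀ i < n, rowAt N σ' aW i = build k V dig j i) (n - 1) (by omega) hσ₁ ?_ ?_ ?_
    fun σ' _ h _ => h
  · refine ⟨(hF₁.mono (by decide)).write (by decide) _ _, fun i hi => ?_⟩
    rw [rowAt_write _ _ _ _ _ (by decide), hr₁ i hi, hV i hi, build]
  · rintro j - σ' - - ⟨hF, -⟩
    simp only [val_sub, val_var, val_one, hF vn (by decide), hn]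
    omega
  · rintro j hj σ₂ hσ₂ hv ⟨hF₂, hr₂⟩
    refine (ok_phaseProg (n := n) (E := (2 ^ (k + 1)) ^ j * E) hσ₂ (by rw [hF₂ _ (by decide), hN])
      (by rw [hF₂ _ (by decide), hkk]) hv (by rw [hF₂ _ (by decide), hdig]) hkx hNx hr₂ (by omega)
      (fun i hi l => abs_build_le hE (by omega) i hi l) ?_).imp ?_
    · refine lt_of_le_of_lt ?_ hEx
      rw [← mul_assoc, ← pow_succ']
      exact mul_le_mul_of_nonneg_right (pow_le_pow_right₀ (one_le_pow₀ (by norm_num)) (by omega)) hE0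
    · rintro σ' - ⟨hF, hr⟩
      refine ⟨by rw [hF vph (by decide), hv], (hF₂.trans (hF.mono (by decide))).write
          (by decide) _ _, fun i hi => ?_⟩
      rw [rowAt_write _ _ _ _ _ (by decide), hr i hi, build]

end SVPRed

namespace SVPRed

/-! ### Shortest vectors -/

variable {N n : ℕ} {W : ℕ → Vec N} {v : Vec N}

/-- The squared length of a shortest non-zero vector. -/
noncomputable def minsq (n : ℕ) (W : ℕ → Vec N) : ℕ :=
  sInf {m : ℕ | ∃ v ∈ Lat n W, v ≠ 0 ∧ v ⬝ᵥ v = m}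

theorem dot_self_pos (hv : v ≠ 0) : 0 < v ⬝ᵥ v := by
  refine lt_of_le_of_ne (dot_self_nonneg v) fun h => hv ?_
  exact dotProduct_self_eq_zero.1 h.symm

theorem minsq_le (hv : v ∈ Lat n W) (h0 : v ≠ 0) : (minsq n W : ℤ) ≤ v ⬝ᵥ v := by
  obtain ⟨m, hm⟩ := Int.eq_ofNat_of_zero_le (dot_self_nonneg v)
  have : minsq n W ≤ m := Nat.sInf_le ⟨v, hv, h0, hm⟩
  rw [hm]
  exact_mod_cast this

theorem Indep.ne_zero (h : Indep n (embf W)) {i : ℕ} (hi : i < n) : W i ≠ 0 := by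
  intro h0
  exact LinearIndependent.ne_zero (⟨i, hi⟩ : Fin n) h (by simp [embf, h0])

theorem exists_minsq (hn : 0 < n) (h : Indep n (embf W)) :
    ∃ v ∈ Lat n W, v ≠ 0 ∧ v ⬝ᵥ v = minsq n W := by
  obtain ⟨m, hm⟩ := Int.eq_ofNat_of_zero_le (dot_self_nonneg (W 0))
  exact Nat.sInf_mem (s := {m : ℕ | ∃ v ∈ Lat n W, v ≠ 0 ∧ v ⬝ᵥ v = m})
    ⟨m, W 0, mem_below hn, h.ne_zero hn, hm⟩

theorem one_le_minsq (hn : 0 < n) (h : Indep n (embf W)) : 1 ≤ minsq n W := by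
  obtain ⟨v, -, h0, hv⟩ := exists_minsq hn h
  have := dot_self_pos h0
  omega

theorem norm_emb (v : Vec N) : ‖emb v‖ = √((v ⬝ᵥ v : ℤ) : ℝ) := by
  rw [← norm_emb_sq, Real.sqrt_sq (norm_nonneg _)]

/-- The lattice of a rational basis that is a multiple of an integral one. -/
theorem mem_lattice_iff {B : RatBasis n N} {r : ℝ} (hB : ∀ i : Fin n, toReal (B.vec i) = r • emb (W i))
    {y : EuclideanSpace ℝ (Fin N)} : y ∈ B.lattice ↔ ∃ v ∈ Lat n W, y = r • emb v := by
  let φ : Vec N →ₗ[ℤ] EuclideanSpace ℝ (Fin N) := (r • (LinearMap.id : EuclideanSpace ℝ (Fin N) →ₗ[ℝ] _)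
    ).toAddMonoidHom.comp emb |>.toIntLinearMap
  have hφ : ∀ v, φ v = r • emb v := fun v => rfl
  have : B.lattice = Submodule.map φ (Lat n W) := by
    rw [RatBasis.lattice, Lat, below, Submodule.map_span]
    congr 1
    ext y
    simp only [Set.mem_range, Set.mem_image, Set.mem_Iio, exists_exists_and_eq_and, hφ]
    constructor
    · rintro ⟨i, rfl⟩
      exact ⟨i, i.2, (hB i).symm⟩
    · rintro ⟨i, hi, rfl⟩
      exact ⟨⟨i, hi⟩, hB _⟩
  rw [this, Submodule.mem_map]
  simp only [hφ, eq_comm]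

/-- Squared lengths in the integral lattice are natural numbers, so the infimum is attained. From
here on minima are handled through the natural number `minsq`. -/
theorem lambda1_eq {B : RatBasis n N} {r : ℝ} (hr : 0 < r) (hn : 0 < n) (h : Indep n (embf W))
    (hB : ∀ i : Fin n, toReal (B.vec i) = r • emb (W i)) :
    lambda1 B.lattice = r * √(minsq n W) := by
  have hnorm : ∀ v : Vec N, ‖r • emb v‖ = r * √((v ⬝ᵥ v : ℤ) : ℝ) := fun v => by
    rw [norm_smul, norm_emb, Real.norm_of_nonneg hr.le]
  obtain ⟨v, hv, h0, hvm⟩ := exists_minsq hn h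
  apply IsLeast.csInf_eq
  constructor
  · refine ⟨r • emb v, (mem_lattice_iff hB).2 ⟨v, hv, rfl⟩, ?_, ?_⟩
    · exact smul_ne_zero hr.ne' fun h => h0 (emb_eq_zero.1 h)
    · rw [hnorm, hvm, Int.cast_natCast]
  · rintro _ ⟨y, hy, hy0, rfl⟩
    obtain ⟨u, hu, rfl⟩ := (mem_lattice_iff hB).1 hy
    have hu0 : u ≠ 0 := by rintro rfl; simp at hy0
    rw [hnorm]
    refine mul_le_mul_of_nonneg_left (Real.sqrt_le_sqrt ?_) hr.le
    exact_mod_cast minsq_le hu hu0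

/-- The rational basis given by a multiple of an integral one. -/
def scaledBasis (W : ℕ → Vec N) (h : Indep n (embf W)) (S : ℤ) (hS : 0 < S) : RatBasis n N where
  vec i j := ((S * W i j : ℤ) : ℚ)
  indep := by
    have : (fun i : Fin n => toReal fun j => ((S * W i j : ℤ) : ℚ)) =
        fun i : Fin n => (S : ℝ) • embf W i := by
      funext i
      ext j
      simp [toReal, embf]
    rw [this]
    have hS' : (S : ℝ) ≠ 0 := by exact_mod_cast hS.ne'
    exact LinearIndependent.units_smul h fun _ => Units.mk0 (S : ℝ) hS'

theorem toReal_scaledBasis (h : Indep n (embf W)) {S : ℤ} (hS : 0 < S) (i : Fin n) :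
    toReal ((scaledBasis W h S hS).vec i) = (S : ℝ) • emb (W i) := by
  ext j
  simp [toReal, scaledBasis]

/-- What an answer of the oracle says. -/
theorem oracle_answer {γ : ℕ → ℝ} {O : List ℤ → Bool} (hO : IsGapSVPOracle γ O) (hn : 0 < n)
    (h : Indep n (embf W)) {S d : ℤ} (hS : 0 < S) (hd : 0 < d) :
    (O (encodeGap (scaledBasis W h S hS) d) = false → (d : ℝ) ≤ S * √(minsq n W)) ∧
    (O (encodeGap (scaledBasis W h S hS) d) = true → S * √(minsq n W) < γ n * d) := by
  obtain ⟨h1, h2⟩ := hO n N (scaledBasis W h S hS) d hn (by exact_mod_cast hd)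
  rw [lambda1_eq (by exact_mod_cast hS) hn h (toReal_scaledBasis h hS)] at h1 h2
  push_cast at h1 h2
  constructor
  · intro hf
    by_contra hlt
    rw [h1 (not_le.1 hlt)] at hf
    exact Bool.noConfusion hf
  · intro ht
    by_contra hle
    rw [h2 (not_lt.1 hle)] at ht
    exact Bool.noConfusion ht

/-- The loss in one round of the search. -/
theorem sqrt_le_of_search {γ : ℝ} (hγ : 1 ≤ γ) {a w Y : ℕ} (ha : 1 ≤ a) (haY : a < Y)
    (h : 16 * Y * √w < γ * (16 * Y * √a + 1)) : √w ≤ γ ^ 2 * √a := by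
  have ha' : (1 : ℝ) ≤ a := by exact_mod_cast ha
  have haY' : (a : ℝ) + 1 ≤ Y := by exact_mod_cast haY
  have hsa : 1 ≤ √(a : ℝ) := Real.one_le_sqrt.2 ha'
  have hsq : √(a : ℝ) ^ 2 = a := Real.sq_sqrt (by linarith)
  have hS : (0 : ℝ) < 16 * Y := by linarith
  set S : ℝ := 16 * Y with hSdef
  set r := √(a : ℝ) with hr
  have hSr : 0 < S * r := by positivity
  -- If `γ` is at least `1 + 1 / (S * r)`, the additive error `1` costs at most another factor `γ`.
  -- Otherwise `γ` is so close to `1` that `w < a + 1`, whence `w ≤ a` by integrality; the scaling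
  -- by `16 * Y` is chosen so that `(1 + ε) ^ 4 * a < a + 1`.
  rcases le_or_gt (1 + 1 / (S * r)) γ with hc | hc
  · have h1 : S * r + 1 ≤ γ * (S * r) := by
      have := mul_le_mul_of_nonneg_right hc hSr.le
      rwa [add_mul, one_mul, one_div, inv_mul_cancel₀ hSr.ne'] at this
    have h2 : S * √w < S * (γ ^ 2 * r) :=
      h.trans_le ((mul_le_mul_of_nonneg_left h1 (by linarith)).trans (le_of_eq (by ring)))
    exact (lt_of_mul_lt_mul_left h2 hS.le).le
  · set ε := 1 / (S * r) with hε
    have hε0 : 0 < ε := by positivity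
    have hεr : ε * (S * r) = 1 := by rw [hε, one_div, inv_mul_cancel₀ hSr.ne']
    have hr2 : r ≤ r ^ 2 := by nlinarith
    have hε1 : 15 * (ε * r ^ 2) < 1 := by
      have hrY : r < Y := by linarith
      have : ε * r ^ 2 * S = r := by linear_combination r * hεr
      have h3 : 15 * (ε * r ^ 2) * S < 1 * S := by rw [mul_assoc, this, hSdef]; linarith
      exact lt_of_mul_lt_mul_right h3 hS.le
    have hεle : ε ≤ 1 := by nlinarith
    have h1 : S * √w < S * ((1 + ε) ^ 2 * r) := by
      refine h.trans_le ?_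
      have h3 : S * r + 1 = (1 + ε) * (S * r) := by rw [add_mul, hεr, one_mul]
      rw [h3]
      calc γ * ((1 + ε) * (S * r)) ≤ (1 + ε) * ((1 + ε) * (S * r)) :=
            mul_le_mul_of_nonneg_right hc.le (by positivity)
        _ = _ := by ring
    have h2 : √w < (1 + ε) ^ 2 * r := lt_of_mul_lt_mul_left h1 hS.le
    have h3 : (w : ℝ) < (1 + ε) ^ 4 * r ^ 2 := by
      have := pow_lt_pow_left₀ h2 (Real.sqrt_nonneg _) two_ne_zero
      rw [Real.sq_sqrt (Nat.cast_nonneg _)] at this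
      linarith
    have h4 : (1 + ε) ^ 4 ≤ 1 + 15 * ε := by
      have e2 : ε ^ 2 ≤ ε := by nlinarith
      have e3 : ε ^ 3 ≤ ε := by nlinarith
      have e4 : ε ^ 4 ≤ ε := by nlinarith [mul_nonneg hε0.le (sub_nonneg.2 e3)]
      linear_combination 6 * e2 + 4 * e3 + e4
    have h5 : (w : ℝ) < a + 1 := by
      have := mul_le_mul_of_nonneg_right h4 (sq_nonneg r)
      rw [← hsq]
      linarith
    have h6 : w ≤ a := Nat.lt_succ_iff.1 (by exact_mod_cast h5)
    refine (Real.sqrt_le_sqrt (by exact_mod_cast h6 : (w : ℝ) ≤ a)).trans ?_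
    exact le_mul_of_one_le_left (by positivity) (one_le_pow₀ hγ)

/-! ### The layout of encoded bases -/

theorem flatten_ofFn {n m : ℕ} (f : Fin n → List ℤ) (g : ℕ → ℤ)
    (h : ∀ i : Fin n, f i = (List.range m).map fun j => g (i * m + j)) :
    (List.ofFn f).flatten = (List.range (n * m)).map g := by
  induction n with
  | zero => simp
  | succ n ih =>
    rw [List.ofFn_succ_last, List.flatten_append, ih _ fun i => h i.castSucc, add_mul, one_mul,
      List.range_add, List.map_append, h]
    simp [Function.comp_def]

theorem encodeVec_eq {v : Fin N → ℚ} (g : ℕ → ℤ) (h : ∀ j : Fin N, g (j * 2) = (v j).num)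
    (h' : ∀ j : Fin N, g (j * 2 + 1) = (v j).den) :
    encodeVec v = (List.range (N * 2)).map g :=
  flatten_ofFn _ g fun j => by simp [encodeRat, List.range_succ, h, h']

theorem encodeBasis_eq {B : RatBasis n N} (g : ℕ → ℤ) (h0 : g 0 = n) (h1 : g 1 = N)
    (h : ∀ (i : Fin n) (j : Fin N), g (2 + (i * (N * 2) + j * 2)) = (B.vec i j).num)
    (h' : ∀ (i : Fin n) (j : Fin N), g (2 + (i * (N * 2) + j * 2 + 1)) = (B.vec i j).den) :
    encodeBasis B = (List.range (2 + n * (N * 2))).map g := by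
  rw [List.range_add, List.map_append, encodeBasis]
  rw [flatten_ofFn (m := N * 2) _ (fun l => g (2 + l))]
  · simp [List.range_succ, h0, h1, Function.comp_def]
  · intro i
    apply encodeVec_eq
    · exact h i
    · exact h' i

theorem encodeGap_eq {B : RatBasis n N} {d : ℚ} (g : ℕ → ℤ) (h0 : g 0 = n) (h1 : g 1 = N)
    (h : ∀ (i : Fin n) (j : Fin N), g (2 + (i * (N * 2) + j * 2)) = (B.vec i j).num)
    (h' : ∀ (i : Fin n) (j : Fin N), g (2 + (i * (N * 2) + j * 2 + 1)) = (B.vec i j).den)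
    (h2 : g (2 + n * (N * 2)) = d.num) (h3 : g (2 + n * (N * 2) + 1) = d.den) :
    encodeGap B d = (List.range (2 + n * (N * 2) + 2)).map g := by
  rw [encodeGap, encodeBasis_eq g h0 h1 h h', List.range_add (m := 2), List.map_append]
  simp [encodeRat, List.range_succ, h2, h3]

end SVPRed

namespace SVPRed

/-! ### Questions to the oracle -/

notation "vt" => (27 : ℕ)
notation "vs" => (28 : ℕ)
notation "vqq" => (29 : ℕ)
notation "vlo" => (30 : ℕ)
notation "vhi" => (31 : ℕ)
notation "vmid" => (32 : ℕ)
notation "vwit" => (33 : ℕ)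
notation "vfnd" => (34 : ℕ)
notation "vcode" => (35 : ℕ)
notation "vS" => (36 : ℕ)
notation "vans" => (37 : ℕ)
notation "vK" => (38 : ℕ)
notation "vdec" => (39 : ℕ)
notation "vrem" => (40 : ℕ)
notation "vY" => (41 : ℕ)

/-- The lists that are instances of the given dimensions. -/
def IsQuery (n N : ℕ) (l : List ℤ) : Prop := ∃ (B : RatBasis n N) (d : ℚ), 0 < d ∧ l = encodeGap B d

section
variable {N n : ℕ} {O : List ℤ → Bool} {G : List ℤ → Prop} {x : ℕ} {σ : Mem} {P : Program}
  {Q : Mem → Prop}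

/-- Writes the digits of a code. -/
def decodeProg (c : Expr) : Program :=
  .seq (.set vrem 0 c) <| forTo vdec (var vs) <|
    .seq (.set aDig (var vt + var vdec) (var vrem - 3 * (var vrem / 3))) <|
      .set vrem 0 (var vrem / 3)

theorem ok_decodeProg {c : Expr} {z : ℤ} {t s : ℕ} {dig : ℤ → ℤ} (hσ : MemB x σ) (hc : c.val σ = z)
    (hz : |z| < 2 ^ x) (ht : σ vt 0 = t) (hs : σ vs 0 = s) (hdig : σ aDig = dig) (hsx : s ≤ x)
    (hx : 2 ≤ x) :
    Ok O G x (decodeProg c) σ fun σ' => Frame [vrem, vdec, aDig] σ σ' ∧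
      σ' aDig = setDigits dig t z s := by
  have h3 : (3 : ℤ) < 2 ^ x := lt_of_lt_of_le (by norm_num) (pow_le_pow_right₀ (by norm_num) hx)
  refine ok_set_seq hσ (by rwa [hc]) fun hσ₁ => ?_
  rw [hc, val_zero] at hσ₁ ⊢
  refine ok_for (fun u σ' => Frame [vrem, vdec, aDig] σ σ' ∧ σ' vrem 0 = z / 3 ^ u ∧
    σ' aDig = setDigits dig t z u) s hsx hσ₁ ?_ ?_ ?_ fun σ' _ h _ => ⟨h.1, h.2.2⟩
  · refine ⟨((Frame.refl _ _).write (by decide) _ _).write (by decide) _ _, by simp [Mem.write], ?_⟩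
    rw [write_other _ _ _ (by decide), write_other _ _ _ (by decide), hdig, setDigits]
  · rintro u - σ' - - ⟨hF, -⟩
    simp [hF vs (by decide), hs]
  · rintro u hu σ₂ hσ₂ hv ⟨hF, hr, hd⟩
    have hm1 := Int.emod_nonneg (z / 3 ^ u) (by norm_num : (3 : ℤ) ≠ 0)
    have hm2 := Int.emod_lt_of_pos (z / 3 ^ u) (by norm_num : (0 : ℤ) < 3)
    have hval : Expr.val σ₂ (var vrem - 3 * (var vrem / 3)) = z / 3 ^ u % 3 := by
      simp only [val_sub, val_var, val_mul, val_ofNat, val_div, hr]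
      have := Int.emod_def (z / 3 ^ u) 3
      rw [this]
    refine ok_set_seq hσ₂ ?_ fun hσ₃ => ok_set hσ₃ ?_ ⟨?_, ?_, ?_, ?_⟩
    · rw [hval, abs_of_nonneg hm1]
      omega
    · have := hσ₂ vrem 0
      simp only [val_div, val_var, val_ofNat, write_other _ _ _ (show vrem ≠ aDig by decide)]
      exact (Int.abs_ediv_le_abs _ _).trans_lt this
    · simp [Mem.write, hv]
    · exact (((hF.write (by decide) _ _).write (by decide) _ _).write (by decide) _ _)
    · simp only [Mem.write]
      simp only [val_div, val_var, val_ofNat, val_zero, Mem.write]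
      norm_num
      rw [hr, pow_succ, Int.ediv_ediv_of_nonneg (by positivity)]
    · rw [write_other _ _ _ (by decide), write_other _ _ _ (by decide), write_eq_update, hd, hval,
        setDigits]
      simp only [val_add, val_var, hF vt (by decide), ht, hv]
      push_cast
      rfl

/-- Submits the multiple by `vS` of the basis in `aW`. -/
def queryProg : Program :=
  .seq (.set aQ 0 (var vn)) <| .seq (.set aQ 1 (var vN)) <|
  .seq (forTo vl (var vn * var vN) <|
    .seq (.set aQ (2 + 2 * var vl) (var vS * .get aW (var vl))) (.set aQ (3 + 2 * var vl) 1)) <|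
  .seq (.set aQ (2 + 2 * (var vn * var vN)) (var vmid)) <|
  .seq (.set aQ (3 + 2 * (var vn * var vN)) 1) <|
  .ask aQ (4 + 2 * (var vn * var vN)) vans

/-- The scaled basis and the threshold are integral, so all denominators are `1`. The length of the
query is made up of the two dimensions, `2 * n * N` cells for the entries, and two for the
threshold. -/
theorem ok_queryProg {W : ℕ → Vec N} {S d : ℤ} (hσ : MemB x σ) (hn : σ vn 0 = n) (hN : σ vN 0 = N)
    (hS' : σ vS 0 = S) (hmid : σ vmid 0 = d) (hd : 0 < d) (hS : 0 < S) (h : Indep n (embf W))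
    (hW : ∀ i < n, rowAt N σ aW i = W i) (hx : 4 + 2 * (n * N) ≤ x)
    (hSW : ∀ i < n, ∀ j, |S * W i j| < 2 ^ x) :
    Ok O (IsQuery n N) x queryProg σ fun σ' => Frame [vl, aQ, vans] σ σ' ∧
      σ' vans 0 = if O (encodeGap (scaledBasis W h S hS) d) then 1 else 0 := by
  have h1x : (1 : ℤ) < 2 ^ x := one_lt_pow₀ (by norm_num) (by omega)
  refine ok_set_seq hσ (hσ _ _) fun hσ₁ => ok_set_seq hσ₁ (hσ₁ _ _) fun hσ₂ => ?_
  have hW' : ∀ l < n * N, ∃ (i : ℕ) (j : Fin N), i < n ∧ l = i * N + j ∧ σ aW l = W i j := by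
    intro l hl
    have hN0 : 0 < N := Nat.pos_of_ne_zero (by rintro rfl; simp at hl)
    have hi : l / N < n := (Nat.div_lt_iff_lt_mul hN0).2 hl
    have hlij : l = l / N * N + l % N := by rw [mul_comm]; exact (Nat.div_add_mod l N).symm
    refine ⟨l / N, ⟨l % N, Nat.mod_lt _ hN0⟩, hi, hlij, ?_⟩
    rw [← hW _ hi, rowAt]
    congr 1
    exact_mod_cast hlij
  refine ok_seq (Q := fun σ' => Frame [vl, aQ, vans] σ σ' ∧ σ' aQ 0 = n ∧ σ' aQ 1 = N ∧
    ∀ l < n * N, σ' aQ (2 + 2 * l) = S * σ aW l ∧ σ' aQ (3 + 2 * l) = 1) ?_ ?_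
  · refine ok_for (fun u σ' => Frame [vl, aQ, vans] σ σ' ∧ σ' aQ 0 = n ∧ σ' aQ 1 = N ∧
      ∀ l < u, σ' aQ (2 + 2 * l) = S * σ aW l ∧ σ' aQ (3 + 2 * l) = 1) (n * N) (by omega) hσ₂ ?_ ?_ ?_
      fun σ' _ h _ => h
    · refine ⟨(((Frame.refl _ _).write (by decide) _ _).write (by decide) _ _).write
        (by decide) _ _, by simp [Mem.write, hn], by simp [Mem.write, hN], by simp⟩
    · rintro u - σ' - - ⟨hF, -⟩
      simp [hF vn (by decide), hF vN (by decide), hn, hN]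
    · rintro u hu σ₃ hσ₃ hv ⟨hF, h0, h1, hl⟩
      obtain ⟨i, j, hi, -, hij⟩ := hW' u hu
      have e1 : Expr.val σ₃ (var vS * .get aW (var vl)) = S * σ aW u := by
        simp [hv, hF vS (by decide), hF aW (by decide), hS']
      have e2 : Expr.val σ₃ (2 + 2 * var vl) = 2 + 2 * u := by simp [hv]
      refine ok_set_seq hσ₃ ?_ fun hσ₄ => ?_
      · rw [e1, hij]
        exact hSW i hi j
      rw [e1, e2] at hσ₄ ⊢
      have e3 : Expr.val (σ₃.write aQ (2 + 2 * u) (S * σ aW u)) (3 + 2 * var vl) = 3 + 2 * u := by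
        simp [hv, Mem.write]
      refine ok_set hσ₄ (by simpa using h1x) ?_
      rw [e3, val_one]
      refine ⟨by simp [Mem.write, hv], ((hF.write (by decide) _ _).write (by decide) _ _).write
        (by decide) _ _, ?_, ?_, fun l hlu => ?_⟩
      · rw [write_other _ _ _ (by decide), write_other_idx _ _ _ (by omega),
          write_other_idx _ _ _ (by omega), h0]
      · rw [write_other _ _ _ (by decide), write_other_idx _ _ _ (by omega),
          write_other_idx _ _ _ (by omega), h1]
      · rw [write_other _ _ _ (by decide), write_self_apply, write_self_apply, write_self_apply,
          write_self_apply, if_neg (by omega), if_neg (by omega : ¬ (3 : ℤ) + 2 * l = 2 + 2 * u)]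
        rcases Nat.lt_succ_iff_lt_or_eq.1 hlu with h | rfl
        · rw [if_neg (by omega), if_neg (by omega)]
          exact hl l h
        · simp
  · rintro σ₃ hσ₃ ⟨hF, h0, h1, hl⟩
    have hn₃ : σ₃ vn 0 = n := by rw [hF _ (by decide), hn]
    have hN₃ : σ₃ vN 0 = N := by rw [hF _ (by decide), hN]
    have hm₃ : σ₃ vmid 0 = d := by rw [hF _ (by decide), hmid]
    refine ok_set_seq hσ₃ (hσ₃ _ _) fun hσ₄ => ok_set_seq hσ₄ (by simpa using h1x) fun hσ₅ => ?_
    set σ₅ := (σ₃.write aQ (Expr.val σ₃ (2 + 2 * (var vn * var vN))) (Expr.val σ₃ (var vmid))).write aQ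
      (Expr.val _ (3 + 2 * (var vn * var vN))) (Expr.val _ 1) with hσ₅def
    have hF₅ : Frame [vl, aQ, vans] σ σ₅ := (hF.write (by decide) _ _).write (by decide) _ _
    have hcell : ∀ z : ℤ, σ₅ aQ z = if z = 3 + 2 * (n * N) then 1 else
        if z = 2 + 2 * (n * N) then d else σ₃ aQ z := by
      intro z
      simp [hσ₅def, Mem.write, hn₃, hN₃, hm₃]
    clear_value σ₅
    have hlen : Expr.val σ₅ (4 + 2 * (var vn * var vN)) = 4 + 2 * (n * N) := by
      simp [hF₅ vn (by decide), hF₅ vN (by decide), hn, hN]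
    have hread : σ₅.read aQ (Expr.val σ₅ (4 + 2 * (var vn * var vN))).toNat =
        encodeGap (scaledBasis W h S hS) d := by
      rw [hlen, read_eq, show (4 + 2 * ((n : ℤ) * N)).toNat = 2 + n * (N * 2) + 2 by
        have : (4 + 2 * ((n : ℤ) * N)) = ((2 + n * (N * 2) + 2 : ℕ) : ℤ) := by push_cast; ring
        rw [this, Int.toNat_natCast]]
      have hlt : ∀ (i : Fin n) (j : Fin N), (i : ℕ) * N + j < n * N := by
        intro i j
        have h1 := j.2
        have h2 := i.2
        nlinarith
      have hltz : ∀ (i : Fin n) (j : Fin N), ((i : ℕ) : ℤ) * N + (j : ℕ) < n * N := fun i j => by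
        exact_mod_cast hlt i j
      have hrow : ∀ (i : Fin n) (j : Fin N), σ aW (((i : ℕ) : ℤ) * N + (j : ℕ)) = W i j :=
        fun i j => by rw [← hW i i.2, rowAt]
      have hnN0 : (0 : ℤ) ≤ n * N := by positivity
      symm
      apply encodeGap_eq
      · rw [hcell, if_neg (by push_cast; omega), if_neg (by push_cast; omega)]; exact h0
      · rw [hcell, if_neg (by push_cast; omega), if_neg (by push_cast; omega)]; exact h1
      · intro i j
        have h4 := (hl _ (hlt i j)).1
        have h5 := hltz i j
        push_cast at h4
        have h6 : ((2 + ((i : ℕ) * (N * 2) + (j : ℕ) * 2) : ℕ) : ℤ) =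
          2 + 2 * (((i : ℕ) : ℤ) * N + (j : ℕ)) := by push_cast; ring
        rw [h6, hcell, if_neg (by omega), if_neg (by omega), h4, hrow]
        simp only [scaledBasis, Rat.num_intCast]
      · intro i j
        have h4 := (hl _ (hlt i j)).2
        have h5 := hltz i j
        push_cast at h4
        have h6 : ((2 + ((i : ℕ) * (N * 2) + (j : ℕ) * 2 + 1) : ℕ) : ℤ) =
          3 + 2 * (((i : ℕ) : ℤ) * N + (j : ℕ)) := by push_cast; ring
        rw [h6, hcell, if_neg (by omega), if_neg (by omega), h4]
        simp only [scaledBasis, Rat.den_intCast, Nat.cast_one]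
      · have h6 : ((2 + n * (N * 2) : ℕ) : ℤ) = 2 + 2 * ((n : ℤ) * N) := by push_cast; ring
        rw [h6, hcell, if_neg (by omega), if_pos rfl, Rat.num_intCast]
      · have h6 : ((2 + n * (N * 2) + 1 : ℕ) : ℤ) = 3 + 2 * ((n : ℤ) * N) := by push_cast; ring
        rw [h6, hcell, if_pos rfl, Rat.den_intCast, Nat.cast_one]
    refine ok_ask hσ₅ (by omega) ?_ ?_ ?_
    · rw [hlen]
      exact_mod_cast hx
    · rw [hread]
      exact ⟨_, d, by exact_mod_cast hd, rfl⟩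
    · refine ⟨hF₅.write (by decide) _ _, ?_⟩
      rw [write_same, hread]

end

end SVPRed

namespace SVPRed

/-! ### The search for good digits -/

/-- The assumptions on the sizes under which the search is run in memories bounded by `2 ^ x`. -/
structure Setup {N : ℕ} (n k x s q : ℕ) (V : ℕ → Vec N) (S : ℤ) : Prop where
  n_pos : 0 < n
  indep : Indep n (embf V)
  n_le : n ≤ x
  N_le : N ≤ x
  nN_le : 4 + 2 * (n * N) ≤ x
  k_le : 2 * k + 3 ≤ x
  s_le : s ≤ x
  q_pos : 0 < q
  q_lt : q < 2 ^ x
  S_pos : 0 < S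
  entries : ∃ E : ℤ, 0 ≤ E ∧ (∀ i < n, ∀ j, |V i j| ≤ E) ∧ S * ((2 ^ (k + 1)) ^ n * E) < 2 ^ x

/-- The contents of the variables that do not change during the search. -/
structure Env {N : ℕ} (n k s q : ℕ) (V : ℕ → Vec N) (S : ℤ) (σ : Mem) : Prop where
  hvn : σ vn 0 = n
  hvN : σ vN 0 = N
  hvkk : σ vkk 0 = k
  hvs : σ vs 0 = s
  hvqq : σ vqq 0 = q
  hvS : σ vS 0 = S
  rows : ∀ i < n, rowAt N σ aV i = V i

abbrev envArrays : List ℕ := [vn, vN, vkk, vs, vqq, vS, aV]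

variable {N n k x s q : ℕ} {V : ℕ → Vec N} {S : ℤ} {σ σ' : Mem} {dig : ℤ → ℤ} {t : ℕ}
  {O : List ℤ → Bool}

theorem Env.congr {L : List ℕ} (h : Env n k s q V S σ) (hF : Frame L σ σ')
    (hL : ∀ a ∈ envArrays, a ∉ L) : Env n k s q V S σ' := by
  obtain ⟨h1, h2, h3, h4, h5, h6, h7⟩ := h
  constructor
  · rw [hF _ (hL _ (by decide)), h1]
  · rw [hF _ (hL _ (by decide)), h2]
  · rw [hF _ (hL _ (by decide)), h3]
  · rw [hF _ (hL _ (by decide)), h4]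
  · rw [hF _ (hL _ (by decide)), h5]
  · rw [hF _ (hL _ (by decide)), h6]
  · intro i hi
    rw [rowAt_congr (hF _ (hL _ (by decide))), h7 i hi]

/-- The stored digits are the given ones, except perhaps those between `t` and `t + s`. -/
def Agree (dig : ℤ → ℤ) (t s : ℕ) (σ : Mem) : Prop :=
  ∀ i : ℤ, (i < t ∨ t + s ≤ i) → σ aDig i = dig i

theorem setDigits_apply (c i : ℤ) : setDigits dig t c s i =
    if (t : ℤ) ≤ i ∧ i < t + s then c / 3 ^ (i - t).toNat % 3 else dig i := by
  induction s with
  | zero => rw [setDigits, if_neg (by push_cast; omega)]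
  | succ s ih =>
    rw [setDigits, Function.update_apply]
    split
    · next h =>
      subst h
      rw [if_pos (by push_cast; omega)]
      congr 3
      push_cast
      omega
    · next h =>
      rw [ih]
      push_cast at h ⊢
      split_ifs <;> first | rfl | omega

/-- A new code overwrites all traces of the previous one, so trial codes never have to be undone. -/
theorem setDigits_of_agree {dig' : ℤ → ℤ} (h : ∀ i : ℤ, (i < t ∨ t + s ≤ i) → dig' i = dig i) (c : ℤ) :
    setDigits dig' t c s = setDigits dig t c s := by
  funext i
  rw [setDigits_apply, setDigits_apply]
  split_ifs
  · rfl
  · exact h i (by omega)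

theorem setDigits_apply_other {i : ℤ} (c : ℤ) (h : i < t ∨ t + s ≤ i) :
    setDigits dig t c s i = dig i := by
  rw [setDigits_apply, if_neg (by omega)]

/-- The basis of the sublattice with the digits `c` after the position `t`. -/
def cand (n k : ℕ) (V : ℕ → Vec N) (dig : ℤ → ℤ) (t s : ℕ) (c : ℤ) : ℕ → Vec N :=
  build k V (setDigits dig t c s) (n - 1)

/-- Computes the basis of a sublattice. -/
def loadProg (c : Expr) : Program := .seq (decodeProg c) buildProg

abbrev loadArrays : List ℕ := vrem :: vdec :: aDig :: buildArrays

variable {G : List ℤ → Prop}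

theorem ok_loadProg (H : Setup n k x s q V S) (hσ : MemB x σ) (hE : Env n k s q V S σ)
    (ht : σ vt 0 = t) (hdig : Agree dig t s σ) {e : Expr} {c : ℤ} (hc : e.val σ = c)
    (hcx : |c| < 2 ^ x) :
    Ok O G x (loadProg e) σ fun σ' => Frame loadArrays σ σ' ∧ σ' aDig = setDigits dig t c s ∧
      ∀ i < n, rowAt N σ' aW i = cand n k V dig t s c i := by
  obtain ⟨E, hE0, hVE, hEx⟩ := H.entries
  have hx2 := H.k_le
  have hEx' : (2 ^ (k + 1)) ^ n * E < 2 ^ x := by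
    refine lt_of_le_of_lt ?_ hEx
    exact le_mul_of_one_le_left (by positivity) H.S_pos
  refine ok_seq (ok_decodeProg (s := s) hσ hc hcx ht hE.hvs rfl H.s_le (by omega)) ?_
  rintro σ₁ hσ₁ ⟨hF₁, hd₁⟩
  rw [setDigits_of_agree hdig] at hd₁
  have hE₁ := hE.congr hF₁ (by decide)
  refine (ok_buildProg hσ₁ H.n_pos hE₁.hvn hE₁.hvN hE₁.hvkk hd₁ H.k_le H.N_le H.n_le
    (by have := H.nN_le; omega) hE₁.rows hVE hEx' hE0).imp ?_
  rintro σ₂ - ⟨hF₂, hr₂⟩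
  exact ⟨(hF₁.mono (by decide)).trans (hF₂.mono (by decide)), by rw [hF₂ _ (by decide), hd₁], hr₂⟩

theorem Agree.of_eq {c : ℤ} (h : σ aDig = setDigits dig t c s) : Agree dig t s σ := fun i hi => by
  rw [h, setDigits_apply_other _ hi]

/-- Asks about one code. -/
def testProg : Program :=
  .seq (loadProg (var vcode)) <| .seq queryProg <|
    .ite (var vans) (.seq (.set vwit 0 (var vcode)) (.set vfnd 0 1)) .skip

abbrev testArrays : List ℕ := aQ :: vans :: vwit :: vfnd :: loadArrays

theorem Setup.abs_cand_lt (H : Setup n k x s q V S) (c : ℤ) : ∀ i < n, ∀ j,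
    |S * cand n k V dig t s c i j| < 2 ^ x := by
  obtain ⟨E, hE0, hVE, hEx⟩ := H.entries
  have hn := H.n_pos
  intro i hi j
  refine lt_of_le_of_lt ?_ hEx
  rw [abs_mul, abs_of_pos H.S_pos]
  refine mul_le_mul_of_nonneg_left ((abs_build_le hVE (by omega) i hi j).trans ?_) H.S_pos.le
  exact mul_le_mul_of_nonneg_right (pow_le_pow_right₀ (one_le_pow₀ (by norm_num)) (by omega)) hE0

theorem Setup.indep_cand (H : Setup n k x s q V S) (c : ℤ) : Indep n (embf (cand n k V dig t s c)) :=
  H.indep.build (by have := H.n_pos; omega)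

/-- Each answer is used only for the one-sided bound that it guarantees; in the gap either answer is
acceptable. -/
theorem ok_testProg {γ : ℕ → ℝ} (hO : IsGapSVPOracle γ O) (H : Setup n k x s q V S) (hσ : MemB x σ)
    (hE : Env n k s q V S σ) (ht : σ vt 0 = t) (hdig : Agree dig t s σ) {c mid : ℤ}
    (hc : σ vcode 0 = c) (hmid : σ vmid 0 = mid) (hmid0 : 0 < mid) :
    Ok O (IsQuery n N) x testProg σ fun σ' => Frame testArrays σ σ' ∧ Agree dig t s σ' ∧
      ((σ' vfnd 0 = 1 ∧ σ' vwit 0 = c ∧ S * √(minsq n (cand n k V dig t s c)) < γ n * mid) ∨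
        (σ' vfnd 0 = σ vfnd 0 ∧ σ' vwit 0 = σ vwit 0 ∧
          (mid : ℝ) ≤ S * √(minsq n (cand n k V dig t s c)))) := by
  have h1x : (1 : ℤ) < 2 ^ x := one_lt_pow₀ (by norm_num) (by have := H.k_le; omega)
  have hind := H.indep_cand (dig := dig) (t := t) c
  obtain ⟨hno, hyes⟩ := oracle_answer hO H.n_pos hind H.S_pos hmid0
  refine ok_seq (ok_loadProg H hσ hE ht hdig (by simpa using hc) (hc ▸ hσ _ _)) ?_
  rintro σ₁ hσ₁ ⟨hF₁, hd₁, hr₁⟩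
  have hE₁ := hE.congr hF₁ (by decide)
  refine ok_seq (ok_queryProg hσ₁ hE₁.hvn hE₁.hvN hE₁.hvS (by rw [hF₁ _ (by decide), hmid]) hmid0
    H.S_pos hind hr₁ H.nN_le (H.abs_cand_lt c)) ?_
  rintro σ₂ hσ₂ ⟨hF₂, ha₂⟩
  have hF₁₂ : Frame testArrays σ σ₂ := (hF₁.mono (by decide)).trans (hF₂.mono (by decide))
  have hA₂ : Agree dig t s σ₂ := Agree.of_eq (by rw [hF₂ _ (by decide), hd₁])
  have hc₂ : σ₂ vcode 0 = c := by rw [hF₂ _ (by decide), hF₁ _ (by decide), hc]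
  refine ok_ite hσ₂ (fun h => ?_) fun h => ?_
  · refine ok_set_seq hσ₂ (hσ₂ _ _) fun hσ₃ => ok_set hσ₃ (by simpa using h1x) ⟨?_, ?_, Or.inl ⟨?_, ?_, ?_⟩⟩
    · exact (hF₁₂.write (by decide) _ _).write (by decide) _ _
    · intro i hi
      rw [write_other _ _ _ (by decide), write_other _ _ _ (by decide), hA₂ i hi]
    · simp
    · simp [Mem.write, hc₂]
    · apply hyes
      by_contra hf
      rw [if_neg hf] at ha₂
      exact h (by simpa using ha₂)
  · refine ok_skip hσ₂ ⟨hF₁₂, hA₂, Or.inr ⟨?_, ?_, ?_⟩⟩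
    · rw [hF₂ _ (by decide), hF₁ _ (by decide)]
    · rw [hF₂ _ (by decide), hF₁ _ (by decide)]
    · apply hno
      by_contra hf
      rw [Bool.not_eq_false] at hf
      rw [if_pos hf] at ha₂
      rw [val_var, ha₂] at h
      exact one_ne_zero h

/-- One step of the binary search. -/
def roundProg : Program :=
  .seq (.set vmid 0 ((var vlo + var vhi) / 2)) <| .seq (.set vfnd 0 0) <|
    .seq (forTo vcode (var vqq) testProg) <|
    .ite (var vfnd) (.set vhi 0 (var vmid)) (.set vlo 0 (var vmid))

/-- The number `q` of rounds of the inner loop is not bounded by `x`, so the cost is spelled out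
instead of being taken from `Program.cst`. -/
def roundCst (x q : ℕ) : ℕ :=
  1 + (Program.set vmid 0 ((var vlo + var vhi) / 2)).cst x + (1 + (Program.set vfnd 0 0).cst x +
    (1 + forCst x vcode (var vqq) q (testProg.cst x) +
      (Program.ite (var vfnd) (.set vhi 0 (var vmid)) (.set vlo 0 (var vmid))).cst x))

abbrev roundArrays : List ℕ := vmid :: vcode :: vhi :: vlo :: testArrays

/-- The invariant of the binary search. -/
structure SearchInv (γ : ℝ) (n k q : ℕ) (V : ℕ → Vec N) (S : ℤ) (dig : ℤ → ℤ) (t s : ℕ)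
    (hi₀ lo hi w : ℤ) : Prop where
  lo_nonneg : 0 ≤ lo
  lo_lt : lo < hi
  hi_le : hi ≤ hi₀
  w_nonneg : 0 ≤ w
  w_lt : w < q
  below : ∀ c : ℕ, c < q → (lo : ℝ) ≤ S * √(minsq n (cand n k V dig t s c))
  above : hi = hi₀ ∨ S * √(minsq n (cand n k V dig t s w)) < γ * hi

/-- A yes for some code gives a witness below `γ * mid`, and `hi` is lowered; if all answers are no,
every candidate has minimum at least `mid`, and `lo` is raised. No consistency between the answers
for different thresholds is needed. -/
theorem run_roundProg {γ : ℕ → ℝ} (hO : IsGapSVPOracle γ O) (H : Setup n k x s q V S) (hσ : MemB x σ)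
    (hE : Env n k s q V S σ) (ht : σ vt 0 = t) (hdig : Agree dig t s σ) {hi₀ lo hi w : ℤ}
    (hlo : σ vlo 0 = lo) (hhi : σ vhi 0 = hi) (hw : σ vwit 0 = w) (hlt : lo + 1 < hi)
    (hI : SearchInv (γ n) n k q V S dig t s hi₀ lo hi w) :
    Run O (IsQuery n N) x roundProg σ (roundCst x q) fun σ' => Frame roundArrays σ σ' ∧
      Agree dig t s σ' ∧ ∃ lo' hi' w', σ' vlo 0 = lo' ∧ σ' vhi 0 = hi' ∧ σ' vwit 0 = w' ∧
        2 * (hi' - lo') ≤ hi - lo + 1 ∧ SearchInv (γ n) n k q V S dig t s hi₀ lo' hi' w' := by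
  have hlo0 := hI.lo_nonneg
  have hhix := hσ vhi 0
  rw [hhi, abs_lt] at hhix
  set mid := (lo + hi) / 2 with hmid
  refine run_seq (Q := fun σ' => Frame [vmid] σ σ' ∧ σ' vmid 0 = mid) (ok_set hσ ?_ ⟨?_, ?_⟩) ?_
  · simp only [val_div, val_add, val_var, hlo, hhi, val_ofNat]
    rw [abs_lt]
    constructor <;> omega
  · exact (Frame.refl _ _).write (by decide) _ _
  · simp [hlo, hhi, hmid]
  rintro σ₁ hσ₁ ⟨hF₁, hm₁⟩
  refine run_seq (Q := fun σ' => Frame [vmid, vfnd] σ σ' ∧ σ' vmid 0 = mid ∧ σ' vfnd 0 = 0)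
    (ok_set hσ₁ (by simp) ⟨?_, ?_, by simp⟩) ?_
  · exact (hF₁.mono (by decide)).write (by decide) _ _
  · simp [Mem.write, hm₁]
  rintro σ₂ hσ₂ ⟨hF₂, hm₂, hf₂⟩
  let I : ℕ → Mem → Prop := fun c σ' => Frame (vmid :: vcode :: testArrays) σ σ' ∧
      Agree dig t s σ' ∧ σ' vmid 0 = mid ∧
      ((σ' vfnd 0 = 0 ∧ σ' vwit 0 = w ∧
        ∀ c' : ℕ, c' < c → (mid : ℝ) ≤ S * √(minsq n (cand n k V dig t s c'))) ∨
      (σ' vfnd 0 = 1 ∧ 0 ≤ σ' vwit 0 ∧ σ' vwit 0 < q ∧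
        S * √(minsq n (cand n k V dig t s (σ' vwit 0))) < γ n * mid))
  have hI_write : ∀ c σ' z, I c σ' → I c (σ'.write vcode 0 z) := by
    rintro c σ' z ⟨h1, h2, h3, h4⟩
    refine ⟨h1.write (by decide) _ _, fun i hi => ?_, ?_, ?_⟩
    · rw [write_other _ _ _ (by decide), h2 i hi]
    · rw [write_other _ _ _ (by decide), h3]
    · rw [write_other _ _ _ (by decide), write_other _ _ _ (by decide)]
      exact h4
  refine run_seq (Q := I q) ?_ ?_
  · refine run_for I q H.q_lt hσ₂ ?_ ?_ ?_ fun σ' _ h _ => h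
    · refine hI_write _ _ _ ⟨hF₂.mono (by decide), fun i hi => ?_, hm₂, Or.inl ⟨hf₂, ?_, by simp⟩⟩
      · rw [hF₂ _ (by decide), hdig i hi]
      · rw [hF₂ _ (by decide), hw]
    · rintro c - σ' - - ⟨hF, -⟩
      exact (hE.congr hF (by decide)).hvqq
    · rintro c hc σ₃ hσ₃ hv ⟨hF₃, hA₃, hm₃, h₃⟩
      refine (ok_testProg hO H hσ₃ (hE.congr hF₃ (by decide)) (by rw [hF₃ _ (by decide), ht]) hA₃
        hv hm₃ (by omega)).imp ?_
      rintro σ₄ - ⟨hF₄, hA₄, h₄⟩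
      refine ⟨by rw [hF₄ _ (by decide), hv], hI_write _ _ _ ⟨hF₃.trans (hF₄.mono (by decide)), hA₄,
        by rw [hF₄ _ (by decide), hm₃], ?_⟩⟩
      rcases h₄ with ⟨h5, h6, h7⟩ | ⟨h5, h6, h7⟩
      · exact Or.inr ⟨h5, by omega, by omega, by rwa [h6]⟩
      rw [h5, h6]
      rcases h₃ with ⟨h8, h9, h10⟩ | h8
      · refine Or.inl ⟨h8, h9, fun c' hc' => ?_⟩
        rcases Nat.lt_succ_iff_lt_or_eq.1 hc' with h | rfl
        · exact h10 c' h
        · exact h7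
      · exact Or.inr h8
  rintro σ₃ hσ₃ ⟨hF₃, hA₃, hm₃, h₃⟩
  have hlo₃ : σ₃ vlo 0 = lo := by rw [hF₃ _ (by decide), hlo]
  have hhi₃ : σ₃ vhi 0 = hi := by rw [hF₃ _ (by decide), hhi]
  have hF₃' : Frame roundArrays σ σ₃ := hF₃.mono (by decide)
  refine ok_ite hσ₃ (fun h => ok_set hσ₃ (hσ₃ _ _) ?_) fun h => ok_set hσ₃ (hσ₃ _ _) ?_
  · rcases h₃ with ⟨h1, -⟩ | ⟨-, h1, h2, h3⟩
    · exact absurd h1 h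
    refine ⟨hF₃'.write (by decide) _ _, fun i hi => ?_, lo, mid, σ₃ vwit 0, by simp [Mem.write, hlo₃],
      by simp [Mem.write, hm₃], by simp [Mem.write], by omega, ?_⟩
    · rw [write_other _ _ _ (by decide), hA₃ i hi]
    · exact ⟨hI.lo_nonneg, by omega, by have := hI.hi_le; omega, h1, h2, hI.below, Or.inr h3⟩
  · rcases h₃ with ⟨-, h1, h2⟩ | ⟨h1, -⟩
    swap
    · rw [val_var, h1] at h
      exact absurd h one_ne_zero
    refine ⟨hF₃'.write (by decide) _ _, fun i hi => ?_, mid, hi, w, by simp [Mem.write, hm₃],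
      by simp [Mem.write, hhi₃], by simp [Mem.write, h1], by omega, ?_⟩
    · rw [write_other _ _ _ (by decide), hA₃ i hi]
    · exact ⟨by omega, by omega, hI.hi_le, hI.w_nonneg, hI.w_lt, h2, hI.above⟩

/-- Binary search for a code with a good sublattice. -/
def searchProg : Program :=
  .seq (.set vlo 0 0) <| .seq (.set vhi 0 (var vS * var vY + 2)) <| .seq (.set vwit 0 0) <|
    .loop ((1 : Expr).less (var vhi - var vlo)) roundProg

def searchCst (x q : ℕ) : ℕ :=
  1 + (Program.set vlo 0 0).cst x + (1 + (Program.set vhi 0 (var vS * var vY + 2)).cst x +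
    (1 + (Program.set vwit 0 0).cst x +
      (x + 1) * (1 + ((1 : Expr).less (var vhi - var vlo)).cst (x + 1) + roundCst x q)))

theorem run_searchProg {γ : ℕ → ℝ} (hO : IsGapSVPOracle γ O) (H : Setup n k x s q V S) (hσ : MemB x σ)
    (hE : Env n k s q V S σ) (ht : σ vt 0 = t) (hdig : Agree dig t s σ) {Y : ℕ} (hY : σ vY 0 = Y)
    (hYx : S * Y + 2 < 2 ^ x) :
    Run O (IsQuery n N) x searchProg σ (searchCst x q) fun σ' => Frame roundArrays σ σ' ∧
      Agree dig t s σ' ∧ ∃ lo w, σ' vwit 0 = w ∧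
        SearchInv (γ n) n k q V S dig t s (S * Y + 2) lo (lo + 1) w := by
  have hSY : 0 ≤ S * Y := mul_nonneg H.S_pos.le (by positivity)
  refine run_seq (Q := fun σ' => Frame [vlo] σ σ' ∧ σ' vlo 0 = 0) (ok_set hσ (by simp) ⟨?_, by simp⟩) ?_
  · exact (Frame.refl _ _).write (by decide) _ _
  rintro σ₁ hσ₁ ⟨hF₁, hl₁⟩
  have hval : Expr.val σ₁ (var vS * var vY + 2) = S * Y + 2 := by
    simp [hF₁ vS (by decide), hF₁ vY (by decide), hE.hvS, hY]
  refine run_seq (Q := fun σ' => Frame [vlo, vhi] σ σ' ∧ σ' vlo 0 = 0 ∧ σ' vhi 0 = S * Y + 2)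
    (ok_set hσ₁ ?_ ⟨?_, ?_, ?_⟩) ?_
  · rwa [hval, abs_of_nonneg (by omega)]
  · exact (hF₁.mono (by decide)).write (by decide) _ _
  · simp [Mem.write, hl₁]
  · rw [val_zero, write_same, hval]
  rintro σ₂ hσ₂ ⟨hF₂, hl₂, hh₂⟩
  refine run_seq (Q := fun σ' => Frame [vlo, vhi, vwit] σ σ' ∧ σ' vlo 0 = 0 ∧ σ' vhi 0 = S * Y + 2 ∧
    σ' vwit 0 = 0) (ok_set hσ₂ (by simp) ⟨?_, ?_, ?_, by simp⟩) ?_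
  · exact (hF₂.mono (by decide)).write (by decide) _ _
  · simp [Mem.write, hl₂]
  · simp [Mem.write, hh₂]
  rintro σ₃ hσ₃ ⟨hF₃, hl₃, hh₃, hw₃⟩
  -- The interval has length at most `2 ^ j` when `j` rounds remain; since its initial length is
  -- below `2 ^ x`, `x` rounds suffice.
  refine run_loop (fun j σ' => Frame roundArrays σ σ' ∧ Agree dig t s σ' ∧ ∃ lo hi w, σ' vlo 0 = lo ∧
    σ' vhi 0 = hi ∧ σ' vwit 0 = w ∧ hi - lo ≤ 2 ^ j ∧
      SearchInv (γ n) n k q V S dig t s (S * Y + 2) lo hi w) x ?_ ?_ hσ₃ ?_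
  · rintro j - σ₄ hσ₄ ⟨hF₄, hA₄, lo, hi, w, h1, h2, h3, h4, hI⟩ hne
    have hlt : lo + 1 < hi := by
      by_contra hc
      apply hne
      simp only [val_less, val_one, val_sub, val_var, h1, h2]
      rw [if_neg (by omega)]
    obtain ⟨j, rfl⟩ : ∃ i, j = i + 1 := Nat.exists_eq_succ_of_ne_zero (by
      rintro rfl
      simp at h4
      omega)
    refine ⟨j, rfl, (run_roundProg hO H hσ₄ (hE.congr hF₄ (by decide)) (by rw [hF₄ _ (by decide), ht])
      hA₄ h1 h2 h3 hlt hI).mono le_rfl le_rfl ?_⟩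
    rintro σ₅ - ⟨hF₅, hA₅, lo', hi', w', e1, e2, e3, e4, e5⟩
    refine ⟨hF₄.trans hF₅, hA₅, lo', hi', w', e1, e2, e3, ?_, e5⟩
    rw [pow_succ] at h4
    omega
  · rintro j - σ₄ hσ₄ ⟨hF₄, hA₄, lo, hi, w, h1, h2, h3, h4, hI⟩ he
    have hlt : ¬lo + 1 < hi := by
      intro hc
      simp only [val_less, val_one, val_sub, val_var, h1, h2] at he
      rw [if_pos (by omega)] at he
      exact one_ne_zero he
    obtain rfl : hi = lo + 1 := by
      have := hI.lo_lt
      omega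
    exact ⟨hF₄, hA₄, lo, w, h3, hI⟩
  · refine ⟨hF₃.mono (by decide), fun i hi => by rw [hF₃ _ (by decide), hdig i hi], 0, S * Y + 2, 0, hl₃,
      hh₃, hw₃, by omega, le_rfl, by omega, le_rfl, le_rfl, by exact_mod_cast H.q_pos, fun c _ => ?_,
      Or.inl rfl⟩
    have : (0 : ℝ) < S := by exact_mod_cast H.S_pos
    rw [Int.cast_zero]
    positivity

/-- What is gained by one search. -/
theorem SearchInv.loss {γ : ℝ} (hγ : 1 ≤ γ) {Y : ℕ} {lo w : ℤ} (hY : 0 < Y) (hn : 0 < n)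
    (hV : Indep n (embf V)) (hq : q = 3 ^ s)
    (h : SearchInv γ n k q V (16 * Y) dig t s (16 * Y * Y + 2) lo (lo + 1) w)
    (hts : t + s ≤ (n - 1) * k) (hdig : ∀ i : ℕ, t ≤ i → i < (n - 1) * k → dig i = 3) :
    √((min (minsq n (cand n k V dig t s w)) Y : ℕ) : ℝ) ≤
      γ ^ 2 * √((min (minsq n (build k V dig (n - 1))) Y : ℕ) : ℝ) := by
  have hprev : Indep n (embf (build k V dig (n - 1))) := hV.build (by omega)
  obtain ⟨v, hv, hv0, hvm⟩ := exists_minsq hn hprev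
  -- Some candidate still contains a shortest vector of the current sublattice; so `lo`, a lower
  -- bound for all candidates, is also one for the current minimum.
  obtain ⟨c, hc, hvc⟩ := exists_digits (by omega) hts hdig hv
  have hcm : minsq n (cand n k V dig t s c) ≤ minsq n (build k V dig (n - 1)) := by
    have := minsq_le hvc hv0
    rw [hvm] at this
    exact_mod_cast this
  have h1 := one_le_minsq hn hprev
  set a := minsq n (build k V dig (n - 1))
  set b := minsq n (cand n k V dig t s w)
  have hlo := h.below c (by rw [hq]; exact hc)
  have hY' : (1 : ℝ) ≤ Y := by exact_mod_cast hY
  have hca : √(minsq n (cand n k V dig t s c) : ℝ) ≤ √(a : ℝ) := Real.sqrt_le_sqrt (by exact_mod_cast hcm)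
  have hlo' : (lo : ℝ) ≤ 16 * Y * √(a : ℝ) := by
    refine hlo.trans ?_
    push_cast
    exact mul_le_mul_of_nonneg_left hca (by positivity)
  have hg : 1 ≤ γ ^ 2 := one_le_pow₀ hγ
  -- If the current minimum already reaches the cap `Y`, the cap alone gives the claim.
  by_cases haY : Y ≤ a
  · rw [min_eq_right haY]
    refine le_trans ?_ (le_mul_of_one_le_left (Real.sqrt_nonneg _) hg)
    exact Real.sqrt_le_sqrt (by exact_mod_cast min_le_right _ _)
  · rw [not_le] at haY
    rw [min_eq_left haY.le]
    refine (Real.sqrt_le_sqrt (by exact_mod_cast min_le_left b Y : ((min b Y : ℕ) : ℝ) ≤ b)).trans ?_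
    refine sqrt_le_of_search hγ h1 haY ?_
    rcases h.above with h2 | h2
    -- If the upper end never moved, the scaled minimum would be at least `16 * Y * Y + 1`, although
    -- `√a ≤ Y`. The summand `2` in the initial upper end is what makes this a contradiction.
    · exfalso
      have h3 : (lo : ℝ) = 16 * Y * Y + 1 := by
        have : lo = 16 * Y * Y + 1 := by linarith
        exact_mod_cast this
      have h4 : √(a : ℝ) ≤ Y := by
        rw [Real.sqrt_le_left (by positivity)]
        have : (a : ℝ) < Y := by exact_mod_cast haY
        nlinarith
      have := mul_le_mul_of_nonneg_left h4 (show (0 : ℝ) ≤ 16 * Y by positivity)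
      linarith
    · push_cast at h2
      refine h2.trans_le (mul_le_mul_of_nonneg_left (by linarith) (by linarith))

end SVPRed

/-! ### All batches of digits, and the exhaustive search over the last one. -/

namespace SVPRed

notation "vbn" => (42 : ℕ)
notation "aBest" => (43 : ℕ)

variable {N n k x s q : ℕ} {V : ℕ → Vec N} {S : ℤ} {σ σ' : Mem} {dig : ℤ → ℤ} {t : ℕ}
  {O : List ℤ → Bool} {G : List ℤ → Prop}

/-- Determines the next `vs` digits. -/
def batchProg : Program :=
  .seq searchProg <| .seq (decodeProg (var vwit)) (.set vt 0 (var vt + var vs))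

def batchCst (x q : ℕ) : ℕ :=
  1 + searchCst x q + (Program.seq (decodeProg (var vwit)) (.set vt 0 (var vt + var vs))).cst x

abbrev batchArrays : List ℕ := vt :: roundArrays

theorem run_batchProg {γ : ℕ → ℝ} (hO : IsGapSVPOracle γ O) (H : Setup n k x s q V S) (hσ : MemB x σ)
    (hE : Env n k s q V S σ) (ht : σ vt 0 = t) (hdig : σ aDig = dig) {Y : ℕ} (hY : σ vY 0 = Y)
    (hYx : S * Y + 2 < 2 ^ x) (htx : t + s ≤ x) :
    Run O (IsQuery n N) x batchProg σ (batchCst x q) fun σ' => Frame batchArrays σ σ' ∧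
      σ' vt 0 = (t + s : ℕ) ∧ ∃ lo w, SearchInv (γ n) n k q V S dig t s (S * Y + 2) lo (lo + 1) w ∧
        σ' aDig = setDigits dig t w s := by
  refine run_seq (run_searchProg hO H hσ hE ht (fun i _ => by rw [hdig]) hY hYx) ?_
  rintro σ₁ hσ₁ ⟨hF₁, hA₁, lo, w, hw, hI⟩
  have hE₁ := hE.congr hF₁ (by decide)
  have ht₁ : σ₁ vt 0 = t := by rw [hF₁ _ (by decide), ht]
  refine ok_seq (ok_decodeProg (s := s) hσ₁ (z := w) (by simpa using hw) (hw ▸ hσ₁ _ _)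
    ht₁ hE₁.hvs rfl H.s_le (by have := H.k_le; omega)) ?_
  rintro σ₂ hσ₂ ⟨hF₂, hd₂⟩
  rw [setDigits_of_agree hA₁] at hd₂
  have hval : Expr.val σ₂ (var vt + var vs) = (t + s : ℕ) := by
    simp [hF₂ vt (by decide), hF₂ vs (by decide), ht₁, hE₁.hvs]
  refine ok_set hσ₂ ?_ ⟨?_, ?_, lo, w, hI, ?_⟩
  · rw [hval, Nat.abs_cast]
    exact_mod_cast lt_of_le_of_lt htx Nat.lt_two_pow_self
  · exact ((hF₁.mono (by decide)).trans (hF₂.mono (by decide))).write (by decide) _ _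
  · rw [val_zero, write_same, hval]
  · rw [write_other _ _ _ (by decide), hd₂]

/-- Determines the digits, except for the last ones. -/
def batchesProg : Program :=
  .seq (.set vt 0 0) <| .loop ((var vt + var vs).less (var vK)) batchProg

def batchesCst (x q : ℕ) : ℕ :=
  1 + (Program.set vt 0 0).cst x +
    (x + 1) * (1 + ((var vt + var vs).less (var vK)).cst (x + 1) + batchCst x q)

theorem minsq_congr {W W' : ℕ → Vec N} (h : ∀ v, v ∈ Lat n W ↔ v ∈ Lat n W') :
    minsq n W = minsq n W' := by
  simp only [minsq, h]

/-- The loop stops as soon as at most `s` digits are missing, since these can be tried exhaustively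
without loss. Hence `e = 0` or `e * s < (n - 1) * k`, and the oracle is not called at all if one
batch suffices. -/
theorem run_batchesProg {γ : ℕ → ℝ} (hγ : 1 ≤ γ n) (hO : IsGapSVPOracle γ O) {Y : ℕ}
    (H : Setup n k x s q V (16 * Y)) (hσ : MemB x σ) (hE : Env n k s q V (16 * Y) σ) (hY : σ vY 0 = Y)
    (hYx : 16 * Y * Y + 2 < (2 : ℤ) ^ x) (hK : σ vK 0 = ((n - 1) * k : ℕ)) (hKx : (n - 1) * k ≤ x)
    (hs : 0 < s) (hq : q = 3 ^ s) (hY0 : 0 < Y)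
    (hdig : ∀ i : ℕ, i < (n - 1) * k → σ aDig i = 3) :
    Run O (IsQuery n N) x batchesProg σ (batchesCst x q) fun σ' => Frame batchArrays σ σ' ∧
      ∃ (e : ℕ) (dig : ℤ → ℤ), σ' vt 0 = (e * s : ℕ) ∧ σ' aDig = dig ∧
        (n - 1) * k ≤ e * s + s ∧ (e = 0 ∨ e * s < (n - 1) * k) ∧
        (∀ i : ℕ, i < e * s → 0 ≤ dig i ∧ dig i < 3) ∧
        (∀ i : ℕ, e * s ≤ i → i < (n - 1) * k → dig i = 3) ∧
        √((min (minsq n (build k V dig (n - 1))) Y : ℕ) : ℝ) ≤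
          γ n ^ (2 * e) * √((min (minsq n V) Y : ℕ) : ℝ) := by
  have hn := H.n_pos
  refine run_seq (Q := fun σ' => Frame batchArrays σ σ' ∧ σ' vt 0 = 0 ∧ σ' aDig = σ aDig)
    (ok_set hσ (by simp) ⟨?_, by simp, write_other _ _ _ (by decide)⟩) ?_
  · exact (Frame.refl _ _).write (by decide) _ _
  rintro σ₁ hσ₁ ⟨hF₁, ht₁, hd₁⟩
  refine (run_loop (fun j σ' => Frame batchArrays σ σ' ∧
      ∃ (e : ℕ) (dig : ℤ → ℤ), σ' vt 0 = (e * s : ℕ) ∧ σ' aDig = dig ∧ (n - 1) * k ≤ e * s + s + j ∧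
        (e = 0 ∨ e * s < (n - 1) * k) ∧
        (∀ i : ℕ, i < e * s → 0 ≤ dig i ∧ dig i < 3) ∧
        (∀ i : ℕ, e * s ≤ i → i < (n - 1) * k → dig i = 3) ∧
        √((min (minsq n (build k V dig (n - 1))) Y : ℕ) : ℝ) ≤
          γ n ^ (2 * e) * √((min (minsq n V) Y : ℕ) : ℝ)) x ?_ ?_ hσ₁ ?_)
  · rintro j - σ₂ hσ₂ ⟨hF₂, e, dig, h1, h2, h3, h4, h5, h6, h7⟩ hne
    have hlt : e * s + s < (n - 1) * k := by
      by_contra hc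
      apply hne
      simp only [val_less, val_add, val_var, h1, hF₂ vs (by decide), hE.hvs, hF₂ vK (by decide), hK]
      rw [if_neg (by exact_mod_cast hc)]
    obtain ⟨j, rfl⟩ : ∃ i, j = i + 1 := Nat.exists_eq_succ_of_ne_zero (by omega)
    refine ⟨j, rfl, (run_batchProg hO H hσ₂ (hE.congr hF₂ (by decide)) h1 h2
      (by rw [hF₂ _ (by decide), hY]) hYx (by omega)).mono le_rfl le_rfl ?_⟩
    rintro σ₃ - ⟨hF₃, ht₃, lo, w, hI, hd₃⟩
    have hes : (e + 1) * s = e * s + s := by ring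
    refine ⟨hF₂.trans hF₃, e + 1, setDigits dig (e * s) w s, ?_, hd₃, by omega, Or.inr (by omega),
      fun i hi => ?_, fun i hi hi' => ?_, ?_⟩
    · rw [ht₃, hes]
    · rcases Nat.lt_or_ge i (e * s) with h | h
      · rw [setDigits_other _ (Or.inl h)]
        exact h5 i h
      · exact setDigits_mem _ h (by omega)
    · rw [setDigits_other _ (Or.inr (by omega))]
      exact h6 i (by omega) hi'
    · refine (hI.loss hγ hY0 hn H.indep hq hlt.le h6).trans ?_
      refine (mul_le_mul_of_nonneg_left h7 (by positivity)).trans (le_of_eq ?_)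
      ring
  · rintro j - σ₂ hσ₂ ⟨hF₂, e, dig, h1, h2, h3, h4, h5⟩ he
    have hlt : ¬e * s + s < (n - 1) * k := by
      intro hc
      simp only [val_less, val_add, val_var, h1, hF₂ vs (by decide), hE.hvs, hF₂ vK (by decide),
        hK] at he
      rw [if_pos (by exact_mod_cast hc)] at he
      exact one_ne_zero he
    exact ⟨hF₂, e, dig, h1, h2, by omega, h4, h5⟩
  · refine ⟨hF₁, 0, σ aDig, by simpa using ht₁, hd₁, by omega, Or.inl rfl, by simp,
      fun i _ hi => hdig i hi, ?_⟩
    rw [minsq_congr fun v => mem_Lat_build_of_three (by omega) hdig]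
    simp

/-- Compares the first vector of a sublattice with the best one so far. -/
def compareProg : Program :=
  .seq (loadProg (var vcode)) <| .seq (dotTo vacc (elt aW 0) (elt aW 0)) <|
    .ite ((var vacc).less (var vbn)) (.seq (.set vbn 0 (var vacc)) (rowTo aBest 0 (elt aW 0))) .skip

abbrev compareArrays : List ℕ := vacc :: vbn :: aBest :: loadArrays

/-- The best of the vectors that belong to the first `q` codes, and of the first basis vector. -/
def finalProg : Program :=
  .seq (.set vbn 0 (var vY)) <| .seq (rowTo aBest 0 (elt aV 0)) <| forTo vcode (var vqq) compareProg

def finalCst (x q : ℕ) : ℕ :=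
  1 + (Program.set vbn 0 (var vY)).cst x + (1 + (rowTo aBest 0 (elt aV 0)).cst x +
    forCst x vcode (var vqq) q (compareProg.cst x))

/-- The search for the best vector starts with `V 0`, so the result also respects the cap `Y`. -/
theorem run_finalProg (H : Setup n k x s q V S) (hσ : MemB x σ)
    (hE : Env n k s q V S σ) (ht : σ vt 0 = t) (hdig : σ aDig = dig) {Y : ℕ} (hY : σ vY 0 = Y)
    (hVY : V 0 ⬝ᵥ V 0 = Y)
    (hdot : ∃ E : ℤ, (∀ i < n, ∀ j, |V i j| ≤ E) ∧ N * (((2 ^ (k + 1)) ^ n * E) ^ 2) < 2 ^ x) :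
    Run O G x finalProg σ (finalCst x q) fun σ' => Frame (vcode :: compareArrays) σ σ' ∧
      ∃ u : Vec N, rowAt N σ' aBest 0 = u ∧ u ∈ Lat n V ∧ u ≠ 0 ∧ u ⬝ᵥ u ≤ Y ∧
        ∀ c : ℕ, c < q → u ⬝ᵥ u ≤ cand n k V dig t s c 0 ⬝ᵥ cand n k V dig t s c 0 := by
  have hn := H.n_pos
  obtain ⟨E, hVE, hEx⟩ := hdot
  refine run_seq (Q := fun σ' => Frame [vbn] σ σ' ∧ σ' vbn 0 = Y) (ok_set hσ (hσ _ _) ⟨?_, ?_⟩) ?_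
  · exact (Frame.refl _ _).write (by decide) _ _
  · simp [hY]
  rintro σ₁ hσ₁ ⟨hF₁, hb₁⟩
  have hE₁ := hE.congr hF₁ (by decide)
  refine run_seq (Q := fun σ' => Frame [vbn, vj, aBest] σ σ' ∧ σ' vbn 0 = Y ∧ rowAt N σ' aBest 0 = V 0)
    ?_ ?_
  · refine ok_row 0 (V 0) (by decide) (by decide) H.N_le hσ₁ hE₁.hvN ?_ ?_ ?_
    · intro l σ' hF hl _ _
      refine ⟨by simp, ?_⟩
      rw [val_elt (r := 0) (by simp) (by rw [hF _ (by decide), hE₁.hvN]) hl,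
        rowAt_congr (hF _ (by decide)), hE₁.rows _ hn]
    · intro l
      rw [← hE₁.rows 0 hn]
      exact hσ₁ _ _
    · rintro σ' - hF h -
      exact ⟨(hF₁.mono (by decide)).trans (hF.mono (by decide)), by rw [hF _ (by decide), hb₁], h⟩
  rintro σ₂ hσ₂ ⟨hF₂, hb₂, hr₂⟩
  refine run_for (fun c σ' => Frame (vcode :: compareArrays) σ σ' ∧ Agree dig t s σ' ∧
    ∃ u : Vec N, rowAt N σ' aBest 0 = u ∧ σ' vbn 0 = u ⬝ᵥ u ∧ u ∈ Lat n V ∧ u ≠ 0 ∧ u ⬝ᵥ u ≤ Y ∧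
        ∀ c' : ℕ, c' < c → u ⬝ᵥ u ≤ cand n k V dig t s c' 0 ⬝ᵥ cand n k V dig t s c' 0)
    q H.q_lt hσ₂ ?_ ?_ ?_ ?_
  · refine ⟨(hF₂.mono (by decide)).write (by decide) _ _, fun i hi => ?_, V 0, ?_, ?_,
      mem_below hn, H.indep.ne_zero hn, hVY.le, by simp⟩
    · rw [write_other _ _ _ (by decide), hF₂ _ (by decide), hdig]
    · rw [rowAt_write _ _ _ _ _ (by decide), hr₂]
    · rw [write_other _ _ _ (by decide), hb₂, hVY]
  · rintro c - σ' - - ⟨hF, -⟩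
    exact (hE.congr hF (by decide)).hvqq
  · rintro c hc σ₃ hσ₃ hv ⟨hF₃, hA₃, u, hu₃, hb₃, hu1, hu2, hu3, hu4⟩
    refine ok_seq (ok_loadProg H hσ₃ (hE.congr hF₃ (by decide)) (by rw [hF₃ _ (by decide), ht]) hA₃
      (by simpa using hv) (hv ▸ hσ₃ _ _)) ?_
    rintro σ₄ hσ₄ ⟨hF₄, hd₄, hr₄⟩
    have hF₄' : Frame (vcode :: compareArrays) σ σ₄ := hF₃.trans (hF₄.mono (by decide))
    have hE₄ := hE.congr hF₄' (by decide)
    have hA₄ : Agree dig t s σ₄ := .of_eq hd₄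
    set w := cand n k V dig t s c with hw
    have hw0 : ∀ j, |w 0 j| ≤ (2 ^ (k + 1)) ^ n * E := fun j => by
      refine (abs_build_le hVE (by omega) 0 hn j).trans ?_
      refine mul_le_mul_of_nonneg_right (pow_le_pow_right₀ (one_le_pow₀ (by norm_num)) (by omega)) ?_
      exact (abs_nonneg _).trans (hVE 0 hn j)
    refine ok_seq (Q := fun σ' => Frame [vj, vacc] σ₄ σ' ∧ σ' vacc 0 = w 0 ⬝ᵥ w 0) ?_ ?_
    · refine ok_dot (w 0) (w 0) (by decide) (by decide) H.N_le hσ₄ hE₄.hvN ?_ hw0 hw0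
        (by rw [← pow_two]; exact hEx) fun σ' _ hF h => ⟨hF, h⟩
      intro l σ' hF hl
      have : (elt aW 0).val σ' = w 0 l := by
        rw [val_elt (r := 0) (by simp) (by rw [hF _ (by decide), hE₄.hvN]) hl,
          rowAt_congr (hF _ (by decide)), hr₄ 0 hn]
      exact ⟨this, this⟩
    rintro σ₅ hσ₅ ⟨hF₅, ha₅⟩
    have hF₅' : Frame (vcode :: compareArrays) σ σ₅ := hF₄'.trans (hF₅.mono (by decide))
    have hE₅ := hE.congr hF₅' (by decide)
    have hA₅ : Agree dig t s σ₅ := fun i hi => by rw [hF₅ _ (by decide), hA₄ i hi]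
    have hb₅ : σ₅ vbn 0 = u ⬝ᵥ u := by rw [hF₅ _ (by decide), hF₄ _ (by decide), hb₃]
    have hv₅ : σ₅ vcode 0 = c := by rw [hF₅ _ (by decide), hF₄ _ (by decide), hv]
    refine ok_ite hσ₅ (fun h => ?_) fun h => ?_
    · have hlt : w 0 ⬝ᵥ w 0 < u ⬝ᵥ u := by
        by_contra hc
        apply h
        rw [val_less, val_var, val_var, ha₅, hb₅, if_neg hc]
      refine ok_seq (Q := fun σ' => Frame [vbn] σ₅ σ' ∧ σ' vbn 0 = w 0 ⬝ᵥ w 0)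
        (ok_set hσ₅ (hσ₅ _ _) ⟨(Frame.refl _ _).write (by decide) _ _, by simp [ha₅]⟩) ?_
      rintro σ₆ hσ₆ ⟨hF₆, hb₆⟩
      have hrow : rowAt N σ₆ aW 0 = w 0 := by
        rw [rowAt_congr (hF₆ _ (by decide)), rowAt_congr (hF₅ _ (by decide)), hr₄ 0 hn]
      have hN₆ : σ₆ vN 0 = N := by rw [hF₆ _ (by decide), hE₅.hvN]
      refine ok_row 0 (w 0) (by decide) (by decide) H.N_le hσ₆ hN₆ ?_ ?_ ?_
      · intro l σ' hF hl _ _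
        refine ⟨by simp, ?_⟩
        rw [val_elt (r := 0) (by simp) (by rw [hF _ (by decide), hN₆]) hl,
          rowAt_congr (hF _ (by decide)), hrow]
      · intro l
        rw [← hrow]
        exact hσ₆ _ _
      · rintro σ' - hF hr -
        refine ⟨by rw [hF _ (by decide), hF₆ _ (by decide), hv₅], ?_, fun i hi => ?_, w 0, ?_, ?_, ?_, ?_,
          by omega, fun c' hc' => ?_⟩
        · exact (hF₅'.trans ((hF₆.mono (by decide)).trans (hF.mono (by decide)))).write (by decide) _ _
        · rw [write_other _ _ _ (by decide), hF _ (by decide), hF₆ _ (by decide), hA₅ i hi]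
        · rw [rowAt_write _ _ _ _ _ (by decide), hr]
        · rw [write_other _ _ _ (by decide), hF _ (by decide), hb₆]
        · exact Lat_build_le (by omega) (mem_below hn)
        · exact (H.indep_cand _).ne_zero hn
        · rcases Nat.lt_succ_iff_lt_or_eq.1 hc' with h | rfl
          · exact hlt.le.trans (hu4 c' h)
          · exact le_rfl
    · have hle : u ⬝ᵥ u ≤ w 0 ⬝ᵥ w 0 := by
        by_contra hc
        rw [val_less, val_var, val_var, ha₅, hb₅, if_pos (not_le.1 hc)] at h
        exact one_ne_zero h
      refine ok_skip hσ₅ ⟨hv₅, hF₅'.write (by decide) _ _, fun i hi => ?_, u, ?_, ?_, hu1, hu2, hu3,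
        fun c' hc' => ?_⟩
      · rw [write_other _ _ _ (by decide), hA₅ i hi]
      · rw [rowAt_write _ _ _ _ _ (by decide), rowAt_congr (hF₅ _ (by decide)),
          rowAt_congr (hF₄ _ (by decide)), hu₃]
      · rw [write_other _ _ _ (by decide), hb₅]
      · rcases Nat.lt_succ_iff_lt_or_eq.1 hc' with h | rfl
        · exact hu4 c' h
        · exact hle
  · rintro σ' - ⟨hF, -, u, h1, -, h2⟩ -
    exact ⟨hF, u, h1, h2⟩

/-- The vector that is found in the end is at least as short as all vectors of the sublattice. -/
theorem le_min_of_final {Y : ℕ} (hn : 0 < n) (hV : Indep n (embf V)) (hred : Reduced n (embf V))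
    (hk : k = 4 * n + 3) (hVY : V 0 ⬝ᵥ V 0 = Y) {m : ℕ} (hm : m ≤ Y)
    (h1 : ∀ i : ℕ, i < t → 0 ≤ dig i ∧ dig i < 3) (ht : t ≤ (n - 1) * k) (hts : (n - 1) * k ≤ t + s)
    (h3 : ∀ i : ℕ, t ≤ i → i < (n - 1) * k → dig i = 3)
    (hc : ∀ c : ℕ, c < 3 ^ s → (m : ℤ) ≤ cand n k V dig t s c 0 ⬝ᵥ cand n k V dig t s c 0) :
    m ≤ min (minsq n (build k V dig (n - 1))) Y := by
  refine le_min ?_ hm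
  by_contra hlt
  rw [not_le] at hlt
  obtain ⟨v, hv, hv0, hvm⟩ := exists_minsq hn (hV.build (k := k) (dig := dig) (by omega : n - 1 < n))
  have hvV := Lat_build_le (by omega) hv
  obtain ⟨x, hx⟩ := mem_Lat.1 hvV
  obtain ⟨s', hs'⟩ := Nat.exists_eq_add_of_le ht
  obtain ⟨c, hc3, hvc⟩ := exists_digits (t := t) (s := s') (by omega) hs'.ge h3 hv
  -- Fewer than `s` digits may be missing; surplus digits are stored beyond the position `(n - 1) *
  -- k` and are never read.
  have heq : build k V (setDigits dig t c s') (n - 1) = cand n k V dig t s c := by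
    refine build_congr fun i hi => ?_
    rw [setDigits_apply, setDigits_apply]
    split_ifs <;> first | rfl | omega
  rw [heq] at hvc
  -- A vector shorter than the output is not longer than `V 0`, which is where the cap `Y` enters;
  -- so its coordinates are at most `4 ^ n`.
  have hnorm : ‖∑ i ∈ Finset.range n, (x i : ℝ) • embf V i‖ ≤ ‖embf V 0‖ := by
    have : ∑ i ∈ Finset.range n, (x i : ℝ) • embf V i = emb v := by
      rw [hx, map_sum]
      exact Finset.sum_congr rfl fun i _ => (emb_smul _ _).symm
    rw [this, embf, norm_emb, norm_emb]
    refine Real.sqrt_le_sqrt ?_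
    rw [hvm, hVY]
    exact_mod_cast hlt.le.trans hm
  have hR : ∀ i < n, |x i| ≤ 4 ^ n := by
    intro i hi
    have := hred.abs_coeff_le hV hnorm hi
    exact_mod_cast this
  rw [hx, cand] at hvc
  -- The value `k = 4 * n + 3` is the smallest with `4 * (4 ^ n) ^ 2 < 2 ^ k`.
  obtain ⟨α, hα⟩ := mem_span_of_mem_build (R := 4 ^ n) hn hV (by
      rw [hk, show (4 : ℤ) = 2 ^ 2 by norm_num, ← pow_mul, ← pow_mul, ← pow_add]
      exact pow_lt_pow_right₀ (by norm_num) (by omega))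
    (fun i hi => by
      rcases Nat.lt_or_ge i t with h | h
      · rw [setDigits_other _ (Or.inl h)]
        exact h1 i h
      · exact setDigits_mem _ h (by omega)) hR hvc
  rw [← hx] at hα
  have hc' := hc c (hc3.trans_le (Nat.pow_le_pow_right (by norm_num) (by omega)))
  rw [cand] at hc'
  set w := build k V (setDigits dig t c s) (n - 1) 0
  have hα0 : α ≠ 0 := by
    rintro rfl
    rw [zero_smul] at hα
    exact hv0 hα
  have hvw : v ⬝ᵥ v = α ^ 2 * (w ⬝ᵥ w) := by
    rw [hα, smul_dotProduct, dotProduct_smul, smul_eq_mul, smul_eq_mul]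
    ring
  have h1α : 1 ≤ α ^ 2 := by
    have := Int.one_le_abs hα0
    rw [← sq_abs]
    nlinarith
  have := mul_le_mul_of_nonneg_right h1α (dot_self_nonneg w)
  omega

end SVPRed

namespace SVPRed

/-! ### The choice of the parameters -/

notation "vu" => (44 : ℕ)

variable {N n x y : ℕ} {σ : Mem} {O : List ℤ → Bool} {G : List ℤ → Prop}

/-- All cells but the first one of array `0` are bounded. -/
def MemB' (x : ℕ) (σ : Mem) : Prop := ∀ a i, (a = 0 ∧ i = 0) ∨ |σ a i| < 2 ^ x

theorem MemB'.write (h : MemB' x σ) (a : ℕ) (i : ℤ) {z : ℤ} (hz : |z| < 2 ^ x) :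
    MemB' x (σ.write a i z) := by
  intro a' i'
  by_cases hc : a' = a ∧ i' = i
  · right
    simpa [Mem.write, hc] using hz
  · simpa [Mem.write, hc] using h a' i'

theorem MemB'.memB (h : MemB' x σ) : MemB x (σ.write aIn 0 0) := by
  intro a i
  by_cases hc : a = 0 ∧ i = 0
  · simp [Mem.write, hc]
  · have := h a i
    simpa [Mem.write, hc] using this

def paramStep : Program :=
  .ite ((Expr.get aIn 0).less (3 * var vqq)) .skip
    (.seq (.set vs 0 (var vs + 1)) (.set vqq 0 (3 * var vqq)))

/-- Computes the number of digits that are determined at a time. -/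
def paramProg : Program :=
  .seq (.set vn 0 (.get aIn 1)) <| .seq (.set vN 0 (.get aIn 2)) <|
    .seq (.set vkk 0 (4 * var vn + 3)) <| .seq (.set vK 0 ((var vn - 1) * var vkk)) <|
    .seq (.set vs 0 0) <| .seq (.set vqq 0 1) <| .seq (forTo vu (var vK) paramStep) <|
    .seq (.ite (var vs) .skip (.seq (.set vs 0 1) (.set vqq 0 3))) <| .set aIn 0 0

abbrev paramArrays : List ℕ := [aIn, vn, vN, vkk, vK, vs, vqq, vu]

/-- The parameter may be far longer than all other input numbers; its cell is erased at the end, so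
that later bounds depend only on `y`. The largest `s ≤ K` with `3 ^ s ≤ p` is taken, but at least
`1`; in the exceptional case `q = 3` is still at most `2 * p` for `p ≥ 2`. If `s` was not stopped by
`K`, then `p < 3 ^ (s + 1) ≤ 3 ^ (2 * s)`. -/
theorem ok_paramProg {p K : ℕ} (hn0 : 0 < n) (hσ : MemB x σ) (hσ' : MemB' y σ) (hyx : y ≤ x)
    (hp : σ aIn 0 = p) (hp1 : 1 ≤ p) (hn : σ aIn 1 = n) (hN : σ aIn 2 = N)
    (hK : K = (n - 1) * (4 * n + 3)) (hKy : 2 * (K + 1) ≤ y) (hny : 4 * n + 3 ≤ y) :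
    Ok O G x paramProg σ fun σ' => MemB y σ' ∧ Frame paramArrays σ σ' ∧
      (∀ i, i ≠ 0 → σ' aIn i = σ aIn i) ∧ σ' vn 0 = n ∧ σ' vN 0 = N ∧ σ' vkk 0 = (4 * n + 3 : ℕ) ∧
      σ' vK 0 = K ∧ ∃ s q : ℕ, σ' vs 0 = s ∧ σ' vqq 0 = q ∧ q = 3 ^ s ∧ 0 < s ∧ s ≤ K + 1 ∧
        (q ≤ p ∨ q = 3) ∧ (K ≤ s ∨ p < 3 ^ (2 * s)) := by
  have h2y : (2 : ℤ) ^ y ≤ 2 ^ x := pow_le_pow_right₀ (by norm_num) hyx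
  have hsmall : ∀ z : ℤ, 0 ≤ z → z ≤ y → |z| < 2 ^ y := fun z h0 h => by
    rw [abs_of_nonneg h0]
    exact h.trans_lt (by exact_mod_cast Nat.lt_two_pow_self)
  have h3y : ∀ s ≤ K + 1, |((3 ^ s : ℕ) : ℤ)| < 2 ^ y := fun s hs => by
    rw [Nat.abs_cast]
    have h1 : 3 ^ s < 4 ^ (K + 1) := by
      calc 3 ^ s ≤ 3 ^ (K + 1) := Nat.pow_le_pow_right (by norm_num) hs
        _ < _ := Nat.pow_lt_pow_left (by norm_num) (by omega)
    have h2 : 4 ^ (K + 1) ≤ 2 ^ y := by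
      rw [show 4 = 2 ^ 2 by norm_num, ← pow_mul]
      exact Nat.pow_le_pow_right (by norm_num) hKy
    exact_mod_cast h1.trans_le h2
  refine ok_seq (Q := fun σ' => MemB' y σ' ∧ Frame paramArrays σ σ' ∧ σ' aIn = σ aIn ∧ σ' vn 0 = n)
    (ok_set hσ (hσ _ _) ⟨hσ'.write _ _ ?_, (Frame.refl _ _).write (by decide) _ _,
      write_other _ _ _ (by decide), by simp [hn]⟩) ?_
  · simp only [val_get, val_one, hn]
    exact hsmall _ (by omega) (by omega)
  rintro σ₁ hσ₁ ⟨hy₁, hF₁, hi₁, hn₁⟩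
  have hNy : |(N : ℤ)| < 2 ^ y := by
    have := hσ' aIn 2
    rw [hN] at this
    simpa using this
  refine ok_seq (Q := fun σ' => MemB' y σ' ∧ Frame paramArrays σ σ' ∧ σ' aIn = σ aIn ∧ σ' vn 0 = n ∧
      σ' vN 0 = N) (ok_set hσ₁ (hσ₁ _ _) ⟨hy₁.write _ _ ?_, hF₁.write (by decide) _ _,
        by rw [write_other _ _ _ (by decide), hi₁], by simp [Mem.write, hn₁], by simp [hi₁, hN]⟩) ?_
  · simpa [hi₁, hN] using hNy
  rintro σ₂ hσ₂ ⟨hy₂, hF₂, hi₂, hn₂, hN₂⟩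
  have e₂ : Expr.val σ₂ (4 * var vn + 3) = (4 * n + 3 : ℕ) := by simp [hn₂]
  refine ok_seq (Q := fun σ' => MemB' y σ' ∧ Frame paramArrays σ σ' ∧ σ' aIn = σ aIn ∧ σ' vn 0 = n ∧
      σ' vN 0 = N ∧ σ' vkk 0 = (4 * n + 3 : ℕ)) (ok_set hσ₂ ?_ ⟨hy₂.write _ _ ?_, hF₂.write (by decide) _ _,
        by rw [write_other _ _ _ (by decide), hi₂], by simp [Mem.write, hn₂], by simp [Mem.write, hN₂],
        by rw [val_zero, write_same, e₂]⟩) ?_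
  · rw [e₂]
    exact (hsmall _ (by omega) (by omega)).trans_le h2y
  · rw [e₂]
    exact hsmall _ (by omega) (by omega)
  rintro σ₃ hσ₃ ⟨hy₃, hF₃, hi₃, hn₃, hN₃, hk₃⟩
  have e₃ : Expr.val σ₃ ((var vn - 1) * var vkk) = K := by
    simp only [val_mul, val_sub, val_var, val_one, hn₃, hk₃, hK]
    push_cast [hn0]
    ring
  refine ok_seq (Q := fun σ' => MemB' y σ' ∧ Frame paramArrays σ σ' ∧ σ' aIn = σ aIn ∧ σ' vn 0 = n ∧
      σ' vN 0 = N ∧ σ' vkk 0 = (4 * n + 3 : ℕ) ∧ σ' vK 0 = K) (ok_set hσ₃ ?_ ⟨hy₃.write _ _ ?_,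
        hF₃.write (by decide) _ _,
        by rw [write_other _ _ _ (by decide), hi₃], by simp [Mem.write, hn₃], by simp [Mem.write, hN₃],
        by simp [Mem.write, hk₃], by rw [val_zero, write_same, e₃]⟩) ?_
  · rw [e₃]
    exact (hsmall _ (by omega) (by omega)).trans_le h2y
  · rw [e₃]
    exact hsmall _ (by omega) (by omega)
  rintro σ₄ hσ₄ ⟨hy₄, hF₄, hi₄, hn₄, hN₄, hk₄, hK₄⟩
  let I : Mem → Prop := fun σ' => MemB' y σ' ∧ Frame paramArrays σ σ' ∧ σ' aIn = σ aIn ∧ σ' vn 0 = n ∧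
      σ' vN 0 = N ∧ σ' vkk 0 = (4 * n + 3 : ℕ) ∧ σ' vK 0 = K
  have hI : ∀ σ' a z, I σ' → a ∈ [vs, vqq, vu] → |z| < 2 ^ y → I (σ'.write a 0 z) := by
    rintro σ' a z ⟨h1, h2, h3, h4, h5, h6, h7⟩ ha hz
    have ha' : a ∈ paramArrays := by
      simp only [List.mem_cons, List.not_mem_nil, or_false] at ha ⊢
      omega
    simp only [List.mem_cons, List.not_mem_nil, or_false] at ha
    refine ⟨h1.write _ _ hz, h2.write ha' _ _, ?_, ?_, ?_, ?_, ?_⟩ <;>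
      rw [write_other _ _ _ (by omega)] <;> assumption
  have h0y : |(0 : ℤ)| < 2 ^ y := by simp
  have h1y : |(1 : ℤ)| < 2 ^ y := by simpa using h3y 0 (by omega)
  refine ok_seq (Q := fun σ' => I σ' ∧ σ' vs 0 = 0) (ok_set hσ₄ (by simp)
    ⟨hI _ _ _ ⟨hy₄, hF₄, hi₄, hn₄, hN₄, hk₄, hK₄⟩ (by decide) h0y, by simp⟩) ?_
  rintro σ₅ hσ₅ ⟨hI₅, hs₅⟩
  refine ok_seq (Q := fun σ' => I σ' ∧ σ' vs 0 = 0 ∧ σ' vqq 0 = 1) (ok_set hσ₅ (h1y.trans_le h2y)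
    ⟨hI _ _ _ hI₅ (by decide) h1y, by simp [Mem.write, hs₅], by simp⟩) ?_
  rintro σ₆ hσ₆ ⟨hI₆, hs₆, hq₆⟩
  refine ok_seq (Q := fun σ' => I σ' ∧ ∃ s : ℕ, s ≤ K ∧ σ' vs 0 = s ∧ σ' vqq 0 = (3 ^ s : ℕ) ∧ 3 ^ s ≤ p ∧
    (s = K ∨ p < 3 ^ (s + 1))) ?_ ?_
  · refine ok_for (fun u σ' => I σ' ∧ ∃ s : ℕ, s ≤ u ∧ σ' vs 0 = s ∧ σ' vqq 0 = (3 ^ s : ℕ) ∧ 3 ^ s ≤ p ∧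
      (s = u ∨ p < 3 ^ (s + 1))) K (by omega) hσ₆ ?_ ?_ ?_ fun σ' _ h _ => h
    · exact ⟨hI _ _ _ hI₆ (by decide) h0y, 0, le_rfl, by simp [Mem.write, hs₆], by simp [Mem.write, hq₆],
        by simpa using hp1, Or.inl rfl⟩
    · rintro u - σ' - - ⟨h, -⟩
      exact h.2.2.2.2.2.2
    · rintro u hu σ₇ hσ₇ hv ⟨hI₇, s, hsu, hs, hq, hsp, hor⟩
      have hval : Expr.val σ₇ ((Expr.get aIn 0).less (3 * var vqq)) =
          if p < 3 ^ (s + 1) then 1 else 0 := by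
        simp only [val_less, val_get, val_zero, val_mul, val_ofNat, val_var, hI₇.2.2.1, hp, hq]
        have : ((p : ℤ) < ((3 : ℕ) : ℤ) * ((3 ^ s : ℕ) : ℤ)) ↔ p < 3 ^ (s + 1) := by
          rw [pow_succ']; exact_mod_cast Iff.rfl
        split_ifs <;> first | rfl | (exfalso; tauto)
      have hu1 : |((u + 1 : ℕ) : ℤ)| < 2 ^ y := hsmall _ (by omega) (by omega)
      refine ok_ite hσ₇ (fun h => ok_skip hσ₇ ⟨hv, hI _ _ _ hI₇ (by decide) hu1, s, by omega,
        by simp [Mem.write, hs], by simp [Mem.write, hq], hsp, Or.inr ?_⟩) fun h => ?_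
      · by_contra hc
        rw [hval, if_neg hc] at h
        exact h rfl
      · have hle : 3 ^ (s + 1) ≤ p := by
          by_contra hc
          rw [hval, if_pos (not_le.1 hc)] at h
          exact one_ne_zero h
        have hs_eq : s = u := by omega
        have e7 : Expr.val σ₇ (var vs + 1) = (s + 1 : ℕ) := by simp [hs]
        have b7 : |((s + 1 : ℕ) : ℤ)| < 2 ^ y := hsmall _ (by omega) (by omega)
        refine ok_seq (Q := fun σ' => I σ' ∧ σ' vu 0 = u ∧ σ' vs 0 = (s + 1 : ℕ) ∧
          σ' vqq 0 = (3 ^ s : ℕ)) (ok_set hσ₇ ?_ ⟨?_, by simp [Mem.write, hv], ?_, by simp [Mem.write, hq]⟩) ?_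
        · rw [e7]; exact b7.trans_le h2y
        · rw [e7]; exact hI _ _ _ hI₇ (by decide) b7
        · rw [val_zero, write_same, e7]
        · rintro σ₈ hσ₈ ⟨hI₈, hv₈, hs₈, hq₈⟩
          have e8 : Expr.val σ₈ (3 * var vqq) = (3 ^ (s + 1) : ℕ) := by
            simp [hq₈, pow_succ']
          have b8 := h3y (s + 1) (by omega)
          refine ok_set hσ₈ ?_ ⟨by simp [Mem.write, hv₈], hI _ _ _ ?_ (by decide) hu1, s + 1,
            by omega, by simp [Mem.write, hs₈], ?_, hle, Or.inl (by omega)⟩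
          · rw [e8]; exact b8.trans_le h2y
          · rw [e8]; exact hI _ _ _ hI₈ (by decide) b8
          · rw [write_other _ _ _ (by decide), val_zero, write_same, e8]
  · rintro σ₇ hσ₇ ⟨hI₇, s, hsK, hs, hq, hsp, hor⟩
    refine ok_seq (Q := fun σ' => I σ' ∧ ∃ s q : ℕ, σ' vs 0 = s ∧ σ' vqq 0 = q ∧ q = 3 ^ s ∧ 0 < s ∧
        s ≤ K + 1 ∧ (q ≤ p ∨ q = 3) ∧ (K ≤ s ∨ p < 3 ^ (2 * s))) (ok_ite hσ₇ (fun h => ?_) fun h => ?_) ?_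
    · rw [val_var, hs] at h
      have hs0 : 0 < s := by omega
      refine ok_skip hσ₇ ⟨hI₇, s, 3 ^ s, hs, hq, rfl, hs0, by omega, Or.inl hsp, ?_⟩
      exact hor.imp Eq.ge fun h => h.trans_le (Nat.pow_le_pow_right (by norm_num) (by omega))
    · rw [val_var, hs] at h
      obtain rfl : s = 0 := by omega
      have b3 : |(3 : ℤ)| < 2 ^ y := by simpa using h3y 1 (by omega)
      refine ok_set_seq hσ₇ (h1y.trans_le h2y) fun hσ₈ => ok_set hσ₈ (b3.trans_le h2y)
        ⟨hI _ _ _ (hI _ _ _ hI₇ (by decide) h1y) (by decide) b3, 1, 3, by simp [Mem.write],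
          by simp, by norm_num, by omega, by omega, Or.inr rfl, ?_⟩
      rcases hor with h | h
      · left; omega
      · right
        exact h.trans_le (Nat.pow_le_pow_right (by norm_num) (by omega))
    · rintro σ₈ hσ₈ ⟨⟨h1, h2, h3, h4, h5, h6, h7⟩, h8⟩
      refine ok_set hσ₈ (by simp) ⟨h1.memB, h2.write (by decide) _ _, fun i hi => ?_, by simpa [Mem.write],
        by simpa [Mem.write], by simpa [Mem.write], by simpa [Mem.write], ?_⟩
      · rw [val_zero, write_other_idx _ _ _ hi, h3]
      · simpa [Mem.write] using h8

end SVPRed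

namespace SVPRed

/-! ### Input and output -/

notation "vDen" => (45 : ℕ)
notation "vga" => (46 : ℕ)
notation "vgb" => (47 : ℕ)
notation "vgt" => (48 : ℕ)

variable {N n x : ℕ} {σ : Mem} {O : List ℤ → Bool} {G : List ℤ → Prop} {Q : Mem → Prop}

/-- Clears the denominators. -/
def matProg : Program :=
  .seq (.seq (.set vDen 0 1) <|
    forTo vl (var vn * var vN) (.set vDen 0 (var vDen * .get aIn (4 + 2 * var vl)))) <|
  mapTo vl (var vn * var vN) aV (var vl) (.get aIn (3 + 2 * var vl) * (var vDen / .get aIn (4 + 2 * var vl)))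

theorem ok_matProg (hσ : MemB x σ) (hn : σ vn 0 = n) (hN : σ vN 0 = N) (hx : n * N ≤ x)
    {D : ℤ} (hD : D = ∏ l ∈ Finset.range (n * N), σ aIn (4 + 2 * l)) (hDx : D < 2 ^ x)
    (hpos : ∀ l < n * N, 0 < σ aIn (4 + 2 * (l : ℕ)))
    (hVx : ∀ l < n * N, |σ aIn (3 + 2 * (l : ℕ)) * (D / σ aIn (4 + 2 * (l : ℕ)))| < 2 ^ x) :
    Ok O G x matProg σ fun σ' => Frame [vDen, vl, aV] σ σ' ∧ σ' vDen 0 = D ∧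
      ∀ l < n * N, σ' aV (l : ℕ) = σ aIn (3 + 2 * (l : ℕ)) * (D / σ aIn (4 + 2 * (l : ℕ))) := by
  have hprod : ∀ l ≤ n * N, 1 ≤ ∏ l ∈ Finset.range l, σ aIn (4 + 2 * l) ∧
      ∏ l ∈ Finset.range l, σ aIn (4 + 2 * l) ≤ D := by
    intro l hl
    have hp : ∀ l ≤ n * N, 0 < ∏ l ∈ Finset.range l, σ aIn (4 + 2 * l) := fun l hl =>
      Finset.prod_pos fun i hi => hpos i ((Finset.mem_range.1 hi).trans_le hl)
    refine ⟨hp l hl, ?_⟩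
    rw [hD]
    exact Int.le_of_dvd (hp _ le_rfl) (Finset.prod_dvd_prod_of_subset _ _ _ (Finset.range_mono hl))
  have h1x : (1 : ℤ) < 2 ^ x := ((hprod 0 (by omega)).1.trans (hprod 0 (by omega)).2).trans_lt hDx
  refine ok_seq (Q := fun σ' => Frame [vDen, vl, aV] σ σ' ∧ σ' vDen 0 = D) ?_ ?_
  · refine ok_seq (Q := fun σ' => Frame [vDen, vl, aV] σ σ' ∧ σ' vDen 0 = 1) (ok_set hσ (by simpa)
      ⟨(Frame.refl _ _).write (by decide) _ _, by simp⟩) ?_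
    rintro σ₁ hσ₁ ⟨hF₁, hd₁⟩
    refine ok_for (fun u σ' => Frame [vDen, vl, aV] σ σ' ∧
      σ' vDen 0 = ∏ l ∈ Finset.range u, σ aIn (4 + 2 * l)) (n * N) hx hσ₁ ?_ ?_ ?_
      fun σ' _ h _ => by rwa [hD]
    · exact ⟨hF₁.write (by decide) _ _, by simp [Mem.write, hd₁]⟩
    · rintro u - σ' - - ⟨hF, -⟩
      simp [hF vn (by decide), hF vN (by decide), hn, hN]
    · rintro u hu σ₂ hσ₂ hv ⟨hF, hd⟩
      have hval : Expr.val σ₂ (var vDen * .get aIn (4 + 2 * var vl)) =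
          ∏ l ∈ Finset.range (u + 1), σ aIn (4 + 2 * l) := by
        rw [Finset.prod_range_succ]
        simp [hd, hv, hF aIn (by decide)]
      obtain ⟨h1, h2⟩ := hprod (u + 1) hu
      refine ok_set hσ₂ ?_ ⟨by simp [Mem.write, hv], (hF.write (by decide) _ _).write (by decide) _ _, ?_⟩
      · rw [hval, abs_of_pos (by omega)]
        omega
      · rw [write_other _ _ _ (by decide), val_zero, write_same, hval]
  rintro σ₁ hσ₁ ⟨hF₁, hd₁⟩
  refine ok_map (n * N) 0 (fun l => σ aIn (3 + 2 * (l : ℕ)) * (D / σ aIn (4 + 2 * (l : ℕ))))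
    (by decide) hx hσ₁ ?_ hVx ?_
  · intro l hl σ' h hv _
    have hF : ∀ a, a ≠ vl → a ≠ aV → a ≠ vDen → σ' a = σ a := fun a h1 h2 h3 => by
      rw [h a h1 h2, hF₁ a (by simp [h1, h2, h3])]
    refine ⟨by simp [hF vn (by decide) (by decide) (by decide), hF vN (by decide) (by decide) (by decide),
      hn, hN], fun _ => ⟨by simp [hv], ?_⟩⟩
    simp [hv, hF aIn (by decide) (by decide) (by decide), h vDen (by decide) (by decide), hd₁]
  · intro σ' _ h h2 _
    refine ⟨hF₁.trans fun a ha => ?_, by rw [h vDen (by decide) (by decide), hd₁], fun l hl => ?_⟩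
    · simp only [List.mem_cons, List.not_mem_nil, or_false, not_or] at ha
      exact h a ha.2.1 ha.2.2
    · simpa using h2 l hl

/-- Prepares the search. -/
def initProg : Program :=
  .seq (dotTo vY (elt aV 0) (elt aV 0)) <| .seq (.set vS 0 (16 * var vY)) <|
    mapTo vl (var vK) aDig (var vl) 3

theorem ok_initProg {V : ℕ → Vec N} {K Y : ℕ} {E : ℤ} (hn : 0 < n) (hσ : MemB x σ) (hN : σ vN 0 = N)
    (hK : σ vK 0 = K) (hV : ∀ i < n, rowAt N σ aV i = V i) (hNx : N ≤ x) (hKx : K ≤ x) (hx : 2 ≤ x)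
    (hE : ∀ j, |V 0 j| ≤ E) (hEx : N * (E * E) < 2 ^ x) (hY : V 0 ⬝ᵥ V 0 = Y)
    (hYx : 16 * (Y : ℤ) < 2 ^ x) :
    Ok O G x initProg σ fun σ' => Frame [vj, vY, vS, vl, aDig] σ σ' ∧ σ' vY 0 = Y ∧
      σ' vS 0 = 16 * Y ∧ ∀ l : ℕ, l < K → σ' aDig l = 3 := by
  have h3 : (3 : ℤ) < 2 ^ x := lt_of_lt_of_le (by norm_num) (pow_le_pow_right₀ (by norm_num) hx)
  refine ok_seq (Q := fun σ' => Frame [vj, vY] σ σ' ∧ σ' vY 0 = Y) ?_ ?_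
  · refine ok_dot (V 0) (V 0) (by decide) (by decide) hNx hσ hN ?_ hE hE hEx
      fun σ' _ hF h => ⟨hF, by rw [h, hY]⟩
    intro l σ' hF hl
    have : (elt aV 0).val σ' = V 0 l := by
      rw [val_elt (r := 0) (by simp) (by rw [hF _ (by decide), hN]) hl,
        rowAt_congr (hF _ (by decide)), hV 0 hn]
    exact ⟨this, this⟩
  rintro σ₁ hσ₁ ⟨hF₁, hy₁⟩
  refine ok_seq (Q := fun σ' => Frame [vj, vY, vS] σ σ' ∧ σ' vY 0 = Y ∧ σ' vS 0 = 16 * Y)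
    (ok_set hσ₁ ?_ ⟨(hF₁.mono (by decide)).write (by decide) _ _, by simp [Mem.write, hy₁],
      by simp [hy₁]⟩) ?_
  · simp only [val_mul, val_ofNat, val_var, hy₁]
    rw [abs_of_nonneg (by positivity)]
    exact_mod_cast hYx
  rintro σ₂ hσ₂ ⟨hF₂, hy₂, hs₂⟩
  refine ok_map K 0 (fun _ => 3) (by decide) hKx hσ₂ ?_ (fun _ _ => by simpa using h3) ?_
  · intro l hl σ' h hv _
    refine ⟨?_, fun _ => ⟨by simp [hv], by simp⟩⟩
    rw [val_var, h vK (by decide) (by decide), hF₂ _ (by decide), hK]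
  · intro σ' _ h h2 _
    refine ⟨(hF₂.mono (by decide)).trans fun a ha => ?_, by rw [h vY (by decide) (by decide), hy₂],
      by rw [h vS (by decide) (by decide), hs₂], fun l hl => by simpa using h2 l hl⟩
    simp only [List.mem_cons, List.not_mem_nil, or_false, not_or] at ha
    exact h a ha.2.2.2.1 ha.2.2.2.2

/-- The greatest common divisor of an integer and the denominator. -/
def gcdProg (e : Expr) : Program :=
  .seq (.set vga 0 (var vDen)) <| .seq (.set vgb 0 (e - var vDen * (e / var vDen))) <|
    .loop (var vgb) <| .seq (.set vgt 0 (var vga - var vgb * (var vga / var vgb))) <|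
      .seq (.set vga 0 (var vgb)) <| .set vgb 0 (var vgt)

/-- Euclid's algorithm: since `a % b + b ≤ a` and `a % b < b`, the product of the two numbers at
least halves in each round. It starts below `D * D < 2 ^ x`, so `x` rounds suffice. -/
theorem ok_gcdProg {e : Expr} {u D : ℤ} (hσ : MemB x σ) (hD : σ vDen 0 = D) (hD0 : 0 < D)
    (hDx : D * D < 2 ^ x) (he : ∀ σ' : Mem, Frame [vga, vgb, vgt] σ σ' → e.val σ' = u) :
    Ok O G x (gcdProg e) σ fun σ' => Frame [vga, vgb, vgt] σ σ' ∧ σ' vga 0 = Int.gcd u D := by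
  have hDx' : D < 2 ^ x := by nlinarith
  refine ok_seq (Q := fun σ' => Frame [vga, vgb, vgt] σ σ' ∧ σ' vga 0 = D) (ok_set hσ (hσ _ _)
    ⟨(Frame.refl _ _).write (by decide) _ _, by simp [hD]⟩) ?_
  rintro σ₁ hσ₁ ⟨hF₁, ha₁⟩
  have hm1 := Int.emod_nonneg u hD0.ne'
  have hm2 := Int.emod_lt_of_pos u hD0
  have e₁ : Expr.val σ₁ (e - var vDen * (e / var vDen)) = u % D := by
    simp only [val_sub, val_mul, val_div, val_var, he σ₁ hF₁, hF₁ vDen (by decide), hD]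
    exact (Int.emod_def u D).symm
  refine ok_seq (Q := fun σ' => Frame [vga, vgb, vgt] σ σ' ∧ σ' vga 0 = D ∧ σ' vgb 0 = u % D)
    (ok_set hσ₁ ?_ ⟨hF₁.write (by decide) _ _, by simp [Mem.write, ha₁], ?_⟩) ?_
  · rw [e₁, abs_of_nonneg hm1]
    omega
  · rw [val_zero, write_same, e₁]
  rintro σ₂ hσ₂ ⟨hF₂, ha₂, hb₂⟩
  refine ok_loop (fun j σ' => Frame [vga, vgb, vgt] σ σ' ∧ ∃ a b : ℤ, σ' vga 0 = a ∧ σ' vgb 0 = b ∧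
    0 ≤ b ∧ b < a ∧ a * b < 2 ^ j ∧ Int.gcd a b = Int.gcd u D) x le_rfl ?_ ?_ hσ₂ ?_
  · rintro j - σ₃ hσ₃ ⟨hF₃, a, b, ha, hb, h0, hlt, hab, hg⟩ hne
    rw [val_var, hb] at hne
    obtain ⟨j, rfl⟩ : ∃ i, j = i + 1 := Nat.exists_eq_succ_of_ne_zero (by
      rintro rfl
      rw [pow_zero] at hab
      have := mul_pos (by omega : 0 < a) (by omega : 0 < b)
      omega)
    have hr1 := Int.emod_nonneg a hne
    have hr2 := Int.emod_lt_of_pos a (by omega : 0 < b)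
    have hq : 1 ≤ a / b := by
      rw [Int.le_ediv_iff_mul_le (by omega)]
      omega
    have hr3 : a % b + b ≤ a := by
      have h := Int.mul_ediv_add_emod a b
      nlinarith
    have e₃ : Expr.val σ₃ (var vga - var vgb * (var vga / var vgb)) = a % b := by
      simp only [val_sub, val_mul, val_div, val_var, ha, hb]
      exact (Int.emod_def a b).symm
    have hbx := hσ₃ vgb 0
    rw [hb, abs_of_nonneg h0] at hbx
    refine ⟨j, rfl, ok_set_seq hσ₃ ?_ fun hσ₄ => ok_set_seq hσ₄ (hσ₄ _ _) fun hσ₅ =>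
      ok_set hσ₅ (hσ₅ _ _) ⟨?_, b, a % b, ?_, ?_, hr1, hr2, ?_, ?_⟩⟩
    · rw [e₃, abs_of_nonneg hr1]
      omega
    · exact ((hF₃.write (by decide) _ _).write (by decide) _ _).write (by decide) _ _
    · simp [Mem.write, hb]
    · rw [e₃]
      simp [Mem.write]
    · rw [pow_succ] at hab
      nlinarith
    · rw [Int.gcd_comm, Int.gcd_emod, hg]
  · rintro j - σ₃ hσ₃ ⟨hF₃, a, b, ha, hb, h0, hlt, hab, hg⟩ he
    rw [val_var, hb] at he
    refine ⟨hF₃, ?_⟩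
    rw [ha, ← hg, he, Int.gcd_zero_right]
    omega
  · refine ⟨hF₂, D, u % D, ha₂, hb₂, hm1, hm2, ?_, ?_⟩
    · nlinarith
    · rw [Int.gcd_comm, Int.gcd_emod]

/-- Writes the result, in lowest terms. -/
def outProg : Program :=
  forTo vi (var vN) <| .seq (gcdProg (.get aBest (var vi))) <|
    .seq (.set aOut (2 * var vi) (.get aBest (var vi) / var vga)) <|
      .set aOut (2 * var vi + 1) (var vDen / var vga)

theorem ok_outProg {u : Vec N} {D : ℤ} (hσ : MemB x σ) (hN : σ vN 0 = N) (hNx : N ≤ x)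
    (hu : rowAt N σ aBest 0 = u) (hD : σ vDen 0 = D) (hD0 : 0 < D) (hDx : D * D < 2 ^ x) :
    Ok O G x outProg σ fun σ' => ∀ j : Fin N, σ' aOut (2 * (j : ℕ)) = u j / Int.gcd (u j) D ∧
      σ' aOut (2 * (j : ℕ) + 1) = D / Int.gcd (u j) D := by
  have hu' : ∀ j : Fin N, σ aBest (j : ℕ) = u j := fun j => by
    rw [← hu]
    simp [rowAt]
  refine ok_for (fun l σ' => Frame [vi, vga, vgb, vgt, aOut] σ σ' ∧ ∀ j : Fin N, (j : ℕ) < l →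
    σ' aOut (2 * (j : ℕ)) = u j / Int.gcd (u j) D ∧
      σ' aOut (2 * (j : ℕ) + 1) = D / Int.gcd (u j) D) N hNx hσ ?_ ?_ ?_ fun σ' _ h _ j => h.2 j j.2
  · exact ⟨(Frame.refl _ _).write (by decide) _ _, by simp⟩
  · rintro l - σ' - - ⟨hF, -⟩
    rw [val_var, hF _ (by decide), hN]
  · rintro l hl σ₁ hσ₁ hv ⟨hF₁, ho₁⟩
    set j₀ : Fin N := ⟨l, hl⟩ with hj₀
    have hb₁ : ∀ σ' : Mem, σ' vi 0 = l → σ' aBest = σ aBest →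
        Expr.val σ' (.get aBest (var vi)) = u j₀ := fun σ' h h' => by
      rw [val_get, val_var, h, h']
      exact hu' j₀
    refine ok_seq (ok_gcdProg (u := u j₀) (D := D) hσ₁ (by rw [hF₁ _ (by decide), hD]) hD0 hDx
      fun σ' hF => hb₁ σ' (by rw [hF _ (by decide), hv]) (by rw [hF _ (by decide), hF₁ _ (by decide)])) ?_
    rintro σ₂ hσ₂ ⟨hF₂, hg₂⟩
    have hv₂ : σ₂ vi 0 = l := by rw [hF₂ _ (by decide), hv]
    have hD₂ : σ₂ vDen 0 = D := by rw [hF₂ _ (by decide), hF₁ _ (by decide), hD]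
    have hF₂' : Frame [vi, vga, vgb, vgt, aOut] σ σ₂ := hF₁.trans (hF₂.mono (by decide))
    have e₂ := hb₁ σ₂ hv₂ (hF₂' _ (by decide))
    have ho₂ : σ₂ aOut = σ₁ aOut := hF₂ _ (by decide)
    refine ok_set_seq hσ₂ ?_ fun hσ₃ => ?_
    · rw [val_div, e₂]
      refine (Int.abs_ediv_le_abs _ _).trans_lt ?_
      rw [← e₂]
      exact hσ₂ _ _
    have e₃ : Expr.val σ₂ (.get aBest (var vi) / var vga) = u j₀ / Int.gcd (u j₀) D := by
      rw [val_div, e₂, val_var, hg₂]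
    have e₄ : Expr.val σ₂ (2 * var vi) = 2 * l := by simp [hv₂]
    rw [e₃, e₄] at hσ₃ ⊢
    refine ok_set hσ₃ ?_ ?_
    · rw [val_div]
      refine (Int.abs_ediv_le_abs _ _).trans_lt ?_
      exact hσ₃ vDen 0
    · have e₅ : Expr.val (σ₂.write aOut (2 * l) (u j₀ / Int.gcd (u j₀) D)) (var vDen / var vga) =
          D / Int.gcd (u j₀) D := by simp [Mem.write, hD₂, hg₂]
      have e₆ : Expr.val (σ₂.write aOut (2 * l) (u j₀ / Int.gcd (u j₀) D)) (2 * var vi + 1) =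
          2 * l + 1 := by simp [Mem.write, hv₂]
      rw [e₅, e₆]
      refine ⟨by simp [Mem.write, hv₂], ((hF₂'.write (by decide) _ _).write (by decide) _ _).write
        (by decide) _ _, fun j hj => ?_⟩
      rw [write_other _ _ _ (by decide), write_self_apply, write_self_apply, write_self_apply,
        write_self_apply, if_neg (by omega), if_neg (by omega : ¬ 2 * ((j : ℕ) : ℤ) + 1 = 2 * l)]
      rcases Nat.lt_succ_iff_lt_or_eq.1 hj with h | h
      · rw [if_neg (by omega), if_neg (by omega), ho₂]
        exact ho₁ j h
      · obtain rfl : j = j₀ := Fin.ext h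
        rw [if_pos (by simp [hj₀]), if_pos (by simp [hj₀])]
        exact ⟨rfl, rfl⟩

theorem num_den_div {u D : ℤ} (hD : 0 < D) :
    ((u : ℚ) / D).num = u / Int.gcd u D ∧ (((u : ℚ) / D).den : ℤ) = D / Int.gcd u D := by
  have hg : 0 < Int.gcd u D := Int.gcd_pos_of_ne_zero_right _ hD.ne'
  have hg' : (0 : ℤ) < Int.gcd u D := by exact_mod_cast hg
  obtain ⟨a, ha⟩ := Int.gcd_dvd_left (a := u) (b := D)
  obtain ⟨b, hb⟩ := Int.gcd_dvd_right (a := u) (b := D)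
  have hcop := Int.gcd_div_gcd_div_gcd hg
  set g : ℤ := (Int.gcd u D : ℤ) with hgdef
  have h1 : u / g = a := by rw [ha, Int.mul_ediv_cancel_left _ hg'.ne']
  have h2 : D / g = b := by rw [hb, Int.mul_ediv_cancel_left _ hg'.ne']
  have hb0 : 0 < b := by rw [hb] at hD; exact pos_of_mul_pos_right hD hg'.le
  rw [h1, h2] at hcop ⊢
  have hq : (u : ℚ) / D = (a : ℚ) / b := by
    have hgq : (g : ℚ) ≠ 0 := by exact_mod_cast hg'.ne'
    rw [ha, hb]
    push_cast
    exact mul_div_mul_left _ _ hgq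
  rw [hq]
  exact ⟨Rat.num_div_eq_of_coprime hb0 hcop, Rat.den_div_eq_of_coprime hb0 hcop⟩

end SVPRed

namespace SVPRed

/-! ### Sizes -/

/-- The bit length of the integral basis. -/
def bexp (y : ℕ) : ℕ := y ^ 3 + y

/-- The bit length of the squared lengths. -/
def wexp (y : ℕ) : ℕ := y + 2 * bexp y

/-- The bit length of the vectors in the orthogonalization. -/
def aexp (y : ℕ) : ℕ := 2 * y * wexp y + y + wexp y

/-- A bound for the number of rounds of the basis reduction. -/
def lllRounds (y : ℕ) : ℕ := 3 * (wexp y * (y * (y + 1))) + 3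

/-- The bit length of the entries of the bases of sublattices. -/
def sexp (y : ℕ) : ℕ := (4 * y + 4) * y + (y + wexp y)

/-- A bound for all bit lengths. -/
def xexp (y : ℕ) : ℕ :=
  lllRounds y + (y + (aexp y + y * (y + 1 + 2 * aexp y) + aexp y) + 1) + (y + 2 * sexp y + 1) +
    (6 + 2 * sexp y) + (2 * bexp y + 1) + (2 * (y * (4 * y + 3) + 1) + 1) + (4 + 2 * (y * y)) +
    (2 * (4 * y + 3) + 3)

theorem polyB_xexp : PolyB xexp := by
  unfold xexp lllRounds sexp aexp wexp bexp
  repeat first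
    | exact PolyB.id
    | exact PolyB.const _
    | apply PolyB.add
    | apply PolyB.mul
    | apply PolyB.pow

variable {N n y k : ℕ}

theorem le_two_pow_of_le (h : n ≤ y) : n ≤ 2 ^ y := h.trans Nat.lt_two_pow_self.le

theorem two_pow_le {a b : ℕ} (h : a ≤ b) : 2 ^ a ≤ 2 ^ b := Nat.pow_le_pow_right (by norm_num) h

theorem dot_self_le_of_abs_le {v : Vec N} (hN : N ≤ y) (h : ∀ j, |v j| ≤ 2 ^ bexp y) :
    v ⬝ᵥ v ≤ (2 ^ wexp y : ℕ) := by
  refine (le_abs_self _).trans ((abs_dot_le h h).trans ?_)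
  have : N * (2 ^ bexp y * 2 ^ bexp y) ≤ 2 ^ wexp y := by
    calc N * (2 ^ bexp y * 2 ^ bexp y) ≤ 2 ^ y * (2 ^ bexp y * 2 ^ bexp y) :=
          Nat.mul_le_mul_right _ (le_two_pow_of_le hN)
      _ = _ := by rw [wexp]; ring
  exact_mod_cast this

theorem pow_mul_le_aexp (hn : n ≤ y) :
    (2 ^ wexp y) ^ (2 * n) * (n * 2 ^ wexp y) ≤ 2 ^ aexp y := by
  calc (2 ^ wexp y) ^ (2 * n) * (n * 2 ^ wexp y) ≤ (2 ^ wexp y) ^ (2 * y) * (2 ^ y * 2 ^ wexp y) := by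
        refine Nat.mul_le_mul ?_ (Nat.mul_le_mul_right _ (le_two_pow_of_le hn))
        exact Nat.pow_le_pow_right (by positivity) (by omega)
    _ = _ := by rw [aexp, ← pow_mul]; ring

theorem reduction_lt (hn : n ≤ y) (hN : N ≤ y) :
    (N + 1) * (2 ^ aexp y * ((N + 2) * 2 ^ aexp y * 2 ^ aexp y) ^ n * 2 ^ aexp y) < 2 ^ xexp y := by
  have h1 : N + 1 ≤ 2 ^ y := (Nat.lt_two_pow_self (n := N)).trans_le (two_pow_le hN)
  have h2 : N + 2 ≤ 2 ^ (y + 1) := (Nat.lt_two_pow_self (n := N + 1)).trans_le (two_pow_le (by omega))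
  calc (N + 1) * (2 ^ aexp y * ((N + 2) * 2 ^ aexp y * 2 ^ aexp y) ^ n * 2 ^ aexp y)
      ≤ 2 ^ y * (2 ^ aexp y * (2 ^ (y + 1) * 2 ^ aexp y * 2 ^ aexp y) ^ y * 2 ^ aexp y) := by
        refine Nat.mul_le_mul h1 (Nat.mul_le_mul_right _ (Nat.mul_le_mul_left _ ?_))
        refine (Nat.pow_le_pow_left (Nat.mul_le_mul_right _ (Nat.mul_le_mul_right _ h2)) n).trans ?_
        exact Nat.pow_le_pow_right (by positivity) hn
    _ = 2 ^ (y + (aexp y + y * (y + 1 + 2 * aexp y) + aexp y)) := by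
        rw [← pow_add, ← pow_add, ← pow_mul, ← pow_add, ← pow_add, ← pow_add]
        congr 1
        ring
    _ < _ := Nat.pow_lt_pow_right (by norm_num) (by unfold xexp; omega)

/-- As `(4 / 3) ^ 3 > 2`, three rounds pay for each factor two of the initial potential; three more
make the inequality strict. -/
theorem rounds_lt (hn : n ≤ y) :
    (2 ^ wexp y) ^ (n * (n + 1)) * 3 ^ lllRounds y < 4 ^ lllRounds y := by
  have h1 : (2 ^ wexp y) ^ (n * (n + 1)) ≤ 2 ^ (wexp y * (y * (y + 1))) := by
    rw [← pow_mul]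
    exact two_pow_le (by gcongr)
  set r := wexp y * (y * (y + 1)) with hr
  have h2 : 4 ^ lllRounds y = 64 ^ r * 64 := by
    rw [lllRounds, ← hr, pow_add, pow_mul]; norm_num
  have h3 : 3 ^ lllRounds y = 27 ^ r * 27 := by
    rw [lllRounds, ← hr, pow_add, pow_mul]; norm_num
  rw [h2, h3]
  calc _ ≤ 2 ^ r * (27 ^ r * 27) := Nat.mul_le_mul_right _ h1
    _ = 54 ^ r * 27 := by rw [← mul_assoc, ← mul_pow]; norm_num
    _ < _ := by
      refine Nat.mul_lt_mul_of_le_of_lt (Nat.pow_le_pow_left (by norm_num) r) (by norm_num) (by positivity)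

theorem build_entry_le (hn : n ≤ y) (hk : k = 4 * n + 3) :
    (2 ^ (k + 1)) ^ n * 2 ^ (y + wexp y) ≤ 2 ^ sexp y := by
  rw [← pow_mul, ← pow_add, sexp]
  refine two_pow_le ?_
  have : (k + 1) * n ≤ (4 * y + 4) * y := Nat.mul_le_mul (by omega) hn
  omega

end SVPRed

namespace SVPRed

/-! ### The reduction -/

variable {N n y s q K : ℕ} {σ : Mem} {O : List ℤ → Bool} {B : RatBasis n N}

/-- Everything after the choice of the parameters. -/
def coreProg : Program :=
  .seq matProg <| .seq lll <| .seq initProg <| .seq batchesProg <| .seq finalProg outProg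

def coreCst (x q : ℕ) : ℕ :=
  1 + matProg.cst x + (1 + lll.cst x + (1 + initProg.cst x + (1 + batchesCst x q +
    (1 + finalCst x q + outProg.cst x))))

/-- Array `0` contains the entries of the basis. -/
structure Input (B : RatBasis n N) (σ : Mem) : Prop where
  num : ∀ (i : Fin n) (j : Fin N), σ aIn (3 + 2 * (((i : ℕ) * N + (j : ℕ) : ℕ) : ℤ)) = (B.vec i j).num
  den : ∀ (i : Fin n) (j : Fin N), σ aIn (4 + 2 * (((i : ℕ) * N + (j : ℕ) : ℕ) : ℤ)) = (B.vec i j).den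

/-- The common denominator. -/
def comden (n N : ℕ) (σ : Mem) : ℤ := ∏ l ∈ Finset.range (n * N), σ aIn (4 + 2 * l)

/-- The integral multiple of a rational basis. -/
def intBasis (n N : ℕ) (σ : Mem) : ℕ → Vec N := fun i j =>
  σ aIn (3 + 2 * ((i * N + (j : ℕ) : ℕ) : ℤ)) *
    (comden n N σ / σ aIn (4 + 2 * ((i * N + (j : ℕ) : ℕ) : ℤ)))

theorem exists_index {l : ℕ} (hl : l < n * N) : ∃ (i : Fin n) (j : Fin N), l = i * N + j := by
  have hN0 : 0 < N := Nat.pos_of_ne_zero (by rintro rfl; simp at hl)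
  refine ⟨⟨l / N, (Nat.div_lt_iff_lt_mul hN0).2 hl⟩, ⟨l % N, Nat.mod_lt _ hN0⟩, ?_⟩
  rw [mul_comm]
  exact (Nat.div_add_mod l N).symm

theorem index_lt (i : Fin n) (j : Fin N) : (i : ℕ) * N + j < n * N := by
  have h1 := j.2
  have h2 := i.2
  nlinarith

theorem Input.den_pos (h : Input B σ) {l : ℕ} (hl : l < n * N) : 0 < σ aIn (4 + 2 * (l : ℤ)) := by
  obtain ⟨i, j, rfl⟩ := exists_index hl
  rw [h.den]
  exact_mod_cast (B.vec i j).den_pos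

theorem Input.comden_pos (h : Input B σ) : 0 < comden n N σ :=
  Finset.prod_pos fun _ hl => h.den_pos (Finset.mem_range.1 hl)

theorem den_dvd_comden {l : ℕ} (hl : l < n * N) :
    σ aIn (4 + 2 * (l : ℤ)) ∣ comden n N σ :=
  Finset.dvd_prod_of_mem (fun l : ℕ => σ aIn (4 + 2 * (l : ℤ))) (Finset.mem_range.2 hl)

theorem Input.vec_eq (h : Input B σ) (i : Fin n) (j : Fin N) :
    B.vec i j = (intBasis n N σ i j : ℚ) / comden n N σ := by
  have hD : (comden n N σ : ℚ) ≠ 0 := by exact_mod_cast h.comden_pos.ne'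
  obtain ⟨e, he⟩ := den_dvd_comden (σ := σ) (index_lt i j)
  have hd0 := (h.den_pos (index_lt i j)).ne'
  rw [intBasis, eq_div_iff hD]
  have : comden n N σ / σ aIn (4 + 2 * (((i : ℕ) * N + (j : ℕ) : ℕ) : ℤ)) = e := by
    rw [he, Int.mul_ediv_cancel_left _ hd0]
  rw [this, he, h.den, h.num]
  push_cast
  rw [← mul_assoc, Rat.mul_den_eq_num]

theorem Input.toReal_vec (h : Input B σ) (i : Fin n) :
    toReal (B.vec i) = ((comden n N σ : ℝ))⁻¹ • emb (intBasis n N σ i) := by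
  ext j
  have := h.vec_eq i j
  simp only [toReal, emb, AddMonoidHom.coe_mk, ZeroHom.coe_mk, PiLp.smul_apply, smul_eq_mul]
  rw [this]
  push_cast
  rw [div_eq_inv_mul]

theorem Input.indep (h : Input B σ) : Indep n (embf (intBasis n N σ)) := by
  have hD : (comden n N σ : ℝ) ≠ 0 := by exact_mod_cast h.comden_pos.ne'
  have := LinearIndependent.units_smul B.indep fun _ => Units.mk0 (comden n N σ : ℝ) hD
  have heq : (fun i : Fin n => embf (intBasis n N σ) i) =
      (fun _ : Fin n => Units.mk0 (comden n N σ : ℝ) hD) • fun i => toReal (B.vec i) := by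
    funext i
    rw [Pi.smul_apply', Units.smul_def, Units.val_mk0, h.toReal_vec, smul_smul, mul_inv_cancel₀ hD,
      one_smul]
    rfl
  unfold Indep
  rw [heq]
  exact this

/-- The common denominator is the product of all denominators, not their least common multiple: at
most `y ^ 2` factors of at most `y` bits each are short enough. -/
theorem Input.comden_le (h : Input B σ) (hσ : MemB y σ) (hn : n ≤ y) (hN : N ≤ y) :
    comden n N σ ≤ 2 ^ (y ^ 3) := by
  calc comden n N σ ≤ ∏ _l ∈ Finset.range (n * N), (2 : ℤ) ^ y := by
        refine Finset.prod_le_prod (fun l hl => (h.den_pos (Finset.mem_range.1 hl)).le) fun l _ => ?_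
        exact ((le_abs_self _).trans_lt (hσ _ _)).le
    _ = 2 ^ (y * (n * N)) := by simp [pow_mul]
    _ ≤ _ := by
        refine pow_le_pow_right₀ (by norm_num) ?_
        calc y * (n * N) ≤ y * (y * y) := by gcongr
          _ = _ := by ring

theorem Input.abs_intBasis_le (h : Input B σ) (hσ : MemB y σ) (hn : n ≤ y) (hN : N ≤ y) (i : ℕ)
    (j : Fin N) : |intBasis n N σ i j| ≤ 2 ^ bexp y := by
  rw [intBasis, abs_mul, bexp, add_comm (y ^ 3), pow_add]
  refine mul_le_mul (hσ _ _).le ?_ (abs_nonneg _) (by positivity)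
  refine (Int.abs_ediv_le_abs _ _).trans ?_
  rw [abs_of_pos h.comden_pos]
  exact h.comden_le hσ hn hN

/-- The squared length of the output is at most the capped minimum of the last sublattice, whose
root is at most `γ ^ (2 * e)` times that of the whole lattice. Basis reduction does not change the
lattice, and the common denominator scales both sides alike. All bounds depend only on `y`, and thus
not on `p`. -/
theorem run_coreProg {γ : ℕ → ℝ} (hγ : 1 ≤ γ n) (hO : IsGapSVPOracle γ O) (hn0 : 0 < n) (hn : n ≤ y)
    (hN : N ≤ y) (hσ : MemB y σ) (hin : Input B σ) (hvn : σ vn 0 = n) (hvN : σ vN 0 = N)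
    (hvkk : σ vkk 0 = (4 * n + 3 : ℕ)) (hvK : σ vK 0 = K) (hK : K = (n - 1) * (4 * n + 3))
    (hvs : σ vs 0 = s) (hvqq : σ vqq 0 = q) (hq : q = 3 ^ s) (hs : 0 < s) (hsK : s ≤ K + 1) :
    Run O (IsQuery n N) (xexp y) coreProg σ (coreCst (xexp y) q) fun σ' =>
      ∃ (e : ℕ) (v : Fin N → ℚ), σ'.read aOut (2 * N) = encodeVec v ∧ toReal v ∈ B.lattice ∧
        0 < ‖toReal v‖ ∧ ‖toReal v‖ ≤ γ n ^ (2 * e) * lambda1 B.lattice ∧ (e = 0 ∨ e * s < K) := by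
  set k := 4 * n + 3 with hk
  set x := xexp y with hx
  set b := intBasis n N σ with hb
  set D := comden n N σ with hD
  have hDpos : 0 < D := hin.comden_pos
  have hDle : D ≤ 2 ^ bexp y := (hin.comden_le hσ hn hN).trans
    (pow_le_pow_right₀ (by norm_num) (by unfold bexp; omega))
  have hbpos : ∀ i j, |b i j| ≤ 2 ^ bexp y := fun i j => hin.abs_intBasis_le hσ hn hN i j
  have hnN : n * N ≤ y * y := Nat.mul_le_mul hn hN
  have hKy : K ≤ y * (4 * y + 3) := by
    rw [hK]; exact Nat.mul_le_mul (by omega) (by omega)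
  have hyx : y ≤ x := by rw [hx]; unfold xexp; omega
  have hxb : 2 * bexp y < x := by rw [hx]; unfold xexp; omega
  have hDD : D * D < 2 ^ x := by
    calc D * D ≤ 2 ^ bexp y * 2 ^ bexp y := mul_le_mul hDle hDle hDpos.le (by positivity)
      _ = 2 ^ (2 * bexp y) := by rw [← pow_add]; congr 1; ring
      _ < _ := pow_lt_pow_right₀ (by norm_num) hxb
  have hσx : MemB x σ := hσ.mono hyx
  have hzlt : ∀ {z : ℤ} {e : ℕ}, z ≤ 2 ^ e → e < x → z < 2 ^ x := fun h he =>
    h.trans_lt (pow_lt_pow_right₀ (by norm_num) he)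
  refine run_seq (ok_matProg (n := n) hσx hvn hvN (by rw [hx]; unfold xexp; omega) hD
    (hzlt hDle (by omega)) (fun l hl => hin.den_pos hl) fun l hl => ?_) ?_
  · obtain ⟨i, j, rfl⟩ := exists_index hl
    exact hzlt (hbpos i j) (by omega)
  rintro σ₁ hσ₁ ⟨hF₁, hD₁, hV₁⟩
  have hrow₁ : ∀ i < n, rowAt N σ₁ aV i = b i := by
    intro i hi
    funext j
    have := hV₁ _ (index_lt ⟨i, hi⟩ j)
    rw [rowAt, hb, intBasis]
    exact_mod_cast this
  have hn₁ : σ₁ vn 0 = n := by rw [hF₁ _ (by decide), hvn]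
  have hN₁ : σ₁ vN 0 = N := by rw [hF₁ _ (by decide), hvN]
  refine run_seq (Q := fun σ' => Frame lllArrays σ₁ σ' ∧ ∃ c : ℕ → Vec N,
    (∀ i < n, rowAt N σ' aV i = c i) ∧ LllInv n (2 ^ wexp y) b c ∧ Reduced n (embf c)) ?_ ?_
  · exact ok_lll (X := 2 ^ wexp y) (A := 2 ^ aexp y) (J := lllRounds y) hn0 Nat.one_le_two_pow hin.indep
      (fun i _ => dot_self_le_of_abs_le hN (hbpos i)) (pow_mul_le_aexp hn) (reduction_lt hn hN)
      (hn.trans hyx) (hN.trans hyx) (rounds_lt hn) (by rw [hx]; unfold xexp; omega) hσ₁ hn₁ hN₁ hrow₁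
      fun σ' c _ h1 h2 h3 h4 => ⟨h1, c, h2, h3, h4⟩
  rintro σ₂ hσ₂ ⟨hF₂, c, hrow₂, hinv, hred⟩
  have hF₁₂ : Frame (vDen :: lllArrays) σ σ₂ := (hF₁.mono (by decide)).trans (hF₂.mono (by decide))
  have hrowle : ∀ i < n, c i ⬝ᵥ c i ≤ 2 ^ (y + wexp y) := by
    intro i hi
    refine (hinv.row_le i hi).trans ?_
    have : n * 2 ^ wexp y ≤ 2 ^ (y + wexp y) := by
      rw [pow_add]; exact Nat.mul_le_mul_right _ (le_two_pow_of_le hn)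
    exact_mod_cast this
  have hcE : ∀ i < n, ∀ j, |c i j| ≤ 2 ^ (y + wexp y) := fun i hi j =>
    abs_le_of_dot_self_le (hrowle i hi) j
  obtain ⟨Y, hY⟩ := Int.eq_ofNat_of_zero_le (dot_self_nonneg (c 0))
  have hYle : (Y : ℤ) ≤ 2 ^ (y + wexp y) := by
    rw [← hY]; exact hrowle 0 hn0
  have hYpos : 0 < Y := by
    have := dot_self_pos (hinv.indep.ne_zero hn0)
    rw [hY] at this
    exact_mod_cast this
  have hsexp : y + wexp y ≤ sexp y := by unfold sexp; omega
  have hxs : 6 + 2 * sexp y ≤ x := by rw [hx]; unfold xexp; omega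
  have hxs' : y + 2 * sexp y < x := by rw [hx]; unfold xexp; omega
  have hbuild : ((2 : ℤ) ^ (k + 1)) ^ n * 2 ^ (y + wexp y) ≤ 2 ^ sexp y := by
    exact_mod_cast build_entry_le hn hk
  have hNpow : (N : ℤ) ≤ 2 ^ y := by exact_mod_cast le_two_pow_of_le hN
  refine run_seq (ok_initProg (K := K) (E := 2 ^ (y + wexp y)) hn0 hσ₂ (by rw [hF₁₂ _ (by decide), hvN])
    (by rw [hF₁₂ _ (by decide), hvK]) hrow₂ (hN.trans hyx) (by rw [hx]; unfold xexp; omega) (by omega)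
    (hcE 0 hn0) ?_ hY ?_) ?_
  · refine hzlt (e := y + 2 * sexp y) ?_ hxs'
    rw [← pow_add, pow_add _ y]
    exact mul_le_mul hNpow (pow_le_pow_right₀ (by norm_num) (by omega)) (by positivity) (by positivity)
  · refine hzlt (e := 4 + sexp y) ?_ (by omega)
    rw [pow_add]
    refine mul_le_mul (by norm_num) (hYle.trans (pow_le_pow_right₀ (by norm_num) hsexp))
      (by positivity) (by positivity)
  rintro σ₃ hσ₃ ⟨hF₃, hY₃, hS₃, hdig₃⟩
  have hqx : q < 2 ^ x := by
    rw [hq]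
    calc 3 ^ s ≤ 4 ^ s := Nat.pow_le_pow_left (by norm_num) s
      _ = 2 ^ (2 * s) := by rw [pow_mul]; norm_num
      _ < _ := Nat.pow_lt_pow_right (by norm_num) (by rw [hx]; unfold xexp; omega)
  have hYs : (Y : ℤ) ≤ 2 ^ sexp y := hYle.trans (pow_le_pow_right₀ (by norm_num) hsexp)
  have hYY : (Y : ℤ) * 2 ^ sexp y ≤ 2 ^ (2 * sexp y) := by
    rw [two_mul, pow_add]
    exact mul_le_mul_of_nonneg_right hYs (by positivity)
  have h16 : ∀ z : ℤ, z ≤ 2 ^ (2 * sexp y) → 16 * z + 2 < 2 ^ x := by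
    intro z hz
    have h1 : (2 : ℤ) ^ (6 + 2 * sexp y) ≤ 2 ^ x := pow_le_pow_right₀ (by norm_num) hxs
    rw [pow_add] at h1
    have h2 : (1 : ℤ) ≤ 2 ^ (2 * sexp y) := one_le_pow₀ (by norm_num)
    linarith
  have H : Setup n k x s q c (16 * Y) := by
    refine ⟨hn0, hinv.indep, hn.trans hyx, hN.trans hyx, ?_, ?_, ?_, ?_, hqx, by have := hYpos; positivity,
      2 ^ (y + wexp y), by positivity, hcE, ?_⟩
    · rw [hx]; unfold xexp; omega
    · rw [hx]; unfold xexp; omega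
    · rw [hx]; unfold xexp; omega
    · rw [hq]; positivity
    · have h1 := h16 (Y * 2 ^ sexp y) hYY
      have h2 : 16 * (Y : ℤ) * ((2 ^ (k + 1)) ^ n * 2 ^ (y + wexp y)) ≤ 16 * Y * 2 ^ sexp y :=
        mul_le_mul_of_nonneg_left hbuild (by positivity)
      linarith
  have hF₃' : Frame [aV, aW, aD, vi, vl, vj, vacc, vq, vflag, vk, atmp, vDen, vY, vS, aDig] σ σ₃ :=
    (hF₁₂.mono (by decide)).trans (hF₃.mono (by decide))
  have hE₃ : Env n k s q c (16 * Y) σ₃ := by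
    refine ⟨?_, ?_, ?_, ?_, ?_, hS₃, fun i hi => ?_⟩
    · rw [hF₃' _ (by decide), hvn]
    · rw [hF₃' _ (by decide), hvN]
    · rw [hF₃' _ (by decide), hvkk]
    · rw [hF₃' _ (by decide), hvs]
    · rw [hF₃' _ (by decide), hvqq]
    · rw [rowAt_congr (hF₃ _ (by decide)), hrow₂ i hi]
  refine run_seq (run_batchesProg hγ hO H hσ₃ hE₃ hY₃ ?_ (by rw [hF₃' _ (by decide), hvK, hK])
    (by rw [← hK, hx]; unfold xexp; omega) hs hq hYpos (by rw [← hK]; exact hdig₃)) ?_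
  · rw [mul_assoc]
    exact h16 _ ((mul_le_mul_of_nonneg_left hYs (by positivity)).trans hYY)
  rw [← hK]
  rintro σ₄ hσ₄ ⟨hF₄, e, dig, ht₄, hd₄, hes, he, hdig, hdig3, hloss⟩
  have hE₄ := hE₃.congr hF₄ (by decide)
  refine run_seq (run_finalProg H hσ₄ hE₄ ht₄ hd₄ (by rw [hF₄ _ (by decide), hY₃]) hY
    ⟨2 ^ (y + wexp y), hcE, ?_⟩) ?_
  · refine hzlt (e := y + 2 * sexp y) ?_ hxs'
    rw [pow_add _ y (2 * sexp y)]
    refine mul_le_mul hNpow ?_ (sq_nonneg _) (by positivity)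
    rw [pow_mul']
    exact pow_le_pow_left₀ (by positivity) hbuild 2
  rintro σ₅ hσ₅ ⟨hF₅, u, hu₅, huL, hu0, huY, huc⟩
  have hDen₅ : σ₅ vDen 0 = D := by
    rw [hF₅ _ (by decide), hF₄ _ (by decide), hF₃ _ (by decide), hF₂ _ (by decide), hD₁]
  refine (ok_outProg hσ₅ (by rw [hF₅ _ (by decide), hE₄.hvN]) (hN.trans hyx) hu₅ hDen₅ hDpos hDD).imp ?_
  intro σ₆ _ hout
  have hD0 : (0 : ℝ) < D := by exact_mod_cast hDpos
  have hreal : toReal (fun j => (u j : ℚ) / D) = (D : ℝ)⁻¹ • emb u := by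
    ext j
    simp only [toReal, emb, AddMonoidHom.coe_mk, ZeroHom.coe_mk, PiLp.smul_apply, smul_eq_mul]
    push_cast
    rw [div_eq_inv_mul]
  have hnorm : ‖(D : ℝ)⁻¹ • emb u‖ = (D : ℝ)⁻¹ * √((u ⬝ᵥ u : ℤ) : ℝ) := by
    rw [norm_smul, norm_emb, Real.norm_of_nonneg (by positivity)]
  have hlam : lambda1 B.lattice = (D : ℝ)⁻¹ * √(minsq n b) :=
    lambda1_eq (by positivity) hn0 hin.indep hin.toReal_vec
  have hminsq : minsq n c = minsq n b := minsq_congr fun v => by rw [hinv.lat]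
  refine ⟨e, fun j => (u j : ℚ) / D, ?_, ?_, ?_, ?_, he⟩
  · rw [read_eq, mul_comm]
    symm
    apply encodeVec_eq
    · intro j
      rw [(num_den_div hDpos).1, ← (hout j).1]
      push_cast
      rw [mul_comm]
    · intro j
      rw [(num_den_div hDpos).2, ← (hout j).2]
      push_cast
      rw [mul_comm]
  · rw [hreal]
    exact (mem_lattice_iff hin.toReal_vec).2 ⟨u, by rw [← hinv.lat]; exact huL, rfl⟩
  · rw [hreal, norm_pos_iff]
    exact smul_ne_zero (by positivity) fun h => hu0 (emb_eq_zero.1 h)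
  · obtain ⟨m, hm⟩ := Int.eq_ofNat_of_zero_le (dot_self_nonneg u)
    have hmY : m ≤ Y := by rw [hm] at huY; exact_mod_cast huY
    have hfin : m ≤ min (minsq n (build k c dig (n - 1))) Y := by
      refine le_min_of_final hn0 hinv.indep hred hk hY hmY hdig ?_ (by rw [← hK]; exact hes)
        (by rw [← hK]; exact hdig3) fun c' hc' => ?_
      · rw [← hK]
        rcases he with rfl | he
        · omega
        · exact he.le
      · have := huc c' (by rw [hq]; exact hc')
        rwa [hm] at this
    rw [hreal, hnorm, hlam, hm, ← hminsq, mul_left_comm]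
    refine mul_le_mul_of_nonneg_left ?_ (by positivity)
    rw [Int.cast_natCast]
    refine (Real.sqrt_le_sqrt (by exact_mod_cast hfin)).trans (hloss.trans ?_)
    refine mul_le_mul_of_nonneg_left (Real.sqrt_le_sqrt ?_) (by positivity)
    exact_mod_cast min_le_left _ _

end SVPRed

namespace SVPRed

/-! ### The initial memory -/

variable {N n : ℕ} {B : RatBasis n N}

/-- The entries of the encoding of a basis. -/
def entryFn (B : RatBasis n N) (l : ℕ) : ℤ :=
  if l = 0 then n else if l = 1 then N else
  if h : (l - 2) / 2 < n * N then
    let ij := finProdFinEquiv.symm ⟨(l - 2) / 2, h⟩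
    if (l - 2) % 2 = 0 then (B.vec ij.1 ij.2).num else (B.vec ij.1 ij.2).den
  else 0

theorem entryFn_add (B : RatBasis n N) (i : Fin n) (j : Fin N) {e : ℕ} (he : e < 2) :
    entryFn B (2 + (2 * ((i : ℕ) * N + j) + e)) =
      if e = 0 then (B.vec i j).num else (B.vec i j).den := by
  have hlt := index_lt i j
  have hdiv : (2 + (2 * ((i : ℕ) * N + j) + e) - 2) / 2 = i * N + j := by omega
  have hmod : (2 + (2 * ((i : ℕ) * N + j) + e) - 2) % 2 = e := by omega
  have hij : finProdFinEquiv.symm ⟨(i : ℕ) * N + j, hlt⟩ = (i, j) := by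
    rw [Equiv.symm_apply_eq]
    ext
    simp [finProdFinEquiv]
    ring
  rw [entryFn, if_neg (by omega), if_neg (by omega), dif_pos (by rw [hdiv]; exact hlt)]
  simp only [hdiv, hmod, hij]

theorem encodeBasis_eq_entryFn (B : RatBasis n N) :
    encodeBasis B = (List.range (2 + n * (N * 2))).map (entryFn B) := by
  have h (i : Fin n) (j : Fin N) (e : ℕ) :
      2 + ((i : ℕ) * (N * 2) + (j : ℕ) * 2 + e) = 2 + (2 * ((i : ℕ) * N + j) + e) := by ring
  refine encodeBasis_eq _ rfl rfl (fun i j => ?_) fun i j => ?_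
  · have := entryFn_add B i j (e := 0) (by norm_num)
    rw [← h] at this
    exact this
  · have := entryFn_add B i j (e := 1) (by norm_num)
    rw [← h] at this
    exact this

theorem startMem_zero (p : ℕ) (L : List ℤ) : startMem ((p : ℤ) :: L) aIn 0 = p := by
  simp [startMem]

theorem startMem_succ (p : ℕ) {l : ℕ} (hl : l < 2 + n * (N * 2)) :
    startMem ((p : ℤ) :: encodeBasis B) aIn ((l + 1 : ℕ) : ℤ) = entryFn B l := by
  rw [startMem, if_pos ⟨rfl, by positivity⟩, Int.toNat_natCast, List.getD_cons_succ,
    encodeBasis_eq_entryFn]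
  simp [List.getD_eq_getElem?_getD, hl]

theorem input_startMem (p : ℕ) : Input B (startMem ((p : ℤ) :: encodeBasis B)) := by
  have hlt (i : Fin n) (j : Fin N) (e : ℕ) (he : e < 2) :
      2 + (2 * ((i : ℕ) * N + j) + e) < 2 + n * (N * 2) := by
    have h1 := index_lt i j
    have h2 : n * (N * 2) = 2 * (n * N) := by ring
    omega
  constructor
  · intro i j
    have h := startMem_succ (B := B) p (hlt i j 0 (by norm_num))
    rw [entryFn_add B i j (by norm_num), if_pos rfl] at h
    rw [← h]
    congr 1
    push_cast
    ring
  · intro i j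
    have h := startMem_succ (B := B) p (hlt i j 1 (by norm_num))
    rw [entryFn_add B i j (by norm_num), if_neg one_ne_zero] at h
    rw [← h]
    congr 1
    push_cast
    ring

theorem vecBits_le (i : Fin n) : vecBits (B.vec i) ≤ B.maxBits :=
  Finset.le_sup (f := fun i => vecBits (B.vec i)) (Finset.mem_univ i)

theorem abs_lt_of_bits_le {z : ℤ} {m : ℕ} (h : bits z ≤ m) : |z| < 2 ^ m := by
  have h1 := Nat.lt_size_self z.natAbs
  have h2 : 2 ^ z.natAbs.size ≤ 2 ^ m := Nat.pow_le_pow_right (by norm_num) (by unfold bits at h; omega)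
  rw [Int.abs_eq_natAbs]
  exact_mod_cast h1.trans_le h2

theorem bits_entry_le (i : Fin n) (j : Fin N) :
    bits (B.vec i j).num ≤ B.maxBits ∧ bits ((B.vec i j).den : ℤ) ≤ B.maxBits := by
  have h1 : bits (B.vec i j).num + bits ((B.vec i j).den : ℤ) ≤ vecBits (B.vec i) :=
    Finset.single_le_sum (f := fun j => bits (B.vec i j).num + bits ((B.vec i j).den : ℤ))
      (fun _ _ => Nat.zero_le _) (Finset.mem_univ j)
  have h2 := vecBits_le (B := B) i
  omega

/-- Every coordinate, even a zero, takes at least one bit; this is why the ambient dimension does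
not appear in the time bound. -/
theorem dim_le_maxBits (hn : 0 < n) : N ≤ B.maxBits := by
  refine le_trans ?_ (vecBits_le ⟨0, hn⟩)
  have : ∑ _j : Fin N, 1 ≤ vecBits (B.vec ⟨0, hn⟩) := Finset.sum_le_sum fun j _ =>
    (bits_pos _).trans (Nat.le_add_right _ _)
  simpa using this

theorem dim_pos (B : RatBasis n N) (hn : 0 < n) : 0 < N := by
  rcases Nat.eq_zero_or_pos N with rfl | h
  · exact absurd (Subsingleton.elim _ _) (B.indep.ne_zero ⟨0, hn⟩)
  · exact h

theorem memB'_startMem {y : ℕ} (p : ℕ) (hn : n ≤ y) (hN : N ≤ y) (hB : B.maxBits ≤ y) :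
    MemB' y (startMem ((p : ℤ) :: encodeBasis B)) := by
  have h2y : (2 : ℤ) ^ B.maxBits ≤ 2 ^ y := pow_le_pow_right₀ (by norm_num) hB
  have hmem : ∀ z ∈ encodeBasis B, |z| < 2 ^ y := by
    intro z hz
    simp only [encodeBasis, encodeVec, encodeRat, List.mem_cons, List.mem_flatten, List.mem_ofFn,
      exists_exists_eq_and, List.not_mem_nil, or_false] at hz
    rcases hz with rfl | rfl | ⟨i, j, rfl | rfl⟩
    · rw [Nat.abs_cast]
      exact_mod_cast hn.trans_lt Nat.lt_two_pow_self
    · rw [Nat.abs_cast]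
      exact_mod_cast hN.trans_lt Nat.lt_two_pow_self
    · exact (abs_lt_of_bits_le (bits_entry_le i j).1).trans_le h2y
    · exact (abs_lt_of_bits_le (bits_entry_le i j).2).trans_le h2y
  intro a i
  by_cases h0 : a = 0 ∧ i = 0
  · exact Or.inl h0
  right
  rw [startMem]
  split
  · next h =>
    obtain ⟨l, hl⟩ : ∃ l, i.toNat = l + 1 := Nat.exists_eq_succ_of_ne_zero (by
      have : i ≠ 0 := fun hi => h0 ⟨h.1, hi⟩
      omega)
    rw [hl, List.getD_cons_succ, List.getD_eq_getElem?_getD]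
    cases hg : (encodeBasis B)[l]? with
    | none => simp
    | some z => exact hmem z (List.mem_of_getElem? hg)
  · simp

theorem memB_startMem {y p : ℕ} (h : MemB' y (startMem ((p : ℤ) :: encodeBasis B))) :
    MemB (y + Nat.size p) (startMem ((p : ℤ) :: encodeBasis B)) := by
  intro a i
  rcases h a i with ⟨rfl, rfl⟩ | h
  · rw [startMem_zero, Nat.abs_cast]
    exact_mod_cast (Nat.lt_size_self p).trans_le (Nat.pow_le_pow_right (by norm_num) (by omega))
  · exact h.trans_le (pow_le_pow_right₀ (by norm_num) (by omega))

/-! ### The running time -/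

/-- Bounds that are polynomial in the first and linear in the second argument. -/
def PolyQ (f : ℕ → ℕ → ℕ) : Prop := ∃ g, PolyB g ∧ ∀ x q, 1 ≤ q → f x q ≤ g x * q

theorem PolyQ.of {g : ℕ → ℕ} (h : PolyB g) : PolyQ fun x _ => g x :=
  ⟨g, h, fun _ _ hq => Nat.le_mul_of_pos_right _ hq⟩

theorem PolyQ.add {f f' : ℕ → ℕ → ℕ} (h : PolyQ f) (h' : PolyQ f') :
    PolyQ fun x q => f x q + f' x q := by
  obtain ⟨g, hg, hf⟩ := h
  obtain ⟨g', hg', hf'⟩ := h'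
  exact ⟨_, hg.add hg', fun x q hq => (add_le_add (hf x q hq) (hf' x q hq)).trans_eq (add_mul ..).symm⟩

theorem PolyQ.mul {f : ℕ → ℕ → ℕ} {h : ℕ → ℕ} (hh : PolyB h) (hf : PolyQ f) :
    PolyQ fun x q => h x * f x q := by
  obtain ⟨g, hg, hf⟩ := hf
  exact ⟨_, hh.mul hg, fun x q hq => (Nat.mul_le_mul_left _ (hf x q hq)).trans_eq (mul_assoc ..).symm⟩

/-- The cost of the body must not depend on `q`: loops over codes are never nested in each other,
which keeps the time linear in `q`. The factor `2` comes from `q + 1 ≤ 2 * q`. -/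
theorem PolyQ.forCst {T : ℕ → ℕ} (hT : PolyB T) (v : ℕ) (e : Expr) :
    PolyQ fun x q => SVPRed.forCst x v e q (T x) := by
  refine (PolyQ.of ((PolyB.const 1).add (Program.polyB_cst _))).add ?_
  refine ⟨_, (PolyB.const 2).mul ((((PolyB.const 1).add (Expr.polyB_cst ((var v).less e)))).add
    (((PolyB.const 1).add hT).add (Program.polyB_cst (.set v 0 (var v + 1))))), fun x q hq => ?_⟩
  rw [mul_right_comm]
  exact Nat.mul_le_mul_right _ (by omega)

theorem PolyQ.prog (P : Program) : PolyQ fun x _ => P.cst x := .of P.polyB_cst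

theorem polyQ_loop {f : ℕ → ℕ → ℕ} (hf : PolyQ f) (e : Expr) :
    PolyQ fun x q => (x + 1) * (1 + e.cst (x + 1) + f x q) :=
  .mul (PolyB.id.add (.const 1)) ((PolyQ.of ((PolyB.const 1).add e.polyB_cst)).add hf)

theorem polyQ_one : PolyQ fun _ _ => 1 := .of (.const 1)

theorem polyQ_roundCst : PolyQ roundCst :=
  (polyQ_one.add (.prog _)).add ((polyQ_one.add (.prog _)).add
    ((polyQ_one.add (.forCst (Program.polyB_cst _) _ _)).add (.prog _)))

theorem polyQ_searchCst : PolyQ searchCst :=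
  (polyQ_one.add (.prog _)).add ((polyQ_one.add (.prog _)).add
    ((polyQ_one.add (.prog _)).add (polyQ_loop polyQ_roundCst _)))

theorem polyQ_batchesCst : PolyQ batchesCst :=
  (polyQ_one.add (.prog _)).add
    (polyQ_loop ((polyQ_one.add polyQ_searchCst).add (.prog _)) _)

theorem polyQ_finalCst : PolyQ finalCst :=
  (polyQ_one.add (.prog _)).add ((polyQ_one.add (.prog _)).add (.forCst (Program.polyB_cst _) _ _))

theorem polyQ_coreCst : PolyQ coreCst :=
  (polyQ_one.add (.prog _)).add ((polyQ_one.add (.prog _)).add ((polyQ_one.add (.prog _)).add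
    ((polyQ_one.add polyQ_batchesCst).add ((polyQ_one.add polyQ_finalCst).add (.prog _)))))

/-- The choice of the parameters handles the number `p` itself and takes time polynomial in its bit
length; this is absorbed by the one factor `p` that is available. -/
theorem exists_size_pow_le (c : ℕ) : ∃ C : ℕ, ∀ p : ℕ, 1 ≤ p → (Nat.size p + 1) ^ c ≤ C * p := by
  obtain ⟨C, hC⟩ := (tendsto_pow_const_div_const_pow_of_one_lt c
    (one_lt_two : (1 : ℝ) < 2)).bddAbove_range
  refine ⟨4 * ⌈C⌉₊, fun p hp => ?_⟩
  have h1 : ((Nat.size p + 1 : ℕ) : ℝ) ^ c / 2 ^ (Nat.size p + 1) ≤ C := hC ⟨Nat.size p + 1, rfl⟩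
  rw [div_le_iff₀ (by positivity)] at h1
  have h2 : 2 ^ (Nat.size p + 1) ≤ 4 * p := by
    have : 0 < Nat.size p := Nat.size_pos.2 hp
    have h3 : 2 ^ (Nat.size p - 1) ≤ p := Nat.lt_size.1 (by omega)
    have h4 : 2 ^ (Nat.size p + 1) = 4 * 2 ^ (Nat.size p - 1) := by
      rw [show (4 : ℕ) = 2 ^ 2 by norm_num, ← pow_add]
      congr 1
      omega
    omega
  have h5 : ((Nat.size p + 1 : ℕ) : ℝ) ^ c ≤ (⌈C⌉₊ : ℝ) * (4 * p : ℕ) := by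
    refine h1.trans (mul_le_mul (Nat.le_ceil C) (by exact_mod_cast h2) (by positivity) (by positivity))
  have h6 : (Nat.size p + 1) ^ c ≤ ⌈C⌉₊ * (4 * p) := by exact_mod_cast h5
  linarith

/-- The bit length of the numbers that the parameters are computed with. -/
def yexp (r : ℕ) : ℕ := 2 * (r * (4 * r + 3) + 1) + (4 * r + 3)

theorem polyB_yexp : PolyB yexp := by
  unfold yexp
  repeat first
    | exact PolyB.id
    | exact PolyB.const _
    | apply PolyB.add
    | apply PolyB.mul

theorem exists_time_bound : ∃ c : ℕ, ∀ n m p q : ℕ, 1 ≤ n → 1 ≤ m → 1 ≤ p → 1 ≤ q → q ≤ 2 * p →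
    1 + paramProg.cst (yexp (n + m) + Nat.size p) + coreCst (xexp (yexp (n + m))) q ≤
      c * n ^ c * m ^ c * p := by
  obtain ⟨a, ha⟩ := paramProg.polyB_cst
  obtain ⟨C, hC⟩ := exists_size_pow_le a
  obtain ⟨g, hg, hcore⟩ := polyQ_coreCst
  obtain ⟨b, hb⟩ := ((PolyB.const 1).add (((PolyB.const a).mul ((polyB_yexp.add (.const 2)).pow a)).mul
    (.const C))).add ((hg.comp (polyB_xexp.comp polyB_yexp)).mul (.const 2))
  -- A single constant has to serve as coefficient, `b * 4 ^ b`, and as exponent, `b`. The factor `4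
  -- ^ b` comes from `n + m + 2 ≤ 4 * (n * m)`.
  refine ⟨b * 4 ^ b + b, fun n m p q hn hm hp hq hqp => ?_⟩
  set y := yexp (n + m) with hy
  have h1 : paramProg.cst (y + Nat.size p) ≤ a * (y + 2) ^ a * C * p := by
    refine (ha _).trans ?_
    have : (y + Nat.size p + 2) ^ a ≤ (y + 2) ^ a * (C * p) := by
      refine le_trans ?_ (Nat.mul_le_mul_left _ (hC p hp))
      rw [← mul_pow]
      refine Nat.pow_le_pow_left ?_ _
      nlinarith
    calc a * (y + Nat.size p + 2) ^ a ≤ a * ((y + 2) ^ a * (C * p)) := Nat.mul_le_mul_left _ this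
      _ = _ := by ring
  have h2 : coreCst (xexp y) q ≤ g (xexp y) * 2 * p := by
    refine (hcore _ _ hq).trans ?_
    rw [mul_assoc]
    exact Nat.mul_le_mul_left _ hqp
  have h3 := hb (n + m)
  simp only [← hy] at h3
  have h4 : (n + m + 2) ^ b ≤ 4 ^ b * (n ^ b * m ^ b) := by
    rw [← mul_pow, ← mul_pow]
    refine Nat.pow_le_pow_left ?_ _
    nlinarith
  have h5 : n ^ b ≤ n ^ (b * 4 ^ b + b) := Nat.pow_le_pow_right hn (by omega)
  have h6 : m ^ b ≤ m ^ (b * 4 ^ b + b) := Nat.pow_le_pow_right hm (by omega)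
  calc 1 + paramProg.cst (y + Nat.size p) + coreCst (xexp y) q
      ≤ p + a * (y + 2) ^ a * C * p + g (xexp y) * 2 * p := by omega
    _ = (1 + a * (y + 2) ^ a * C + g (xexp y) * 2) * p := by ring
    _ ≤ (b * (4 ^ b * (n ^ b * m ^ b))) * p :=
        Nat.mul_le_mul_right _ (h3.trans (Nat.mul_le_mul_left _ h4))
    _ = b * 4 ^ b * n ^ b * m ^ b * p := by ring
    _ ≤ _ := by gcongr; omega

/-! ### The approximation factor -/

/-- If one batch suffices, then `e = 0`. Otherwise `p < 3 ^ (2 * s)` gives `log p ≤ 4 * s`, and with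
`e * s < K ≤ 4 * n ^ 2` it follows that `2 * e * log p ≤ 8 * e * s ≤ 32 * n ^ 2`. -/
theorem pow_le_rpow_exponent {γ p : ℝ} (hγ : 1 ≤ γ) (hp : 2 ≤ p) {e s K : ℕ}
    (hK : K = (n - 1) * (4 * n + 3)) (hs : K ≤ s ∨ ⌊p⌋₊ < 3 ^ (2 * s)) (he : e = 0 ∨ e * s < K) :
    γ ^ (2 * e) ≤ γ ^ (32 * (n : ℝ) ^ 2 / Real.logb 2 p) := by
  have hlog : 0 < Real.logb 2 p := Real.logb_pos (by norm_num) (by linarith)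
  rw [← Real.rpow_natCast]
  refine Real.rpow_le_rpow_of_exponent_le hγ ?_
  rw [le_div_iff₀ hlog]
  rcases he with rfl | he
  · simp
  rcases Nat.eq_zero_or_pos e with rfl | he0
  · simp
  rcases hs with hs | hs
  · nlinarith
  have hlog' : Real.logb 2 p ≤ 4 * s := by
    rw [Real.logb_le_iff_le_rpow (by norm_num) (by linarith)]
    have h1 : p < 3 ^ (2 * s) := by
      have := (Nat.floor_lt (by linarith)).1 hs
      exact_mod_cast this
    have h2 : (3 : ℝ) ^ (2 * s) ≤ 4 ^ (2 * s) := pow_le_pow_left₀ (by norm_num) (by norm_num) _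
    have h3 : (2 : ℝ) ^ ((4 : ℝ) * s) = 4 ^ (2 * s) := by
      rw [show (4 : ℝ) * s = ((2 * (2 * s) : ℕ) : ℝ) by push_cast; ring, Real.rpow_natCast, pow_mul]
      norm_num
    linarith
  have hK4 : K ≤ 4 * n ^ 2 := by
    rw [hK]
    rcases n with _ | n
    · simp
    · simp only [Nat.add_sub_cancel]
      nlinarith
  have h1 : ((e * s : ℕ) : ℝ) ≤ (4 * n ^ 2 : ℕ) := by exact_mod_cast he.le.trans hK4
  push_cast at h1 ⊢
  calc 2 * (e : ℝ) * Real.logb 2 p ≤ 2 * e * (4 * s) := by gcongr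
    _ ≤ _ := by linarith

theorem exists_exec {O : List ℤ → Bool} {γ p : ℕ → ℝ} (hγ : ∀ n, 1 ≤ γ n) (hp : ∀ n, 2 ≤ p n)
    (hO : IsGapSVPOracle γ O) (B : RatBasis n N) (hn : 0 < n) :
    ∃ (σ : Mem) (t : ℕ) (qs : List (List ℤ)) (v : Fin N → ℚ) (q : ℕ),
      Exec O (.seq paramProg coreProg) (startMem ((⌊p n⌋₊ : ℤ) :: encodeBasis B)) σ t qs ∧
      σ.read 1 (2 * N) = encodeVec v ∧
      IsSVPSolution (γ n ^ (32 * (n : ℝ) ^ 2 / Real.logb 2 (p n))) B v ∧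
      QueriesInDimension n N qs ∧ 1 ≤ q ∧ q ≤ 2 * ⌊p n⌋₊ ∧
      t ≤ 1 + paramProg.cst (yexp (n + B.maxBits) + Nat.size ⌊p n⌋₊) +
        coreCst (xexp (yexp (n + B.maxBits))) q := by
  set m := B.maxBits with hm
  set y := yexp (n + m) with hy
  set P := ⌊p n⌋₊ with hP
  have hP2 : 2 ≤ P := Nat.le_floor (by exact_mod_cast hp n)
  have hNm : N ≤ m := dim_le_maxBits hn
  obtain ⟨K, hK⟩ : ∃ K, K = (n - 1) * (4 * n + 3) := ⟨_, rfl⟩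
  have hKle : K ≤ (n + m) * (4 * (n + m) + 3) := by
    rw [hK]; exact Nat.mul_le_mul (by omega) (by omega)
  have hyge : 2 * (K + 1) ≤ y ∧ 4 * (n + m) + 3 ≤ y := by
    rw [hy, yexp]; omega
  have hB' : MemB' y (startMem ((P : ℤ) :: encodeBasis B)) :=
    memB'_startMem P (by omega) (by omega) (by omega)
  have h1 : startMem ((P : ℤ) :: encodeBasis B) aIn 1 = n := by
    have := startMem_succ (B := B) P (l := 0) (by omega)
    simpa [entryFn] using this
  have h2 : startMem ((P : ℤ) :: encodeBasis B) aIn 2 = N := by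
    have := startMem_succ (B := B) P (l := 1) (by omega)
    simpa [entryFn] using this
  obtain ⟨σ₁, t₁, q₁, e₁, ht₁, hq₁, -, hσ₁, -, hi₁, hvn, hvN, hvkk, hvK, s, q, hvs, hvq, hq, hs, hsK, hqP,
    hsP⟩ := ok_paramProg (O := O) (G := IsQuery n N) hn (memB_startMem hB') hB' (by omega)
      (startMem_zero P _) (by omega) h1 h2 hK hyge.1 (by omega)
  have hin : Input B σ₁ := by
    have h := input_startMem (B := B) P
    constructor
    · intro i j
      rw [hi₁ _ (by omega), h.num]
    · intro i j
      rw [hi₁ _ (by omega), h.den]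
  obtain ⟨σ₂, t₂, q₂, e₂, ht₂, hq₂, -, e, v, hread, hmem, hpos, hnorm, he⟩ :=
    run_coreProg (hγ n) hO hn (by omega) (by omega) hσ₁ hin hvn hvN hvkk hvK hK hvs hvq hq hs hsK
  refine ⟨σ₂, _, _, v, q, .seq e₁ e₂, hread, ⟨hmem, hpos, hnorm.trans ?_⟩, ?_, ?_, ?_, by omega⟩
  · refine mul_le_mul_of_nonneg_right (pow_le_rpow_exponent (hγ n) (hp n) hK hsP he) ?_
    exact Real.sInf_nonneg (by rintro _ ⟨y, -, -, rfl⟩; exact norm_nonneg y)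
  · intro l hl
    rcases List.mem_append.1 hl with h | h
    · exact hq₁ l h
    · exact hq₂ l h
  · rw [hq]; exact Nat.one_le_pow _ _ (by norm_num)
  · omega

end SVPRed

theorem theorem1p3 :
    ∃ (M : Program) (C : ℝ) (c : ℕ),
      ∀ γ p : ℕ → ℝ, (∀ n, 1 ≤ γ n) → (∀ n, 2 ≤ p n) →
      ∀ O : List ℤ → Bool, IsGapSVPOracle γ O →
      ∀ (n N : ℕ) (B : RatBasis n N), 0 < n →
        ∃ (σ : Mem) (t : ℕ) (qs : List (List ℤ)) (x : Fin N → ℚ),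
          Exec O M (startMem ((⌊p n⌋₊ : ℤ) :: encodeBasis B)) σ t qs ∧
          σ.read 1 (2 * N) = encodeVec x ∧
          IsSVPSolution (γ n ^ (C * (n : ℝ) ^ 2 / Real.logb 2 (p n))) B x ∧
          QueriesInDimension n N qs ∧
          (t : ℝ) ≤ c * (n : ℝ) ^ c * (B.maxBits : ℝ) ^ c * p n := by
  obtain ⟨c, hc⟩ := exists_time_bound
  refine ⟨.seq paramProg coreProg, 32, c, fun γ p hγ hp O hO n N B hn => ?_⟩
  obtain ⟨σ, t, qs, x, q, h1, h2, h3, h4, h5, h6, h7⟩ := exists_exec hγ hp hO B hn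
  refine ⟨σ, t, qs, x, h1, h2, h3, h4, ?_⟩
  have hP : 1 ≤ ⌊p n⌋₊ := Nat.le_floor (by have := hp n; push_cast; linarith)
  have hm : 1 ≤ B.maxBits := Nat.lt_of_lt_of_le (dim_pos B hn) (dim_le_maxBits hn)
  have h8 := h7.trans (hc n B.maxBits ⌊p n⌋₊ q hn hm hP h5 h6)
  have h9 : (t : ℝ) ≤ c * (n : ℝ) ^ c * (B.maxBits : ℝ) ^ c * ⌊p n⌋₊ := by exact_mod_cast h8
  refine h9.trans (mul_le_mul_of_nonneg_left (Nat.floor_le ?_) (by positivity))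
  linarith [hp n]
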